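/- **Morse gluing.** Let $C$ be a smooth $n$-dimensional manifold without boundary, $f:C\to\mathbb R$ a Morse function, and suppose that the negative gradient flow $\psi:\mathbb R\times C\to C$, $\psi^a=\psi(a,\cdot)$, of $f$ with respect to a smooth Riemannian metric is defined for all times. Let $W_-,W_+\subset C$ be (embedded) submanifolds with $\dim W_-+\dim W_+=\dim C$, and put $$W_-\times_\psi W_+=\{(R,w_-,w_+)\in\mathbb R\times W_-\times W_+ \mid \psi^R(w_-)=w_+\}.$$ Let $p$ be a critical point of $f$ with stable and unstable manifolds $W^s(p)=\{x:\psi^t(x)\to p,\ t\to\infty\}$ and $W^u(p)=\{x:\psi^t(x)\to p,\ t\to-\infty\}$. Assume that $W_-\times_\psi W_+$ is cut out transversely, i.e. at each of its points the map $d\psi:\mathbb R\oplus T_{w_-}W_-\to T_{w_+}C/T_{w_+}W_+$ is surjective, and that $W_-\pitchfork W^s(p)$ and $W^u(p)\pitchfork W_+$. Then for every $$(w_-^\infty,w_+^\infty)\in (W_-\cap W^s(p))\times(W^u(p)\cap W_+)$$ there are $R_0\in\mathbb R$ and a smooth injective immersion $[R_0,\infty)\to W_-\times_\psi W_+$, $R\mapsto(R,w_-^R,w_+^R)$,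 such that: (i) $\lim_{R\to\infty}w_\pm^R=w_\pm^\infty$; (ii) there is $\delta>0$ such that for every $(R,w_-,w_+)\in W_-\times_\psi W_+$ with $\mathrm{dist}(w_-,w_-^\infty)+\mathrm{dist}(w_+,w_+^\infty)<\delta$: if $R\ge R_0$, then $(w_-,w_+)=(w_-^R,w_+^R)$; and $R\ge R_0$ holds automatically unless $w_-^\infty=w_+^\infty=p$; (iii) suppose that $W_-$ is oriented and $W_+$ is cooriented (i.e. $TC/TW_+$ is oriented). Choose an orientation of $W^u(p)$; it coorients $W^s(p)$ through $T_pW^u(p)\cong T_pC/T_pW^s(p)$. Let $\varepsilon_-$ (resp. $\varepsilon_+$) be $+1$ or $-1$ according to whether $T_{w_-^\infty}W_-\to T_{w_-^\infty}C/T_{w_-^\infty}W^s(p)$ (resp. $T_{w_+^\infty}W^u(p)\to T_{w_+^\infty}C/T_{w_+^\infty}W_+$) preserves or reverses orientation, and let $\varepsilon=\varepsilon_-\varepsilon_+$. Whenever $0\to K\to X\to Z\to0$ is exact and $X,Z$ are oriented, orient $K$ through $\det K\otimes\det Z\cong\det X$: a basis of $K$ followed by a lift of a positive basis of $Z$ is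 a positive basis of $X$ if and only if the basis of $K$ is positive. Then for all $R\ge R_0$: a) the orientation of the vector $(1,\partial_Rw_-^R,\partial_Rw_+^R)$ tangent to $W_-\times_\psi W_+$ is $\varepsilon$, where $T(W_-\times_\psi W_+)$ is oriented as the kernel of $d\psi:\mathbb R\oplus T_{w_-}W_-\to T_{w_+}C/T_{w_+}W_+$; b) if $W_-$ is everywhere transverse to $\operatorname{grad} f$, i.e. $\operatorname{grad}_wf\notin T_wW_-$ for all $w\in W_-$, the orientation of $\partial_Rw_+^R$ as a tangent vector of $\widetilde W_-\cap W_+$ is $\varepsilon$. Here $\widetilde W_-=\mathbb R\times W_-$ is mapped to $C$ by $\psi$ and is oriented by $-\operatorname{grad}_wf\,\mathbb R\oplus T_wW_-\cong T_w\widetilde W_-$, and $T(\widetilde W_-\cap W_+)$ is oriented as the kernel of $T\widetilde W_-\to TC/TW_+$; c) if $W_+$ is everywhere transverse to $\operatorname{grad} f$, the orientation of $\partial_Rw_-^R$ as a tangent vector of $W_-\cap\widetilde W_+$ is $-\varepsilon$. Here $\widetilde W_+=\mathbb R\times W_+$ is mapped to $C$ by $\psi$ and is cooriented by $-\operatorname{grad}_wf\,\mathbb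 R\oplus T_wC/T_w\widetilde W_+\cong T_wC/T_wW_+$, and $T(W_-\cap\widetilde W_+)$ is oriented as the kernel of $TW_-\to TC/T\widetilde W_+$. In b) and c) the orientations given along $W_\pm$ are transported along $\widetilde W_\pm$ with $d\psi$. -/

import Mathlib

open Set Filter Topology Manifold ContDiff Bundle

noncomputable section

namespace MorseGluing

/-! ### Linear algebra of orientations -/

section Linear

variable {V X Z : Type*} [AddCommGroup V] [Module ℝ V] [AddCommGroup X] [Module ℝ X]
  [AddCommGroup Z] [Module ℝ Z]

/-- The sign of a `k`-tuple of vectors of an oriented `k`-dimensional real vector space: `1` for a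
positive basis, `-1` for a negative basis and `0` for a linearly dependent tuple. If `k = 0`, it is
the sign `±1` which is the orientation of a zero-dimensional space. -/
def tupleSign {k : ℕ} (o : Orientation ℝ V (Fin k)) (v : Fin k → V) : SignType :=
  SignType.sign (o.someVector v)

open Classical in
/-- The sign of an isomorphism `φ : X → Z` of oriented vector spaces of dimension `k`: `1` if `φ`
preserves the orientations and `-1` if it reverses them. -/
def isoSign {k : ℕ} (oX : Orientation ℝ X (Fin k)) (oZ : Orientation ℝ Z (Fin k))
    (φ : X →ₗ[ℝ] Z) : SignType :=
  if ∀ v : Fin k → X, tupleSign oZ (fun i => φ (v i)) = tupleSign oX v then 1 else -1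

/-- Let `0 → K → X → Z → 0` be exact with `φ : X → Z`, `dim Z = k`, `dim K = 1`, and `X`, `Z`
oriented. The kernel `K` is oriented through `det K ⊗ det Z ≅ det X`, i.e. `κ ∈ K` is positive if
and only if `κ, x₁, …, x_k` is a positive basis of `X` whenever `φ x₁, …, φ x_k` is a positive
basis of `Z`. The predicate says that `κ` lies in `K` and that its orientation is `s`. -/
def KernelVectorSign {k : ℕ} (oX : Orientation ℝ X (Fin (k + 1))) (oZ : Orientation ℝ Z (Fin k))
    (φ : X →ₗ[ℝ] Z) (κ : X) (s : SignType) : Prop :=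
  φ κ = 0 ∧ ∀ v : Fin k → X,
    tupleSign oX (Fin.cons κ v : Fin (k + 1) → X) = s * tupleSign oZ (fun i => φ (v i))

/-- The isomorphism `ℝ ⊕ V ≅ X`, `(θ, ξ) ↦ θ ν + L ξ` preserves orientations, where `ℝ ⊕ V` carries
the direct sum orientation (standard orientation of `ℝ` first). -/
def OrientedAsSum {k : ℕ} (oV : Orientation ℝ V (Fin k)) (oX : Orientation ℝ X (Fin (k + 1)))
    (ν : X) (L : V →ₗ[ℝ] X) : Prop :=
  ∀ v : Fin k → V, tupleSign oX (Fin.cons ν (fun i => L (v i)) : Fin (k + 1) → X) = tupleSign oV v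

end Linear

/-! ### Subsets of manifolds: submanifolds, tangent spaces, orientations -/

section Manifold

variable {n : ℕ} {C : Type*} [TopologicalSpace C] [ChartedSpace (EuclideanSpace ℝ (Fin n)) C]

/-- `S ⊂ C` is an (embedded, smooth) submanifold of dimension `k`: around each point of `S` there
is a smooth chart of `C` in which `S` is an affine subspace of dimension `k`. -/
def IsSubmanifold (k : ℕ) (S : Set C) : Prop :=
  ∀ x ∈ S, ∃ φ ∈ IsManifold.maximalAtlas (𝓡 n) ∞ C, x ∈ φ.source ∧
    ∃ V : Submodule ℝ (EuclideanSpace ℝ (Fin n)), Module.finrank ℝ V = k ∧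
      ∀ y ∈ φ.source, y ∈ S ↔ φ y - φ x ∈ V

/-- The tangent space `T_x S` of a submanifold `S ⊂ C`, spanned by the velocities at `x` of the
smooth curves of `C` through `x` which lie in `S`. -/
def tangentSpaceOf (n : ℕ) {C : Type*} [TopologicalSpace C]
    [ChartedSpace (EuclideanSpace ℝ (Fin n)) C] (S : Set C) (x : C) :
    Submodule ℝ (TangentSpace (𝓡 n) x) :=
  Submodule.span ℝ {v | ∃ γ : ℝ → C, ContMDiffAt 𝓘(ℝ, ℝ) (𝓡 n) ∞ γ 0 ∧ (∀ᶠ t in 𝓝 0, γ t ∈ S) ∧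
    (⟨γ 0, mfderiv 𝓘(ℝ, ℝ) (𝓡 n) γ 0 (1 : ℝ)⟩ : TangentBundle (𝓡 n) C) = ⟨x, v⟩}

/-- The normal space `T_x C / T_x S`. -/
abbrev NormalSpace (n : ℕ) {C : Type*} [TopologicalSpace C]
    [ChartedSpace (EuclideanSpace ℝ (Fin n)) C] (S : Set C) (x : C) : Type :=
  TangentSpace (𝓡 n) x ⧸ tangentSpaceOf n S x

/-- An orientation of a `k`-dimensional submanifold `S`: orientations of the tangent spaces that
depend continuously on the point, i.e. locally there are continuous frames of constant sign. -/
def IsOrientationOf [IsManifold (𝓡 n) ∞ C] {k : ℕ} (S : Set C)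
    (o : (x : S) → Orientation ℝ (tangentSpaceOf n S (x : C)) (Fin k)) : Prop :=
  ∀ x₀ ∈ S, ∃ U ∈ 𝓝 x₀, ∃ F : Fin k → (x : C) → TangentSpace (𝓡 n) x, ∃ s : SignType, s ≠ 0 ∧
    (∀ i, ContinuousOn (fun x => (⟨x, F i x⟩ : TangentBundle (𝓡 n) C)) (S ∩ U)) ∧
    ∀ x : S, (x : C) ∈ U → ∃ h : ∀ i, F i x ∈ tangentSpaceOf n S (x : C),
      tupleSign (o x) (fun i => ⟨F i x, h i⟩) = s

/-- A coorientation of a submanifold `S` of codimension `k`: orientations of the normal spaces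
`T_x C / T_x S` that depend continuously on the point. -/
def IsCoorientationOf [IsManifold (𝓡 n) ∞ C] {k : ℕ} (S : Set C)
    (c : (x : S) → Orientation ℝ (NormalSpace n S (x : C)) (Fin k)) : Prop :=
  ∀ x₀ ∈ S, ∃ U ∈ 𝓝 x₀, ∃ F : Fin k → (x : C) → TangentSpace (𝓡 n) x, ∃ s : SignType, s ≠ 0 ∧
    (∀ i, ContinuousOn (fun x => (⟨x, F i x⟩ : TangentBundle (𝓡 n) C)) (S ∩ U)) ∧
    ∀ x : S, (x : C) ∈ U →
      tupleSign (c x) (fun i => (tangentSpaceOf n S (x : C)).mkQ (F i x)) = s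

/-- The composition `T_x A ⊂ T_x C → T_x C / T_x B`. -/
def toNormal (n : ℕ) {C : Type*} [TopologicalSpace C]
    [ChartedSpace (EuclideanSpace ℝ (Fin n)) C] (A B : Set C) (x : C) :
    tangentSpaceOf n A x →ₗ[ℝ] NormalSpace n B x :=
  (tangentSpaceOf n B x).mkQ ∘ₗ (tangentSpaceOf n A x).subtype

/-- `A` and `B` intersect transversely (at every point of the intersection). -/
def TransverseIntersection (n : ℕ) {C : Type*} [TopologicalSpace C]
    [ChartedSpace (EuclideanSpace ℝ (Fin n)) C] (A B : Set C) : Prop :=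
  ∀ x ∈ A ∩ B, tangentSpaceOf n A x ⊔ tangentSpaceOf n B x = ⊤

/-! ### Morse functions and the negative gradient flow -/

/-- `f` is a Morse function: it is smooth and its Hessian, computed in a chart, is non-degenerate
at every critical point. -/
def IsMorse (n : ℕ) {C : Type*} [TopologicalSpace C]
    [ChartedSpace (EuclideanSpace ℝ (Fin n)) C] (f : C → ℝ) : Prop :=
  ContMDiff (𝓡 n) 𝓘(ℝ, ℝ) ∞ f ∧
    ∀ p : C, mfderiv (𝓡 n) 𝓘(ℝ, ℝ) f p = 0 → ∀ v : EuclideanSpace ℝ (Fin n),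
      (∀ w : EuclideanSpace ℝ (Fin n),
        fderiv ℝ (fderiv ℝ (f ∘ (extChartAt (𝓡 n) p).symm)) (extChartAt (𝓡 n) p p) v w = 0) → v = 0

/-- The stable manifold `W^s(p)`. -/
def stableManifold (ψ : ℝ → C → C) (p : C) : Set C := {x | Tendsto (fun t => ψ t x) atTop (𝓝 p)}

/-- The unstable manifold `W^u(p)`. -/
def unstableManifold (ψ : ℝ → C → C) (p : C) : Set C := {x | Tendsto (fun t => ψ t x) atBot (𝓝 p)}

instance instFiniteDimensionalTangent (x : C) : FiniteDimensional ℝ (TangentSpace (𝓡 n) x) :=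
  inferInstanceAs (FiniteDimensional ℝ (EuclideanSpace ℝ (Fin n)))

section Gradient

variable [RiemannianBundle (fun x : C => TangentSpace (𝓡 n) x)]

instance instCompleteTangent (x : C) : CompleteSpace (TangentSpace (𝓡 n) x) :=
  FiniteDimensional.complete ℝ _

/-- The gradient of `f` with respect to the Riemannian metric: `⟨grad f, v⟩ = df(v)`. -/
def grad (n : ℕ) {C : Type*} [TopologicalSpace C] [ChartedSpace (EuclideanSpace ℝ (Fin n)) C]
    [RiemannianBundle (fun x : C => TangentSpace (𝓡 n) x)] (f : C → ℝ) (x : C) :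
    TangentSpace (𝓡 n) x :=
  (InnerProductSpace.toDual ℝ (TangentSpace (𝓡 n) x)).symm (mfderiv (𝓡 n) 𝓘(ℝ, ℝ) f x)

/-- `ψ` is the (globally defined) negative gradient flow of `f`: a smooth map `ℝ × C → C` such that
`ψ⁰ = id` and `t ↦ ψᵗ(x)` is an integral curve of `-grad f` for each `x`. -/
structure IsNegGradFlow (f : C → ℝ) (ψ : ℝ → C → C) : Prop where
  smooth : ContMDiff (𝓘(ℝ, ℝ).prod (𝓡 n)) (𝓡 n) ∞ (fun q : ℝ × C => ψ q.1 q.2)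
  zero : ∀ x, ψ 0 x = x
  integralCurve : ∀ x, IsMIntegralCurve (I := 𝓡 n) (fun t => ψ t x) (fun y => -grad n f y)

/-- `grad f ⋔ S`: the submanifold `S` is everywhere transverse to the gradient of `f`. -/
def GradTransverse (f : C → ℝ) (S : Set C) : Prop := ∀ x ∈ S, grad n f x ∉ tangentSpaceOf n S x

end Gradient

/-! ### The space of finite length flow lines -/

/-- `W₋ ×_ψ W₊ = {(R, w₋, w₊) | ψᴿ(w₋) = w₊} ⊂ ℝ × W₋ × W₊`. -/
def flowLines (ψ : ℝ → C → C) (Wm Wp : Set C) : Set (ℝ × C × C) :=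
  {q | q.2.1 ∈ Wm ∧ q.2.2 ∈ Wp ∧ ψ q.1 q.2.1 = q.2.2}

/-- The differential of `ψ : ℝ × C → C` at `(R, w)`, restricted to `ℝ ⊕ T_w S`. -/
def flowDiff (n : ℕ) {C : Type*} [TopologicalSpace C]
    [ChartedSpace (EuclideanSpace ℝ (Fin n)) C] (ψ : ℝ → C → C) (S : Set C) (R : ℝ) (w : C) :
    (ℝ × tangentSpaceOf n S w) →ₗ[ℝ] TangentSpace (𝓡 n) (ψ R w) :=
  (mfderiv (𝓘(ℝ, ℝ).prod (𝓡 n)) (𝓡 n) (fun q : ℝ × C => ψ q.1 q.2) (R, w) :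
    (ℝ × TangentSpace (𝓡 n) w) →L[ℝ] TangentSpace (𝓡 n) (ψ R w)).toLinearMap ∘ₗ
      (LinearMap.prodMap LinearMap.id (tangentSpaceOf n S w).subtype)

/-- The map `dψ : ℝ ⊕ T_{w₋} W₋ → T_{w₊} C / T_{w₊} W₊` at `(R, w₋, w₊)`, `w₊ = ψᴿ(w₋)`. -/
def flowLineMap (n : ℕ) {C : Type*} [TopologicalSpace C]
    [ChartedSpace (EuclideanSpace ℝ (Fin n)) C] (ψ : ℝ → C → C) (Wm Wp : Set C) (R : ℝ) (w : C) :
    (ℝ × tangentSpaceOf n Wm w) →ₗ[ℝ] NormalSpace n Wp (ψ R w) :=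
  (tangentSpaceOf n Wp (ψ R w)).mkQ ∘ₗ flowDiff n ψ Wm R w

/-- `W₋ ×_ψ W₊` is cut-out transversely. -/
def FlowLinesTransverse (n : ℕ) {C : Type*} [TopologicalSpace C]
    [ChartedSpace (EuclideanSpace ℝ (Fin n)) C] (ψ : ℝ → C → C) (Wm Wp : Set C) : Prop :=
  ∀ R : ℝ, ∀ w ∈ Wm, ψ R w ∈ Wp → Function.Surjective (flowLineMap n ψ Wm Wp R w)

/-- The map `γ`, defined on `[R₀, ∞)`, is a smooth injective immersion into `ℝ × C × C`. -/
def IsInjectiveImmersionOn (n : ℕ) {C : Type*} [TopologicalSpace C]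
    [ChartedSpace (EuclideanSpace ℝ (Fin n)) C] (R₀ : ℝ) (γ : ℝ → ℝ × C × C) : Prop :=
  ContMDiffOn 𝓘(ℝ, ℝ) (𝓘(ℝ, ℝ).prod ((𝓡 n).prod (𝓡 n))) ∞ γ (Ici R₀) ∧ InjOn γ (Ici R₀) ∧
    ∀ R ∈ Ici R₀, Function.Injective
      (mfderivWithin 𝓘(ℝ, ℝ) (𝓘(ℝ, ℝ).prod ((𝓡 n).prod (𝓡 n))) γ (Ici R₀) R)

/-- The derivative `∂_R γ` of a curve `γ : [R₀, ∞) → C` (one-sided at `R₀`). -/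
def velocity (n : ℕ) {C : Type*} [TopologicalSpace C]
    [ChartedSpace (EuclideanSpace ℝ (Fin n)) C] (R₀ : ℝ) (γ : ℝ → C) (R : ℝ) :
    TangentSpace (𝓡 n) (γ R) :=
  mfderivWithin 𝓘(ℝ, ℝ) (𝓡 n) γ (Ici R₀) R (1 : ℝ)

/-! ### Orientation of the glued family -/

/-- An orientation `oᵘ` of `W^u(p)` and a coorientation `cˢ` of `W^s(p)` correspond to each other:
at `p` the isomorphism `T_p W^u(p) → T_p C / T_p W^s(p)` preserves them. -/
def InducesCoorientation {k : ℕ} (ψ : ℝ → C → C) (p : C)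
    (ou : (x : unstableManifold ψ p) →
      Orientation ℝ (tangentSpaceOf n (unstableManifold ψ p) (x : C)) (Fin k))
    (cs : (x : stableManifold ψ p) →
      Orientation ℝ (NormalSpace n (stableManifold ψ p) (x : C)) (Fin k)) : Prop :=
  ∀ (hu : p ∈ unstableManifold ψ p) (hs : p ∈ stableManifold ψ p),
    ∀ v : Fin k → tangentSpaceOf n (unstableManifold ψ p) p,
      tupleSign (cs ⟨p, hs⟩)
        (fun i => toNormal n (unstableManifold ψ p) (stableManifold ψ p) p (v i)) =
      tupleSign (ou ⟨p, hu⟩) v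

/-- The sign `±1` of a point `x` of a transverse zero-dimensional intersection `A ∩ B` of an
oriented and a cooriented submanifold, from the isomorphism `T_x A → T_x C / T_x B`. -/
def pointSign {k : ℕ} {A B : Set C}
    (oA : (x : A) → Orientation ℝ (tangentSpaceOf n A (x : C)) (Fin k))
    (cB : (x : B) → Orientation ℝ (NormalSpace n B (x : C)) (Fin k))
    (x : C) (hA : x ∈ A) (hB : x ∈ B) : SignType :=
  isoSign (oA ⟨x, hA⟩) (cB ⟨x, hB⟩) (toNormal n A B x)

/-- The orientation of the tangent vector `(1, ξ₋, ξ₊)` of `W₋ ×_ψ W₊` at `(R, w, ψᴿ(w))` is `s`.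
Here `T(W₋ ×_ψ W₊)` is the kernel in the exact sequence
`0 → T(W₋ ×_ψ W₊) → ℝ ⊕ T_w W₋ → T C / T W₊ → 0`, and is oriented by it. -/
def FlowLineVectorSign {k : ℕ} (ψ : ℝ → C → C) {Wm Wp : Set C}
    (om : (x : Wm) → Orientation ℝ (tangentSpaceOf n Wm (x : C)) (Fin k))
    (cp : (x : Wp) → Orientation ℝ (NormalSpace n Wp (x : C)) (Fin k))
    (R : ℝ) (w : C) (hw : w ∈ Wm) (hψ : ψ R w ∈ Wp)
    (ξm : TangentSpace (𝓡 n) w) (ξp : TangentSpace (𝓡 n) (ψ R w)) (s : SignType) : Prop :=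
  ∃ hξ : ξm ∈ tangentSpaceOf n Wm w, ξp ∈ tangentSpaceOf n Wp (ψ R w) ∧
    flowDiff n ψ Wm R w (1, ⟨ξm, hξ⟩) = ξp ∧
    ∀ oX : Orientation ℝ (ℝ × tangentSpaceOf n Wm w) (Fin (k + 1)),
      OrientedAsSum (om ⟨w, hw⟩) oX (1, 0) (LinearMap.inr ℝ ℝ (tangentSpaceOf n Wm w)) →
      KernelVectorSign oX (cp ⟨ψ R w, hψ⟩) (flowLineMap n ψ Wm Wp R w) (1, ⟨ξm, hξ⟩) s

/-- The tangent space of `W̃₋ = ℝ × W₋`, mapped to `C` by `ψ`, at the point `(R, w)`. It is a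
subspace of `T_{ψᴿ(w)} C`. -/
def flowoutMinus (n : ℕ) {C : Type*} [TopologicalSpace C]
    [ChartedSpace (EuclideanSpace ℝ (Fin n)) C] (ψ : ℝ → C → C) (Wm : Set C) (R : ℝ) (w : C) :
    Submodule ℝ (TangentSpace (𝓡 n) (ψ R w)) :=
  LinearMap.range (flowDiff n ψ Wm R w)

/-- Assume `grad f ⋔ W₋`. The orientation of the vector `ξ` of `W̃₋ ∩ W₊` at `ψᴿ(w)`, `w ∈ W₋`, is
`s`. Here `T W̃₋` is oriented by `-(grad f) ℝ ⊕ T W₋ ≅ T W̃₋` (transported with `dψᴿ`, which fixes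
`grad f`), and `T (W̃₋ ∩ W₊)` by `0 → T (W̃₋ ∩ W₊) → T W̃₋ → T C / T W₊ → 0`. -/
def FlowoutMinusVectorSign {k : ℕ} (ψ : ℝ → C → C) {Wm Wp : Set C}
    (om : (x : Wm) → Orientation ℝ (tangentSpaceOf n Wm (x : C)) (Fin k))
    (cp : (x : Wp) → Orientation ℝ (NormalSpace n Wp (x : C)) (Fin k))
    (R : ℝ) (w : C) (hw : w ∈ Wm) (hψ : ψ R w ∈ Wp)
    (ξ : TangentSpace (𝓡 n) (ψ R w)) (s : SignType) : Prop :=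
  ∃ hξ : ξ ∈ flowoutMinus n ψ Wm R w,
    ∀ oX : Orientation ℝ (flowoutMinus n ψ Wm R w) (Fin (k + 1)),
      OrientedAsSum (om ⟨w, hw⟩) oX ((flowDiff n ψ Wm R w).rangeRestrict (1, 0))
        ((flowDiff n ψ Wm R w).rangeRestrict ∘ₗ LinearMap.inr ℝ ℝ (tangentSpaceOf n Wm w)) →
      KernelVectorSign oX (cp ⟨ψ R w, hψ⟩)
        ((tangentSpaceOf n Wp (ψ R w)).mkQ ∘ₗ (flowoutMinus n ψ Wm R w).subtype) ⟨ξ, hξ⟩ s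

section Gradient

variable [RiemannianBundle (fun x : C => TangentSpace (𝓡 n) x)]

/-- The tangent space at `w` of `W̃₊ = ℝ × W₊`, mapped to `C` by `ψ`, where `ψᴿ(w) ∈ W₊`. It is
`ℝ grad f ⊕ T W₊` at `ψᴿ(w)`, moved back to `w` with the isomorphism `d(ψᴿ)_w`. -/
def flowoutPlus (f : C → ℝ) (ψ : ℝ → C → C) (Wp : Set C) (R : ℝ) (w : C) :
    Submodule ℝ (TangentSpace (𝓡 n) w) :=
  (Submodule.span ℝ {-grad n f (ψ R w)} ⊔ tangentSpaceOf n Wp (ψ R w)).comap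
    (mfderiv (𝓡 n) (𝓡 n) (ψ R) w).toLinearMap

/-- Assume `grad f ⋔ W₊`. The orientation of the vector `ξ` of `W₋ ∩ W̃₊` at `w`, `ψᴿ(w) ∈ W₊`, is
`s`. Here `W̃₊` is cooriented by `-(grad f) ℝ ⊕ T C / T W̃₊ ≅ T C / T W₊` at `ψᴿ(w)` (transported
back to `w` with `d(ψᴿ)_w`), and `T (W₋ ∩ W̃₊)` is oriented by
`0 → T (W₋ ∩ W̃₊) → T W₋ → T C / T W̃₊ → 0`. The codimension of `W̃₊` is `j = k - 1`. -/
def FlowoutPlusVectorSign {k : ℕ} (f : C → ℝ) (ψ : ℝ → C → C) {Wm Wp : Set C}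
    (om : (x : Wm) → Orientation ℝ (tangentSpaceOf n Wm (x : C)) (Fin k))
    (cp : (x : Wp) → Orientation ℝ (NormalSpace n Wp (x : C)) (Fin k))
    (R : ℝ) (w : C) (hw : w ∈ Wm) (hψ : ψ R w ∈ Wp)
    (ξ : TangentSpace (𝓡 n) w) (s : SignType) : Prop :=
  ∃ hξ : ξ ∈ tangentSpaceOf n Wm w, ∃ (j : ℕ) (hj : k = j + 1),
    ∀ oZ : Orientation ℝ (TangentSpace (𝓡 n) w ⧸ flowoutPlus f ψ Wp R w) (Fin j),
      (∀ z : Fin j → TangentSpace (𝓡 n) w,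
        tupleSign (cp ⟨ψ R w, hψ⟩) (fun i : Fin k => (tangentSpaceOf n Wp (ψ R w)).mkQ
          ((Fin.cons (-grad n f (ψ R w)) (fun i => mfderiv (𝓡 n) (𝓡 n) (ψ R) w (z i)) :
            Fin (j + 1) → TangentSpace (𝓡 n) (ψ R w)) (Fin.cast hj i))) =
        tupleSign oZ (fun i => (flowoutPlus f ψ Wp R w).mkQ (z i))) →
      KernelVectorSign (Orientation.reindex ℝ _ (finCongr hj) (om ⟨w, hw⟩)) oZ
        ((flowoutPlus f ψ Wp R w).mkQ ∘ₗ (tangentSpaceOf n Wm w).subtype) ⟨ξ, hξ⟩ s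

end Gradient

end Manifold

end MorseGluing

end

/-!
# Gluing of broken negative gradient flow lines

The negative gradient flow `ψ` is hyperbolic at the critical point `p`: the linearized flow is
generated by minus the Hessian, which is self-adjoint for the metric and therefore diagonalizable
with non-zero real eigenvalues. Hence there is a chart `κ` with values in `Es × Eu` in which the
flow is a small perturbation of a linear map contracting `Es` and expanding `Eu`
(`IsNegGradFlow.exists_hypFlow`). As the energy `f` decreases, a flow line which starts and ends
near `p` stays near `p` in between (`IsNegGradFlow.no_return`).

The stable manifold is only given as a set of points. Its tangent spaces are controlled through
the smooth curves of points with small forward orbits: such orbits are the zeros of a smooth map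
on a space of bounded sequences (`IsHyperbolic.exists_stable_curve`). It follows that the tangent
vectors of the stable manifold are those with bounded forward orbits, that near `p` they are in a
narrow cone around `Es`, and that a tangent vector of `Wm` transverse to them is moved by the flow
into the unstable cone. So the flow moves a disc of `Wm` through `w₋^∞`, and backwards a disc of
`Wp` through `w₊^∞`, into a small box around `p`, where these discs are graphs over `Eu` and over
`Es` (`GluingData`, `HypFlow.exists_gluingData`).

A flow line of length `R` from the first disc to the second one is then an orbit of a hyperbolic
map with boundary conditions at both ends. Invariance of cones gives uniqueness
(`GluingData.eq_of_flow_eq`). For existence, the linearized boundary value problem is invertible,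
with bounds which do not depend on the length, and a pseudo-orbit along the broken flow line can
be corrected to an orbit (`IsHyperbolic.exists_orbit`, `GluingData.exists_flow_eq`). The solutions
depend smoothly on `R` by the implicit function theorem (`GluingData.exists_family`). If the
broken flow line is not constant, short or backward flow lines do not exist near it, by
compactness and because the energy decreases (`eventually_le_of_flow_eq`).

For the orientations, the frames of `T Wm` stay in the unstable cone while they pass through the
box, where the sign of the determinant of their unstable components is constant
(`IsHyperbolic.sign_det_iterate`). The orientation of `Wm` and the coorientation of `Wp` are
compared with this sign along the stable and along the unstable orbit; so `dψ^R` maps `T Wm`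
isomorphically to `T C / T Wp` with sign `ε₋ ε₊` (`GluingData.flow_sign`). The three orientation
statements then follow by linear algebra from the fact that the velocity of the family is in the
kernel (`kernelVectorSign_of_orientedAsSum`, `flowoutPlusVectorSign`).
-/

noncomputable section

namespace MorseGluing

set_option linter.unusedSectionVars false

/-! ### Hyperbolic linear maps: cones and boundary value problems -/

section Hyperbolic

variable {Es Eu : Type*} [NormedAddCommGroup Es] [NormedSpace ℝ Es]
  [NormedAddCommGroup Eu] [NormedSpace ℝ Eu]

/-- The linear map `Ls × Lu` of `Es × Eu` contracts the first factor by `1/4` and expands the second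
one by `4`. -/
structure IsHyperbolic (Ls : Es →L[ℝ] Es) (Lu : Eu →L[ℝ] Eu) : Prop where
  contract : ∀ v, ‖Ls v‖ ≤ 1 / 4 * ‖v‖
  expand : ∀ v, 4 * ‖v‖ ≤ ‖Lu v‖

variable {Ls : Es →L[ℝ] Es} {Lu : Eu →L[ℝ] Eu}

lemma IsHyperbolic.fst_bound (h : IsHyperbolic Ls Lu) {w w' : Es × Eu} {e : ℝ}
    (hw : ‖w' - (Ls.prodMap Lu) w‖ ≤ e) : ‖w'.1‖ ≤ 1 / 4 * ‖w.1‖ + e := by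
  have h1 : ‖w'.1 - Ls w.1‖ ≤ e := (norm_fst_le (w' - (Ls.prodMap Lu) w)).trans hw
  have h2 := norm_le_insert' w'.1 (Ls w.1)
  have := h.contract w.1
  linarith

lemma IsHyperbolic.snd_bound (h : IsHyperbolic Ls Lu) {w w' : Es × Eu} {e : ℝ}
    (hw : ‖w' - (Ls.prodMap Lu) w‖ ≤ e) : 4 * ‖w.2‖ ≤ ‖w'.2‖ + e := by
  have h1 : ‖w'.2 - Lu w.2‖ ≤ e := (norm_snd_le (w' - (Ls.prodMap Lu) w)).trans hw
  have h2 := norm_le_insert w'.2 (Lu w.2)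
  have := h.expand w.2
  linarith

/-- A small perturbation of a hyperbolic map sends the unstable cone `η ‖w.1‖ ≤ ‖w.2‖` into
itself and expands it. -/
lemma IsHyperbolic.cone_step (h : IsHyperbolic Ls Lu) {η ε : ℝ} (hη : 0 < η) (hη1 : η ≤ 1)
    (hε : ε ≤ η / 16) {w w' : Es × Eu} (hw : ‖w' - (Ls.prodMap Lu) w‖ ≤ ε * ‖w‖)
    (hc : η * ‖w.1‖ ≤ ‖w.2‖) : 3 * ‖w.2‖ ≤ ‖w'.2‖ ∧ η * ‖w'.1‖ ≤ 1 / 2 * ‖w.2‖ := by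
  have hn : η * ‖w‖ ≤ ‖w.2‖ := by
    rw [Prod.norm_def]
    rcases max_cases ‖w.1‖ ‖w.2‖ with ⟨h1, _⟩ | ⟨h1, _⟩ <;> rw [h1]
    · exact hc
    · nlinarith [norm_nonneg w.2]
  have he : ε * ‖w‖ ≤ ‖w.2‖ / 16 := by
    have := mul_le_mul_of_nonneg_right hε (norm_nonneg w)
    linarith
  have h1 := h.fst_bound (hw.trans he)
  have h2 := h.snd_bound (hw.trans he)
  refine ⟨by linarith [norm_nonneg w.2], ?_⟩
  have h3 := mul_le_mul_of_nonneg_left h1 hη.le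
  have h4 : η * (‖w.2‖ / 16) ≤ ‖w.2‖ / 16 := by nlinarith [norm_nonneg w.2]
  nlinarith [norm_nonneg w.2]

/-- An orbit of small perturbations which starts in the unstable cone stays there and grows
exponentially. -/
lemma IsHyperbolic.cone_iterate (h : IsHyperbolic Ls Lu) {η ε : ℝ} (hη : 0 < η) (hη1 : η ≤ 1)
    (hε : ε ≤ η / 16) {w : ℕ → Es × Eu} {N : ℕ}
    (hw : ∀ j < N, ‖w (j + 1) - (Ls.prodMap Lu) (w j)‖ ≤ ε * ‖w j‖)
    (hc : η * ‖(w 0).1‖ ≤ ‖(w 0).2‖) :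
    ∀ j ≤ N, η * ‖(w j).1‖ ≤ ‖(w j).2‖ ∧ 3 ^ j * ‖(w 0).2‖ ≤ ‖(w j).2‖ := by
  intro j
  induction j with
  | zero => intro _; simpa using hc
  | succ j ih =>
    intro hj
    obtain ⟨h1, h2⟩ := ih (by omega)
    obtain ⟨h3, h4⟩ := h.cone_step hη hη1 hε (hw j (by omega)) h1
    refine ⟨by linarith [norm_nonneg (w j).2], ?_⟩
    rw [pow_succ]
    linarith

/-- An orbit which starts in the unstable cone and ends in the stable cone vanishes. -/
lemma IsHyperbolic.eq_zero_of_cones (h : IsHyperbolic Ls Lu) {w : ℕ → Es × Eu} {N : ℕ}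
    (hw : ∀ j < N, ‖w (j + 1) - (Ls.prodMap Lu) (w j)‖ ≤ 1 / 16 * ‖w j‖)
    (hc : ‖(w 0).1‖ ≤ ‖(w 0).2‖) (hN : ‖(w N).2‖ ≤ 1 / 2 * ‖(w N).1‖) : w 0 = 0 := by
  obtain ⟨h1, h2⟩ := h.cone_iterate one_pos le_rfl le_rfl hw (by simpa using hc) N le_rfl
  have h3 : ‖(w N).2‖ ≤ 0 := by linarith [norm_nonneg (w N).1]
  have h4 : (1 : ℝ) ≤ 3 ^ N := one_le_pow₀ (by norm_num)
  have h5 : ‖(w 0).2‖ ≤ 0 := by nlinarith [norm_nonneg (w 0).2]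
  exact Prod.ext (norm_le_zero_iff.1 (hc.trans h5)) (norm_le_zero_iff.1 h5)

/-- A bounded orbit stays in the stable cone. -/
lemma IsHyperbolic.stable_of_bounded (h : IsHyperbolic Ls Lu) {η ε : ℝ} (hη : 0 < η) (hη1 : η ≤ 1)
    (hε : ε ≤ η / 16) {w : ℕ → Es × Eu}
    (hw : ∀ j, ‖w (j + 1) - (Ls.prodMap Lu) (w j)‖ ≤ ε * ‖w j‖) {M : ℝ} (hM : ∀ j, ‖w j‖ ≤ M) :
    ‖(w 0).2‖ ≤ η * ‖(w 0).1‖ := by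
  by_contra! hc
  have h0 : 0 < ‖(w 0).2‖ := lt_of_le_of_lt (by positivity) hc
  obtain ⟨j, hj⟩ := pow_unbounded_of_one_lt (M / ‖(w 0).2‖) (by norm_num : (1 : ℝ) < 3)
  have h1 := (h.cone_iterate hη hη1 hε (N := j) (fun i _ => hw i) hc.le j le_rfl).2
  rw [div_lt_iff₀ h0] at hj
  linarith [hM j, norm_snd_le (w j)]

/-- A step which ends in the stable cone halves the norm. -/
lemma IsHyperbolic.norm_le_half (h : IsHyperbolic Ls Lu) {w w' : Es × Eu}
    (hw : ‖w' - (Ls.prodMap Lu) w‖ ≤ 1 / 16 * ‖w‖) (hc : ‖w'.2‖ ≤ ‖w'.1‖) :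
    ‖w'‖ ≤ 1 / 2 * ‖w‖ := by
  have h1 := h.fst_bound hw
  rw [Prod.norm_def w', max_eq_left hc]
  linarith [norm_nonneg w, norm_fst_le w]

/-- A bounded orbit decays exponentially. -/
lemma IsHyperbolic.norm_le_pow_of_bounded (h : IsHyperbolic Ls Lu) {w : ℕ → Es × Eu}
    (hw : ∀ j, ‖w (j + 1) - (Ls.prodMap Lu) (w j)‖ ≤ 1 / 16 * ‖w j‖) {M : ℝ}
    (hM : ∀ j, ‖w j‖ ≤ M) (j : ℕ) : ‖w j‖ ≤ (1 / 2) ^ j * ‖w 0‖ := by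
  induction j with
  | zero => simp
  | succ j ih =>
    have := h.stable_of_bounded one_pos le_rfl le_rfl (w := fun i => w (i + (j + 1)))
      (fun i => by simpa [add_right_comm] using hw (i + (j + 1))) (fun i => hM _)
    have := h.norm_le_half (hw j) (by simpa using this)
    rw [pow_succ]
    linarith

/-- The discrete boundary value problem for a hyperbolic map, with boundary conditions in the
unstable cone at the start and in the stable cone at the end, is well-posed with a bound which
does not depend on the length. -/
lemma IsHyperbolic.norm_le_of_boundary (h : IsHyperbolic Ls Lu) {M : ℕ} {z : Fin (M + 1) → Es × Eu}
    {e : ℝ} (he : ∀ i : Fin M, ‖z i.succ - (Ls.prodMap Lu) (z i.castSucc)‖ ≤ e) (he0 : 0 ≤ e)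
    (h0 : ‖(z 0).1‖ ≤ 1 / 2 * ‖z 0‖) (hM : ‖(z (Fin.last M)).2‖ ≤ 1 / 2 * ‖z (Fin.last M)‖)
    (i : Fin (M + 1)) : ‖z i‖ ≤ 2 * e := by
  obtain ⟨k, hk⟩ := Finite.exists_max (fun i => ‖z i‖)
  refine (hk i).trans ?_
  rcases max_cases ‖(z k).1‖ ‖(z k).2‖ with ⟨h1, _⟩ | ⟨h1, _⟩ <;> rw [← Prod.norm_def] at h1
  · induction k using Fin.cases with
    | zero => linarith [norm_nonneg (z 0)]
    | succ j =>
      have := h.fst_bound (he j)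
      linarith [norm_fst_le (z j.castSucc), hk j.castSucc]
  · induction k using Fin.lastCases with
    | last => linarith [norm_nonneg (z (Fin.last M))]
    | cast j =>
      have := h.snd_bound (he j)
      linarith [norm_snd_le (z j.succ), hk j.succ, norm_nonneg (z j.castSucc)]

/-- The sequence `u, x₀, …, x_{N-1}, v`. -/
def withEnds {V : Type*} {N : ℕ} (u v : V) (x : Fin N → V) : Fin (N + 1 + 1) → V :=
  Fin.cons u (Fin.snoc x v : Fin (N + 1) → V)

@[simp] lemma withEnds_zero {V : Type*} {N : ℕ} (u v : V) (x : Fin N → V) :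
    withEnds u v x 0 = u := rfl

@[simp] lemma withEnds_last {V : Type*} {N : ℕ} (u v : V) (x : Fin N → V) :
    withEnds u v x (Fin.last (N + 1)) = v := by
  rw [← Fin.succ_last, withEnds, Fin.cons_succ, Fin.snoc_last]

@[simp] lemma withEnds_middle {V : Type*} {N : ℕ} (u v : V) (x : Fin N → V) (i : Fin N) :
    withEnds u v x i.castSucc.succ = x i := by
  rw [withEnds, Fin.cons_succ, Fin.snoc_castSucc]

lemma withEnds_induction {V : Type*} {N : ℕ} {P : V → Prop} {u v : V} {x : Fin N → V}
    (hu : P u) (hv : P v) (hx : ∀ i, P (x i)) (i : Fin (N + 1 + 1)) : P (withEnds u v x i) := by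
  induction i using Fin.cases with
  | zero => simpa
  | succ i =>
    induction i using Fin.lastCases with
    | last => rw [Fin.succ_last, withEnds_last]; exact hv
    | cast i => rw [withEnds_middle]; exact hx i

lemma map_withEnds {V W : Type*} {N : ℕ} (f : V → W) (u v : V) (x : Fin N → V)
    (i : Fin (N + 1 + 1)) : withEnds (f u) (f v) (f ∘ x) i = f (withEnds u v x i) := by
  induction i using Fin.cases with
  | zero => simp
  | succ i =>
    induction i using Fin.lastCases with
    | last => rw [Fin.succ_last, withEnds_last, withEnds_last]
    | cast i => rw [withEnds_middle, withEnds_middle]; rfl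

lemma map₂_withEnds {V W U : Type*} {N : ℕ} (f : V → W → U) (u v : V) (x : Fin N → V)
    (u' v' : W) (x' : Fin N → W) (i : Fin (N + 1 + 1)) :
    withEnds (f u u') (f v v') (fun i => f (x i) (x' i)) i =
      f (withEnds u v x i) (withEnds u' v' x' i) := by
  induction i using Fin.cases with
  | zero => simp
  | succ i =>
    induction i using Fin.lastCases with
    | last => simp only [Fin.succ_last, withEnds_last]
    | cast i => simp only [withEnds_middle]

/-- The linearized boundary value problem `(a, b, x) ↦ (z_{i+1} - L z_i)_i`, where `z` is the
sequence `(m' a, a), x₀, …, x_{N-1}, (b, q' b)`. -/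
def boundaryOperator (Ls : Es →L[ℝ] Es) (Lu : Eu →L[ℝ] Eu) (m' : Eu →L[ℝ] Es) (q' : Es →L[ℝ] Eu)
    (N : ℕ) : (Eu × Es × (Fin N → Es × Eu)) →ₗ[ℝ] (Fin (N + 1) → Es × Eu) where
  toFun X i := withEnds (m' X.1, X.1) (X.2.1, q' X.2.1) X.2.2 i.succ -
    (Ls.prodMap Lu) (withEnds (m' X.1, X.1) (X.2.1, q' X.2.1) X.2.2 i.castSucc)
  map_add' X Y := by
    have key : ∀ j, withEnds (m' (X + Y).1, (X + Y).1) ((X + Y).2.1, q' (X + Y).2.1) (X + Y).2.2 j =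
        withEnds (m' X.1, X.1) (X.2.1, q' X.2.1) X.2.2 j +
        withEnds (m' Y.1, Y.1) (Y.2.1, q' Y.2.1) Y.2.2 j := by
      intro j
      rw [← map₂_withEnds (fun a b : Es × Eu => a + b)]
      simp [Prod.mk_add_mk]
      rfl
    ext1 i
    simp only [key, map_add, Pi.add_apply]
    abel
  map_smul' c X := by
    have key : ∀ j, withEnds (m' (c • X).1, (c • X).1) ((c • X).2.1, q' (c • X).2.1) (c • X).2.2 j =
        c • withEnds (m' X.1, X.1) (X.2.1, q' X.2.1) X.2.2 j := by
      intro j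
      rw [← map_withEnds (fun a : Es × Eu => c • a)]
      simp [Prod.smul_mk]
      rfl
    ext1 i
    simp only [key, map_smul, Pi.smul_apply, smul_sub, RingHom.id_apply]

lemma boundaryOperator_apply (m' : Eu →L[ℝ] Es) (q' : Es →L[ℝ] Eu)
    (N : ℕ) (X : Eu × Es × (Fin N → Es × Eu)) (i : Fin (N + 1)) :
    boundaryOperator Ls Lu m' q' N X i =
    withEnds (m' X.1, X.1) (X.2.1, q' X.2.1) X.2.2 i.succ -
    (Ls.prodMap Lu) (withEnds (m' X.1, X.1) (X.2.1, q' X.2.1) X.2.2 i.castSucc) := rfl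

/-- The linearized boundary value problem is invertible, and the norm of its inverse is at most `2`
whatever the length `N`. -/
lemma IsHyperbolic.norm_le_boundaryOperator (h : IsHyperbolic Ls Lu) {m' : Eu →L[ℝ] Es}
    {q' : Es →L[ℝ] Eu} (hm' : ∀ a, ‖m' a‖ ≤ 1 / 2 * ‖a‖) (hq' : ∀ b, ‖q' b‖ ≤ 1 / 2 * ‖b‖) {N : ℕ}
    (X : Eu × Es × (Fin N → Es × Eu)) : ‖X‖ ≤ 2 * ‖boundaryOperator Ls Lu m' q' N X‖ := by
  set z := withEnds (m' X.1, X.1) (X.2.1, q' X.2.1) X.2.2 with hz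
  have hb := h.norm_le_of_boundary (z := z) (e := ‖boundaryOperator Ls Lu m' q' N X‖)
    (fun i => norm_le_pi_norm (boundaryOperator Ls Lu m' q' N X) i) (norm_nonneg _)
    (by
      have : ‖X.1‖ ≤ ‖z 0‖ := norm_snd_le (z 0)
      exact (hm' X.1).trans (by linarith))
    (by
      have : ‖X.2.1‖ ≤ ‖z (Fin.last (N + 1))‖ := by
        rw [hz, withEnds_last]; exact norm_fst_le (X.2.1, q' X.2.1)
      have h2 := hq' X.2.1
      have h3 : (z (Fin.last (N + 1))).2 = q' X.2.1 := by rw [hz, withEnds_last]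
      rw [h3]
      linarith)
  rw [Prod.norm_def, Prod.norm_def]
  refine max_le ((norm_snd_le (z 0)).trans (hb 0)) (max_le ?_ ?_)
  · have := hb (Fin.last (N + 1))
    rw [hz, withEnds_last] at this
    exact (norm_fst_le (X.2.1, q' X.2.1)).trans this
  · rw [pi_norm_le_iff_of_nonneg (by positivity)]
    intro i
    have := hb i.castSucc.succ
    rwa [hz, withEnds_middle] at this

/-- Existence for the nonlinear boundary value problem: a pseudo-orbit `m 0, x₀, …, x_{N-1}, q 0`
of a map close to a hyperbolic linear map is shadowed by an orbit from the disc `m` to the disc `q`.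
The bounds do not depend on the length of the orbit. -/
theorem IsHyperbolic.exists_orbit [FiniteDimensional ℝ Es] [FiniteDimensional ℝ Eu]
    (h : IsHyperbolic Ls Lu) {φ : Es × Eu → Es × Eu} {r : ℝ}
    (hφ : ∀ x y, ‖x‖ ≤ r → ‖y‖ ≤ r →
      ‖φ x - φ y - (Ls.prodMap Lu) (x - y)‖ ≤ 1 / 16 * ‖x - y‖)
    {m : Eu → Es × Eu} {q : Es → Es × Eu} {m' : Eu →L[ℝ] Es} {q' : Es →L[ℝ] Eu} {ρ c : ℝ}
    (hc0 : 0 ≤ c) (hc : c * (1 + ‖Ls.prodMap Lu‖) ≤ 1 / 16)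
    (hm : ∀ a a', ‖a‖ ≤ ρ → ‖a'‖ ≤ ρ → ‖m a - m a' - (m' (a - a'), a - a')‖ ≤ c * ‖a - a'‖)
    (hq : ∀ b b', ‖b‖ ≤ ρ → ‖b'‖ ≤ ρ → ‖q b - q b' - (b - b', q' (b - b'))‖ ≤ c * ‖b - b'‖)
    (hm' : ∀ a, ‖m' a‖ ≤ 1 / 2 * ‖a‖) (hq' : ∀ b, ‖q' b‖ ≤ 1 / 2 * ‖b‖)
    (hmr : ∀ a, ‖a‖ ≤ ρ → ‖m a‖ ≤ r) (hqr : ∀ b, ‖b‖ ≤ ρ → ‖q b‖ ≤ r)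
    {N : ℕ} {x : Fin N → Es × Eu} (hx : ∀ i, ‖x i‖ ≤ r / 2) {e : ℝ} (he0 : 0 ≤ e)
    (he : ∀ i : Fin (N + 1), ‖withEnds (m 0) (q 0) x i.succ -
      φ (withEnds (m 0) (q 0) x i.castSucc)‖ ≤ e) (heρ : 4 * e ≤ ρ) (her : 4 * e ≤ r / 2) :
    ∃ a b, ∃ y : Fin N → Es × Eu, ‖a‖ ≤ 4 * e ∧ ‖b‖ ≤ 4 * e ∧ (∀ i, ‖y i‖ ≤ r) ∧
      ∀ i : Fin (N + 1), withEnds (m a) (q b) y i.succ = φ (withEnds (m a) (q b) y i.castSucc) := by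
  -- orbits are the zeros of `F`, which on a ball around the pseudo-orbit is a perturbation with
  -- Lipschitz constant `1/4` of the linear bijection `A`, with `‖A⁻¹‖ ≤ 2`; hence the image of the
  -- ball of radius `4 e` contains a ball of radius `(1/2 - 1/4) * 4 e = e`, and so it contains `0`
  set A := boundaryOperator Ls Lu m' q' N with hA
  have hAb : ∀ X, ‖X‖ ≤ 2 * ‖A X‖ := h.norm_le_boundaryOperator hm' hq'
  have hinj : Function.Injective A := by
    rw [← LinearMap.ker_eq_bot, LinearMap.ker_eq_bot']
    intro X hX
    have := hAb X
    rw [hX, norm_zero, mul_zero] at this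
    exact norm_le_zero_iff.1 this
  let Ae : (Eu × Es × (Fin N → Es × Eu)) ≃ₗ[ℝ] (Fin (N + 1) → Es × Eu) :=
    LinearEquiv.ofInjectiveOfFinrankEq A hinj (by
      simp [Module.finrank_prod, Module.finrank_pi_fintype]; ring)
  have hAe : ∀ X, Ae X = A X := fun X => rfl
  let F : Eu × Es × (Fin N → Es × Eu) → (Fin (N + 1) → Es × Eu) := fun X i =>
    withEnds (m X.1) (q X.2.1) X.2.2 i.succ - φ (withEnds (m X.1) (q X.2.1) X.2.2 i.castSucc)
  let X₀ : Eu × Es × (Fin N → Es × Eu) := (0, 0, x)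
  have hball : ∀ X ∈ Metric.closedBall X₀ (4 * e), ‖X.1‖ ≤ ρ ∧ ‖X.2.1‖ ≤ ρ ∧
      ∀ i, ‖X.2.2 i‖ ≤ r := by
    intro X hX
    rw [mem_closedBall_iff_norm] at hX
    have h1 := (norm_fst_le (X - X₀)).trans hX
    have h2 := (norm_snd_le (X - X₀)).trans hX
    have h3 := (norm_fst_le (X - X₀).2).trans h2
    have h4 := (norm_snd_le (X - X₀).2).trans h2
    simp only [X₀, Prod.fst_sub, Prod.snd_sub, sub_zero] at h1 h3 h4
    refine ⟨h1.trans heρ, h3.trans heρ, fun i => ?_⟩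
    have h5 := (norm_le_pi_norm (X.2.2 - x) i).trans h4
    have h6 := norm_le_insert' (X.2.2 i) (x i)
    rw [Pi.sub_apply] at h5
    linarith [hx i]
  have happ : ApproximatesLinearOn F (LinearMap.toContinuousLinearMap A)
      (Metric.closedBall X₀ (4 * e)) (1 / 4 : NNReal) := by
    intro X hX Y hY
    obtain ⟨hX1, hX2, hX3⟩ := hball X hX
    obtain ⟨hY1, hY2, hY3⟩ := hball Y hY
    rw [pi_norm_le_iff_of_nonneg (by positivity)]
    intro i
    have h16 : c ≤ 1 / 16 := by nlinarith [norm_nonneg (Ls.prodMap Lu)]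
    set zX := withEnds (m X.1) (q X.2.1) X.2.2
    set zY := withEnds (m Y.1) (q Y.2.1) Y.2.2
    set zL := withEnds (m' (X - Y).1, (X - Y).1) ((X - Y).2.1, q' (X - Y).2.1) (X - Y).2.2
    have hzX : ∀ j, ‖zX j‖ ≤ r := withEnds_induction (P := fun v => ‖v‖ ≤ r) (hmr _ hX1) (hqr _ hX2) hX3
    have hzY : ∀ j, ‖zY j‖ ≤ r := withEnds_induction (P := fun v => ‖v‖ ≤ r) (hmr _ hY1) (hqr _ hY2) hY3
    have hn1 : ‖X.1 - Y.1‖ ≤ ‖X - Y‖ := norm_fst_le (X - Y)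
    have hn2 : ‖X.2.1 - Y.2.1‖ ≤ ‖X - Y‖ := (norm_fst_le (X - Y).2).trans (norm_snd_le (X - Y))
    have hn3 : ∀ j, ‖X.2.2 j - Y.2.2 j‖ ≤ ‖X - Y‖ := fun j =>
      (norm_le_pi_norm ((X - Y).2.2) j).trans ((norm_snd_le (X - Y).2).trans (norm_snd_le (X - Y)))
    have hd : ∀ j, ‖zX j - zY j - zL j‖ ≤ c * ‖X - Y‖ := by
      intro j
      have : zX j - zY j - zL j = withEnds (m X.1 - m Y.1 - (m' (X.1 - Y.1), X.1 - Y.1))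
          (q X.2.1 - q Y.2.1 - (X.2.1 - Y.2.1, q' (X.2.1 - Y.2.1)))
          (fun i => X.2.2 i - Y.2.2 i - (X.2.2 i - Y.2.2 i)) j := by
        rw [map₂_withEnds (fun a b : Es × Eu => a - b), map₂_withEnds (fun a b : Es × Eu => a - b)]
        rfl
      rw [this]
      refine withEnds_induction (P := fun v => ‖v‖ ≤ c * ‖X - Y‖) ?_ ?_ ?_ j
      · exact (hm _ _ hX1 hY1).trans (by gcongr)
      · exact (hq _ _ hX2 hY2).trans (by gcongr)
      · intro i; simp; positivity
    have hL : ∀ j, ‖zL j‖ ≤ ‖X - Y‖ := by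
      intro j
      refine withEnds_induction (P := fun v => ‖v‖ ≤ ‖X - Y‖) ?_ ?_ hn3 j
      · refine max_le ((hm' _).trans ?_) hn1
        simp only [Prod.fst_sub]; linarith [norm_nonneg (X.1 - Y.1)]
      · refine max_le hn2 ((hq' _).trans ?_)
        simp only [Prod.fst_sub, Prod.snd_sub]; linarith [norm_nonneg (X.2.1 - Y.2.1)]
    have hzz : ∀ j, ‖zX j - zY j‖ ≤ (1 + c) * ‖X - Y‖ := by
      intro j
      have := norm_le_insert' (zX j - zY j) (zL j)
      linarith [hd j, hL j]
    have heq : (F X - F Y - LinearMap.toContinuousLinearMap A (X - Y)) i =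
        (zX i.succ - zY i.succ - zL i.succ) -
        (φ (zX i.castSucc) - φ (zY i.castSucc) - (Ls.prodMap Lu) (zX i.castSucc - zY i.castSucc)) -
        (Ls.prodMap Lu) (zX i.castSucc - zY i.castSucc - zL i.castSucc) := by
      simp only [Pi.sub_apply, LinearMap.coe_toContinuousLinearMap', hA, boundaryOperator_apply, F,
        map_sub (Ls.prodMap Lu)]
      abel
    rw [heq]
    have e1 := hd i.succ
    have e2 := (hφ _ _ (hzX i.castSucc) (hzY i.castSucc)).trans
      (mul_le_mul_of_nonneg_left (hzz i.castSucc) (by norm_num))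
    have e3 := ((Ls.prodMap Lu).le_opNorm (zX i.castSucc - zY i.castSucc - zL i.castSucc)).trans
      (mul_le_mul_of_nonneg_left (hd i.castSucc) (norm_nonneg _))
    refine (norm_sub_le _ _).trans ((add_le_add (norm_sub_le _ _) le_rfl).trans ?_)
    have hXY := norm_nonneg (X - Y)
    have e4 : c * (1 + ‖Ls.prodMap Lu‖) * ‖X - Y‖ ≤ 1 / 16 * ‖X - Y‖ := by gcongr
    have e5 : c * ‖X - Y‖ ≤ 1 / 16 * ‖X - Y‖ := by gcongr
    have e6 : (((1 / 4 : NNReal) : ℝ)) = 1 / 4 := by norm_num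
    rw [e6]
    nlinarith
  let Ainv : (LinearMap.toContinuousLinearMap A).NonlinearRightInverse :=
    { toFun := Ae.symm
      nnnorm := 2
      bound' := fun y => by
        have := hAb (Ae.symm y)
        rwa [← hAe, Ae.apply_symm_apply] at this
      right_inv' := fun y => by
        change A (Ae.symm y) = y
        rw [← hAe, Ae.apply_symm_apply] }
  have hsurj := happ.surjOn_closedBall_of_nonlinearRightInverse Ainv (by positivity) Subset.rfl
  have h0 : (0 : Fin (N + 1) → Es × Eu) ∈ Metric.closedBall (F X₀)
      ((((Ainv.nnnorm : NNReal) : ℝ)⁻¹ - ((1 / 4 : NNReal) : ℝ)) * (4 * e)) := by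
    rw [mem_closedBall_iff_norm, zero_sub, norm_neg]
    have : ((((Ainv.nnnorm : NNReal) : ℝ)⁻¹ - ((1 / 4 : NNReal) : ℝ)) * (4 * e)) = e := by
      have : ((Ainv.nnnorm : NNReal) : ℝ) = 2 := rfl
      rw [this]; norm_num; ring
    rw [this, pi_norm_le_iff_of_nonneg he0]
    exact he
  obtain ⟨X, hX, hFX⟩ := hsurj h0
  obtain ⟨_, _, hX3⟩ := hball X hX
  rw [mem_closedBall_iff_norm] at hX
  have h1 := (norm_fst_le (X - X₀)).trans hX
  have h3 := (norm_fst_le (X - X₀).2).trans ((norm_snd_le (X - X₀)).trans hX)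
  simp only [X₀, Prod.fst_sub, Prod.snd_sub, sub_zero] at h1 h3
  exact ⟨X.1, X.2.1, X.2.2, h1, h3, hX3, fun i => sub_eq_zero.1 (congrFun hFX i)⟩

end Hyperbolic

/-! ### Superposition operators on bounded sequences -/

section Superposition

open BoundedContinuousFunction

universe u

lemma norm_seqEval_apply_le {E F : Type u} [NormedAddCommGroup E] [NormedSpace ℝ E]
    [NormedAddCommGroup F] [NormedSpace ℝ F] (T : ℕ →ᵇ (E →L[ℝ] F)) (h : ℕ →ᵇ E) (j : ℕ) :
    ‖T j (h j)‖ ≤ ‖T‖ * ‖h‖ := by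
  refine ((T j).le_opNorm (h j)).trans ?_
  gcongr
  · exact T.norm_coe_le_norm j
  · exact h.norm_coe_le_norm j

set_option synthInstance.maxHeartbeats 100000 in
/-- Pointwise evaluation `(T, h) ↦ (T_j h_j)_j` of a bounded sequence of linear maps on a bounded
sequence of vectors. -/
def seqEval (E F : Type u) [NormedAddCommGroup E] [NormedSpace ℝ E] [NormedAddCommGroup F]
    [NormedSpace ℝ F] : (ℕ →ᵇ (E →L[ℝ] F)) →L[ℝ] (ℕ →ᵇ E) →L[ℝ] (ℕ →ᵇ F) :=
  LinearMap.mkContinuous₂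
    (LinearMap.mk₂ ℝ (fun (T : ℕ →ᵇ (E →L[ℝ] F)) (h : ℕ →ᵇ E) =>
      ofNormedAddCommGroupDiscrete (fun j => T j (h j)) (‖T‖ * ‖h‖) (norm_seqEval_apply_le T h))
      (fun _ _ _ => by ext j; simp) (fun _ _ _ => by ext j; simp)
      (fun _ _ _ => by ext j; simp) (fun _ _ _ => by ext j; simp)) 1
    (fun T h => by
      rw [one_mul]
      exact (norm_le (by positivity)).2 (norm_seqEval_apply_le T h))

lemma seqEval_apply {E F : Type u} [NormedAddCommGroup E] [NormedSpace ℝ E] [NormedAddCommGroup F]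
    [NormedSpace ℝ F] (T : ℕ →ᵇ (E →L[ℝ] F)) (h : ℕ →ᵇ E) (j : ℕ) :
    seqEval E F T h j = T j (h j) := rfl

/-- The superposition operator `x ↦ (N x_j)_j` on bounded sequences is differentiable, if the
derivative of `N` is Lipschitz; its derivative is a superposition operator, too. -/
lemma hasFDerivAt_superposition {E F : Type u} [NormedAddCommGroup E] [NormedSpace ℝ E]
    [NormedAddCommGroup F] [NormedSpace ℝ F] {N : E → F} (hd : Differentiable ℝ N)
    {C K : NNReal} (hL : LipschitzWith C N) (hK : LipschitzWith K (fderiv ℝ N)) (x : ℕ →ᵇ E) :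
    HasFDerivAt (fun x : ℕ →ᵇ E => x.comp N hL) (seqEval E F (x.comp (fderiv ℝ N) hK)) x := by
  rw [hasFDerivAt_iff_isLittleO_nhds_zero]
  refine (Asymptotics.IsBigO.of_bound K (g := fun h : ℕ →ᵇ E => ‖h‖ ^ 2)
    (Eventually.of_forall fun h => ?_)).trans_isLittleO
    (Asymptotics.isLittleO_norm_pow_id (by norm_num))
  rw [norm_le (by positivity)]
  intro j
  have key := (convex_segment (𝕜 := ℝ) (x j) (x j + h j)).norm_image_sub_le_of_norm_fderiv_le'
    (f := N) (φ := fderiv ℝ N (x j)) (C := K * ‖h‖) (fun y _ => hd y)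
    (fun y hy => by
      have h1 : ‖fderiv ℝ N y - fderiv ℝ N (x j)‖ ≤ K * ‖y - x j‖ := hK.norm_sub_le y (x j)
      have h2 : ‖y - x j‖ ≤ ‖h j‖ := by
        have := norm_sub_le_of_mem_segment hy
        simpa using this
      exact h1.trans (mul_le_mul_of_nonneg_left (h2.trans (h.norm_coe_le_norm j)) K.2))
    (left_mem_segment ℝ _ _) (right_mem_segment ℝ _ _)
  rw [add_sub_cancel_left] at key
  have e1 : (fun x : ℕ →ᵇ E => x.comp N hL) (x + h) j - (fun x : ℕ →ᵇ E => x.comp N hL) x j -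
      (seqEval E F (x.comp (fderiv ℝ N) hK)) h j = N (x j + h j) - N (x j) - fderiv ℝ N (x j) (h j) :=
    rfl
  have e2 := h.norm_coe_le_norm j
  have e3 : (0 : ℝ) ≤ K := K.2
  calc _ = ‖N (x j + h j) - N (x j) - fderiv ℝ N (x j) (h j)‖ := by rw [← e1]; rfl
    _ ≤ K * ‖h‖ * ‖h j‖ := key
    _ ≤ K * ‖h‖ * ‖h‖ := by gcongr
    _ = K * ‖‖h‖ ^ 2‖ := by rw [Real.norm_of_nonneg (by positivity)]; ring

set_option synthInstance.maxHeartbeats 100000 in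
/-- The derivative of a superposition operator is a superposition operator followed by the bounded
bilinear map `seqEval`, so smoothness follows by induction. -/
lemma contDiff_superposition_nat {E : Type u} [NormedAddCommGroup E] [NormedSpace ℝ E] (n : ℕ) :
    ∀ {F : Type u} [NormedAddCommGroup F] [NormedSpace ℝ F] {N : E → F}, ContDiff ℝ ∞ N →
      HasCompactSupport N → ∀ {C : NNReal} (hL : LipschitzWith C N),
      ContDiff ℝ n (fun x : ℕ →ᵇ E => x.comp N hL) := by
  induction n with
  | zero =>
    intro F _ _ N _ _ C hL
    exact contDiff_zero.2 (lipschitz_comp hL).continuous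
  | succ n ih =>
    intro F _ _ N hN hs C hL
    have hN' : ContDiff ℝ ∞ (fderiv ℝ N) := hN.fderiv_right (m := ∞) (by norm_num)
    have hs' : HasCompactSupport (fderiv ℝ N) := hs.fderiv ℝ
    obtain ⟨K, hK⟩ := hN'.lipschitzWith_of_hasCompactSupport hs' (by simp)
    rw [Nat.cast_add, Nat.cast_one, contDiff_succ_iff_hasFDerivAt]
    have h1 : ContDiff ℝ n (seqEval E F) := by fun_prop
    exact ⟨fun x => seqEval E F (x.comp (fderiv ℝ N) hK), h1.comp (ih hN' hs' hK), fun x =>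
      hasFDerivAt_superposition (hN.differentiable (by simp)) hL hK x⟩

lemma contDiff_superposition {E F : Type u} [NormedAddCommGroup E] [NormedSpace ℝ E]
    [NormedAddCommGroup F] [NormedSpace ℝ F] {N : E → F} (hN : ContDiff ℝ ∞ N)
    (hs : HasCompactSupport N) {C : NNReal} (hL : LipschitzWith C N) :
    ContDiff ℝ ∞ (fun x : ℕ →ᵇ E => x.comp N hL) :=
  contDiff_infty.2 fun n => contDiff_superposition_nat n hN hs hL

end Superposition

/-! ### Smooth curves in the stable set of a hyperbolic fixed point -/

section StableCurves

open BoundedContinuousFunction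

universe u

variable {Es Eu : Type u} [NormedAddCommGroup Es] [NormedSpace ℝ Es]
  [NormedAddCommGroup Eu] [NormedSpace ℝ Eu]

lemma norm_shift_le {A : Es →L[ℝ] Es} {B : Eu →L[ℝ] Eu} {c : ℝ} (hA : ∀ v, ‖A v‖ ≤ c * ‖v‖)
    (hB : ∀ v, ‖B v‖ ≤ c * ‖v‖) (hc : 0 ≤ c) (d : ℕ) (x : ℕ →ᵇ Es × Eu) (j : ℕ) :
    ‖((Nat.casesOn j 0 (fun i => A (x i).1), B (x (j + d)).2) : Es × Eu)‖ ≤ c * ‖x‖ := by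
  refine max_le ?_ ((hB _).trans ?_)
  · cases j with
    | zero =>
      change ‖(0 : Es)‖ ≤ _
      rw [norm_zero]
      positivity
    | succ i =>
      refine (hA _).trans ?_
      gcongr
      exact (norm_fst_le (x i)).trans (x.norm_coe_le_norm i)
  · gcongr
    exact (norm_snd_le (x (j + d))).trans (x.norm_coe_le_norm _)

/-- The operator on bounded sequences which shifts the first component to the right, applying `A`,
and applies `B` to the second component, shifted to the left by `d`. -/
def seqShift (A : Es →L[ℝ] Es) (B : Eu →L[ℝ] Eu) (d : ℕ) {c : ℝ} (hA : ∀ v, ‖A v‖ ≤ c * ‖v‖)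
    (hB : ∀ v, ‖B v‖ ≤ c * ‖v‖) (hc : 0 ≤ c) : (ℕ →ᵇ Es × Eu) →L[ℝ] (ℕ →ᵇ Es × Eu) :=
  LinearMap.mkContinuous
    { toFun := fun x => ofNormedAddCommGroupDiscrete
        (fun j => (Nat.casesOn j 0 (fun i => A (x i).1), B (x (j + d)).2)) (c * ‖x‖)
        (norm_shift_le hA hB hc d x)
      map_add' := fun x y => by
        ext j
        · cases j <;> simp
        · simp
      map_smul' := fun r x => by
        ext j
        · cases j <;> simp
        · simp } c (fun x => (norm_le (by positivity)).2 (norm_shift_le hA hB hc d x))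

section

variable {A : Es →L[ℝ] Es} {B : Eu →L[ℝ] Eu} {d : ℕ} {c : ℝ} (hA : ∀ v, ‖A v‖ ≤ c * ‖v‖)
    (hB : ∀ v, ‖B v‖ ≤ c * ‖v‖) (hc : 0 ≤ c)

lemma seqShift_fst_zero (x : ℕ →ᵇ Es × Eu) : (seqShift A B d hA hB hc x 0).1 = 0 := rfl

lemma seqShift_fst_succ (x : ℕ →ᵇ Es × Eu) (j : ℕ) :
    (seqShift A B d hA hB hc x (j + 1)).1 = A (x j).1 := rfl

lemma seqShift_snd (x : ℕ →ᵇ Es × Eu) (j : ℕ) :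
    (seqShift A B d hA hB hc x j).2 = B (x (j + d)).2 := rfl

lemma norm_seqShift_le : ‖seqShift A B d hA hB hc‖ ≤ c :=
  LinearMap.mkContinuous_norm_le _ hc _

end

/-- For each stable direction `v` of a hyperbolic fixed point of a smooth map there is a smooth
curve with velocity `v` at the fixed point, the points of which have small forward orbits. The
orbits are obtained from the inverse function theorem in the space of bounded sequences. -/
theorem IsHyperbolic.exists_stable_curve [FiniteDimensional ℝ Es] [FiniteDimensional ℝ Eu]
    {Ls : Es →L[ℝ] Es} {Lu : Eu →L[ℝ] Eu} (h : IsHyperbolic Ls Lu) {φ : Es × Eu → Es × Eu}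
    {U : Set (Es × Eu)} (hU : IsOpen U) (h0U : 0 ∈ U) (hφ : ContDiffOn ℝ ∞ φ U)
    (hφ0 : φ 0 = 0) (hφ' : HasFDerivAt φ (Ls.prodMap Lu) 0) (v : Es) :
    ∃ γ : ℝ → Es × Eu, ContDiffAt ℝ ∞ γ 0 ∧ γ 0 = 0 ∧ HasDerivAt γ (v, 0) 0 ∧
      ∀ r > 0, ∀ᶠ t in 𝓝 0, ∃ x : ℕ → Es × Eu, x 0 = γ t ∧
        ∀ j, ‖x j‖ ≤ r ∧ x (j + 1) = φ (x j) := by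
  obtain ⟨R, hR, hRU⟩ := Metric.isOpen_iff.1 hU 0 h0U
  -- the nonlinear part of `φ`, cut off outside of a neighbourhood of the fixed point
  let χ : ContDiffBump (0 : Es × Eu) := ⟨R / 3, R / 2, by positivity, by linarith⟩
  let N : Es × Eu → Es × Eu := fun x => χ x • (φ x - (Ls.prodMap Lu) x)
  have hcpt : HasCompactSupport N := χ.hasCompactSupport.smul_right
  have hN : ContDiff ℝ ∞ N := by
    rw [contDiff_iff_contDiffAt]
    intro x
    by_cases hx : x ∈ U
    · exact χ.contDiff.contDiffAt.smul
        ((hφ.contDiffAt (hU.mem_nhds hx)).sub (Ls.prodMap Lu).contDiff.contDiffAt)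
    · have hx' : x ∉ tsupport χ := by
        rw [χ.tsupport_eq]
        intro h1
        refine hx (hRU (Metric.closedBall_subset_ball ?_ h1))
        change R / 2 < R
        linarith
      refine (contDiffAt_const (c := (0 : Es × Eu))).congr_of_eventuallyEq ?_
      filter_upwards [(isClosed_tsupport χ).isOpen_compl.mem_nhds hx'] with y hy
      simp only [N]
      rw [image_eq_zero_of_notMem_tsupport hy, zero_smul]
  have hNin : ∀ x, ‖x‖ ≤ R / 3 → φ x = (Ls.prodMap Lu) x + N x := by
    intro x hx
    have : χ x = 1 := χ.one_of_mem_closedBall (mem_closedBall_zero_iff.2 hx)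
    simp only [N, this, one_smul]
    abel
  have hN0 : N 0 = 0 := by
    have := hNin 0 (by simp; positivity)
    rw [hφ0, map_zero, zero_add] at this
    exact this.symm
  have hN' : HasFDerivAt N (0 : Es × Eu →L[ℝ] Es × Eu) 0 := by
    have h1 : HasFDerivAt (fun x => φ x - (Ls.prodMap Lu) x) (0 : Es × Eu →L[ℝ] Es × Eu) 0 := by
      have := hφ'.sub (Ls.prodMap Lu).hasFDerivAt
      rwa [sub_self] at this
    refine h1.congr_of_eventuallyEq ?_
    filter_upwards [Metric.closedBall_mem_nhds (0 : Es × Eu) (by positivity : 0 < R / 3)] with x hx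
    rw [hNin x (mem_closedBall_zero_iff.1 hx)]
    abel
  obtain ⟨C, hC⟩ := hN.lipschitzWith_of_hasCompactSupport hcpt (by simp)
  obtain ⟨K, hK⟩ := (hN.fderiv_right (m := ∞) (by norm_num)).lipschitzWith_of_hasCompactSupport
    (hcpt.fderiv ℝ) (by simp)
  -- the inverse of the expanding part
  have hinj : Function.Injective Lu := by
    rw [injective_iff_map_eq_zero]
    intro u hu
    have := h.expand u
    rw [hu, norm_zero] at this
    exact norm_le_zero_iff.1 (by linarith)
  let Le : Eu ≃ₗ[ℝ] Eu := LinearEquiv.ofInjectiveEndo (Lu : Eu →ₗ[ℝ] Eu) hinj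
  have hLe : ∀ u, Lu (Le.symm u) = u := fun u => Le.apply_symm_apply u
  let B : Eu →L[ℝ] Eu := LinearMap.toContinuousLinearMap (Le.symm : Eu →ₗ[ℝ] Eu)
  have hLB : ∀ u, Lu (B u) = u := hLe
  have hB : ∀ u, ‖B u‖ ≤ 1 / 4 * ‖u‖ := by
    intro u
    have := h.expand (B u)
    rw [hLB] at this
    linarith
  have hB1 : ∀ u, ‖(-B) u‖ ≤ 1 * ‖u‖ := by
    intro u
    have := hB u
    simp only [_root_.neg_apply, norm_neg]
    linarith [norm_nonneg u]
  have hid : ∀ u, ‖ContinuousLinearMap.id ℝ Es u‖ ≤ 1 * ‖u‖ := fun u => by simp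
  -- orbits with prescribed stable component `ξ` at the start are the solutions of `H x = (ξ, 0, …)`
  let T := seqShift Ls B 1 h.contract hB (by norm_num)
  let S := seqShift (ContinuousLinearMap.id ℝ Es) (-B) 0 hid hB1 zero_le_one
  have hT : ‖T‖ < 1 := (norm_seqShift_le _ _ _).trans_lt (by norm_num)
  let H : (ℕ →ᵇ Es × Eu) → (ℕ →ᵇ Es × Eu) := fun x => x - T x - S (x.comp N hC)
  have hHs : ContDiff ℝ ∞ H :=
    (contDiff_id.sub T.contDiff).sub (S.contDiff.comp (contDiff_superposition hN hcpt hC))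
  let f' : (ℕ →ᵇ Es × Eu) ≃L[ℝ] (ℕ →ᵇ Es × Eu) :=
    ContinuousLinearEquiv.ofUnit (Units.oneSub T hT)
  have hf'T : ∀ x, f' x = x - T x := fun x => rfl
  -- the nonlinear part has zero derivative at the fixed point, hence `1 - T` is the derivative of `H`
  have hH' : HasFDerivAt H (f' : (ℕ →ᵇ Es × Eu) →L[ℝ] (ℕ →ᵇ Es × Eu)) 0 := by
    have h1 := ((hasFDerivAt_id (𝕜 := ℝ) (0 : ℕ →ᵇ Es × Eu)).sub T.hasFDerivAt).sub
      (S.hasFDerivAt.comp 0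
        (hasFDerivAt_superposition (hN.differentiable (by simp)) hC hK (0 : ℕ →ᵇ Es × Eu)))
    refine h1.congr_fderiv ?_
    ext1 x
    have h2 : seqEval (Es × Eu) (Es × Eu) ((0 : ℕ →ᵇ Es × Eu).comp (fderiv ℝ N) hK) x = 0 := by
      ext1 j
      rw [seqEval_apply]
      change fderiv ℝ N 0 (x j) = 0
      rw [hN'.fderiv]
      rfl
    change x - T x - S (seqEval (Es × Eu) (Es × Eu) _ x) = f' x
    rw [h2, map_zero, sub_zero, hf'T]
  have hH0 : H 0 = 0 := by
    have : (0 : ℕ →ᵇ Es × Eu).comp N hC = 0 := by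
      ext1 j
      exact hN0
    simp only [H, this, map_zero, sub_zero]
  have hstr := hHs.contDiffAt.hasStrictFDerivAt' hH' (by simp)
  let G := hHs.contDiffAt.localInverse hH' (by simp)
  have hGs : ContDiffAt ℝ ∞ G 0 := by
    have := hHs.contDiffAt.to_localInverse hH' (by simp)
    rwa [hH0] at this
  have hG0 : G 0 = 0 := by
    have := hHs.contDiffAt.localInverse_apply_image hH' (by simp)
    rwa [hH0] at this
  have hGr : ∀ᶠ y in 𝓝 0, H (G y) = y := by
    have := hstr.eventually_right_inverse
    rwa [hH0] at this
  have hG' : HasFDerivAt G (f'.symm : (ℕ →ᵇ Es × Eu) →L[ℝ] (ℕ →ᵇ Es × Eu)) 0 := by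
    have := hstr.to_localInverse.hasFDerivAt
    rwa [hH0] at this
  -- the curve is `t ↦ (H⁻¹ (t e)) 0` with `e = (v, 0), 0, …`; its velocity is the initial point of the
  -- linear orbit `w`, the solution of `(1 - T) w = e`
  let e : ℕ →ᵇ Es × Eu := ofNormedAddCommGroupDiscrete (fun j => Nat.casesOn j (v, 0) (fun _ => 0))
    ‖v‖ (fun j => by cases j <;> simp)
  have hpow : ∀ j : ℕ, ‖(((Ls ^ j) v, 0) : Es × Eu)‖ ≤ ‖v‖ := by
    intro j
    have h1 : ‖(Ls ^ j) v‖ ≤ ‖v‖ := by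
      induction j with
      | zero => simp
      | succ j ih =>
        rw [pow_succ']
        refine (h.contract ((Ls ^ j) v)).trans ?_
        linarith [norm_nonneg ((Ls ^ j) v)]
    exact max_le h1 (by simp)
  let w : ℕ →ᵇ Es × Eu := ofNormedAddCommGroupDiscrete (fun j => ((Ls ^ j) v, 0)) ‖v‖ hpow
  have hfw : f' w = e := by
    rw [hf'T]
    ext1 j
    refine Prod.ext ?_ ?_
    · cases j with
      | zero =>
        change (w 0).1 - (T w 0).1 = v
        rw [seqShift_fst_zero]
        simp [w]
      | succ j =>
        change (w (j + 1)).1 - (T w (j + 1)).1 = 0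
        rw [seqShift_fst_succ]
        change (Ls ^ (j + 1)) v - Ls ((Ls ^ j) v) = 0
        rw [pow_succ']
        exact sub_self _
    · change (w j).2 - (T w j).2 = (e j).2
      rw [seqShift_snd]
      cases j <;> simp [w, e]
  have hline : HasDerivAt (fun t : ℝ => t • e) e 0 := by
    simpa using (hasDerivAt_id (0 : ℝ)).smul_const e
  have hlines : ContDiff ℝ ∞ (fun t : ℝ => t • e) := contDiff_id.smul contDiff_const
  let ev : (ℕ →ᵇ Es × Eu) →L[ℝ] Es × Eu := evalCLM ℝ 0
  have h0e : (0 : ℝ) • e = 0 := zero_smul ℝ e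
  refine ⟨fun t => ev (G (t • e)), ?_, ?_, ?_, ?_⟩
  · refine ev.contDiff.contDiffAt.comp 0 (ContDiffAt.comp (0 : ℝ) ?_ hlines.contDiffAt)
    rwa [h0e]
  · change ev (G ((0 : ℝ) • e)) = 0
    rw [h0e, hG0, map_zero]
  · have h1 : HasFDerivAt G (f'.symm : (ℕ →ᵇ Es × Eu) →L[ℝ] (ℕ →ᵇ Es × Eu)) ((0 : ℝ) • e) := by
      rwa [h0e]
    have h2 := ev.hasFDerivAt.comp_hasDerivAt (0 : ℝ) (h1.comp_hasDerivAt (0 : ℝ) hline)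
    refine h2.congr_deriv ?_
    change ev (f'.symm e) = (v, 0)
    rw [← hfw, f'.symm_apply_apply]
    change w 0 = (v, 0)
    simp [w]
  · intro r hr
    have hcont : Tendsto (fun t : ℝ => G (t • e)) (𝓝 0) (𝓝 0) := by
      have h1 : ContinuousAt (fun t : ℝ => G (t • e)) 0 :=
        ContinuousAt.comp (g := G) (by rw [h0e]; exact hGs.continuousAt) hline.continuousAt
      have h2 := h1.tendsto
      rwa [h0e, hG0] at h2
    have hlim : Tendsto (fun t : ℝ => t • e) (𝓝 0) (𝓝 0) := by
      have h2 := hline.continuousAt.tendsto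
      rwa [h0e] at h2
    have hsmall : 0 < min r (R / 3) := lt_min hr (by positivity)
    filter_upwards [hlim.eventually hGr,
      hcont.eventually (Metric.ball_mem_nhds 0 hsmall)] with t ht1 ht2
    set x := G (t • e) with hx
    have hxn : ‖x‖ ≤ min r (R / 3) := (mem_ball_zero_iff.1 ht2).le
    refine ⟨fun j => x j, rfl, fun j => ⟨(x.norm_coe_le_norm j).trans (hxn.trans (min_le_left _ _)),
      ?_⟩⟩
    -- componentwise, `H x = t e` says that `x` is an orbit of `φ`
    have hpt : ∀ i, x i - T x i - S (x.comp N hC) i = t • e i := fun i => by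
      have := DFunLike.congr_fun ht1 i
      exact this
    rw [hNin (x j) ((x.norm_coe_le_norm j).trans (hxn.trans (min_le_right _ _)))]
    refine Prod.ext ?_ ?_
    · have h1 := congrArg Prod.fst (hpt (j + 1))
      have h2 : (x (j + 1)).1 - Ls (x j).1 - (N (x j)).1 = (t • e (j + 1)).1 := h1
      have h3 : (t • e (j + 1)).1 = 0 := by simp [e]
      rw [h3, sub_sub, sub_eq_zero] at h2
      exact h2
    · have h1 := congrArg Prod.snd (hpt j)
      have h2 : (x j).2 - B (x (j + 1)).2 - (-B) (N (x j)).2 = (t • e j).2 := h1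
      have h3 : (t • e j).2 = 0 := by cases j <;> simp [e]
      rw [h3, _root_.neg_apply, sub_neg_eq_add] at h2
      have h4 := congrArg Lu h2
      rw [map_add, map_sub, hLB, hLB, map_zero] at h4
      change (x (j + 1)).2 = Lu (x j).2 + (N (x j)).2
      rw [← sub_eq_zero, ← neg_eq_zero, ← h4]
      abel

end StableCurves

/-! ### Derivatives of maps between manifolds and vector spaces -/

section Calculus

variable {n : ℕ} {C : Type*} [TopologicalSpace C] [ChartedSpace (EuclideanSpace ℝ (Fin n)) C]
  {F G : Type*} [NormedAddCommGroup F] [NormedSpace ℝ F] [NormedAddCommGroup G] [NormedSpace ℝ G]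

/-- The differential of a vector valued function, as a linear map into the vector space. -/
def dAt (n : ℕ) {C : Type*} [TopologicalSpace C] [ChartedSpace (EuclideanSpace ℝ (Fin n)) C]
    {F : Type*} [NormedAddCommGroup F] [NormedSpace ℝ F] (h : C → F) (x : C) :
    TangentSpace (𝓡 n) x →ₗ[ℝ] F :=
  (mfderiv (𝓡 n) 𝓘(ℝ, F) h x).toLinearMap

/-- The differential of a map from a vector space to a manifold, as a linear map from the vector
space. -/
def dOf (n : ℕ) {C : Type*} [TopologicalSpace C] [ChartedSpace (EuclideanSpace ℝ (Fin n)) C]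
    {F : Type*} [NormedAddCommGroup F] [NormedSpace ℝ F] (σ : F → C) (a : F) :
    F →ₗ[ℝ] TangentSpace (𝓡 n) (σ a) :=
  (mfderiv 𝓘(ℝ, F) (𝓡 n) σ a).toLinearMap

/-- The differential of a map of the manifold to itself. -/
def dMap (n : ℕ) {C : Type*} [TopologicalSpace C] [ChartedSpace (EuclideanSpace ℝ (Fin n)) C]
    (g : C → C) (x : C) : TangentSpace (𝓡 n) x →ₗ[ℝ] TangentSpace (𝓡 n) (g x) :=
  (mfderiv (𝓡 n) (𝓡 n) g x).toLinearMap

lemma dAt_comp_dMap {h : C → F} {g : C → C} {x : C} (hh : MDifferentiableAt (𝓡 n) 𝓘(ℝ, F) h (g x))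
    (hg : MDifferentiableAt (𝓡 n) (𝓡 n) g x) (v : TangentSpace (𝓡 n) x) :
    dAt n (fun y => h (g y)) x v = dAt n h (g x) (dMap n g x v) := by
  have := mfderiv_comp x hh hg
  exact congrArg (fun L => L v) this

lemma dAt_vector_comp {h : C → F} {g : F → G} {x : C} (hh : MDifferentiableAt (𝓡 n) 𝓘(ℝ, F) h x)
    (hg : DifferentiableAt ℝ g (h x)) (v : TangentSpace (𝓡 n) x) :
    dAt n (fun y => g (h y)) x v = fderiv ℝ g (h x) (dAt n h x v) := by
  have := mfderiv_comp x hg.mdifferentiableAt hh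
  rw [mfderiv_eq_fderiv] at this
  exact congrArg (fun L => L v) this

lemma fderiv_comp_dOf {h : C → G} {σ : F → C} {a : F}
    (hh : MDifferentiableAt (𝓡 n) 𝓘(ℝ, G) h (σ a)) (hσ : MDifferentiableAt 𝓘(ℝ, F) (𝓡 n) σ a)
    (v : F) : fderiv ℝ (fun y => h (σ y)) a v = dAt n h (σ a) (dOf n σ a v) := by
  have := mfderiv_comp a hh hσ
  rw [mfderiv_eq_fderiv] at this
  exact congrArg (fun L => L v) this

lemma dMap_comp_dOf {g : C → C} {σ : F → C} {a : F}
    (hg : MDifferentiableAt (𝓡 n) (𝓡 n) g (σ a)) (hσ : MDifferentiableAt 𝓘(ℝ, F) (𝓡 n) σ a)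
    (v : F) : dOf n (fun y => g (σ y)) a v = dMap n g (σ a) (dOf n σ a v) := by
  have := mfderiv_comp a hg hσ
  exact congrArg (fun L => L v) this

lemma dOf_comp_fderiv {σ : G → C} {g : F → G} {a : F}
    (hσ : MDifferentiableAt 𝓘(ℝ, G) (𝓡 n) σ (g a)) (hg : DifferentiableAt ℝ g a)
    (v : F) : dOf n (fun y => σ (g y)) a v = dOf n σ (g a) (fderiv ℝ g a v) := by
  have := mfderiv_comp a hσ hg.mdifferentiableAt
  rw [mfderiv_eq_fderiv] at this
  exact congrArg (fun L => L v) this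

lemma hasDerivAt_comp_curve {h : C → F} {γ : ℝ → C} {t : ℝ}
    (hh : MDifferentiableAt (𝓡 n) 𝓘(ℝ, F) h (γ t))
    (hγ : MDifferentiableAt 𝓘(ℝ, ℝ) (𝓡 n) γ t) :
    HasDerivAt (fun s => h (γ s)) (dAt n h (γ t) (dOf n γ t 1)) t := by
  rw [← fderiv_comp_dOf hh hγ]
  have : DifferentiableAt ℝ (fun s => h (γ s)) t := (hh.comp t hγ).differentiableAt
  exact this.hasFDerivAt.hasDerivAt

lemma dAt_congr {h h' : C → F} {x : C} (hh : h =ᶠ[𝓝 x] h') : dAt n h x = dAt n h' x := by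
  have := hh.mfderiv_eq (I := 𝓡 n) (I' := 𝓘(ℝ, F))
  ext v
  exact congrArg (fun L => L v) this

/-- A vector valued chart which is smooth together with its inverse. -/
structure IsSmoothChart (n : ℕ) {C : Type*} [TopologicalSpace C]
    [ChartedSpace (EuclideanSpace ℝ (Fin n)) C]
    {F : Type*} [NormedAddCommGroup F] [NormedSpace ℝ F] (e : OpenPartialHomeomorph C F) :
    Prop where
  smooth : ContMDiffOn (𝓡 n) 𝓘(ℝ, F) ∞ e e.source
  smooth_symm : ContMDiffOn 𝓘(ℝ, F) (𝓡 n) ∞ e.symm e.target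

variable {e : OpenPartialHomeomorph C F}

lemma IsSmoothChart.contMDiffAt (he : IsSmoothChart n e) {x : C} (hx : x ∈ e.source) :
    ContMDiffAt (𝓡 n) 𝓘(ℝ, F) ∞ e x := he.smooth.contMDiffAt (e.open_source.mem_nhds hx)

lemma IsSmoothChart.contMDiffAt_symm (he : IsSmoothChart n e) {z : F} (hz : z ∈ e.target) :
    ContMDiffAt 𝓘(ℝ, F) (𝓡 n) ∞ e.symm z := he.smooth_symm.contMDiffAt (e.open_target.mem_nhds hz)

lemma IsSmoothChart.mdifferentiableAt (he : IsSmoothChart n e) {x : C} (hx : x ∈ e.source) :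
    MDifferentiableAt (𝓡 n) 𝓘(ℝ, F) e x := (he.contMDiffAt hx).mdifferentiableAt (by simp)

lemma IsSmoothChart.mdifferentiableAt_symm (he : IsSmoothChart n e) {z : F} (hz : z ∈ e.target) :
    MDifferentiableAt 𝓘(ℝ, F) (𝓡 n) e.symm z := (he.contMDiffAt_symm hz).mdifferentiableAt (by simp)

lemma IsSmoothChart.mdifferentiable (he : IsSmoothChart n e) :
    e.MDifferentiable (𝓡 n) 𝓘(ℝ, F) :=
  ⟨he.smooth.mdifferentiableOn (by simp), he.smooth_symm.mdifferentiableOn (by simp)⟩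

lemma IsSmoothChart.dAt_bijective (he : IsSmoothChart n e) {x : C} (hx : x ∈ e.source) :
    Function.Bijective (dAt n e x) := he.mdifferentiable.mfderiv_bijective hx

lemma IsSmoothChart.dAt_dOf_symm (he : IsSmoothChart n e) {z : F} (hz : z ∈ e.target) (v : F) :
    dAt n e (e.symm z) (dOf n e.symm z v) = v := by
  rw [← fderiv_comp_dOf (he.mdifferentiableAt (e.map_target hz)) (he.mdifferentiableAt_symm hz)]
  have : (fun y => e (e.symm y)) =ᶠ[𝓝 z] id := by
    filter_upwards [e.open_target.mem_nhds hz] with y hy using e.right_inv hy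
  rw [this.fderiv_eq, fderiv_id]
  rfl

/-- Composition of a chart with an invertible affine map. -/
lemma IsSmoothChart.affine (he : IsSmoothChart n e) (Θ : F ≃L[ℝ] G) (c : F) :
    ∃ e' : OpenPartialHomeomorph C G, IsSmoothChart n e' ∧ e'.source = e.source ∧
      (∀ x, e' x = Θ (e x - c)) ∧ ∀ z, e'.symm z = e.symm (Θ.symm z + c) := by
  let A : F ≃ₜ G := (Homeomorph.subRight c).trans Θ.toHomeomorph
  have hA : ∀ z, A z = Θ (z - c) := fun z => rfl
  have hA' : ∀ z, A.symm z = Θ.symm z + c := fun z => rfl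
  refine ⟨e.transHomeomorph A, ⟨?_, ?_⟩, rfl, fun x => rfl, fun z => rfl⟩
  · have h1 : ContDiff ℝ ∞ A := by
      have : (A : F → G) = fun z => Θ (z - c) := rfl
      rw [this]
      exact Θ.contDiff.comp (contDiff_id.sub contDiff_const)
    exact h1.contMDiff.comp_contMDiffOn he.smooth
  · have h1 : ContDiff ℝ ∞ A.symm := by
      have : (A.symm : G → F) = fun z => Θ.symm z + c := rfl
      rw [this]
      exact Θ.symm.contDiff.add contDiff_const
    exact he.smooth_symm.comp h1.contMDiff.contMDiffOn (fun z hz => hz)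

lemma finrank_tangentSpace (x : C) : Module.finrank ℝ (TangentSpace (𝓡 n) x) = n :=
  finrank_euclideanSpace_fin (𝕜 := ℝ) (n := n)

lemma IsSmoothChart.of_mem_maximalAtlas [IsManifold (𝓡 n) ∞ C]
    {φ : OpenPartialHomeomorph C (EuclideanSpace ℝ (Fin n))}
    (hφ : φ ∈ IsManifold.maximalAtlas (𝓡 n) ∞ C) : IsSmoothChart n φ :=
  ⟨contMDiffOn_of_mem_maximalAtlas hφ, contMDiffOn_symm_of_mem_maximalAtlas hφ⟩

/-! ### Tangent spaces of subsets -/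

lemma mem_tangentSpaceOf {S : Set C} {γ : ℝ → C} (hγ : ContMDiffAt 𝓘(ℝ, ℝ) (𝓡 n) ∞ γ 0)
    (hS : ∀ᶠ t in 𝓝 0, γ t ∈ S) : dOf n γ 0 1 ∈ tangentSpaceOf n S (γ 0) :=
  Submodule.subset_span ⟨γ, hγ, hS, rfl⟩

lemma mem_tangentSpaceOf' {S : Set C} {γ : ℝ → C} {t : ℝ}
    (hγ : ContMDiffAt 𝓘(ℝ, ℝ) (𝓡 n) ∞ γ t)
    (hS : ∀ᶠ s in 𝓝 t, γ s ∈ S) : dOf n γ t 1 ∈ tangentSpaceOf n S (γ t) := by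
  have h1 : ContDiff ℝ ∞ (fun s : ℝ => s + t) := contDiff_id.add contDiff_const
  have h2 : ContMDiffAt 𝓘(ℝ, ℝ) (𝓡 n) ∞ γ ((fun s : ℝ => s + t) 0) := by simpa using hγ
  have h3 := mem_tangentSpaceOf (S := S) (γ := fun s => γ (s + t))
    (h2.comp (0 : ℝ) h1.contMDiff.contMDiffAt)
    ((by simpa using (continuous_add_const t).tendsto 0 : Tendsto (fun s : ℝ => s + t) (𝓝 0)
      (𝓝 t)).eventually hS)
  have h4 := dOf_comp_fderiv (n := n) (σ := γ) (g := fun s : ℝ => s + t) (a := 0)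
    (h2.mdifferentiableAt (by simp)) (h1.differentiable (by simp) 0) 1
  rw [h4] at h3
  have h5 : fderiv ℝ (fun s : ℝ => s + t) 0 1 = 1 := by simp
  rw [h5] at h3
  have key : ∀ b, b = t → dOf n γ b 1 ∈ tangentSpaceOf n S (γ b) →
      dOf n γ t 1 ∈ tangentSpaceOf n S (γ t) := by
    rintro _ rfl h
    exact h
  exact key _ (zero_add t) h3

/-- To bound the tangent space of a set from above, it is enough to consider the velocities of
smooth curves in the set. -/
lemma tangentSpaceOf_le {S : Set C} {x : C} {V : Submodule ℝ (TangentSpace (𝓡 n) x)}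
    (h : ∀ γ : ℝ → C, ContMDiffAt 𝓘(ℝ, ℝ) (𝓡 n) ∞ γ 0 → (∀ᶠ t in 𝓝 0, γ t ∈ S) →
      ∀ hx : γ 0 = x, hx ▸ dOf n γ 0 1 ∈ V) : tangentSpaceOf n S x ≤ V := by
  refine Submodule.span_le.2 ?_
  rintro v ⟨γ, hγ, hS, heq⟩
  obtain rfl : γ 0 = x := congrArg TotalSpace.proj heq
  have hv : dOf n γ 0 1 = v := by
    have := (TotalSpace.mk_inj (F := EuclideanSpace ℝ (Fin n))
      (E := fun x : C => TangentSpace (𝓡 n) x) (b := γ 0)).1 heq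
    exact this
  rw [← hv]
  exact h γ hγ hS rfl

lemma dMap_mem_tangentSpaceOf {S S' : Set C} {g : C → C} {x : C}
    (hg : ContMDiffAt (𝓡 n) (𝓡 n) ∞ g x) (hS : MapsTo g S S') {v : TangentSpace (𝓡 n) x}
    (hv : v ∈ tangentSpaceOf n S x) : dMap n g x v ∈ tangentSpaceOf n S' (g x) := by
  have : tangentSpaceOf n S x ≤ (tangentSpaceOf n S' (g x)).comap (dMap n g x) := by
    refine tangentSpaceOf_le fun γ hγ hγS hx => ?_
    subst hx
    change dMap n g (γ 0) (dOf n γ 0 1) ∈ tangentSpaceOf n S' (g (γ 0))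
    rw [← dMap_comp_dOf (hg.mdifferentiableAt (by simp)) (hγ.mdifferentiableAt (by simp))]
    exact mem_tangentSpaceOf (γ := fun t => g (γ t)) (hg.comp (0 : ℝ) hγ)
      (hγS.mono fun t ht => hS ht)
  exact this hv

lemma dOf_mem_tangentSpaceOf {S : Set C} {σ : F → C} {a : F}
    (hσ : ContMDiffAt 𝓘(ℝ, F) (𝓡 n) ∞ σ a) (hS : ∀ᶠ b in 𝓝 a, σ b ∈ S) (v : F) :
    dOf n σ a v ∈ tangentSpaceOf n S (σ a) := by
  have h1 : ContDiff ℝ ∞ (fun s : ℝ => a + s • v) :=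
    contDiff_const.add (contDiff_id.smul contDiff_const)
  have h0 : (fun s : ℝ => a + s • v) 0 = a := by simp
  have h2 : ContMDiffAt 𝓘(ℝ, F) (𝓡 n) ∞ σ ((fun s : ℝ => a + s • v) 0) := by rwa [h0]
  have h3 := mem_tangentSpaceOf (S := S) (γ := fun s => σ (a + s • v))
    (h2.comp (0 : ℝ) h1.contMDiff.contMDiffAt)
    ((by simpa using h1.continuous.tendsto 0 : Tendsto (fun s : ℝ => a + s • v) (𝓝 0)
      (𝓝 a)).eventually hS)
  have h4 := dOf_comp_fderiv (n := n) (σ := σ) (g := fun s : ℝ => a + s • v) (a := 0)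
    (h2.mdifferentiableAt (by simp)) (h1.differentiable (by simp) 0) 1
  rw [h4] at h3
  have h5 : fderiv ℝ (fun s : ℝ => a + s • v) 0 1 = v := by
    have : HasDerivAt (fun s : ℝ => a + s • v) v 0 := by
      simpa using ((hasDerivAt_id (0 : ℝ)).smul_const v).const_add a
    have := this.hasFDerivAt.fderiv
    rw [this]; simp
  rw [h5] at h3
  have key : ∀ b, b = a → dOf n σ b v ∈ tangentSpaceOf n S (σ b) →
      dOf n σ a v ∈ tangentSpaceOf n S (σ a) := by
    rintro _ rfl h
    exact h
  exact key _ h0 h3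

/-- The points of a chart with values in `F × G` whose second component vanishes, parametrized by
the first component. -/
def slice (e : OpenPartialHomeomorph C (F × G)) (a : F) : C := e.symm (a, 0)

lemma contDiff_slice : ContDiff ℝ ∞ (fun a : F => ((a, 0) : F × G)) :=
  contDiff_id.prodMk contDiff_const

lemma IsSmoothChart.contMDiffAt_slice {e : OpenPartialHomeomorph C (F × G)}
    (he : IsSmoothChart n e) {a : F} (ha : (a, 0) ∈ e.target) :
    ContMDiffAt 𝓘(ℝ, F) (𝓡 n) ∞ (slice e) a :=
  (he.contMDiffAt_symm ha).comp a contDiff_slice.contMDiff.contMDiffAt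

lemma IsSmoothChart.mdifferentiableAt_slice {e : OpenPartialHomeomorph C (F × G)}
    (he : IsSmoothChart n e) {a : F} (ha : (a, 0) ∈ e.target) :
    MDifferentiableAt 𝓘(ℝ, F) (𝓡 n) (slice e) a := (he.contMDiffAt_slice ha).mdifferentiableAt (by simp)

lemma IsSmoothChart.dAt_dOf_slice {e : OpenPartialHomeomorph C (F × G)}
    (he : IsSmoothChart n e) {a : F} (ha : (a, 0) ∈ e.target) (w : F) :
    dAt n e (slice e a) (dOf n (slice e) a w) = (w, 0) := by
  have h1 := dOf_comp_fderiv (n := n) (σ := e.symm) (g := fun a : F => ((a, 0) : F × G)) (a := a)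
    (he.mdifferentiableAt_symm ha) (contDiff_slice.differentiable (by simp) a) w
  have h2 : fderiv ℝ (fun a : F => ((a, 0) : F × G)) a w = (w, 0) := by
    have : HasFDerivAt (fun a : F => ((a, 0) : F × G)) (ContinuousLinearMap.inl ℝ F G) a :=
      (ContinuousLinearMap.inl ℝ F G).hasFDerivAt
    rw [this.fderiv]
    rfl
  rw [h2] at h1
  have h3 := he.dAt_dOf_symm ha (w, 0)
  rw [← h1] at h3
  exact h3

lemma IsSmoothChart.dOf_slice_mem {S : Set C} {e : OpenPartialHomeomorph C (F × G)}
    (he : IsSmoothChart n e) (hS : ∀ y ∈ e.source, y ∈ S ↔ (e y).2 = 0) {a : F}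
    (ha : (a, 0) ∈ e.target) (w : F) :
    dOf n (slice e) a w ∈ tangentSpaceOf n S (slice e a) := by
  refine dOf_mem_tangentSpaceOf (he.contMDiffAt_slice ha) ?_ w
  filter_upwards [contDiff_slice.continuous.continuousAt.eventually
    (e.open_target.mem_nhds ha)] with b hb
  rw [slice, hS _ (e.map_target hb), e.right_inv hb]

/-- If a set is `{y | (e y).2 = 0}` in a smooth chart `e`, its tangent spaces are given by the
vanishing of the second component. -/
lemma mem_tangentSpaceOf_iff {S : Set C} {e : OpenPartialHomeomorph C (F × G)}
    (he : IsSmoothChart n e) (hS : ∀ y ∈ e.source, y ∈ S ↔ (e y).2 = 0) {x : C} (hx : x ∈ S)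
    (hxe : x ∈ e.source) (v : TangentSpace (𝓡 n) x) :
    v ∈ tangentSpaceOf n S x ↔ (dAt n e x v).2 = 0 := by
  constructor
  · have : tangentSpaceOf n S x ≤ LinearMap.ker (LinearMap.snd ℝ F G ∘ₗ dAt n e x) := by
      refine tangentSpaceOf_le fun γ hγ hγS hx => ?_
      subst hx
      change (dAt n e (γ 0) (dOf n γ 0 1)).2 = 0
      have h1 := (ContinuousLinearMap.snd ℝ F G).hasFDerivAt.comp_hasDerivAt (0 : ℝ)
        (hasDerivAt_comp_curve (he.mdifferentiableAt hxe) (hγ.mdifferentiableAt (by simp)))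
      have h2 : (fun t => (e (γ t)).2) =ᶠ[𝓝 0] fun _ => 0 := by
        filter_upwards [hγS, hγ.continuousAt.eventually (e.open_source.mem_nhds hxe)] with t h1 h2
        exact (hS _ h2).1 h1
      exact h1.unique ((hasDerivAt_const (0 : ℝ) (0 : G)).congr_of_eventuallyEq h2)
    exact fun hv => this hv
  · intro hv
    obtain ⟨a, rfl, ha⟩ : ∃ a, slice e a = x ∧ (a, 0) ∈ e.target := by
      have h1 : ((e x).1, (0 : G)) = e x := Prod.ext rfl ((hS x hxe).1 hx).symm
      refine ⟨(e x).1, ?_, ?_⟩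
      · rw [slice, h1, e.left_inv hxe]
      · rw [h1]; exact e.map_source hxe
    have h2 : v = dOf n (slice e) a (dAt n e (slice e a) v).1 := by
      refine (he.dAt_bijective hxe).1 ?_
      rw [he.dAt_dOf_slice ha]
      exact Prod.ext rfl hv
    rw [h2]
    exact he.dOf_slice_mem hS ha _

/-- Adapted charts of a submanifold: the submanifold is given by the vanishing of the second
component. -/
lemma IsSubmanifold.exists_chart [IsManifold (𝓡 n) ∞ C] [FiniteDimensional ℝ F]
    [FiniteDimensional ℝ G] {k : ℕ} {S : Set C} (hS : IsSubmanifold (n := n) k S)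
    (hF : Module.finrank ℝ F = k) (hG : k + Module.finrank ℝ G = n) {x : C} (hx : x ∈ S) :
    ∃ e : OpenPartialHomeomorph C (F × G), IsSmoothChart n e ∧ x ∈ e.source ∧ e x = 0 ∧
      ∀ y ∈ e.source, y ∈ S ↔ (e y).2 = 0 := by
  obtain ⟨φ, hφ, hxφ, V, hV, hVS⟩ := hS x hx
  obtain ⟨V', hV'⟩ := V.exists_isCompl
  have h1 : Module.finrank ℝ V' = Module.finrank ℝ G := by
    have := Submodule.finrank_add_eq_of_isCompl hV'
    rw [finrank_euclideanSpace_fin] at this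
    omega
  let Θ : EuclideanSpace ℝ (Fin n) ≃ₗ[ℝ] F × G :=
    (Submodule.prodEquivOfIsCompl V V' hV').symm.trans
      ((LinearEquiv.ofFinrankEq V F (hV.trans hF.symm)).prodCongr (LinearEquiv.ofFinrankEq V' G h1))
  obtain ⟨e, he, hes, heq, -⟩ := (IsSmoothChart.of_mem_maximalAtlas hφ).affine
    Θ.toContinuousLinearEquiv (φ x)
  refine ⟨e, he, by rwa [hes], by rw [heq, sub_self, map_zero], fun y hy => ?_⟩
  rw [hes] at hy
  rw [hVS y hy, heq]
  change _ ↔ (Θ (φ y - φ x)).2 = 0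
  simp only [Θ, LinearEquiv.trans_apply, LinearEquiv.prodCongr_apply]
  rw [LinearEquiv.map_eq_zero_iff, Submodule.prodEquivOfIsCompl_symm_apply_snd_eq_zero]

end Calculus

/-! ### Smooth flows -/

section Flow

variable {n : ℕ} {C : Type*} [TopologicalSpace C] [ChartedSpace (EuclideanSpace ℝ (Fin n)) C]

/-- A smooth action of `ℝ` on a manifold. -/
structure IsSmoothFlow (n : ℕ) {C : Type*} [TopologicalSpace C]
    [ChartedSpace (EuclideanSpace ℝ (Fin n)) C] (ψ : ℝ → C → C) : Prop where
  smooth : ContMDiff (𝓘(ℝ, ℝ).prod (𝓡 n)) (𝓡 n) ∞ (fun q : ℝ × C => ψ q.1 q.2)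
  zero : ∀ x, ψ 0 x = x
  add : ∀ s t x, ψ (s + t) x = ψ s (ψ t x)

variable {ψ : ℝ → C → C}

lemma IsSmoothFlow.reverse (hψ : IsSmoothFlow n ψ) : IsSmoothFlow n (fun t => ψ (-t)) where
  smooth := by
    have h1 : ContMDiff 𝓘(ℝ, ℝ) 𝓘(ℝ, ℝ) ∞ (fun t : ℝ => -t) := contDiff_neg.contMDiff
    exact hψ.smooth.comp ((h1.comp contMDiff_fst).prodMk contMDiff_snd)
  zero x := by simp [hψ.zero]
  add s t x := by rw [neg_add, hψ.add]

lemma IsSmoothFlow.contMDiff (hψ : IsSmoothFlow n ψ) (t : ℝ) :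
    ContMDiff (𝓡 n) (𝓡 n) ∞ (ψ t) :=
  hψ.smooth.comp (contMDiff_const.prodMk contMDiff_id)

lemma IsSmoothFlow.mdifferentiable (hψ : IsSmoothFlow n ψ) (t : ℝ) :
    MDifferentiable (𝓡 n) (𝓡 n) (ψ t) := (hψ.contMDiff t).mdifferentiable (by simp)

lemma IsSmoothFlow.continuous (hψ : IsSmoothFlow n ψ) : Continuous (fun q : ℝ × C => ψ q.1 q.2) :=
  hψ.smooth.continuous

lemma IsSmoothFlow.continuous_right (hψ : IsSmoothFlow n ψ) (t : ℝ) : Continuous (ψ t) :=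
  (hψ.contMDiff t).continuous

lemma IsSmoothFlow.continuous_left (hψ : IsSmoothFlow n ψ) (x : C) : Continuous (fun t => ψ t x) :=
  hψ.continuous.comp (by fun_prop : Continuous fun t : ℝ => (t, x))

lemma IsSmoothFlow.neg_apply (hψ : IsSmoothFlow n ψ) (t : ℝ) (x : C) : ψ (-t) (ψ t x) = x := by
  rw [← hψ.add, neg_add_cancel, hψ.zero]

lemma IsSmoothFlow.apply_neg (hψ : IsSmoothFlow n ψ) (t : ℝ) (x : C) : ψ t (ψ (-t) x) = x := by
  rw [← hψ.add, add_neg_cancel, hψ.zero]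

lemma IsSmoothFlow.dMap_injective [IsManifold (𝓡 n) ∞ C] (hψ : IsSmoothFlow n ψ) (t : ℝ) (x : C) :
    Function.Injective (dMap n (ψ t) x) := by
  let e := chartAt (EuclideanSpace ℝ (Fin n)) x
  have he : IsSmoothChart n e := .of_mem_maximalAtlas (IsManifold.chart_mem_maximalAtlas x)
  have hx : x ∈ e.source := mem_chart_source _ x
  have h2 : (fun y => e (ψ (-t) (ψ t y))) = e := funext fun y => by rw [hψ.neg_apply]
  have h3 : MDifferentiableAt (𝓡 n) 𝓘(ℝ, EuclideanSpace ℝ (Fin n)) (fun y => e (ψ (-t) y)) (ψ t x) :=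
    MDifferentiableAt.comp (ψ t x) (by rw [hψ.neg_apply]; exact he.mdifferentiableAt hx)
      (hψ.mdifferentiable (-t) _)
  intro v w hvw
  refine (he.dAt_bijective hx).1 ?_
  have h4 := dAt_comp_dMap h3 (hψ.mdifferentiable t x)
  rw [h2] at h4
  rw [h4, h4, hvw]

lemma IsSmoothFlow.dMap_bijective [IsManifold (𝓡 n) ∞ C] (hψ : IsSmoothFlow n ψ) (t : ℝ) (x : C) :
    Function.Bijective (dMap n (ψ t) x) := by
  have h := hψ.dMap_injective t x
  exact ⟨h, (LinearMap.injective_iff_surjective_of_finrank_eq_finrank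
    ((finrank_tangentSpace x).trans (finrank_tangentSpace (ψ t x)).symm)).1 h⟩

lemma IsSmoothFlow.finrank_tangentSpaceOf_le [IsManifold (𝓡 n) ∞ C] (hψ : IsSmoothFlow n ψ)
    {S : Set C} {t : ℝ} (hS : MapsTo (ψ t) S S) (x : C) :
    Module.finrank ℝ (tangentSpaceOf n S x) ≤ Module.finrank ℝ (tangentSpaceOf n S (ψ t x)) := by
  refine LinearMap.finrank_le_finrank_of_injective (f := (dMap n (ψ t) x).restrict
    fun v hv => dMap_mem_tangentSpaceOf (hψ.contMDiff t x) hS hv) ?_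
  intro v w hvw
  exact Subtype.ext (hψ.dMap_injective t x (congrArg Subtype.val hvw))

lemma IsSmoothFlow.finrank_tangentSpaceOf [IsManifold (𝓡 n) ∞ C] (hψ : IsSmoothFlow n ψ)
    {S : Set C} (hS : ∀ t, MapsTo (ψ t) S S) (t : ℝ) (x : C) :
    Module.finrank ℝ (tangentSpaceOf n S (ψ t x)) = Module.finrank ℝ (tangentSpaceOf n S x) := by
  refine le_antisymm ?_ (hψ.finrank_tangentSpaceOf_le (hS t) x)
  have := hψ.finrank_tangentSpaceOf_le (hS (-t)) (ψ t x)
  rwa [hψ.neg_apply] at this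

lemma IsSmoothFlow.mapsTo_stableManifold (hψ : IsSmoothFlow n ψ) (p : C) (t : ℝ) :
    MapsTo (ψ t) (stableManifold ψ p) (stableManifold ψ p) := by
  intro x hx
  have h1 := (show Tendsto (fun t => ψ t x) atTop (𝓝 p) from hx).comp
    (tendsto_atTop_add_const_right atTop t tendsto_id)
  refine h1.congr fun s => ?_
  exact hψ.add s t x

lemma stableManifold_reverse (p : C) :
    stableManifold (fun t => ψ (-t)) p = unstableManifold ψ p := by
  ext x
  constructor
  · intro h
    have h1 := (show Tendsto (fun t => ψ (-t) x) atTop (𝓝 p) from h).comp tendsto_neg_atBot_atTop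
    have h2 : Tendsto (fun t => ψ t x) atBot (𝓝 p) := by simpa [Function.comp_def] using h1
    exact h2
  · intro h
    exact (show Tendsto (fun t => ψ t x) atBot (𝓝 p) from h).comp tendsto_neg_atTop_atBot

lemma IsSmoothFlow.mapsTo_unstableManifold (hψ : IsSmoothFlow n ψ) (p : C) (t : ℝ) :
    MapsTo (ψ t) (unstableManifold ψ p) (unstableManifold ψ p) := by
  have := hψ.reverse.mapsTo_stableManifold p (-t)
  simpa [stableManifold_reverse] using this

end Flow

/-! ### The negative gradient flow -/

/-- The critical points of a Morse function are isolated. -/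
lemma IsMorse.eventually_ne_zero {n : ℕ} {C : Type*} [TopologicalSpace C]
    [ChartedSpace (EuclideanSpace ℝ (Fin n)) C] [IsManifold (𝓡 n) ∞ C] {f : C → ℝ} (hf : IsMorse n f) {p : C}
    (hp : mfderiv (𝓡 n) 𝓘(ℝ, ℝ) f p = 0) :
    ∀ᶠ x in 𝓝 p, x ≠ p → mfderiv (𝓡 n) 𝓘(ℝ, ℝ) f x ≠ 0 := by
  -- in a chart, the derivative of `f` vanishes at `p` and has an injective derivative there
  let e := chartAt (EuclideanSpace ℝ (Fin n)) p
  have he : IsSmoothChart n e := .of_mem_maximalAtlas (IsManifold.chart_mem_maximalAtlas p)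
  have hpe : p ∈ e.source := mem_chart_source _ p
  have hsm : ContDiffAt ℝ ∞ (fun z => f (e.symm z)) (e p) :=
    ((hf.1.contMDiffAt).comp (e p) (he.contMDiffAt_symm (e.map_source hpe))).contDiffAt
  have hfd : HasFDerivAt (fderiv ℝ (fun z => f (e.symm z)))
      (fderiv ℝ (fderiv ℝ (fun z => f (e.symm z))) (e p)) (e p) :=
    ((hsm.fderiv_right (m := 1) (WithTop.coe_le_coe.2 le_top)).differentiableAt (by simp)).hasFDerivAt
  set A := fderiv ℝ (fderiv ℝ (fun z => f (e.symm z))) (e p) with hA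
  have hinj : LinearMap.ker (A : EuclideanSpace ℝ (Fin n) →ₗ[ℝ] EuclideanSpace ℝ (Fin n) →L[ℝ] ℝ) =
      ⊥ := by
    rw [LinearMap.ker_eq_bot']
    intro v hv
    refine hf.2 p hp v fun w => ?_
    exact congrArg (fun L => L w) hv
  obtain ⟨K, _, hK⟩ := LinearMap.exists_antilipschitzWith _ hinj
  have hev := hfd.eventually_ne (c := 0) ⟨K, hK⟩
  rw [eventually_nhdsWithin_iff] at hev
  filter_upwards [e.open_source.mem_nhds hpe,
    (e.continuousAt hpe).eventually hev] with x hxe hx hxp hcrit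
  refine hx (fun h => hxp (e.injOn hxe hpe h)) ?_
  ext w
  have h1 := fderiv_comp_dOf (n := n) (h := f) (σ := e.symm) (a := e x)
    (hf.1.mdifferentiable (by simp) _) (he.mdifferentiableAt_symm (e.map_source hxe)) w
  rw [h1]
  have h2 : ∀ y, y = x → ∀ v, dAt n f y v = 0 := by
    rintro _ rfl v
    rw [dAt, hcrit]
    rfl
  exact h2 _ (e.left_inv hxe) _

section GradientFlow

variable {n : ℕ} {C : Type*} [TopologicalSpace C] [ChartedSpace (EuclideanSpace ℝ (Fin n)) C]
  [RiemannianBundle (fun x : C => TangentSpace (𝓡 n) x)] {f : C → ℝ} {ψ : ℝ → C → C}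

lemma inner_grad (f : C → ℝ) (x : C) (v : TangentSpace (𝓡 n) x) :
    inner ℝ (grad n f x) v = dAt n f x v :=
  InnerProductSpace.toDual_symm_apply

lemma grad_eq_zero_iff (f : C → ℝ) (x : C) :
    grad n f x = 0 ↔ mfderiv (𝓡 n) 𝓘(ℝ, ℝ) f x = 0 := by
  rw [grad]
  exact LinearIsometryEquiv.map_eq_zero_iff _

lemma IsNegGradFlow.velocity_eq (hψ : IsNegGradFlow (n := n) f ψ) (x : C) (t : ℝ) :
    dOf n (fun t => ψ t x) t 1 = -grad n f (ψ t x) := by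
  have := (hψ.integralCurve x t).mfderiv
  have h2 := congrArg (fun L => L (1 : ℝ)) this
  refine h2.trans ?_
  change (1 : ℝ) • (-grad n f (ψ t x)) = _
  rw [one_smul]

lemma IsNegGradFlow.mdifferentiableAt_left (hψ : IsNegGradFlow (n := n) f ψ) (x : C) (t : ℝ) :
    MDifferentiableAt 𝓘(ℝ, ℝ) (𝓡 n) (fun t => ψ t x) t :=
  (hψ.integralCurve x t).mdifferentiableAt

lemma IsNegGradFlow.hasDerivAt_energy (hψ : IsNegGradFlow (n := n) f ψ)
    (hf : ContMDiff (𝓡 n) 𝓘(ℝ, ℝ) ∞ f) (x : C) (t : ℝ) :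
    HasDerivAt (fun t => f (ψ t x)) (-‖grad n f (ψ t x)‖ ^ 2) t := by
  have := hasDerivAt_comp_curve (h := f) (γ := fun t => ψ t x) (t := t)
    (hf.mdifferentiable (by simp) _) (hψ.mdifferentiableAt_left x t)
  refine this.congr_deriv ?_
  have h2 := hψ.velocity_eq x t
  rw [h2, map_neg]
  have h3 := inner_grad f (ψ t x) (grad n f (ψ t x))
  rw [← h3, real_inner_self_eq_norm_sq]

lemma IsNegGradFlow.antitone_energy (hψ : IsNegGradFlow (n := n) f ψ)
    (hf : ContMDiff (𝓡 n) 𝓘(ℝ, ℝ) ∞ f) (x : C) : Antitone (fun t => f (ψ t x)) :=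
  antitone_of_deriv_nonpos (fun t => (hψ.hasDerivAt_energy hf x t).differentiableAt) fun t => by
    rw [(hψ.hasDerivAt_energy hf x t).deriv]
    exact neg_nonpos.2 (by positivity)

lemma IsNegGradFlow.energy_lt (hψ : IsNegGradFlow (n := n) f ψ)
    (hf : ContMDiff (𝓡 n) 𝓘(ℝ, ℝ) ∞ f) {x : C} (hx : grad n f x ≠ 0) {t : ℝ} (ht : 0 < t) :
    f (ψ t x) < f x := by
  have hanti := hψ.antitone_energy hf x
  have h0 : f (ψ 0 x) = f x := by rw [hψ.zero]
  refine lt_of_le_of_ne ((hanti ht.le).trans h0.le) fun heq => hx ?_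
  -- otherwise the energy is constant on `[0, t]`, and its derivative at `0` vanishes
  have h1 : HasDerivWithinAt (fun t => f (ψ t x)) 0 (Icc 0 t) 0 := by
    refine (hasDerivWithinAt_const 0 (Icc 0 t) (f x)).congr (fun s hs => ?_) h0
    exact le_antisymm ((hanti hs.1).trans h0.le) (heq.symm.le.trans (hanti hs.2))
  have h2 := (hψ.hasDerivAt_energy hf x 0).hasDerivWithinAt (s := Icc 0 t)
  have h3 := (uniqueDiffOn_Icc ht 0 (left_mem_Icc.2 ht.le)).eq_deriv _ h1 h2
  rw [hψ.zero] at h3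
  have h4 : ‖grad n f x‖ = 0 := by
    have : ‖grad n f x‖ ^ 2 = 0 := by linarith
    exact pow_eq_zero_iff (two_ne_zero) |>.1 this
  exact norm_eq_zero.1 h4

variable [IsManifold (𝓡 n) ∞ C]

/-- The vector field `-grad f` is smooth since it is the initial velocity of a smooth flow. -/
lemma IsNegGradFlow.contMDiff_neg_grad (hψ : IsNegGradFlow (n := n) f ψ) :
    ContMDiff (𝓡 n) (𝓡 n).tangent 1
      (fun x => (⟨x, -grad n f x⟩ : TangentBundle (𝓡 n) C)) := by
  have h1 : ContMDiff ((𝓘(ℝ, ℝ).prod (𝓡 n)).tangent) (𝓡 n).tangent 1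
      (tangentMap (𝓘(ℝ, ℝ).prod (𝓡 n)) (𝓡 n) (fun q : ℝ × C => ψ q.1 q.2)) :=
    hψ.smooth.contMDiff_tangentMap (WithTop.coe_le_coe.2 le_top)
  have h2 : ContMDiff (𝓡 n) (𝓡 n).tangent 1 (zeroSection (EuclideanSpace ℝ (Fin n))
      (fun x : C => TangentSpace (𝓡 n) x)) := Bundle.contMDiff_zeroSection ℝ _
  have h3 : ContMDiff (𝓡 n) 𝓘(ℝ, ℝ).tangent 1
      (fun _ : C => (⟨0, (1 : ℝ)⟩ : TangentBundle 𝓘(ℝ, ℝ) ℝ)) := contMDiff_const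
  -- the tangent map of `ψ` sends `(∂/∂t, 0)` at `(0, x)` to `-grad f x`
  have h4 := h1.comp ((contMDiff_equivTangentBundleProd_symm (I := 𝓘(ℝ, ℝ)) (I' := 𝓡 n)
    (M := ℝ) (M' := C) (n := 1)).comp (h3.prodMk h2))
  refine h4.congr fun x => ?_
  have h5 : mfderiv (𝓘(ℝ, ℝ).prod (𝓡 n)) (𝓡 n) (fun q : ℝ × C => ψ q.1 q.2) ((0 : ℝ), x)
      ((1 : ℝ), (0 : TangentSpace (𝓡 n) x)) = -grad n f (ψ 0 x) := by
    have := mfderiv_prod_eq_add_apply (I := 𝓘(ℝ, ℝ)) (I' := 𝓡 n) (I'' := 𝓡 n)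
      (f := fun q : ℝ × C => ψ q.1 q.2) (p := ((0 : ℝ), x))
      (v := ((1 : ℝ), (0 : TangentSpace (𝓡 n) x))) (hψ.smooth.mdifferentiableAt (by simp))
    refine this.trans ?_
    rw [map_zero, add_zero]
    exact hψ.velocity_eq x 0
  have h6 : ∀ y, y = x → (⟨x, -grad n f x⟩ : TangentBundle (𝓡 n) C) = ⟨y, -grad n f y⟩ := by
    rintro _ rfl
    rfl
  refine (h6 _ (hψ.zero x)).trans ?_
  exact congrArg (fun v => (⟨ψ 0 x, v⟩ : TangentBundle (𝓡 n) C)) h5.symm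

variable [T2Space C]

/-- The group law follows from the uniqueness of integral curves. -/
theorem IsNegGradFlow.isSmoothFlow (hψ : IsNegGradFlow (n := n) f ψ) : IsSmoothFlow n ψ where
  smooth := hψ.smooth
  zero := hψ.zero
  add s t x := by
    have h1 : IsMIntegralCurve (I := 𝓡 n) (fun s => ψ (s + t) x) (fun y => -grad n f y) :=
      (hψ.integralCurve x).comp_add t
    have h2 := isMIntegralCurve_Ioo_eq_of_contMDiff_boundaryless (t₀ := 0) hψ.contMDiff_neg_grad h1
      (hψ.integralCurve (ψ t x)) (by simp [hψ.zero])
    exact congrFun h2 s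

lemma IsNegGradFlow.apply_eq_of_grad_eq_zero (hψ : IsNegGradFlow (n := n) f ψ) {p : C}
    (hp : grad n f p = 0) (t : ℝ) : ψ t p = p := by
  have h1 : IsMIntegralCurve (I := 𝓡 n) (fun _ : ℝ => p) (fun y => -grad n f y) := by
    intro t
    have h3 := hasMFDerivAt_const (I := 𝓘(ℝ, ℝ)) (I' := 𝓡 n) p t
    have h4 : ((1 : ℝ →L[ℝ] ℝ).smulRight (-grad n f p) : ℝ →L[ℝ] TangentSpace (𝓡 n) p) = 0 := by
      ext
      simp [hp]
    rw [h4]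
    exact h3
  exact congrFun (isMIntegralCurve_Ioo_eq_of_contMDiff_boundaryless (t₀ := 0)
    hψ.contMDiff_neg_grad (hψ.integralCurve p) h1 (hψ.zero p)) t

/-- A flow line of the negative gradient flow which starts and ends near a critical point stays near
it: otherwise it would pass through the boundary of a compact neighbourhood without other critical
points, and lose an amount of energy there which is bounded from below. -/
lemma IsNegGradFlow.no_return (hψ : IsNegGradFlow (n := n) f ψ) (hf : IsMorse n f) {p : C}
    (hp : mfderiv (𝓡 n) 𝓘(ℝ, ℝ) f p = 0) {U : Set C} (hU : U ∈ 𝓝 p) :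
    ∃ V ∈ 𝓝 p, ∀ x ∈ V, ∀ t, 0 ≤ t → ψ t x ∈ V → ∀ s ∈ Icc 0 t, ψ s x ∈ U := by
  have : LocallyCompactSpace C := Manifold.locallyCompact_of_finiteDimensional (𝓡 n)
  have hfl := hψ.isSmoothFlow
  have hfix := hψ.apply_eq_of_grad_eq_zero ((grad_eq_zero_iff f p).2 hp)
  -- `K` is a compact neighbourhood of `p` without other critical points; a flow line which leaves it
  -- meets its frontier `S`, and then loses at least the energy `c` within the next unit of time
  obtain ⟨K, hK, hKU, hKc⟩ := local_compact_nhds (inter_mem hU (hf.eventually_ne_zero hp))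
  set S := frontier K with hS
  have hSK : S ⊆ K := hKc.isClosed.frontier_subset
  have hSc : IsCompact S := hKc.of_isClosed_subset isClosed_frontier hSK
  have hpS : p ∉ S := fun h => h.2 (mem_interior_iff_mem_nhds.2 hK)
  have hcrit : ∀ y ∈ S, grad n f y ≠ 0 := fun y hy h =>
    (hKU (hSK hy)).2 (fun h' => hpS (h' ▸ hy)) ((grad_eq_zero_iff f y).1 h)
  have hfc : Continuous f := hf.1.continuous
  obtain ⟨c, hc0, hc⟩ : ∃ c > 0, ∀ y ∈ S, c ≤ f y - f (ψ 1 y) := by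
    rcases S.eq_empty_or_nonempty with h | h
    · exact ⟨1, one_pos, fun y hy => by rw [h] at hy; exact hy.elim⟩
    · obtain ⟨y, hy, hmin⟩ := hSc.exists_isMinOn h
        ((hfc.sub (hfc.comp (hfl.continuous_right 1))).continuousOn)
      exact ⟨f y - f (ψ 1 y), sub_pos.2 (hψ.energy_lt hf.1 (hcrit y hy) one_pos), hmin⟩
  -- neither the points of `S` nor their orbits up to time `1` come close to `p`, so that a return
  -- takes longer than one unit of time
  have hTc : IsCompact ((fun q : ℝ × C => ψ q.1 q.2) '' (Icc 0 1 ×ˢ S)) :=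
    (isCompact_Icc.prod hSc).image hfl.continuous
  have hpT : p ∉ (fun q : ℝ × C => ψ q.1 q.2) '' (Icc 0 1 ×ˢ S) := by
    rintro ⟨⟨s, y⟩, ⟨_, hy⟩, hsy⟩
    refine hpS ?_
    have h1 := hfl.neg_apply s y
    simp only at hsy
    rw [hsy, hfix] at h1
    rwa [h1]
  refine ⟨interior K ∩ ((fun q : ℝ × C => ψ q.1 q.2) '' (Icc 0 1 ×ˢ S))ᶜ ∩
    {x | |f x - f p| < c / 2}, inter_mem (inter_mem (interior_mem_nhds.2 hK)
      (hTc.isClosed.isOpen_compl.mem_nhds hpT)) ?_, ?_⟩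
  · refine (isOpen_lt (hfc.sub continuous_const).abs continuous_const).mem_nhds ?_
    simp [hc0]
  rintro x ⟨⟨hxK, _⟩, hxf⟩ t ht ⟨⟨htK, htT⟩, htf⟩ s hs
  by_contra hsU
  have hsK : ψ s x ∉ K := fun h => hsU (hKU h).1
  -- `r` is a time at which the flow line crosses `S`
  obtain ⟨r, hr, hrS⟩ : ∃ r ∈ Icc 0 s, ψ r x ∈ S := by
    have hpre : IsPreconnected ((fun r => ψ r x) '' Icc 0 s) :=
      isPreconnected_Icc.image _ (hfl.continuous_left x).continuousOn
    by_contra! hcon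
    have hcov : (fun r => ψ r x) '' Icc 0 s ⊆ interior K ∪ Kᶜ := by
      rintro _ ⟨r, hr, rfl⟩
      by_contra h
      rw [mem_union, not_or, mem_compl_iff, not_not] at h
      exact hcon r hr ⟨subset_closure h.2, h.1⟩
    obtain ⟨y, _, hy1, hy2⟩ := hpre (interior K) Kᶜ isOpen_interior hKc.isClosed.isOpen_compl hcov
      ⟨x, ⟨0, left_mem_Icc.2 hs.1, hfl.zero x⟩, hxK⟩ ⟨ψ s x, ⟨s, right_mem_Icc.2 hs.1, rfl⟩, hsK⟩
    exact hy2 (interior_subset hy1)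
  have h1 : ψ t x = ψ (t - r) (ψ r x) := by rw [← hfl.add, sub_add_cancel]
  have h2 : 1 < t - r := by
    by_contra! h
    exact htT ⟨(t - r, ψ r x), ⟨⟨by linarith [hr.2, hs.2], h⟩, hrS⟩, h1.symm⟩
  have h3 : f (ψ t x) ≤ f (ψ 1 (ψ r x)) := by
    rw [h1]
    exact hψ.antitone_energy hf.1 _ h2.le
  have h4 : f (ψ r x) ≤ f x := by
    have := hψ.antitone_energy hf.1 x hr.1
    simpa only [hψ.zero] using this
  have h5 := hc _ hrS
  rw [mem_ofPred_eq, abs_lt] at hxf htf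
  linarith [hxf.1, hxf.2, htf.1, htf.2]

end GradientFlow

/-! ### Continuity of differentials -/

section TangentMaps

variable {n : ℕ} {C : Type*} [TopologicalSpace C] [ChartedSpace (EuclideanSpace ℝ (Fin n)) C]
  [IsManifold (𝓡 n) ∞ C]
  {F G : Type*} [NormedAddCommGroup F] [NormedSpace ℝ F] [NormedAddCommGroup G] [NormedSpace ℝ G]
  {T : Type*} [TopologicalSpace T]

/-- The differential of a smooth function is continuous along continuous families of tangent
vectors. -/
lemma continuousWithinAt_dAt {h : C → F} {U : Set C} (hU : IsOpen U)
    (hh : ContMDiffOn (𝓡 n) 𝓘(ℝ, F) ∞ h U) {x : T → C} {v : (s : T) → TangentSpace (𝓡 n) (x s)}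
    {A : Set T} {s : T} (hs : x s ∈ U)
    (hv : ContinuousWithinAt (fun s => (⟨x s, v s⟩ : TangentBundle (𝓡 n) C)) A s) :
    ContinuousWithinAt (fun s => dAt n h (x s) (v s)) A s := by
  have : IsManifold (𝓡 n) 1 C := .of_le (m := 1) (n := ∞) (WithTop.coe_le_coe.2 le_top)
  have h1 := hh.continuousOn_tangentMapWithin (WithTop.coe_le_coe.2 le_top) hU.uniqueMDiffOn
  have h2 : ContinuousAt (tangentMapWithin (𝓡 n) 𝓘(ℝ, F) h U)
      (⟨x s, v s⟩ : TangentBundle (𝓡 n) C) :=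
    h1.continuousAt ((hU.preimage (FiberBundle.continuous_proj _ _)).mem_nhds hs)
  have h3 : ContinuousAt (tangentMap (𝓡 n) 𝓘(ℝ, F) h) (⟨x s, v s⟩ : TangentBundle (𝓡 n) C) := by
    refine h2.congr ?_
    filter_upwards [(hU.preimage (FiberBundle.continuous_proj (EuclideanSpace ℝ (Fin n))
      (TangentSpace (𝓡 n) : C → Type _))).mem_nhds (x := ⟨x s, v s⟩) hs] with w hw
    exact tangentMapWithin_eq_tangentMap (hU.uniqueMDiffOn _ hw)
      ((hh.contMDiffAt (hU.mem_nhds hw)).mdifferentiableAt (by simp))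
  have h4 : Continuous (fun w : TangentBundle 𝓘(ℝ, F) F => w.2) := by
    have := (tangentBundleModelSpaceHomeomorph 𝓘(ℝ, F)).continuous
    exact continuous_snd.comp this
  exact ContinuousAt.comp_continuousWithinAt (f := fun s => (⟨x s, v s⟩ : TangentBundle (𝓡 n) C))
    (h4.continuousAt.comp h3) hv

lemma continuousAt_dOf {σ : F → C} {U : Set F} (hU : IsOpen U)
    (hσ : ContMDiffOn 𝓘(ℝ, F) (𝓡 n) ∞ σ U) {z u : T → F} {s : T} (hs : z s ∈ U)
    (hz : ContinuousAt z s) (hu : ContinuousAt u s) :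
    ContinuousAt (fun s => (⟨σ (z s), dOf n σ (z s) (u s)⟩ : TangentBundle (𝓡 n) C)) s := by
  have : IsManifold (𝓡 n) 1 C := .of_le (m := 1) (n := ∞) (WithTop.coe_le_coe.2 le_top)
  have h1 := hσ.continuousOn_tangentMapWithin (WithTop.coe_le_coe.2 le_top) hU.uniqueMDiffOn
  have h2 : ContinuousAt (tangentMapWithin 𝓘(ℝ, F) (𝓡 n) σ U)
      (⟨z s, u s⟩ : TangentBundle 𝓘(ℝ, F) F) :=
    h1.continuousAt ((hU.preimage (FiberBundle.continuous_proj _ _)).mem_nhds hs)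
  have h3 : ContinuousAt (tangentMap 𝓘(ℝ, F) (𝓡 n) σ) (⟨z s, u s⟩ : TangentBundle 𝓘(ℝ, F) F) := by
    refine h2.congr ?_
    filter_upwards [(hU.preimage (FiberBundle.continuous_proj F
      (TangentSpace 𝓘(ℝ, F) : F → Type _))).mem_nhds (x := ⟨z s, u s⟩) hs] with w hw
    exact tangentMapWithin_eq_tangentMap (hU.uniqueMDiffOn _ hw)
      ((hσ.contMDiffAt (hU.mem_nhds hw)).mdifferentiableAt (by simp))
  have h4 : ContinuousAt (fun s => (⟨z s, u s⟩ : TangentBundle 𝓘(ℝ, F) F)) s := by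
    have := (tangentBundleModelSpaceHomeomorph 𝓘(ℝ, F)).symm.continuous
    exact this.continuousAt.comp (hz.prodMk hu)
  exact ContinuousAt.comp (f := fun s => (⟨z s, u s⟩ : TangentBundle 𝓘(ℝ, F) F)) h3 h4

end TangentMaps

/-! ### The linearization at a critical point -/

section Linearization

/-- An injective endomorphism which is self-adjoint with respect to the inner product pulled back by
`J` is diagonal with non-zero eigenvalues in suitable coordinates. -/
lemma exists_diagonalization {n : ℕ} {E V : Type*} [AddCommGroup E] [Module ℝ E]
    [NormedAddCommGroup V] [InnerProductSpace ℝ V] [FiniteDimensional ℝ V]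
    (hV : Module.finrank ℝ V = n) (J : E ≃ₗ[ℝ] V) (A : E →ₗ[ℝ] E)
    (hA : ∀ v w, inner ℝ (J (A v)) (J w) = inner ℝ (J (A w)) (J v))
    (hinj : ∀ v, A v = 0 → v = 0) :
    ∃ (μ : Fin n → ℝ) (B : E ≃ₗ[ℝ] (Fin n → ℝ)), (∀ i, μ i ≠ 0) ∧ ∀ z i, B (A z) i = μ i * B z i := by
  let S : V →ₗ[ℝ] V := J.toLinearMap ∘ₗ A ∘ₗ J.symm.toLinearMap
  have hS : S.IsSymmetric := by
    intro x y
    have := hA (J.symm x) (J.symm y)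
    simp only [LinearEquiv.apply_symm_apply] at this
    refine this.trans ?_
    rw [real_inner_comm]
    rfl
  let b := hS.eigenvectorBasis hV
  have hb : ∀ i, S (b i) = hS.eigenvalues hV i • b i := fun i => hS.apply_eigenvectorBasis hV i
  refine ⟨hS.eigenvalues hV, J.trans b.toBasis.equivFun, fun i hi => ?_, fun z i => ?_⟩
  · have h1 := hb i
    rw [hi, zero_smul] at h1
    have h2 : J (A (J.symm (b i))) = 0 := h1
    rw [LinearEquiv.map_eq_zero_iff] at h2
    have h3 := hinj _ h2
    rw [LinearEquiv.map_eq_zero_iff] at h3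
    exact b.orthonormal.ne_zero i h3
  · have h1 : ∀ w, (J.trans b.toBasis.equivFun) w i = inner ℝ (b i) (J w) := by
      intro w
      rw [LinearEquiv.trans_apply, Module.Basis.equivFun_apply, b.coe_toBasis_repr_apply,
        b.repr_apply_apply]
    rw [h1, h1]
    have h2 : J (A z) = S (J z) := by simp [S]
    rw [h2, ← hS (b i) (J z), hb, real_inner_smul_left]

/-- The linear map of `ι → ℝ` given by a diagonal matrix. -/
def diagonalMap {ι : Type*} (μ : ι → ℝ) : (ι → ℝ) →L[ℝ] (ι → ℝ) :=
  ContinuousLinearMap.pi fun i => μ i • ContinuousLinearMap.proj i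

lemma diagonalMap_apply {ι : Type*} (μ : ι → ℝ) (v : ι → ℝ) (i : ι) :
    diagonalMap μ v i = μ i * v i := rfl

lemma norm_diagonalMap_le {ι : Type*} [Fintype ι] {μ : ι → ℝ} {c : ℝ} (hc : 0 ≤ c)
    (h : ∀ i, |μ i| ≤ c) (v : ι → ℝ) : ‖diagonalMap μ v‖ ≤ c * ‖v‖ := by
  refine (pi_norm_le_iff_of_nonneg (by positivity)).2 fun i => ?_
  rw [diagonalMap_apply, norm_mul]
  exact mul_le_mul (h i) (norm_le_pi_norm v i) (norm_nonneg _) hc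

lemma le_norm_diagonalMap {ι : Type*} [Fintype ι] {μ : ι → ℝ} {c : ℝ} (hc : 0 < c)
    (h : ∀ i, c ≤ μ i) (v : ι → ℝ) : c * ‖v‖ ≤ ‖diagonalMap μ v‖ := by
  rw [← le_div_iff₀' hc]
  refine (pi_norm_le_iff_of_nonneg (by positivity)).2 fun i => ?_
  rw [le_div_iff₀' hc]
  refine le_trans ?_ (norm_le_pi_norm _ i)
  rw [diagonalMap_apply, norm_mul]
  exact mul_le_mul_of_nonneg_right ((h i).trans (le_abs_self _)) (norm_nonneg _)

lemma eq_exp_mul_of_hasDerivAt {y : ℝ → ℝ} {μ : ℝ} (h : ∀ t, HasDerivAt y (μ * y t) t) (t : ℝ) :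
    y t = Real.exp (μ * t) * y 0 := by
  have h1 : ∀ t, HasDerivAt (fun t => Real.exp (-(μ * t)) * y t) 0 t := by
    intro t
    have h2 : HasDerivAt (fun t => Real.exp (-(μ * t))) (Real.exp (-(μ * t)) * (-(μ * 1))) t :=
      (((hasDerivAt_id t).const_mul μ).neg).exp
    refine (h2.mul (h t)).congr_deriv ?_
    ring
  have h3 := is_const_of_deriv_eq_zero (fun t => (h1 t).differentiableAt) (fun t => (h1 t).deriv) t 0
  simp only [mul_zero, neg_zero, Real.exp_zero, one_mul] at h3
  rw [← h3, ← mul_assoc, ← Real.exp_add]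
  simp

end Linearization

/-! ### Flows near a hyperbolic fixed point -/

section HyperbolicFlow

variable {n : ℕ} {C : Type*} [TopologicalSpace C] [ChartedSpace (EuclideanSpace ℝ (Fin n)) C]
  {Es Eu : Type*} [NormedAddCommGroup Es] [NormedSpace ℝ Es]
  [NormedAddCommGroup Eu] [NormedSpace ℝ Eu]

/-- A smooth flow `ψ` near a hyperbolic fixed point `p`, in a chart `κ` in which the linearization
at `p` is a product: `Ls t` contracts and `Lu t` expands if `t ≥ τ`. The field `noReturn` says that
orbit segments with both ends near `p` stay near `p`. By `segment`, `Lu t` is joined to the identity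
by a segment of isomorphisms, so that it preserves orientation. -/
structure HypFlow (n : ℕ) {C : Type*} [TopologicalSpace C]
    [ChartedSpace (EuclideanSpace ℝ (Fin n)) C]
    {Es Eu : Type*} [NormedAddCommGroup Es] [NormedSpace ℝ Es]
    [NormedAddCommGroup Eu] [NormedSpace ℝ Eu] (ψ : ℝ → C → C) (p : C)
    (κ : OpenPartialHomeomorph C (Es × Eu)) (Ls : ℝ → Es →L[ℝ] Es) (Lu : ℝ → Eu →L[ℝ] Eu)
    (τ : ℝ) : Prop where
  flow : IsSmoothFlow n ψ
  fixed : ∀ t, ψ t p = p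
  noReturn : ∀ U ∈ 𝓝 p, ∃ V ∈ 𝓝 p, ∀ x ∈ V, ∀ t, 0 ≤ t → ψ t x ∈ V → ∀ s ∈ Icc 0 t, ψ s x ∈ U
  chart : IsSmoothChart n κ
  mem_source : p ∈ κ.source
  chart_fixed : κ p = 0
  deriv : ∀ t, HasFDerivAt (fun z => κ (ψ t (κ.symm z))) ((Ls t).prodMap (Lu t)) 0
  tau_pos : 0 < τ
  hyp : ∀ t, τ ≤ t → IsHyperbolic (Ls t) (Lu t)
  hyp_neg : ∀ t, τ ≤ t → IsHyperbolic (Lu (-t)) (Ls (-t))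
  segment : ∀ t, τ ≤ t → ∀ s ∈ Icc (0 : ℝ) 1, ∀ v, ‖v‖ ≤ ‖(1 - s) • v + s • Lu t v‖
  segment_neg : ∀ t, τ ≤ t → ∀ s ∈ Icc (0 : ℝ) 1, ∀ v, ‖v‖ ≤ ‖(1 - s) • v + s • Ls (-t) v‖

variable {ψ : ℝ → C → C} {p : C} {κ : OpenPartialHomeomorph C (Es × Eu)}
  {Ls : ℝ → Es →L[ℝ] Es} {Lu : ℝ → Eu →L[ℝ] Eu} {τ : ℝ}

/-- The chart with the two factors exchanged. -/
def swapChart (κ : OpenPartialHomeomorph C (Es × Eu)) : OpenPartialHomeomorph C (Eu × Es) :=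
  κ.transHomeomorph (Homeomorph.prodComm Es Eu)

lemma swapChart_apply (x : C) : swapChart κ x = (κ x).swap := rfl

lemma IsSmoothChart.swap (hκ : IsSmoothChart n κ) : IsSmoothChart n (swapChart κ) := by
  constructor
  · have h1 : ContDiff ℝ ∞ (Prod.swap : Es × Eu → Eu × Es) := contDiff_snd.prodMk contDiff_fst
    exact h1.contMDiff.comp_contMDiffOn hκ.smooth
  · have h1 : ContDiff ℝ ∞ (Prod.swap : Eu × Es → Es × Eu) := contDiff_snd.prodMk contDiff_fst
    exact hκ.smooth_symm.comp h1.contMDiff.contMDiffOn (fun z hz => hz)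

/-- Reversing time exchanges stable and unstable directions. -/
lemma HypFlow.reverse (h : HypFlow n ψ p κ Ls Lu τ) :
    HypFlow n (fun t => ψ (-t)) p (swapChart κ) (fun t => Lu (-t)) (fun t => Ls (-t)) τ where
  flow := h.flow.reverse
  fixed t := h.fixed (-t)
  noReturn U hU := by
    obtain ⟨V, hV, hVU⟩ := h.noReturn U hU
    refine ⟨V, hV, fun x hx t ht hxt s hs => ?_⟩
    have := hVU _ hxt t ht (by rwa [h.flow.apply_neg]) (t - s) ⟨sub_nonneg.2 hs.2, by linarith [hs.1]⟩
    rwa [← h.flow.add, show t - s + -t = -s by ring] at this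
  chart := h.chart.swap
  mem_source := h.mem_source
  chart_fixed := by rw [swapChart_apply, h.chart_fixed]; rfl
  deriv t := by
    have h1 : HasFDerivAt (Prod.swap : Es × Eu → Eu × Es)
        ((ContinuousLinearMap.snd ℝ Es Eu).prod (ContinuousLinearMap.fst ℝ Es Eu))
        (κ (ψ (-t) (κ.symm 0))) :=
      ((ContinuousLinearMap.snd ℝ Es Eu).prod (ContinuousLinearMap.fst ℝ Es Eu)).hasFDerivAt
    have h2 : HasFDerivAt (Prod.swap : Eu × Es → Es × Eu)
        ((ContinuousLinearMap.snd ℝ Eu Es).prod (ContinuousLinearMap.fst ℝ Eu Es)) 0 :=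
      ((ContinuousLinearMap.snd ℝ Eu Es).prod (ContinuousLinearMap.fst ℝ Eu Es)).hasFDerivAt
    exact (h1.comp (0 : Es × Eu) (h.deriv (-t))).comp (0 : Eu × Es) h2
  tau_pos := h.tau_pos
  hyp := h.hyp_neg
  hyp_neg t ht := by simpa using h.hyp t ht
  segment := h.segment_neg
  segment_neg t ht := by simpa using h.segment t ht

end HyperbolicFlow

section Existence

variable {n : ℕ} {C : Type*} [TopologicalSpace C] [ChartedSpace (EuclideanSpace ℝ (Fin n)) C]

lemma IsSmoothFlow.contDiffAt_chart {ψ : ℝ → C → C} (hψ : IsSmoothFlow n ψ)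
    {F : Type*} [NormedAddCommGroup F] [NormedSpace ℝ F] {G : Type*} [NormedAddCommGroup G]
    [NormedSpace ℝ G] {e : OpenPartialHomeomorph C F} (he : IsSmoothChart n e) {σ : G → C}
    {t : ℝ} {z : G} (hσ : ContMDiffAt 𝓘(ℝ, G) (𝓡 n) ∞ σ z) (ht : ψ t (σ z) ∈ e.source) :
    ContDiffAt ℝ ∞ (fun q : ℝ × G => e (ψ q.1 (σ q.2))) (t, z) := by
  have h1 : ContMDiffAt 𝓘(ℝ, ℝ × G) (𝓘(ℝ, ℝ).prod (𝓡 n)) ∞ (fun q : ℝ × G => (q.1, σ q.2)) (t, z) :=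
    (contDiff_fst.contMDiff.contMDiffAt).prodMk
      (ContMDiffAt.comp (t, z) hσ contDiff_snd.contMDiff.contMDiffAt)
  have h2 : ContMDiffAt 𝓘(ℝ, ℝ × G) (𝓡 n) ∞ (fun q : ℝ × G => ψ q.1 (σ q.2)) (t, z) :=
    hψ.smooth.contMDiffAt.comp (t, z) h1
  exact ((he.contMDiffAt ht).comp (t, z) h2).contDiffAt

lemma hasFDerivAt_partial_snd {E F G : Type*} [NormedAddCommGroup E] [NormedSpace ℝ E]
    [NormedAddCommGroup F] [NormedSpace ℝ F] [NormedAddCommGroup G] [NormedSpace ℝ G]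
    {Φ : E × F → G} {a : E} {b : F} (h : DifferentiableAt ℝ Φ (a, b)) :
    HasFDerivAt (fun z => Φ (a, z)) ((fderiv ℝ Φ (a, b)).comp (ContinuousLinearMap.inr ℝ E F)) b :=
  HasFDerivAt.comp (f := fun z => (a, z)) b h.hasFDerivAt (hasFDerivAt_prodMk_right a b)

lemma hasFDerivAt_partial_fst {E F G : Type*} [NormedAddCommGroup E] [NormedSpace ℝ E]
    [NormedAddCommGroup F] [NormedSpace ℝ F] [NormedAddCommGroup G] [NormedSpace ℝ G]
    {Φ : E × F → G} {a : E} {b : F} (h : DifferentiableAt ℝ Φ (a, b)) :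
    HasFDerivAt (fun z => Φ (z, b)) ((fderiv ℝ Φ (a, b)).comp (ContinuousLinearMap.inl ℝ E F)) a :=
  HasFDerivAt.comp (f := fun z => (z, b)) a h.hasFDerivAt (hasFDerivAt_prodMk_left a b)

/-- The linearization of a flow at a fixed point, in a chart `e`: the linearized flow `L t` solves
the linear differential equation given by the derivative `A` of the vector field. -/
lemma IsSmoothFlow.exists_linearization {ψ : ℝ → C → C} (hψ : IsSmoothFlow n ψ)
    {F : Type*} [NormedAddCommGroup F] [NormedSpace ℝ F] {p : C} (hp : ∀ t, ψ t p = p)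
    {e : OpenPartialHomeomorph C F} (he : IsSmoothChart n e) (hpe : p ∈ e.source) :
    ∃ (X : F → F) (A : F →L[ℝ] F) (L : ℝ → F →L[ℝ] F), HasFDerivAt X A (e p) ∧
      (∀ z ∈ e.target, HasDerivAt (fun t => e (ψ t (e.symm z))) (X z) 0) ∧
      (∀ t, HasFDerivAt (fun z => e (ψ t (e.symm z))) (L t) (e p)) ∧
      (∀ w, L 0 w = w) ∧ ∀ w t, HasDerivAt (fun t => L t w) (A (L t w)) t := by
  set z₀ := e p with hz₀
  have hz₀t : z₀ ∈ e.target := e.map_source hpe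
  have hsym : e.symm z₀ = p := e.left_inv hpe
  let Φ : ℝ × F → F := fun q => e (ψ q.1 (e.symm q.2))
  have hΦ : ∀ t, ContDiffAt ℝ ∞ Φ (t, z₀) := fun t =>
    hψ.contDiffAt_chart he (he.contMDiffAt_symm hz₀t) (by rw [hsym, hp]; exact hpe)
  have hΦ0 : ∀ z ∈ e.target, ContDiffAt ℝ ∞ Φ (0, z) := fun z hz =>
    hψ.contDiffAt_chart he (he.contMDiffAt_symm hz) (by rw [hψ.zero]; exact e.map_target hz)
  let L : ℝ → F →L[ℝ] F := fun t => (fderiv ℝ Φ (t, z₀)).comp (ContinuousLinearMap.inr ℝ ℝ F)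
  have hL : ∀ t, HasFDerivAt (fun z => e (ψ t (e.symm z))) (L t) z₀ := fun t =>
    hasFDerivAt_partial_snd ((hΦ t).differentiableAt (by simp))
  have hfd : HasFDerivAt (fderiv ℝ Φ) (fderiv ℝ (fderiv ℝ Φ) (0, z₀)) (0, z₀) :=
    (((hΦ 0).fderiv_right (m := 1) (WithTop.coe_le_coe.2 le_top)).differentiableAt
      (by simp)).hasFDerivAt
  have hsymm : IsSymmSndFDerivAt ℝ Φ (0, z₀) :=
    (hΦ 0).isSymmSndFDerivAt (by simp only [minSmoothness_of_isRCLikeNormedField]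
                                 exact WithTop.coe_le_coe.2 le_top)
  -- `X = ∂Φ/∂t` at `t = 0`, and `A` is its derivative; by the symmetry of the second derivative of `Φ`,
  -- `A` is also the derivative of `L` at `0`
  let A : F →L[ℝ] F := (ContinuousLinearMap.apply ℝ F ((1 : ℝ), (0 : F))).comp
    ((fderiv ℝ (fderiv ℝ Φ) (0, z₀)).comp (ContinuousLinearMap.inr ℝ ℝ F))
  have hL0 : ∀ w, L 0 w = w := by
    have h1 : HasFDerivAt (fun z => e (ψ 0 (e.symm z))) (ContinuousLinearMap.id ℝ F) z₀ := by
      refine (hasFDerivAt_id z₀).congr_of_eventuallyEq ?_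
      filter_upwards [e.open_target.mem_nhds hz₀t] with z hz
      rw [hψ.zero, e.right_inv hz]
      rfl
    intro w
    rw [(hL 0).unique h1]
    rfl
  have hadd : ∀ s t w, L (s + t) w = L s (L t w) := by
    intro s t w
    have h1 : HasFDerivAt (fun z => e (ψ s (e.symm (e (ψ t (e.symm z)))))) ((L s).comp (L t)) z₀ := by
      refine HasFDerivAt.comp (g := fun z => e (ψ s (e.symm z))) z₀ ?_ (hL t)
      rw [hsym, hp]
      exact hL s
    have h2 : HasFDerivAt (fun z => e (ψ (s + t) (e.symm z))) ((L s).comp (L t)) z₀ := by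
      refine h1.congr_of_eventuallyEq ?_
      have hc : ContinuousAt (fun z => ψ t (e.symm z)) z₀ :=
        (hψ.continuous_right t).continuousAt.comp (e.continuousAt_symm hz₀t)
      have : ∀ᶠ z in 𝓝 z₀, ψ t (e.symm z) ∈ e.source :=
        hc.eventually (e.open_source.mem_nhds (by beta_reduce; rw [hsym, hp]; exact hpe))
      filter_upwards [this] with z hz
      rw [e.left_inv hz, hψ.add]
    rw [(hL (s + t)).unique h2]
    rfl
  refine ⟨fun z => fderiv ℝ Φ (0, z) (1, 0), A, L, ?_, ?_, hL, hL0, ?_⟩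
  · have h1 := HasFDerivAt.comp (f := fun z => ((0 : ℝ), z)) z₀ hfd (hasFDerivAt_prodMk_right 0 z₀)
    exact ((ContinuousLinearMap.apply ℝ F ((1 : ℝ), (0 : F))).hasFDerivAt).comp z₀ h1
  · intro z hz
    exact (hasFDerivAt_partial_fst ((hΦ0 z hz).differentiableAt (by simp))).hasDerivAt
  · intro w t
    have h0 : ∀ w, HasDerivAt (fun t => L t w) (A w) 0 := by
      intro w
      have h1 := HasFDerivAt.comp (f := fun t : ℝ => (t, z₀)) (0 : ℝ) hfd
        (hasFDerivAt_prodMk_left 0 z₀)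
      have h2 := (((ContinuousLinearMap.apply ℝ F ((0 : ℝ), w)).hasFDerivAt).comp (0 : ℝ) h1)
      refine h2.hasDerivAt.congr_deriv ?_
      exact hsymm (1, 0) (0, w)
    have h1 : HasDerivAt (fun s => L (s - t) (L t w)) (A (L t w)) t :=
      HasDerivAt.comp_sub_const t t (by rw [sub_self]; exact h0 (L t w))
    refine h1.congr_of_eventuallyEq (.of_forall fun s => ?_)
    change L s w = L (s - t) (L t w)
    rw [← hadd, sub_add_cancel]

lemma IsSmoothChart.dOf_symm_dAt {F : Type*} [NormedAddCommGroup F] [NormedSpace ℝ F]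
    {e : OpenPartialHomeomorph C F} (he : IsSmoothChart n e) {z : F} (hz : z ∈ e.target)
    (v : TangentSpace (𝓡 n) (e.symm z)) : dOf n e.symm z (dAt n e (e.symm z) v) = v :=
  (he.dAt_bijective (e.map_target hz)).1 (he.dAt_dOf_symm hz _)

lemma hasDerivAt_smul_of_continuousAt {c : ℝ → ℝ} (hc : ContinuousAt c 0) :
    HasDerivAt (fun s => s * c s) (c 0) 0 := by
  rw [hasDerivAt_iff_tendsto_slope_zero]
  refine (hc.tendsto.mono_left nhdsWithin_le_nhds).congr' ?_
  filter_upwards [self_mem_nhdsWithin] with s hs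
  have hs' : s ≠ 0 := hs
  simp only [zero_add, zero_mul, sub_zero, smul_eq_mul]
  field_simp

variable [IsManifold (𝓡 n) ∞ C] [T2Space C] [RiemannianBundle (fun x : C => TangentSpace (𝓡 n) x)]
  [IsContMDiffRiemannianBundle (𝓡 n) ∞ (EuclideanSpace ℝ (Fin n))
    (fun x : C => TangentSpace (𝓡 n) x)]

lemma isContinuousRiemannianBundle : IsContinuousRiemannianBundle (EuclideanSpace ℝ (Fin n))
    (fun x : C => TangentSpace (𝓡 n) x) := by
  obtain ⟨g, hg, h⟩ := IsContMDiffRiemannianBundle.exists_contMDiff (IB := 𝓡 n) (n := ∞)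
    (F := EuclideanSpace ℝ (Fin n)) (E := fun x : C => TangentSpace (𝓡 n) x)
  exact ⟨⟨g, hg.continuous, h⟩⟩

/-- At a critical point the derivative `A` of the negative gradient represents the Hessian, up to
sign, with respect to the Riemannian metric. -/
lemma hessian_eq {f : C → ℝ} (hf : ContMDiff (𝓡 n) 𝓘(ℝ, ℝ) ∞ f)
    {F : Type*} [NormedAddCommGroup F] [NormedSpace ℝ F]
    {e : OpenPartialHomeomorph C F} (he : IsSmoothChart n e) {z₀ : F} (hz₀ : z₀ ∈ e.target)
    {X : F → F} {A : F →L[ℝ] F} (hX : HasFDerivAt X A z₀) (hX0 : X z₀ = 0)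
    (hgrad : ∀ z ∈ e.target, dOf n e.symm z (X z) = -grad n f (e.symm z)) (v w : F) :
    fderiv ℝ (fderiv ℝ (fun z => f (e.symm z))) z₀ v w =
      -inner ℝ (dOf n e.symm z₀ (A v)) (dOf n e.symm z₀ w) := by
  have hcb : IsContinuousRiemannianBundle (EuclideanSpace ℝ (Fin n))
      (fun x : C => TangentSpace (𝓡 n) x) := isContinuousRiemannianBundle
  have hsm : ContDiffAt ℝ ∞ (fun z => f (e.symm z)) z₀ :=
    ((hf.contMDiffAt).comp z₀ (he.contMDiffAt_symm hz₀)).contDiffAt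
  have hline : HasDerivAt (fun s : ℝ => z₀ + s • v) v 0 := by
    simpa using ((hasDerivAt_id (0 : ℝ)).smul_const v).const_add z₀
  have hline0 : z₀ + (0 : ℝ) • v = z₀ := by simp
  -- the left-hand side is the derivative of `s ↦ D(f ∘ e⁻¹)(z₀ + s v) w`
  have h1 : HasDerivAt (fun s : ℝ => fderiv ℝ (fun z => f (e.symm z)) (z₀ + s • v) w)
      (fderiv ℝ (fderiv ℝ (fun z => f (e.symm z))) z₀ v w) 0 := by
    have hfd : HasFDerivAt (fderiv ℝ (fun z => f (e.symm z)))
        (fderiv ℝ (fderiv ℝ (fun z => f (e.symm z))) z₀) (z₀ + (0 : ℝ) • v) := by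
      rw [hline0]
      exact ((hsm.fderiv_right (m := 1) (WithTop.coe_le_coe.2 le_top)).differentiableAt
        (by simp)).hasFDerivAt
    have := hfd.comp_hasDerivAt (0 : ℝ) hline
    exact ((ContinuousLinearMap.apply ℝ ℝ w).hasFDerivAt).comp_hasDerivAt (0 : ℝ) this
  have hXl : HasDerivAt (fun s : ℝ => X (z₀ + s • v)) (A v) 0 := by
    have : HasFDerivAt X A (z₀ + (0 : ℝ) • v) := by rwa [hline0]
    exact this.comp_hasDerivAt (0 : ℝ) hline
  -- `X (z₀ + s v) = s u(s)` with `u` continuous and `u 0 = A v`, so that only the continuity of the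
  -- metric is needed to differentiate `⟪grad f, w⟫` at `s = 0`
  set u : ℝ → F := dslope (fun s : ℝ => X (z₀ + s • v)) 0 with hu
  have hu0 : u 0 = A v := by rw [hu, dslope_same, hXl.deriv]
  have huc : ContinuousAt u 0 := continuousAt_dslope_same.2 hXl.differentiableAt
  have hus : ∀ s, X (z₀ + s • v) = s • u s := by
    intro s
    have := sub_smul_dslope (fun s : ℝ => X (z₀ + s • v)) 0 s
    simp only [sub_zero, hline0, hX0] at this
    exact this.symm
  let c : ℝ → ℝ := fun s =>
    -inner ℝ (dOf n e.symm (z₀ + s • v) (u s)) (dOf n e.symm (z₀ + s • v) w)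
  have hzs : (fun s : ℝ => z₀ + s • v) 0 ∈ e.target := by simpa using hz₀
  have hcc : ContinuousAt c 0 := by
    have h2 := continuousAt_dOf (n := n) e.open_target he.smooth_symm (z := fun s : ℝ => z₀ + s • v)
      (u := u) hzs hline.continuousAt huc
    have h3 := continuousAt_dOf (n := n) e.open_target he.smooth_symm (z := fun s : ℝ => z₀ + s • v)
      (u := fun _ => w) hzs hline.continuousAt continuousAt_const
    exact (h2.inner_bundle h3).neg
  have h4 : HasDerivAt (fun s : ℝ => fderiv ℝ (fun z => f (e.symm z)) (z₀ + s • v) w) (c 0) 0 := by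
    refine (hasDerivAt_smul_of_continuousAt hcc).congr_of_eventuallyEq ?_
    filter_upwards [hline.continuousAt.eventually (e.open_target.mem_nhds hzs)] with s hs
    have h5 := fderiv_comp_dOf (n := n) (h := f) (σ := e.symm)
      (hf.mdifferentiable (by simp) (e.symm (z₀ + s • v))) (he.mdifferentiableAt_symm hs) w
    rw [h5, ← inner_grad]
    have h6 := hgrad _ hs
    have h7 : grad n f (e.symm (z₀ + s • v)) = -(s • dOf n e.symm (z₀ + s • v) (u s)) := by
      rw [← map_smul, ← hus, h6, neg_neg]
    rw [h7, inner_neg_left, real_inner_smul_left, mul_neg]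
  rw [h1.unique h4]
  simp only [c, hu0]
  rw [hline0]

/-- The negative gradient flow of a Morse function is hyperbolic at critical points. -/
theorem IsNegGradFlow.exists_hypFlow {f : C → ℝ} {ψ : ℝ → C → C}
    (hψ : IsNegGradFlow (n := n) f ψ) (hf : IsMorse n f) {p : C}
    (hp : mfderiv (𝓡 n) 𝓘(ℝ, ℝ) f p = 0) :
    ∃ (I J : Finset (Fin n)) (κ : OpenPartialHomeomorph C ((I → ℝ) × (J → ℝ)))
      (Ls : ℝ → (I → ℝ) →L[ℝ] (I → ℝ)) (Lu : ℝ → (J → ℝ) →L[ℝ] (J → ℝ)) (τ : ℝ),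
      HypFlow n ψ p κ Ls Lu τ := by
  have hfl := hψ.isSmoothFlow
  have hfix := hψ.apply_eq_of_grad_eq_zero ((grad_eq_zero_iff f p).2 hp)
  let e := chartAt (EuclideanSpace ℝ (Fin n)) p
  have he : IsSmoothChart n e := .of_mem_maximalAtlas (IsManifold.chart_mem_maximalAtlas p)
  have hpe : p ∈ e.source := mem_chart_source _ p
  have hz₀ : e p ∈ e.target := e.map_source hpe
  -- the linearized flow `L t` is generated by `A`, which is minus the Hessian with respect to the
  -- metric, hence diagonalizable with real non-zero eigenvalues `μ`
  obtain ⟨X, A, L, hXA, hX, hL, hL0, hLA⟩ := hfl.exists_linearization hfix he hpe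
  have hgrad : ∀ z ∈ e.target, dOf n e.symm z (X z) = -grad n f (e.symm z) := by
    intro z hz
    have h1 := hasDerivAt_comp_curve (n := n) (h := e) (γ := fun t => ψ t (e.symm z)) (t := 0)
      (by rw [hψ.zero]; exact he.mdifferentiableAt (e.map_target hz))
      (hψ.mdifferentiableAt_left _ _)
    have h2 : X z = dAt n e (e.symm z) (-grad n f (e.symm z)) := by
      rw [(hX z hz).unique h1, hψ.velocity_eq]
      have : ∀ y, y = e.symm z → dAt n e y (-grad n f y) =
          dAt n e (e.symm z) (-grad n f (e.symm z)) := by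
        rintro _ rfl
        rfl
      exact this _ (hψ.zero _)
    rw [h2, he.dOf_symm_dAt hz]
  have hX0 : X (e p) = 0 := by
    refine (hX _ hz₀).unique ((hasDerivAt_const (0 : ℝ) (e p)).congr_of_eventuallyEq
      (.of_forall fun t => ?_))
    simp only [e.left_inv hpe, hfix]
  have hess := hessian_eq hf.1 he hz₀ hXA hX0 hgrad
  have hsm : ContDiffAt ℝ ∞ (fun z => f (e.symm z)) (e p) :=
    ((hf.1.contMDiffAt).comp (e p) (he.contMDiffAt_symm hz₀)).contDiffAt
  have hsymm : IsSymmSndFDerivAt ℝ (fun z => f (e.symm z)) (e p) :=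
    hsm.isSymmSndFDerivAt (by simp only [minSmoothness_of_isRCLikeNormedField]
                              exact WithTop.coe_le_coe.2 le_top)
  have hfr : Module.finrank ℝ (TangentSpace (𝓡 n) (e.symm (e p))) = n := finrank_tangentSpace _
  -- the differential of the chart identifies the model space with `T_p C` and its inner product
  let J₀ : EuclideanSpace ℝ (Fin n) ≃ₗ[ℝ] TangentSpace (𝓡 n) (e.symm (e p)) :=
    LinearEquiv.ofBijective (dOf n e.symm (e p))
      ⟨fun v w h => by rw [← he.dAt_dOf_symm hz₀ v, h, he.dAt_dOf_symm hz₀],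
        fun v => ⟨_, he.dOf_symm_dAt hz₀ v⟩⟩
  obtain ⟨μ, B, hμ, hB⟩ := exists_diagonalization hfr J₀ A.toLinearMap
    (fun v w => by
      have h1 := hess v w
      rw [hsymm v w, hess w v] at h1
      exact (neg_injective h1).symm)
    (fun v hv => hf.2 p hp v fun w => by
      refine (hess v w).trans ?_
      have : A v = 0 := hv
      rw [this, map_zero, inner_zero_left, neg_zero])
  have hBL : ∀ w t i, B (L t w) i = Real.exp (μ i * t) * B w i := by
    intro w t i
    have h1 : ∀ t, HasDerivAt (fun t => B (L t w) i) (μ i * B (L t w) i) t := by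
      intro t
      let P : EuclideanSpace ℝ (Fin n) →L[ℝ] ℝ :=
        (ContinuousLinearMap.proj i).comp B.toContinuousLinearEquiv.toContinuousLinearMap
      have h2 := P.hasFDerivAt.comp_hasDerivAt t (hLA w t)
      refine h2.congr_deriv ?_
      exact hB (L t w) i
    have h3 := eq_exp_mul_of_hasDerivAt h1 t
    rw [h3, hL0]
  -- the stable coordinates `I` and the unstable coordinates `J`
  let I : Finset (Fin n) := Finset.univ.filter fun i => μ i < 0
  let J : Finset (Fin n) := Finset.univ.filter fun i => ¬ μ i < 0
  have hI : ∀ i : I, μ i < 0 := fun i => (Finset.mem_filter.1 i.2).2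
  have hJ : ∀ i : J, 0 < μ i := fun i =>
    lt_of_le_of_ne (not_lt.1 (Finset.mem_filter.1 i.2).2) (hμ i).symm
  let Θ₀ : EuclideanSpace ℝ (Fin n) →ₗ[ℝ] (I → ℝ) × (J → ℝ) :=
    (LinearMap.funLeft ℝ ℝ (Subtype.val : I → Fin n)).prod
      (LinearMap.funLeft ℝ ℝ (Subtype.val : J → Fin n)) ∘ₗ B.toLinearMap
  have hΘinj : Function.Injective Θ₀ := by
    rw [← LinearMap.ker_eq_bot, LinearMap.ker_eq_bot']
    intro w hw
    have : B w = 0 := by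
      funext i
      by_cases hi : μ i < 0
      · exact congrFun (congrArg Prod.fst hw) ⟨i, Finset.mem_filter.2 ⟨Finset.mem_univ _, hi⟩⟩
      · exact congrFun (congrArg Prod.snd hw) ⟨i, Finset.mem_filter.2 ⟨Finset.mem_univ _, hi⟩⟩
    exact (LinearEquiv.map_eq_zero_iff B).1 this
  have hcard : Module.finrank ℝ (EuclideanSpace ℝ (Fin n)) =
      Module.finrank ℝ ((I → ℝ) × (J → ℝ)) := by
    rw [finrank_euclideanSpace_fin, Module.finrank_prod, Module.finrank_fintype_fun_eq_card,
      Module.finrank_fintype_fun_eq_card, Fintype.card_coe, Fintype.card_coe,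
      Finset.card_filter_add_card_filter_not, Finset.card_univ, Fintype.card_fin]
  let Θ : EuclideanSpace ℝ (Fin n) ≃L[ℝ] (I → ℝ) × (J → ℝ) :=
    (LinearEquiv.ofInjectiveOfFinrankEq Θ₀ hΘinj hcard).toContinuousLinearEquiv
  have hΘ : ∀ w, Θ w = Θ₀ w := fun w => rfl
  obtain ⟨κ, hκ, hκs, hκe, hκsymm⟩ := he.affine Θ (e p)
  have htend : ∀ i, Tendsto (fun t => |μ i| * t) atTop atTop := fun i =>
    tendsto_id.const_mul_atTop (abs_pos.2 (hμ i))
  -- from time `τ` on, the factors `exp (μ t)` are at least `4` or at most `1/4`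
  obtain ⟨τ, hτ0, hτ⟩ : ∃ τ > 0, ∀ t, τ ≤ t → ∀ i, 4 ≤ Real.exp (|μ i| * t) := by
    have h1 : ∀ᶠ t in atTop, ∀ i, 4 ≤ Real.exp (|μ i| * t) := eventually_all.2 fun i =>
      (Real.tendsto_exp_atTop.comp (htend i)).eventually_ge_atTop 4
    obtain ⟨τ, hτ⟩ := eventually_atTop.1 h1
    exact ⟨max τ 1, by positivity, fun t ht => hτ t ((le_max_left _ _).trans ht)⟩
  have hexpand : ∀ t, τ ≤ t → ∀ i, 0 < μ i → 4 ≤ Real.exp (μ i * t) := fun t ht i hi => by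
    have := hτ t ht i
    rwa [abs_of_pos hi] at this
  have hexpand' : ∀ t, τ ≤ t → ∀ i, μ i < 0 → 4 ≤ Real.exp (μ i * (-t)) := fun t ht i hi => by
    have := hτ t ht i
    rwa [abs_of_neg hi, neg_mul, ← mul_neg] at this
  have hcontract : ∀ s : ℝ, 4 ≤ Real.exp (-s) → |Real.exp s| ≤ 1 / 4 := fun s hs => by
    rw [abs_of_pos (Real.exp_pos s), ← neg_neg s, Real.exp_neg, one_div]
    exact inv_anti₀ (by norm_num) hs
  have hseg : ∀ {ι : Type} [Fintype ι] (ν : ι → ℝ), (∀ i, 4 ≤ ν i) → ∀ s ∈ Icc (0 : ℝ) 1, ∀ v,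
      ‖v‖ ≤ ‖(1 - s) • v + s • diagonalMap ν v‖ := by
    intro ι _ ν hν s hs v
    have h1 := le_norm_diagonalMap (μ := fun i => 1 - s + s * ν i) one_pos
      (fun i => by nlinarith [hs.1, hs.2, hν i]) v
    rw [one_mul] at h1
    refine h1.trans_eq (congrArg _ ?_)
    funext i
    simp only [diagonalMap_apply, Pi.add_apply, Pi.smul_apply, smul_eq_mul]
    ring
  refine ⟨I, J, κ, fun t => diagonalMap fun i => Real.exp (μ i * t),
    fun t => diagonalMap fun i => Real.exp (μ i * t), τ, hfl, hfix,
    fun U hU => hψ.no_return hf hp hU, hκ, hκs ▸ hpe, by rw [hκe, sub_self, map_zero], ?_, hτ0,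
    ?_, ?_, ?_, ?_⟩
  · intro t
    have h0 : HasFDerivAt (fun z => Θ.symm z + e p) (Θ.symm : _ →L[ℝ] _) 0 :=
      (Θ.symm.hasFDerivAt).add_const _
    have h1 : HasFDerivAt (fun z => e (ψ t (e.symm z))) (L t) (Θ.symm 0 + e p) := by
      rw [map_zero, zero_add]
      exact hL t
    have h2 := h1.comp (0 : (I → ℝ) × (J → ℝ)) h0
    have h3 := Θ.hasFDerivAt.comp (0 : (I → ℝ) × (J → ℝ)) (h2.sub_const (e p))
    have h4 : (fun z => κ (ψ t (κ.symm z))) = fun z => Θ (e (ψ t (e.symm (Θ.symm z + e p))) - e p) := by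
      funext z
      rw [hκe, hκsymm]
    rw [h4]
    refine h3.congr_fderiv ?_
    refine ContinuousLinearMap.ext fun z => ?_
    change Θ (L t (Θ.symm z)) = _
    obtain ⟨w, rfl⟩ := Θ.surjective z
    rw [Θ.symm_apply_apply]
    refine Prod.ext (funext fun i => ?_) (funext fun i => ?_)
    · exact hBL w t i
    · exact hBL w t i
  · intro t ht
    exact ⟨norm_diagonalMap_le (by norm_num) fun i => hcontract _ (by
      rw [← mul_neg]; exact hexpand' t ht i (hI i)),
      le_norm_diagonalMap (by norm_num) fun i => hexpand t ht i (hJ i)⟩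
  · intro t ht
    exact ⟨norm_diagonalMap_le (by norm_num) fun i => hcontract _ (by
      rw [← mul_neg, neg_neg]; exact hexpand t ht i (hJ i)),
      le_norm_diagonalMap (by norm_num) fun i => hexpand' t ht i (hI i)⟩
  · exact fun t ht => hseg _ fun i => hexpand t ht i (hJ i)
  · exact fun t ht => hseg _ fun i => hexpand' t ht i (hI i)

end Existence

/-! ### Boxes around a hyperbolic fixed point -/

section Box

variable {n : ℕ} {C : Type*} [TopologicalSpace C] [ChartedSpace (EuclideanSpace ℝ (Fin n)) C]
  {Es Eu : Type*} [NormedAddCommGroup Es] [NormedSpace ℝ Es]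
  [NormedAddCommGroup Eu] [NormedSpace ℝ Eu]
  {ψ : ℝ → C → C} {p : C} {κ : OpenPartialHomeomorph C (Es × Eu)}
  {Ls : ℝ → Es →L[ℝ] Es} {Lu : ℝ → Eu →L[ℝ] Eu} {τ : ℝ}

/-- In the ball of radius `r` of the chart `κ`, the flow for times in `[τ, 2τ]` is `ε`-close in the
`C¹` sense to its linearization. -/
structure IsBox (ψ : ℝ → C → C) (κ : OpenPartialHomeomorph C (Es × Eu)) (Ls : ℝ → Es →L[ℝ] Es)
    (Lu : ℝ → Eu →L[ℝ] Eu) (τ ε r : ℝ) : Prop where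
  pos : 0 < r
  subset : ∀ z, ‖z‖ ≤ r → z ∈ κ.target
  mem : ∀ t ∈ Icc τ (2 * τ), ∀ z, ‖z‖ ≤ r → ψ t (κ.symm z) ∈ κ.source
  diff : ∀ t ∈ Icc τ (2 * τ), ∀ z, ‖z‖ ≤ r → DifferentiableAt ℝ (fun z => κ (ψ t (κ.symm z))) z
  bound : ∀ t ∈ Icc τ (2 * τ), ∀ z, ‖z‖ ≤ r →
    ‖fderiv ℝ (fun z => κ (ψ t (κ.symm z))) z - (Ls t).prodMap (Lu t)‖ ≤ ε

/-- The points whose coordinates in the chart `κ` have norm at most `r`. -/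
def box (κ : OpenPartialHomeomorph C (Es × Eu)) (r : ℝ) : Set C := {x | x ∈ κ.source ∧ ‖κ x‖ ≤ r}

lemma HypFlow.box_mem_nhds (h : HypFlow n ψ p κ Ls Lu τ) {r : ℝ} (hr : 0 < r) : box κ r ∈ 𝓝 p := by
  have h1 : ∀ᶠ x in 𝓝 p, ‖κ x‖ < r := by
    have : ContinuousAt (fun x => ‖κ x‖) p := (κ.continuousAt h.mem_source).norm
    exact this.eventually_lt continuousAt_const (by simpa [h.chart_fixed] using hr)
  filter_upwards [κ.open_source.mem_nhds h.mem_source, h1] with x h1 h2 using ⟨h1, h2.le⟩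

lemma HypFlow.symm_zero (h : HypFlow n ψ p κ Ls Lu τ) : κ.symm 0 = p := by
  rw [← h.chart_fixed, κ.left_inv h.mem_source]

lemma HypFlow.zero_mem_target (h : HypFlow n ψ p κ Ls Lu τ) : (0 : Es × Eu) ∈ κ.target := by
  rw [← h.chart_fixed]
  exact κ.map_source h.mem_source

lemma HypFlow.contDiffAt (h : HypFlow n ψ p κ Ls Lu τ) (t : ℝ) :
    ContDiffAt ℝ ∞ (fun q : ℝ × (Es × Eu) => κ (ψ q.1 (κ.symm q.2))) (t, 0) :=
  h.flow.contDiffAt_chart h.chart (h.chart.contMDiffAt_symm h.zero_mem_target)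
    (by rw [h.symm_zero, h.fixed]; exact h.mem_source)

lemma HypFlow.fderiv_eq (h : HypFlow n ψ p κ Ls Lu τ) (t : ℝ) :
    (fderiv ℝ (fun q : ℝ × (Es × Eu) => κ (ψ q.1 (κ.symm q.2))) (t, 0)).comp
      (ContinuousLinearMap.inr ℝ ℝ (Es × Eu)) = (Ls t).prodMap (Lu t) :=
  (hasFDerivAt_partial_snd ((h.contDiffAt t).differentiableAt (by simp))).unique (h.deriv t)

lemma HypFlow.continuous_linearization (h : HypFlow n ψ p κ Ls Lu τ) :
    Continuous fun t => (Ls t).prodMap (Lu t) := by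
  have h1 : ∀ t, (Ls t).prodMap (Lu t) =
      (fderiv ℝ (fun q : ℝ × (Es × Eu) => κ (ψ q.1 (κ.symm q.2))) (t, 0)).comp
      (ContinuousLinearMap.inr ℝ ℝ (Es × Eu)) := fun t => (h.fderiv_eq t).symm
  simp_rw [h1]
  refine Continuous.clm_comp (continuous_iff_continuousAt.2 fun t => ?_) continuous_const
  have h2 : ContinuousAt (fderiv ℝ (fun q : ℝ × (Es × Eu) => κ (ψ q.1 (κ.symm q.2)))) (t, 0) :=
    ((h.contDiffAt t).fderiv_right (m := 0) (WithTop.coe_le_coe.2 le_top)).continuousAt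
  exact ContinuousAt.comp (f := fun t : ℝ => (t, (0 : Es × Eu))) h2 (by fun_prop)

/-- Small balls around the fixed point are boxes, uniformly in the time by the compactness of
`[τ, 2τ]`. -/
lemma HypFlow.exists_isBox (h : HypFlow n ψ p κ Ls Lu τ) {ε : ℝ} (hε : 0 < ε) :
    ∃ r, IsBox ψ κ Ls Lu τ ε r := by
  set Φ : ℝ × (Es × Eu) → Es × Eu := fun q => κ (ψ q.1 (κ.symm q.2)) with hΦ
  have h1 : ∀ t ∈ Icc τ (2 * τ), ∀ᶠ q : ℝ × (Es × Eu) in 𝓝 (t, 0),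
      ψ q.1 (κ.symm q.2) ∈ κ.source ∧ DifferentiableAt ℝ Φ q ∧
      ‖(fderiv ℝ Φ q).comp (ContinuousLinearMap.inr ℝ ℝ (Es × Eu)) -
        (Ls q.1).prodMap (Lu q.1)‖ < ε := by
    intro t _
    have hc1 : ContinuousAt (fun q : ℝ × (Es × Eu) => ψ q.1 (κ.symm q.2)) (t, 0) := by
      have : ContinuousAt (fun q : ℝ × (Es × Eu) => (q.1, κ.symm q.2)) (t, 0) :=
        continuousAt_fst.prodMk
          (ContinuousAt.comp (x := (t, (0 : Es × Eu))) (κ.continuousAt_symm h.zero_mem_target)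
            continuousAt_snd)
      exact ContinuousAt.comp (f := fun q : ℝ × (Es × Eu) => (q.1, κ.symm q.2))
        h.flow.continuous.continuousAt this
    have hc2 : ContinuousAt (fun q : ℝ × (Es × Eu) =>
        ‖(fderiv ℝ Φ q).comp (ContinuousLinearMap.inr ℝ ℝ (Es × Eu)) -
        (Ls q.1).prodMap (Lu q.1)‖) (t, 0) := by
      have h2 : ContinuousAt (fderiv ℝ Φ) (t, 0) :=
        ((h.contDiffAt t).fderiv_right (m := 0) (WithTop.coe_le_coe.2 le_top)).continuousAt
      exact ((h2.clm_comp continuousAt_const).sub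
        (h.continuous_linearization.continuousAt.comp continuousAt_fst)).norm
    have hd : ∀ᶠ q in 𝓝 ((t, 0) : ℝ × (Es × Eu)), DifferentiableAt ℝ Φ q := by
      filter_upwards [((h.contDiffAt t).of_le (m := 1) (WithTop.coe_le_coe.2 le_top)).eventually
        (by simp)] with q hq using hq.differentiableAt (by simp)
    refine (hc1.eventually (κ.open_source.mem_nhds ?_)).and
      (hd.and (hc2.eventually_lt continuousAt_const ?_))
    · beta_reduce
      rw [h.symm_zero, h.fixed]
      exact h.mem_source
    · simpa [hΦ, h.fderiv_eq] using hε
  have h2 := (isCompact_Icc (a := τ) (b := 2 * τ)).eventually_forall_of_forall_eventually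
    (x₀ := (0 : Es × Eu)) (P := fun z t => ψ t (κ.symm z) ∈ κ.source ∧
      DifferentiableAt ℝ Φ (t, z) ∧ ‖(fderiv ℝ Φ (t, z)).comp
        (ContinuousLinearMap.inr ℝ ℝ (Es × Eu)) - (Ls t).prodMap (Lu t)‖ < ε)
    (fun t ht => by
      have h4 : Tendsto (fun z : (Es × Eu) × ℝ => (z.2, z.1)) (𝓝 (0, t)) (𝓝 (t, 0)) :=
        (continuous_snd.prodMk continuous_fst).tendsto _
      exact h4.eventually (h1 t ht))
  obtain ⟨r, hr, hr'⟩ := Metric.eventually_nhds_iff_ball.1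
    (h2.and (κ.open_target.mem_nhds h.zero_mem_target))
  have hmem : ∀ z : Es × Eu, ‖z‖ ≤ r / 2 → z ∈ Metric.ball 0 r := fun z hz => by
    rw [mem_ball_zero_iff]; linarith
  refine ⟨r / 2, by positivity, fun z hz => (hr' z (hmem z hz)).2,
    fun t ht z hz => ((hr' z (hmem z hz)).1 t ht).1,
    fun t ht z hz => (hasFDerivAt_partial_snd ((hr' z (hmem z hz)).1 t ht).2.1).differentiableAt,
    fun t ht z hz => ?_⟩
  obtain ⟨_, h3, h4⟩ := (hr' z (hmem z hz)).1 t ht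
  have h5 : fderiv ℝ (fun z => κ (ψ t (κ.symm z))) z = _ := (hasFDerivAt_partial_snd h3).fderiv
  rw [h5]
  exact h4.le

lemma IsBox.lipschitz {ε r : ℝ} (hb : IsBox ψ κ Ls Lu τ ε r) {t : ℝ} (ht : t ∈ Icc τ (2 * τ))
    {z z' : Es × Eu} (hz : ‖z‖ ≤ r) (hz' : ‖z'‖ ≤ r) :
    ‖κ (ψ t (κ.symm z)) - κ (ψ t (κ.symm z')) - (Ls t).prodMap (Lu t) (z - z')‖ ≤ ε * ‖z - z'‖ :=
  Convex.norm_image_sub_le_of_norm_fderiv_le' (f := fun z => κ (ψ t (κ.symm z)))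
    (s := Metric.closedBall 0 r) (x := z') (y := z)
    (fun x hx => hb.diff t ht x (mem_closedBall_zero_iff.1 hx))
    (fun x hx => hb.bound t ht x (mem_closedBall_zero_iff.1 hx)) (convex_closedBall 0 r)
    (mem_closedBall_zero_iff.2 hz') (mem_closedBall_zero_iff.2 hz)

lemma IsBox.step_sub {ε r : ℝ} (hb : IsBox ψ κ Ls Lu τ ε r) {t : ℝ} (ht : t ∈ Icc τ (2 * τ))
    {x y : C} (hx : x ∈ box κ r) (hy : y ∈ box κ r) :
    ‖κ (ψ t x) - κ (ψ t y) - (Ls t).prodMap (Lu t) (κ x - κ y)‖ ≤ ε * ‖κ x - κ y‖ := by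
  have := hb.lipschitz ht hx.2 hy.2
  rwa [κ.left_inv hx.1, κ.left_inv hy.1] at this

lemma IsSmoothFlow.mdifferentiableAt_chart (hψ : IsSmoothFlow n ψ)
    {F : Type*} [NormedAddCommGroup F] [NormedSpace ℝ F] {e : OpenPartialHomeomorph C F}
    (he : IsSmoothChart n e) {t : ℝ} {x : C} (hx : ψ t x ∈ e.source) :
    MDifferentiableAt (𝓡 n) 𝓘(ℝ, F) (fun y => e (ψ t y)) x :=
  (he.mdifferentiableAt hx).comp x (hψ.mdifferentiable t x)

/-- Tangent vectors move along an orbit in the box by an approximately hyperbolic linear map. -/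
lemma HypFlow.step_tangent (h : HypFlow n ψ p κ Ls Lu τ) {ε r : ℝ}
    (hb : IsBox ψ κ Ls Lu τ ε r) {t : ℝ} (ht : t ∈ Icc τ (2 * τ)) {s : ℝ} {x : C}
    (hx : ψ s x ∈ box κ r) (v : TangentSpace (𝓡 n) x) :
    ‖dAt n (fun y => κ (ψ (s + t) y)) x v -
      (Ls t).prodMap (Lu t) (dAt n (fun y => κ (ψ s y)) x v)‖ ≤
      ε * ‖dAt n (fun y => κ (ψ s y)) x v‖ := by
  have h1 : (fun y => κ (ψ (s + t) y)) =ᶠ[𝓝 x]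
      fun y => (fun z => κ (ψ t (κ.symm z))) (κ (ψ s y)) := by
    filter_upwards [(h.flow.continuous_right s).continuousAt.eventually
      (κ.open_source.mem_nhds hx.1)] with y hy
    rw [κ.left_inv hy, ← h.flow.add, add_comm t s]
  rw [dAt_congr h1, dAt_vector_comp (h.flow.mdifferentiableAt_chart h.chart hx.1)
    (hb.diff t ht _ hx.2)]
  have := (fderiv ℝ (fun z => κ (ψ t (κ.symm z))) (κ (ψ s x)) -
    (Ls t).prodMap (Lu t)).le_of_opNorm_le (hb.bound t ht _ hx.2)
      (dAt n (fun y => κ (ψ s y)) x v)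
  exact this

lemma HypFlow.mem_Icc (h : HypFlow n ψ p κ Ls Lu τ) : τ ∈ Icc τ (2 * τ) :=
  ⟨le_rfl, by linarith [h.tau_pos]⟩

lemma HypFlow.exists_open_noReturn (h : HypFlow n ψ p κ Ls Lu τ) {U : Set C} (hU : U ∈ 𝓝 p) :
    ∃ V, IsOpen V ∧ p ∈ V ∧ ∀ x ∈ V, ∀ t, 0 ≤ t → ψ t x ∈ V → ∀ s ∈ Icc 0 t, ψ s x ∈ U := by
  obtain ⟨V, hV, hVU⟩ := h.noReturn U hU
  obtain ⟨V', hV', hV'o, hpV'⟩ := mem_nhds_iff.1 hV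
  exact ⟨V', hV'o, hpV', fun x hx t ht hxt => hVU x (hV' hx) t ht (hV' hxt)⟩

/-- Points of the stable manifold near `p` stay near `p` forever. -/
lemma stable_orbit_mem {U V : Set C} (hV : V ∈ 𝓝 p)
    (hVU : ∀ x ∈ V, ∀ t, 0 ≤ t → ψ t x ∈ V → ∀ s ∈ Icc 0 t, ψ s x ∈ U) {x : C} (hx : x ∈ V)
    (hxs : x ∈ stableManifold ψ p) {t : ℝ} (ht : 0 ≤ t) : ψ t x ∈ U := by
  have h1 : ∀ᶠ s in atTop, ψ s x ∈ V := (show Tendsto (fun t => ψ t x) atTop (𝓝 p) from hxs) hV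
  obtain ⟨s, hs, hts⟩ := (h1.and (eventually_ge_atTop t)).exists
  exact hVU x hx s (ht.trans hts) hs t ⟨ht, hts⟩

/-- An inequality between secants passes to the derivatives. -/
lemma norm_deriv_le_of_secants {E F : Type*} [NormedAddCommGroup E] [NormedSpace ℝ E]
    [NormedAddCommGroup F] [NormedSpace ℝ F] {f : ℝ → E} {g : ℝ → F} {f' : E} {g' : F}
    (hf : HasDerivAt f f' 0) (hg : HasDerivAt g g' 0)
    (hfg : ∀ᶠ s in 𝓝 0, ‖f s - f 0‖ ≤ ‖g s - g 0‖) : ‖f'‖ ≤ ‖g'‖ := by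
  rw [hasDerivAt_iff_tendsto_slope_zero] at hf hg
  refine le_of_tendsto_of_tendsto hf.norm hg.norm ?_
  filter_upwards [hfg.filter_mono nhdsWithin_le_nhds] with s hs
  simp only [zero_add, norm_smul]
  exact mul_le_mul_of_nonneg_left hs (norm_nonneg _)

/-! ### Tangent spaces of the stable manifold -/

/-- The tangent vectors at `x` with bounded forward orbits, in the chart `κ` and at times in `ℕ τ`. -/
def boundedVectors (n : ℕ) {C : Type*} [TopologicalSpace C]
    [ChartedSpace (EuclideanSpace ℝ (Fin n)) C] (ψ : ℝ → C → C)
    (κ : OpenPartialHomeomorph C (Es × Eu)) (τ : ℝ) (x : C) :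
    Submodule ℝ (TangentSpace (𝓡 n) x) where
  carrier := {v | ∃ M, ∀ j : ℕ, ‖dAt n (fun y => κ (ψ (j * τ) y)) x v‖ ≤ M}
  add_mem' := by
    rintro v v' ⟨M, hM⟩ ⟨M', hM'⟩
    refine ⟨M + M', fun j => ?_⟩
    simp only [map_add]
    exact (norm_add_le _ _).trans (add_le_add (hM j) (hM' j))
  zero_mem' := ⟨0, fun j => by simp⟩
  smul_mem' := by
    rintro c v ⟨M, hM⟩
    refine ⟨‖c‖ * M, fun j => ?_⟩
    simp only [map_smul, norm_smul]
    exact mul_le_mul_of_nonneg_left (hM j) (norm_nonneg c)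

/-- `HypFlow.step_tangent` along the orbit with time step `τ`. -/
lemma HypFlow.step_tangent_nat (h : HypFlow n ψ p κ Ls Lu τ) {ε r : ℝ}
    (hb : IsBox ψ κ Ls Lu τ ε r) {x : C} {T : ℝ} {j : ℕ} (hx : ψ (T + j * τ) x ∈ box κ r)
    (v : TangentSpace (𝓡 n) x) :
    ‖dAt n (fun y => κ (ψ (T + (j + 1 : ℕ) * τ) y)) x v -
      (Ls τ).prodMap (Lu τ) (dAt n (fun y => κ (ψ (T + j * τ) y)) x v)‖ ≤
      ε * ‖dAt n (fun y => κ (ψ (T + j * τ) y)) x v‖ := by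
  have := h.step_tangent hb h.mem_Icc hx v
  have h2 : T + ((j + 1 : ℕ) : ℝ) * τ = T + j * τ + τ := by push_cast; ring
  rwa [h2]

/-- Secants of the stable manifold near `p` have bounded forward orbits, and hence so do its tangent
vectors. -/
lemma HypFlow.tangentSpaceOf_le_boundedVectors (h : HypFlow n ψ p κ Ls Lu τ) {ε r : ℝ}
    (hε : ε ≤ 1 / 16) (hb : IsBox ψ κ Ls Lu τ ε r) {V : Set C} (hVo : IsOpen V) (hpV : p ∈ V)
    (hV : ∀ x ∈ V, ∀ t, 0 ≤ t → ψ t x ∈ V → ∀ s ∈ Icc 0 t, ψ s x ∈ box κ r) {x : C} (hxV : x ∈ V)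
    (hxs : x ∈ stableManifold ψ p) :
    tangentSpaceOf n (stableManifold ψ p) x ≤ boundedVectors n ψ κ τ x := by
  have hmem : ∀ {y}, y ∈ V → y ∈ stableManifold ψ p → ∀ j : ℕ, ψ (j * τ) y ∈ box κ r :=
    fun hy hys j => stable_orbit_mem (hVo.mem_nhds hpV) hV hy hys
      (by have := h.tau_pos; positivity)
  refine tangentSpaceOf_le fun γ hγ hγS hx => ?_
  subst hx
  refine ⟨‖dAt n (fun y => κ (ψ ((0 : ℕ) * τ) y)) (γ 0) (dOf n γ 0 1)‖, fun j => ?_⟩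
  have hd : ∀ j : ℕ, HasDerivAt (fun s => κ (ψ (j * τ) (γ s)))
      (dAt n (fun y => κ (ψ (j * τ) y)) (γ 0) (dOf n γ 0 1)) 0 := fun j =>
    hasDerivAt_comp_curve (h.flow.mdifferentiableAt_chart h.chart (hmem hxV hxs j).1)
      (hγ.mdifferentiableAt (by simp))
  refine norm_deriv_le_of_secants (hd j) (hd 0) ?_
  filter_upwards [hγS, hγ.continuousAt.eventually (hVo.mem_nhds hxV)] with s hs hsV
  have h1 := (h.hyp τ le_rfl).norm_le_pow_of_bounded
    (w := fun j : ℕ => κ (ψ (j * τ) (γ s)) - κ (ψ (j * τ) (γ 0))) (fun j => by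
      have h2 := hb.step_sub h.mem_Icc (hmem hsV hs j) (hmem hxV hxs j)
      have h3 : ((j + 1 : ℕ) : ℝ) * τ = τ + j * τ := by push_cast; ring
      simp only [h3, h.flow.add]
      exact h2.trans (mul_le_mul_of_nonneg_right hε (norm_nonneg _)))
    (M := r + r) (fun j => (norm_sub_le _ _).trans
      (add_le_add (hmem hsV hs j).2 (hmem hxV hxs j).2)) j
  exact h1.trans (mul_le_of_le_one_left (norm_nonneg _) (pow_le_one₀ (by norm_num) (by norm_num)))

/-- Tangent vectors with bounded forward orbits belong to the stable cone, by expansion outside of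
it. -/
lemma HypFlow.stable_cone_of_mem_boundedVectors (h : HypFlow n ψ p κ Ls Lu τ) {η r : ℝ}
    (hη : 0 < η) (hη1 : η ≤ 1) (hb : IsBox ψ κ Ls Lu τ (η / 16) r) {x : C}
    (hx : ∀ j : ℕ, ψ (j * τ) x ∈ box κ r) {v : TangentSpace (𝓡 n) x}
    (hv : v ∈ boundedVectors n ψ κ τ x) : ‖(dAt n κ x v).2‖ ≤ η * ‖(dAt n κ x v).1‖ := by
  obtain ⟨M, hM⟩ := hv
  have hw0 : (fun y => κ (ψ ((0 : ℕ) * τ) y)) = κ := by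
    funext y
    rw [Nat.cast_zero, zero_mul, h.flow.zero]
  have := (h.hyp τ le_rfl).stable_of_bounded hη hη1 le_rfl
    (w := fun j => dAt n (fun y => κ (ψ (j * τ) y)) x v) (fun j => by
      have := h.step_tangent_nat hb (T := 0) (by rw [zero_add]; exact hx j) v
      simpa only [zero_add] using this) hM
  simpa only [hw0] using this

/-- Tangent vectors of the stable manifold near `p` belong to the stable cone of any given
aperture. -/
lemma HypFlow.eventually_stable_cone (h : HypFlow n ψ p κ Ls Lu τ) {η : ℝ} (hη : 0 < η)
    (hη1 : η ≤ 1) : ∀ᶠ x in 𝓝 p, x ∈ stableManifold ψ p →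
      ∀ v ∈ tangentSpaceOf n (stableManifold ψ p) x, ‖(dAt n κ x v).2‖ ≤ η * ‖(dAt n κ x v).1‖ := by
  obtain ⟨r, hb⟩ := h.exists_isBox (show 0 < η / 16 by positivity)
  obtain ⟨V, hVo, hpV, hV⟩ := h.exists_open_noReturn (h.box_mem_nhds hb.pos)
  filter_upwards [hVo.mem_nhds hpV] with x hxV hxs v hv
  exact h.stable_cone_of_mem_boundedVectors hη hη1 hb
    (fun j => stable_orbit_mem (hVo.mem_nhds hpV) hV hxV hxs (by have := h.tau_pos; positivity))
    (h.tangentSpaceOf_le_boundedVectors (by linarith) hb hVo hpV hV hxV hxs hv)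

end Box

section StableManifold

universe u

variable {n : ℕ} {C : Type*} [TopologicalSpace C] [ChartedSpace (EuclideanSpace ℝ (Fin n)) C]
  {Es Eu : Type u} [NormedAddCommGroup Es] [NormedSpace ℝ Es]
  [NormedAddCommGroup Eu] [NormedSpace ℝ Eu]
  {ψ : ℝ → C → C} {p : C} {κ : OpenPartialHomeomorph C (Es × Eu)}
  {Ls : ℝ → Es →L[ℝ] Es} {Lu : ℝ → Eu →L[ℝ] Eu} {τ : ℝ}

/-- Points with bounded forward orbits, in a box around `p`, belong to the stable manifold. -/
lemma HypFlow.mem_stableManifold (h : HypFlow n ψ p κ Ls Lu τ) {r : ℝ}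
    (hb : IsBox ψ κ Ls Lu τ (1 / 16) r) {y : C} (hy : ∀ j : ℕ, ψ (j * τ) y ∈ box κ r) :
    y ∈ stableManifold ψ p := by
  have hp : p ∈ box κ r := ⟨h.mem_source, by rw [h.chart_fixed, norm_zero]; exact hb.pos.le⟩
  have hpow := (h.hyp τ le_rfl).norm_le_pow_of_bounded (w := fun j : ℕ => κ (ψ (j * τ) y))
    (fun j => by
      have h2 := hb.step_sub h.mem_Icc (hy j) hp
      rw [h.fixed, h.chart_fixed, sub_zero, sub_zero] at h2
      have h3 : ((j + 1 : ℕ) : ℝ) * τ = τ + j * τ := by push_cast; ring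
      simpa only [h3, h.flow.add] using h2) (M := r) (fun j => (hy j).2)
  have h0 : Tendsto (fun j : ℕ => κ (ψ (j * τ) y)) atTop (𝓝 0) := by
    refine squeeze_zero_norm hpow ?_
    have := (tendsto_pow_atTop_nhds_zero_of_lt_one (by norm_num : (0 : ℝ) ≤ 1 / 2)
      (by norm_num)).mul_const ‖κ (ψ ((0 : ℕ) * τ) y)‖
    rwa [zero_mul] at this
  have h1 : Tendsto (fun j : ℕ => ψ (j * τ) y) atTop (𝓝 p) := by
    have h2 : ContinuousAt κ.symm 0 := κ.continuousAt_symm h.zero_mem_target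
    have h3 := h2.tendsto.comp h0
    rw [h.symm_zero] at h3
    exact h3.congr fun j => κ.left_inv (hy j).1
  -- the discrete orbit converges; the flow for times in `[0, τ]` preserves nearness to `p`
  change Tendsto (fun t => ψ t y) atTop (𝓝 p)
  rw [tendsto_def]
  intro U hU
  have h4 : ∀ᶠ x in 𝓝 p, ∀ t ∈ Icc 0 τ, ψ t x ∈ U := by
    refine (isCompact_Icc (a := 0) (b := τ)).eventually_forall_of_forall_eventually
      (P := fun x t => ψ t x ∈ U) fun t _ => ?_
    have h5 : Tendsto (fun z : C × ℝ => ψ z.2 z.1) (𝓝 (p, t)) (𝓝 (ψ t p)) :=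
      (h.flow.continuous.comp (continuous_snd.prodMk continuous_fst)).tendsto (p, t)
    rw [h.fixed] at h5
    exact h5 hU
  have h6 : Tendsto (fun t : ℝ => ⌊t / τ⌋₊) atTop atTop :=
    tendsto_nat_floor_atTop.comp (tendsto_id.atTop_div_const h.tau_pos)
  filter_upwards [(h6.eventually (h1.eventually h4)), eventually_ge_atTop 0] with t ht ht0
  have h7 : (⌊t / τ⌋₊ : ℝ) ≤ t / τ := Nat.floor_le (div_nonneg ht0 h.tau_pos.le)
  have h8 := Nat.lt_floor_add_one (t / τ)
  rw [le_div_iff₀ h.tau_pos] at h7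
  rw [div_lt_iff₀ h.tau_pos] at h8
  have h9 := ht (t - ⌊t / τ⌋₊ * τ) ⟨by linarith, by linarith⟩
  rwa [← h.flow.add, sub_add_cancel] at h9

lemma HypFlow.finrank_add [FiniteDimensional ℝ Es] [FiniteDimensional ℝ Eu]
    (h : HypFlow n ψ p κ Ls Lu τ) : Module.finrank ℝ Es + Module.finrank ℝ Eu = n := by
  have := (LinearEquiv.ofBijective _ (h.chart.dAt_bijective h.mem_source)).finrank_eq
  rw [Module.finrank_prod, finrank_tangentSpace] at this
  exact this.symm

variable [FiniteDimensional ℝ Es] [FiniteDimensional ℝ Eu]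

/-- The tangent space at `p` of the stable manifold is the stable subspace of the linearization. -/
lemma HypFlow.mem_tangentSpaceOf_fixed (h : HypFlow n ψ p κ Ls Lu τ)
    (v : TangentSpace (𝓡 n) p) :
    v ∈ tangentSpaceOf n (stableManifold ψ p) p ↔ (dAt n κ p v).2 = 0 := by
  have hps : p ∈ stableManifold ψ p := by
    change Tendsto (fun t => ψ t p) atTop (𝓝 p)
    simp only [h.fixed]
    exact tendsto_const_nhds
  constructor
  · intro hv
    by_contra hne
    have h1 : 0 < ‖(dAt n κ p v).2‖ := norm_pos_iff.2 hne
    -- an aperture for which `v` is outside of the stable cone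
    set c := ‖(dAt n κ p v).2‖ / (2 * (‖(dAt n κ p v).1‖ + ‖(dAt n κ p v).2‖)) with hc
    have h2 : 0 < ‖(dAt n κ p v).1‖ + ‖(dAt n κ p v).2‖ := by positivity
    have h3 : 0 < c := by positivity
    have h4 : c ≤ 1 := by
      rw [hc, div_le_one (by positivity)]
      linarith [norm_nonneg (dAt n κ p v).1]
    have h5 := (h.eventually_stable_cone h3 h4).self_of_nhds hps v hv
    have h6 : c * ‖(dAt n κ p v).1‖ ≤ c * (‖(dAt n κ p v).1‖ + ‖(dAt n κ p v).2‖) :=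
      mul_le_mul_of_nonneg_left (by linarith) h3.le
    have h7 : c * (‖(dAt n κ p v).1‖ + ‖(dAt n κ p v).2‖) = ‖(dAt n κ p v).2‖ / 2 := by
      rw [hc]
      field_simp
    linarith
  · intro hv
    -- `v` is the velocity of a curve of points with small forward orbits, which belong to the stable
    -- manifold
    obtain ⟨r, hb⟩ := h.exists_isBox (show (0 : ℝ) < 1 / 16 by norm_num)
    set U : Set (Es × Eu) := κ.target ∩ κ.symm ⁻¹' (ψ τ ⁻¹' κ.source) with hU
    have hUo : IsOpen U := κ.symm.isOpen_inter_preimage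
      (κ.open_source.preimage (h.flow.continuous_right τ))
    have h0U : (0 : Es × Eu) ∈ U := ⟨h.zero_mem_target, by
      rw [mem_preimage, h.symm_zero, mem_preimage, h.fixed]; exact h.mem_source⟩
    have hφ : ContDiffOn ℝ ∞ (fun z => κ (ψ τ (κ.symm z))) U := fun z hz => by
      have h1 := h.flow.contDiffAt_chart h.chart (t := τ) (h.chart.contMDiffAt_symm hz.1) hz.2
      exact (h1.comp z (contDiffAt_const.prodMk contDiffAt_id)).contDiffWithinAt
    obtain ⟨γ, hγ, hγ0, hγ', hγo⟩ := (h.hyp τ le_rfl).exists_stable_curve hUo h0U hφ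
      (by rw [h.symm_zero, h.fixed, h.chart_fixed]) (h.deriv τ) (dAt n κ p v).1
    have hsm : ContMDiffAt 𝓘(ℝ, ℝ) (𝓡 n) ∞ (fun t => κ.symm (γ t)) 0 := by
      refine ContMDiffAt.comp (0 : ℝ) ?_ hγ.contMDiffAt
      rw [hγ0]
      exact h.chart.contMDiffAt_symm h.zero_mem_target
    have hmem := mem_tangentSpaceOf (S := stableManifold ψ p) hsm (by
      filter_upwards [hγo r hb.pos] with t ht
      obtain ⟨x, hx0, hx⟩ := ht
      have key : ∀ j : ℕ, ψ (j * τ) (κ.symm (γ t)) = κ.symm (x j) := by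
        intro j
        induction j with
        | zero => rw [Nat.cast_zero, zero_mul, h.flow.zero, hx0]
        | succ j ih =>
          have h3 : ((j + 1 : ℕ) : ℝ) * τ = τ + j * τ := by push_cast; ring
          rw [h3, h.flow.add, ih, (hx j).2, κ.left_inv (hb.mem τ h.mem_Icc _ (hx j).1)]
      refine h.mem_stableManifold hb fun j => ?_
      rw [key]
      have h4 := hb.subset _ (hx j).1
      exact ⟨κ.map_target h4, by rw [κ.right_inv h4]; exact (hx j).1⟩)
    have hbase : κ.symm (γ 0) = p := by rw [hγ0, h.symm_zero]
    have h5 : HasDerivAt (fun t => κ (κ.symm (γ t)))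
        (dAt n κ (κ.symm (γ 0)) (dOf n (fun t => κ.symm (γ t)) 0 1)) 0 :=
      hasDerivAt_comp_curve (h.chart.mdifferentiableAt (by rw [hbase]; exact h.mem_source))
        (hsm.mdifferentiableAt (by simp))
    have h6 : HasDerivAt (fun t => κ (κ.symm (γ t))) ((dAt n κ p v).1, 0) 0 := by
      refine hγ'.congr_of_eventuallyEq ?_
      have : ContinuousAt γ 0 := hγ'.continuousAt
      filter_upwards [this.eventually (κ.open_target.mem_nhds
        (by rw [hγ0]; exact h.zero_mem_target))] with t ht using κ.right_inv ht
    have h7 := h5.unique h6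
    have key : ∀ y, y = p → ∀ w : TangentSpace (𝓡 n) y, w ∈ tangentSpaceOf n (stableManifold ψ p) y →
        dAt n κ y w = ((dAt n κ p v).1, 0) → v ∈ tangentSpaceOf n (stableManifold ψ p) p := by
      rintro _ rfl w hw hw'
      have : w = v := (h.chart.dAt_bijective h.mem_source).1 (hw'.trans (Prod.ext rfl hv.symm))
      rwa [← this]
    exact key _ hbase _ hmem h7

variable [IsManifold (𝓡 n) ∞ C]

/-- The dimension of the stable manifold is at most the number of stable directions. -/
lemma HypFlow.finrank_stable_le (h : HypFlow n ψ p κ Ls Lu τ) {x : C}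
    (hx : x ∈ stableManifold ψ p) :
    Module.finrank ℝ (tangentSpaceOf n (stableManifold ψ p) x) ≤ Module.finrank ℝ Es := by
  have h1 : ∀ᶠ t in atTop, _ := (show Tendsto (fun t => ψ t x) atTop (𝓝 p) from hx).eventually
    ((h.eventually_stable_cone one_pos le_rfl).and (κ.open_source.mem_nhds h.mem_source))
  -- the flow moves `x` close to `p`, where the tangent space is in the stable cone and projects
  -- injectively to `Es`
  obtain ⟨t, ht, hts⟩ := h1.exists
  rw [← h.flow.finrank_tangentSpaceOf (h.flow.mapsTo_stableManifold p) t x]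
  have hcone := ht (h.flow.mapsTo_stableManifold p t hx)
  refine LinearMap.finrank_le_finrank_of_injective (f := LinearMap.fst ℝ Es Eu ∘ₗ
    dAt n κ (ψ t x) ∘ₗ (tangentSpaceOf n (stableManifold ψ p) (ψ t x)).subtype) ?_
  rw [← LinearMap.ker_eq_bot, LinearMap.ker_eq_bot']
  intro v hv
  have h2 : (dAt n κ (ψ t x) v).1 = 0 := hv
  have h3 := hcone v v.2
  rw [h2, norm_zero, mul_zero, norm_le_zero_iff] at h3
  exact Subtype.ext ((h.chart.dAt_bijective hts).1
    ((Prod.ext h2 h3 : _ = (0 : Es × Eu)).trans (map_zero (dAt n κ (ψ t x))).symm))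

/-- A point of both the stable and the unstable manifold of `p` is `p`. -/
lemma HypFlow.eq_of_mem_of_mem [T2Space C] (h : HypFlow n ψ p κ Ls Lu τ) {x : C}
    (hs : x ∈ stableManifold ψ p) (hu : x ∈ unstableManifold ψ p) : x = p := by
  by_contra hne
  obtain ⟨V, hVo, hpV, hV⟩ := h.exists_open_noReturn
    (isOpen_compl_singleton.mem_nhds (Ne.symm hne : p ∈ ({x} : Set C)ᶜ))
  obtain ⟨t, ht, ht0⟩ := (((show Tendsto (fun t => ψ t x) atTop (𝓝 p) from hs).eventually
    (hVo.mem_nhds hpV)).and (eventually_ge_atTop 0)).exists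
  obtain ⟨s, hs, hs0⟩ := (((show Tendsto (fun t => ψ t x) atBot (𝓝 p) from hu).eventually
    (hVo.mem_nhds hpV)).and (eventually_le_atBot 0)).exists
  -- the orbit of `x` starts and ends near `p`, so it stays away from `x`; but it passes through `x`
  have h1 := hV (ψ s x) hs (t - s) (by linarith) (by rwa [← h.flow.add, sub_add_cancel]) (-s)
    ⟨by linarith, by linarith⟩
  rw [h.flow.neg_apply] at h1
  exact h1 rfl

end StableManifold

/-! ### Submanifolds transverse to the stable manifold enter the unstable cone -/

/-- A linear family of orbits of small perturbations of a hyperbolic map enters the unstable cone if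
it has no bounded member. -/
lemma IsHyperbolic.exists_entry {F Es Eu : Type*} [NormedAddCommGroup F] [NormedSpace ℝ F]
    [FiniteDimensional ℝ F] [NormedAddCommGroup Es] [NormedSpace ℝ Es] [NormedAddCommGroup Eu]
    [NormedSpace ℝ Eu] {Ls : Es →L[ℝ] Es} {Lu : Eu →L[ℝ] Eu} (h : IsHyperbolic Ls Lu)
    {M : ℕ → F →L[ℝ] Es × Eu}
    (hM : ∀ j a, ‖M (j + 1) a - (Ls.prodMap Lu) (M j a)‖ ≤ 1 / 16 * ‖M j a‖)
    (hinj : ∀ a, (∃ B, ∀ j, ‖M j a‖ ≤ B) → a = 0) :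
    ∃ j, ∀ a, 6 * ‖(M j a).1‖ ≤ ‖(M j a).2‖ ∧ ((M j a).2 = 0 → a = 0) := by
  have hstep : ∀ j a, ‖(M j a).1‖ < ‖(M j a).2‖ → ‖(M (j + 1) a).1‖ < ‖(M (j + 1) a).2‖ ∧
      6 * ‖(M (j + 1) a).1‖ ≤ ‖(M (j + 1) a).2‖ := by
    intro j a hc
    obtain ⟨h1, h2⟩ := h.cone_step one_pos le_rfl le_rfl (hM j a) (by linarith)
    have h3 : 0 < ‖(M j a).2‖ := (norm_nonneg _).trans_lt hc
    exact ⟨by linarith, by linarith⟩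
  -- the unit vectors whose images are not in the unstable cone at time `j` form a decreasing sequence
  -- of compact sets; a common member would have a bounded orbit
  let A : ℕ → Set F := fun j => {a | a ∈ Metric.sphere 0 1 ∧ ‖(M j a).2‖ ≤ ‖(M j a).1‖}
  have hAc : ∀ j, IsClosed (A j) := fun j =>
    Metric.isClosed_sphere.inter (isClosed_le
      ((continuous_snd.comp (M j).continuous).norm) ((continuous_fst.comp (M j).continuous).norm))
  obtain ⟨J, hJ⟩ : ∃ J, A J = ∅ := by
    by_contra! hne
    obtain ⟨a, ha⟩ := IsCompact.nonempty_iInter_of_sequence_nonempty_isCompact_isClosed A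
      (fun j a ha => ⟨ha.1, by
        by_contra! hc
        exact absurd ha.2 (not_le.2 (hstep j a hc).1)⟩) hne
      ((isCompact_sphere (0 : F) 1).of_isClosed_subset (hAc 0) fun a ha => ha.1) hAc
    rw [mem_iInter] at ha
    have h1 : ∀ j, ‖M j a‖ ≤ ‖M 0 a‖ := by
      intro j
      induction j with
      | zero => exact le_rfl
      | succ j ih =>
        have := h.norm_le_half (hM j a) (ha (j + 1)).2
        linarith [norm_nonneg (M j a)]
    have h2 := hinj a ⟨_, h1⟩
    have h3 := mem_sphere_zero_iff_norm.1 (ha 0).1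
    rw [h2, norm_zero] at h3
    exact zero_ne_one h3
  have hJ' : ∀ a, a ≠ 0 → ‖(M J a).1‖ < ‖(M J a).2‖ := by
    intro a ha
    have h1 : 0 < ‖a‖ := norm_pos_iff.2 ha
    by_contra! hc
    have h2 : ‖a‖⁻¹ • a ∈ A J := by
      refine ⟨by rw [mem_sphere_zero_iff_norm, norm_smul, norm_inv, norm_norm,
        inv_mul_cancel₀ h1.ne'], ?_⟩
      rw [map_smul, Prod.smul_fst, Prod.smul_snd, norm_smul, norm_smul]
      exact mul_le_mul_of_nonneg_left hc (norm_nonneg _)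
    rw [hJ] at h2
    exact h2
  refine ⟨J + 1, fun a => ?_⟩
  rcases eq_or_ne a 0 with rfl | ha
  · simp
  · obtain ⟨h1, h2⟩ := hstep J a (hJ' a ha)
    refine ⟨h2, fun h3 => ?_⟩
    rw [h3, norm_zero] at h1
    exact absurd h1 (not_lt.2 (norm_nonneg _))

/-- The tangent spaces of an invariant set are invariant under the differential of the flow. -/
lemma IsSmoothFlow.dMap_mem_iff {n : ℕ} {C : Type*} [TopologicalSpace C]
    [ChartedSpace (EuclideanSpace ℝ (Fin n)) C] [IsManifold (𝓡 n) ∞ C] {ψ : ℝ → C → C}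
    (hψ : IsSmoothFlow n ψ) {S : Set C} (hS : ∀ t, MapsTo (ψ t) S S) (t : ℝ) (x : C)
    (v : TangentSpace (𝓡 n) x) :
    dMap n (ψ t) x v ∈ tangentSpaceOf n S (ψ t x) ↔ v ∈ tangentSpaceOf n S x := by
  refine ⟨fun hv => ?_, fun hv => dMap_mem_tangentSpaceOf (hψ.contMDiff t x) (hS t) hv⟩
  let D : tangentSpaceOf n S x →ₗ[ℝ] tangentSpaceOf n S (ψ t x) := (dMap n (ψ t) x).restrict
    fun v hv => dMap_mem_tangentSpaceOf (hψ.contMDiff t x) (hS t) hv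
  have hD : Function.Injective D := fun v w hvw =>
    Subtype.ext (hψ.dMap_injective t x (congrArg Subtype.val hvw))
  obtain ⟨u, hu⟩ := (LinearMap.injective_iff_surjective_of_finrank_eq_finrank
    (hψ.finrank_tangentSpaceOf hS t x).symm).1 hD ⟨_, hv⟩
  have : (u : TangentSpace (𝓡 n) x) = v := hψ.dMap_injective t x (congrArg Subtype.val hu)
  rw [← this]
  exact u.2

section Entry

universe u

variable {n : ℕ} {C : Type*} [TopologicalSpace C] [ChartedSpace (EuclideanSpace ℝ (Fin n)) C]
  [IsManifold (𝓡 n) ∞ C]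
  {Es Eu : Type u} [NormedAddCommGroup Es] [NormedSpace ℝ Es]
  [NormedAddCommGroup Eu] [NormedSpace ℝ Eu] [FiniteDimensional ℝ Es] [FiniteDimensional ℝ Eu]
  {ψ : ℝ → C → C} {p : C} {κ : OpenPartialHomeomorph C (Es × Eu)}
  {Ls : ℝ → Es →L[ℝ] Es} {Lu : ℝ → Eu →L[ℝ] Eu} {τ : ℝ}

/-- At points with full-dimensional stable tangent space, the bounded vectors are the tangent
vectors of the stable manifold. -/
lemma HypFlow.mem_of_mem_boundedVectors (h : HypFlow n ψ p κ Ls Lu τ) {r : ℝ}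
    (hb : IsBox ψ κ Ls Lu τ (1 / 16) r) {V : Set C} (hVo : IsOpen V) (hpV : p ∈ V)
    (hV : ∀ x ∈ V, ∀ t, 0 ≤ t → ψ t x ∈ V → ∀ s ∈ Icc 0 t, ψ s x ∈ box κ r) {x : C} (hxV : x ∈ V)
    (hxs : x ∈ stableManifold ψ p)
    (hdim : Module.finrank ℝ (tangentSpaceOf n (stableManifold ψ p) x) = Module.finrank ℝ Es)
    {v : TangentSpace (𝓡 n) x} (hv : v ∈ boundedVectors n ψ κ τ x) :
    v ∈ tangentSpaceOf n (stableManifold ψ p) x := by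
  have hmem : ∀ j : ℕ, ψ (j * τ) x ∈ box κ r := fun j =>
    stable_orbit_mem (hVo.mem_nhds hpV) hV hxV hxs (by have := h.tau_pos; positivity)
  have hxκ : x ∈ κ.source := by
    have := (hmem 0).1
    rwa [Nat.cast_zero, zero_mul, h.flow.zero] at this
  have hle := h.tangentSpaceOf_le_boundedVectors le_rfl hb hVo hpV hV hxV hxs
  -- the bounded vectors form a subspace in the stable cone, so its dimension is at most that of `Es`
  have h1 : Module.finrank ℝ (boundedVectors n ψ κ τ x) ≤ Module.finrank ℝ Es := by
    refine LinearMap.finrank_le_finrank_of_injective (f := LinearMap.fst ℝ Es Eu ∘ₗ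
      dAt n κ x ∘ₗ (boundedVectors n ψ κ τ x).subtype) ?_
    rw [← LinearMap.ker_eq_bot, LinearMap.ker_eq_bot']
    intro v hv
    have h2 : (dAt n κ x v).1 = 0 := hv
    have h3 := h.stable_cone_of_mem_boundedVectors one_pos le_rfl hb hmem v.2
    rw [h2, norm_zero, mul_zero, norm_le_zero_iff] at h3
    exact Subtype.ext ((h.chart.dAt_bijective hxκ).1
      ((Prod.ext h2 h3 : _ = (0 : Es × Eu)).trans (map_zero (dAt n κ x)).symm))
  rwa [Submodule.eq_of_le_of_finrank_le hle (h1.trans hdim.ge)]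

/-- A submanifold of complementary dimension which is transverse to the stable manifold at `x` is
moved by the flow into the unstable cone near `p`. The first coordinates of an adapted chart of the
submanifold can be chosen such that they agree to first order with the unstable coordinates at that
time. -/
theorem HypFlow.exists_entry (h : HypFlow n ψ p κ Ls Lu τ) {W : Set C} {k : ℕ}
    (hW : IsSubmanifold (n := n) k W) (hk : Module.finrank ℝ Eu = k) {x : C} (hx : x ∈ W)
    (hxs : x ∈ stableManifold ψ p)
    (htr : tangentSpaceOf n W x ⊔ tangentSpaceOf n (stableManifold ψ p) x = ⊤)
    (hdim : Module.finrank ℝ (tangentSpaceOf n (stableManifold ψ p) x) = Module.finrank ℝ Es)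
    {U : Set C} (hU : U ∈ 𝓝 p) :
    ∃ (T : ℝ) (e : OpenPartialHomeomorph C (Eu × Es)) (m' : Eu →L[ℝ] Es), 0 ≤ T ∧
      IsSmoothChart n e ∧ x ∈ e.source ∧ e x = 0 ∧ (∀ y ∈ e.source, y ∈ W ↔ (e y).2 = 0) ∧
      ψ T x ∈ U ∧ (∀ a, ‖m' a‖ ≤ 1 / 6 * ‖a‖) ∧
      HasFDerivAt (fun a => κ (ψ T (slice e a))) (m'.prod (ContinuousLinearMap.id ℝ Eu)) 0 := by
  obtain ⟨r, hb⟩ := h.exists_isBox (show (0 : ℝ) < 1 / 16 by norm_num)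
  obtain ⟨V, hVo, hpV, hV⟩ := h.exists_open_noReturn (inter_mem hU (h.box_mem_nhds hb.pos))
  have hVb : ∀ x ∈ V, ∀ t, 0 ≤ t → ψ t x ∈ V → ∀ s ∈ Icc 0 t, ψ s x ∈ box κ r :=
    fun x hx t ht hxt s hs => (hV x hx t ht hxt s hs).2
  obtain ⟨T₀, hT₀V, hT₀⟩ := (((show Tendsto (fun t => ψ t x) atTop (𝓝 p) from hxs).eventually
    (hVo.mem_nhds hpV)).and (eventually_ge_atTop 0)).exists
  have hWs := h.flow.mapsTo_stableManifold p
  have hmem : ∀ j : ℕ, ψ (T₀ + j * τ) x ∈ U ∩ box κ r := fun j => by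
    rw [add_comm, h.flow.add]
    exact stable_orbit_mem (hVo.mem_nhds hpV) hV hT₀V (hWs T₀ hxs)
      (by have := h.tau_pos; positivity)
  obtain ⟨e, he, hxe, hex, heW⟩ := hW.exists_chart (F := Eu) (G := Es) hk
    (by rw [← hk, add_comm]; exact h.finrank_add) hx
  have h0e : ((0 : Eu), (0 : Es)) ∈ e.target := by
    have := e.map_source hxe
    rwa [hex] at this
  obtain rfl : slice e 0 = x := (congrArg e.symm hex.symm).trans (e.left_inv hxe)
  -- by dimension, transversality means that the tangent spaces are complementary
  have hinf : tangentSpaceOf n W (slice e 0) ⊓ tangentSpaceOf n (stableManifold ψ p) (slice e 0) =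
      ⊥ := by
    have h1 := Submodule.finrank_sup_add_finrank_inf_eq (tangentSpaceOf n W (slice e 0))
      (tangentSpaceOf n (stableManifold ψ p) (slice e 0))
    have h2 : Module.finrank ℝ (tangentSpaceOf n W (slice e 0)) ≤ Module.finrank ℝ Eu := by
      refine LinearMap.finrank_le_finrank_of_injective (f := LinearMap.fst ℝ Eu Es ∘ₗ
        dAt n e (slice e 0) ∘ₗ (tangentSpaceOf n W (slice e 0)).subtype) fun v w hvw => ?_
      refine Subtype.ext ((he.dAt_bijective hxe).1 (Prod.ext hvw ?_))
      exact ((mem_tangentSpaceOf_iff he heW hx hxe v).1 v.2).trans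
        ((mem_tangentSpaceOf_iff he heW hx hxe w).1 w.2).symm
    rw [htr, finrank_top, finrank_tangentSpace, hdim] at h1
    have h3 := h.finrank_add
    exact Submodule.finrank_eq_zero.1 (by omega)
  -- tangent vectors of `W` with bounded orbits are tangent to the stable manifold, hence zero
  let M : ℕ → Eu →L[ℝ] Es × Eu := fun j =>
    fderiv ℝ (fun a => κ (ψ (T₀ + j * τ) (slice e a))) 0
  have hMv : ∀ j a, M j a =
      dAt n (fun y => κ (ψ (T₀ + j * τ) y)) (slice e 0) (dOf n (slice e) 0 a) := fun j a =>
    fderiv_comp_dOf (h := fun y => κ (ψ (T₀ + j * τ) y))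
      (h.flow.mdifferentiableAt_chart h.chart (hmem j).2.1) (he.mdifferentiableAt_slice h0e) a
  obtain ⟨J, hJ⟩ := (h.hyp τ le_rfl).exists_entry (M := M)
    (fun j a => by
      rw [hMv, hMv]
      exact h.step_tangent_nat hb (hmem j).2 _)
    (fun a ha => by
      have h1 : dMap n (ψ T₀) (slice e 0) (dOf n (slice e) 0 a) ∈
          boundedVectors n ψ κ τ (ψ T₀ (slice e 0)) := by
        obtain ⟨B, hB⟩ := ha
        refine ⟨B, fun j => ?_⟩
        have h2 : ψ (j * τ) (ψ T₀ (slice e 0)) ∈ κ.source := by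
          rw [← h.flow.add, add_comm]
          exact (hmem j).2.1
        rw [← dAt_comp_dMap (h := fun y => κ (ψ (j * τ) y))
          (h.flow.mdifferentiableAt_chart h.chart h2) (h.flow.mdifferentiable T₀ _)]
        have h3 := hB j
        rw [hMv] at h3
        have h4 : (fun y => κ (ψ (T₀ + j * τ) y)) = fun y => κ (ψ (j * τ) (ψ T₀ y)) := by
          funext y
          rw [← h.flow.add, add_comm]
        rwa [h4] at h3
      have h2 := h.mem_of_mem_boundedVectors hb hVo hpV hVb hT₀V (hWs T₀ hxs)
        ((h.flow.finrank_tangentSpaceOf hWs T₀ _).trans hdim) h1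
      rw [h.flow.dMap_mem_iff hWs] at h2
      have h3 : dOf n (slice e) 0 a = 0 := by
        have : dOf n (slice e) 0 a ∈ tangentSpaceOf n W (slice e 0) ⊓
          tangentSpaceOf n (stableManifold ψ p) (slice e 0) := ⟨he.dOf_slice_mem heW h0e a, h2⟩
        rwa [hinf, Submodule.mem_bot] at this
      have h4 := he.dAt_dOf_slice h0e a
      rw [h3, map_zero] at h4
      exact (congrArg Prod.fst h4).symm)
  -- change of coordinates on `W`, after which the unstable component of the differential is the
  -- identity
  let A : Eu →ₗ[ℝ] Eu := LinearMap.snd ℝ Es Eu ∘ₗ (M J).toLinearMap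
  have hA : Function.Injective A := by
    rw [← LinearMap.ker_eq_bot, LinearMap.ker_eq_bot']
    exact fun a ha => (hJ a).2 ha
  let Ae : Eu ≃L[ℝ] Eu := (LinearEquiv.ofInjectiveEndo A hA).toContinuousLinearEquiv
  have hAe : ∀ a, Ae a = (M J a).2 := fun a => rfl
  obtain ⟨e', he', hes, hee, hesymm⟩ := he.affine (Ae.prodCongr (ContinuousLinearEquiv.refl ℝ Es)) 0
  have hsl : ∀ a, slice e' a = slice e (Ae.symm a) := fun a => by
    rw [slice, hesymm, add_zero]
    rfl
  refine ⟨T₀ + J * τ, e', (ContinuousLinearMap.fst ℝ Es Eu).comp ((M J).comp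
    (Ae.symm : Eu →L[ℝ] Eu)), by have := h.tau_pos; positivity, he', by rwa [hes], by simp [hee, hex],
    fun y hy => ?_, (hmem J).1, fun a => ?_, ?_⟩
  · rw [hes] at hy
    rw [heW y hy, hee, sub_zero]
    rfl
  · have h1 := (hJ (Ae.symm a)).1
    rw [← hAe, Ae.apply_symm_apply] at h1
    change ‖(M J (Ae.symm a)).1‖ ≤ _
    linarith
  · have h1 : HasFDerivAt (fun a => κ (ψ (T₀ + J * τ) (slice e a))) (M J) (Ae.symm 0) := by
      rw [map_zero]
      have h2 := (h.flow.mdifferentiableAt_chart h.chart (hmem J).2.1).comp (0 : Eu)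
        (he.mdifferentiableAt_slice h0e)
      exact h2.differentiableAt.hasFDerivAt
    have h3 := h1.comp (0 : Eu) Ae.symm.hasFDerivAt
    have h4 : (fun a => κ (ψ (T₀ + J * τ) (slice e' a))) =
        (fun a => κ (ψ (T₀ + J * τ) (slice e a))) ∘ Ae.symm := funext fun a => by
      rw [hsl]
      rfl
    rw [h4]
    refine h3.congr_fderiv (ContinuousLinearMap.ext fun a => Prod.ext rfl ?_)
    change (M J (Ae.symm a)).2 = a
    rw [← hAe, Ae.apply_symm_apply]

end Entry

/-! ### Discs near the fixed point -/

section Discs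

universe u

variable {n : ℕ} {C : Type*} [TopologicalSpace C] [ChartedSpace (EuclideanSpace ℝ (Fin n)) C]
  {F G : Type u} [NormedAddCommGroup F] [NormedSpace ℝ F]
  [NormedAddCommGroup G] [NormedSpace ℝ G]

/-- A disc `‖a‖ ≤ ρ` of a submanifold `W`, parametrized by the slice of an adapted chart `e`, which
the flow at time `T` moves into `V` and, in the chart `κ`, `C¹`-close to the graph of the linear map
`m'`. -/
structure EntryDisc (n : ℕ) {C : Type*} [TopologicalSpace C]
    [ChartedSpace (EuclideanSpace ℝ (Fin n)) C] (ψ : ℝ → C → C)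
    (κ : OpenPartialHomeomorph C (G × F)) (W : Set C) (e : OpenPartialHomeomorph C (F × G)) (T : ℝ)
    (m' : F →L[ℝ] G) (V : Set C) (ρ c : ℝ) : Prop where
  chart : IsSmoothChart n e
  mem_iff : ∀ y ∈ e.source, y ∈ W ↔ (e y).2 = 0
  mem_target : ∀ a : F, ‖a‖ ≤ ρ → (a, (0 : G)) ∈ e.target
  mem : ∀ a : F, ‖a‖ ≤ ρ → ψ T (slice e a) ∈ V
  slope : ∀ a, ‖m' a‖ ≤ 1 / 6 * ‖a‖
  diff : ∀ a : F, ‖a‖ ≤ ρ → DifferentiableAt ℝ (fun a => κ (ψ T (slice e a))) a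
  bound : ∀ a : F, ‖a‖ ≤ ρ →
    ‖fderiv ℝ (fun a => κ (ψ T (slice e a))) a - m'.prod (ContinuousLinearMap.id ℝ F)‖ ≤ c

variable {ψ : ℝ → C → C} {κ : OpenPartialHomeomorph C (G × F)} {W : Set C}
  {e : OpenPartialHomeomorph C (F × G)} {T : ℝ} {m' : F →L[ℝ] G} {V : Set C} {ρ c : ℝ}

lemma EntryDisc.mono {ρ' : ℝ} (h : EntryDisc n ψ κ W e T m' V ρ c) (hρ : ρ' ≤ ρ) :
    EntryDisc n ψ κ W e T m' V ρ' c where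
  chart := h.chart
  mem_iff := h.mem_iff
  mem_target a ha := h.mem_target a (ha.trans hρ)
  mem a ha := h.mem a (ha.trans hρ)
  slope := h.slope
  diff a ha := h.diff a (ha.trans hρ)
  bound a ha := h.bound a (ha.trans hρ)

/-- Secants of the disc are close to the graph of `m'`. -/
lemma EntryDisc.lipschitz (h : EntryDisc n ψ κ W e T m' V ρ c) {a a' : F} (ha : ‖a‖ ≤ ρ)
    (ha' : ‖a'‖ ≤ ρ) : ‖κ (ψ T (slice e a)) - κ (ψ T (slice e a')) - (m' (a - a'), a - a')‖ ≤
      c * ‖a - a'‖ :=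
  Convex.norm_image_sub_le_of_norm_fderiv_le' (f := fun a => κ (ψ T (slice e a)))
    (φ := m'.prod (ContinuousLinearMap.id ℝ F)) (s := Metric.closedBall 0 ρ) (x := a') (y := a)
    (fun x hx => h.diff x (mem_closedBall_zero_iff.1 hx))
    (fun x hx => h.bound x (mem_closedBall_zero_iff.1 hx)) (convex_closedBall 0 ρ)
    (mem_closedBall_zero_iff.2 ha') (mem_closedBall_zero_iff.2 ha)

lemma EntryDisc.slice_mem (h : EntryDisc n ψ κ W e T m' V ρ c) {a : F} (ha : ‖a‖ ≤ ρ) :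
    slice e a ∈ W := by
  have := h.mem_target a ha
  rw [slice, h.mem_iff _ (e.map_target this), e.right_inv this]

/-- Vectors close to the graph of `m'` belong to the cone `2 ‖w.1‖ ≤ ‖w.2‖`. -/
lemma EntryDisc.cone (h : EntryDisc n ψ κ W e T m' V ρ c) (hc : c ≤ 1 / 16) {a : F} {w : G × F}
    (hw : ‖w - (m' a, a)‖ ≤ c * ‖a‖) :
    ‖w.1‖ ≤ 1 / 2 * ‖w.2‖ ∧ (w.2 = 0 → a = 0) := by
  have h0 : c * ‖a‖ ≤ 1 / 16 * ‖a‖ := mul_le_mul_of_nonneg_right hc (norm_nonneg a)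
  have h1 : ‖w.1 - m' a‖ ≤ 1 / 16 * ‖a‖ := (norm_fst_le (w - (m' a, a))).trans (hw.trans h0)
  have h2 : ‖w.2 - a‖ ≤ 1 / 16 * ‖a‖ := (norm_snd_le (w - (m' a, a))).trans (hw.trans h0)
  have h3 := norm_le_insert' w.1 (m' a)
  have h4 := norm_le_insert w.2 a
  have h5 := h.slope a
  refine ⟨by linarith [norm_nonneg a], fun h6 => ?_⟩
  rw [h6, norm_zero, zero_add] at h4
  rw [h6] at h2
  exact norm_le_zero_iff.1 (by linarith [norm_nonneg a])

lemma EntryDisc.fderiv_sub_le (h : EntryDisc n ψ κ W e T m' V ρ c) {a : F} (ha : ‖a‖ ≤ ρ) (α : F) :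
    ‖fderiv ℝ (fun a => κ (ψ T (slice e a))) a α - (m' α, α)‖ ≤ c * ‖α‖ :=
  (fderiv ℝ (fun a => κ (ψ T (slice e a))) a -
    m'.prod (ContinuousLinearMap.id ℝ F)).le_of_opNorm_le (h.bound a ha) α

/-- A small disc around the centre of an adapted chart as in `HypFlow.exists_entry` is an entry
disc. -/
lemma exists_entryDisc (hψ : IsSmoothFlow n ψ) (hκ : IsSmoothChart n κ) (he : IsSmoothChart n e)
    (heW : ∀ y ∈ e.source, y ∈ W ↔ (e y).2 = 0) (h0 : ((0 : F), (0 : G)) ∈ e.target)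
    (hV : IsOpen V) (hVκ : V ⊆ κ.source) (hT : ψ T (slice e 0) ∈ V)
    (hm : ∀ a, ‖m' a‖ ≤ 1 / 6 * ‖a‖)
    (hd : HasFDerivAt (fun a => κ (ψ T (slice e a))) (m'.prod (ContinuousLinearMap.id ℝ F)) 0)
    (hc : 0 < c) : ∃ ρ > 0, EntryDisc n ψ κ W e T m' V ρ c := by
  have hsl : ContinuousAt (slice e) 0 := (he.contMDiffAt_slice h0).continuousAt
  have h1 : ∀ᶠ a : F in 𝓝 0, (a, (0 : G)) ∈ e.target :=
    contDiff_slice.continuous.continuousAt.eventually (e.open_target.mem_nhds h0)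
  have h2 : ∀ᶠ a : F in 𝓝 0, ψ T (slice e a) ∈ V :=
    ((hψ.continuous_right T).continuousAt.comp hsl).eventually (hV.mem_nhds hT)
  have hsm : ContDiffAt ℝ ∞ (fun a => κ (ψ T (slice e a))) 0 :=
    (hψ.contDiffAt_chart hκ (he.contMDiffAt_slice h0) (hVκ hT)).comp (0 : F)
      (contDiffAt_const.prodMk contDiffAt_id)
  have h3 : ∀ᶠ a in 𝓝 0, DifferentiableAt ℝ (fun a => κ (ψ T (slice e a))) a := by
    filter_upwards [(hsm.of_le (m := 1) (WithTop.coe_le_coe.2 le_top)).eventually (by simp)] with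
      q hq using hq.differentiableAt (by simp)
  have h4 : ∀ᶠ a in 𝓝 0, ‖fderiv ℝ (fun a => κ (ψ T (slice e a))) a -
      m'.prod (ContinuousLinearMap.id ℝ F)‖ < c := by
    have h5 := (hsm.fderiv_right (m := 0) (WithTop.coe_le_coe.2 le_top)).continuousAt
    refine ((h5.sub continuousAt_const).norm).eventually_lt continuousAt_const ?_
    rw [Pi.sub_apply, hd.fderiv, sub_self, norm_zero]
    exact hc
  obtain ⟨ρ, hρ, hall⟩ := Metric.eventually_nhds_iff_ball.1 (h1.and (h2.and (h3.and h4)))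
  have hmem : ∀ a : F, ‖a‖ ≤ ρ / 2 → a ∈ Metric.ball 0 ρ := fun a ha => by
    rw [mem_ball_zero_iff]; linarith
  exact ⟨ρ / 2, by positivity, he, heW, fun a ha => (hall a (hmem a ha)).1,
    fun a ha => (hall a (hmem a ha)).2.1, hm, fun a ha => (hall a (hmem a ha)).2.2.1,
    fun a ha => (hall a (hmem a ha)).2.2.2.le⟩

end Discs

/-! ### Flow lines from one disc to another one -/

section Gluing

universe u

variable {n : ℕ} {C : Type*} [TopologicalSpace C] [ChartedSpace (EuclideanSpace ℝ (Fin n)) C]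
  {Es Eu : Type u} [NormedAddCommGroup Es] [NormedSpace ℝ Es]
  [NormedAddCommGroup Eu] [NormedSpace ℝ Eu]

/-- The setting of the gluing construction: a box around the hyperbolic fixed point `p`, a disc of
`Wm` which enters the box in the unstable cone at time `Tm`, and a disc of `Wp` which enters the box
in the stable cone at time `-Tp`. The constant `c` bounds the deviation of the discs from the graphs
of `m'` and `q'`, and is small compared to the norms of the linearizations. -/
structure GluingData (n : ℕ) {C : Type*} [TopologicalSpace C]
    [ChartedSpace (EuclideanSpace ℝ (Fin n)) C] (ψ : ℝ → C → C) (p : C)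
    (κ : OpenPartialHomeomorph C (Es × Eu)) (Ls : ℝ → Es →L[ℝ] Es) (Lu : ℝ → Eu →L[ℝ] Eu) (τ : ℝ)
    (Wm Wp : Set C) (em : OpenPartialHomeomorph C (Eu × Es)) (ep : OpenPartialHomeomorph C (Es × Eu))
    (Tm Tp : ℝ) (m' : Eu →L[ℝ] Es) (q' : Es →L[ℝ] Eu) (V : Set C) (r ρ c : ℝ) : Prop where
  hyp : HypFlow n ψ p κ Ls Lu τ
  box : IsBox ψ κ Ls Lu τ (1 / 16) r
  isOpen : IsOpen V
  mem_nhds : p ∈ V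
  noReturn : ∀ x ∈ V, ∀ t, 0 ≤ t → ψ t x ∈ V → ∀ s ∈ Icc 0 t, ψ s x ∈ MorseGluing.box κ (r / 2)
  minus : EntryDisc n ψ κ Wm em Tm m' V ρ c
  plus : EntryDisc n (fun t => ψ (-t)) (swapChart κ) Wp ep Tp q' V ρ c
  rho_pos : 0 < ρ
  c_nonneg : 0 ≤ c
  c_le : ∀ t ∈ Icc τ (2 * τ), c * (1 + ‖(Ls t).prodMap (Lu t)‖) ≤ 1 / 16

variable {ψ : ℝ → C → C} {p : C} {κ : OpenPartialHomeomorph C (Es × Eu)}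
  {Ls : ℝ → Es →L[ℝ] Es} {Lu : ℝ → Eu →L[ℝ] Eu} {τ : ℝ}
  {Wm Wp : Set C} {em : OpenPartialHomeomorph C (Eu × Es)} {ep : OpenPartialHomeomorph C (Es × Eu)}
  {Tm Tp : ℝ} {m' : Eu →L[ℝ] Es} {q' : Es →L[ℝ] Eu} {V : Set C} {r ρ c : ℝ}

/-- Each time `S ≥ τ` is a multiple of a step `t` in `[τ, 2τ]`. -/
lemma exists_mul_eq {τ S : ℝ} (hτ : 0 < τ) (hS : τ ≤ S) :
    ∃ (N : ℕ) (t : ℝ), t ∈ Icc τ (2 * τ) ∧ (N + 1 : ℕ) * t = S ∧ S / τ ≤ N + 2 := by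
  have h0 : 0 ≤ S / τ := div_nonneg (hτ.le.trans hS) hτ.le
  have h1 : 1 ≤ ⌊S / τ⌋₊ := Nat.one_le_floor_iff _ |>.2 ((one_le_div hτ).2 hS)
  obtain ⟨N, hN⟩ : ∃ N, ⌊S / τ⌋₊ = N + 1 := ⟨⌊S / τ⌋₊ - 1, by omega⟩
  have h2 : ((N + 1 : ℕ) : ℝ) ≤ S / τ := hN ▸ Nat.floor_le h0
  have h3 : S / τ < (N + 1 : ℕ) + 1 := hN ▸ Nat.lt_floor_add_one (S / τ)
  have h4 : (0 : ℝ) < (N + 1 : ℕ) := by positivity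
  have h5 : (1 : ℝ) ≤ (N + 1 : ℕ) := by exact_mod_cast Nat.le_add_left 1 N
  refine ⟨N, S / (N + 1 : ℕ), ⟨?_, ?_⟩, by field_simp, by push_cast at h3; linarith⟩
  · rw [le_div_iff₀ h4]
    rwa [le_div_iff₀ hτ, mul_comm] at h2
  · rw [div_le_iff₀ h4]
    rw [div_lt_iff₀ hτ] at h3
    nlinarith

lemma GluingData.c_le' (h : GluingData n ψ p κ Ls Lu τ Wm Wp em ep Tm Tp m' q' V r ρ c) :
    c ≤ 1 / 16 := by
  have h1 := h.c_le τ h.hyp.mem_Icc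
  have := mul_nonneg h.c_nonneg (norm_nonneg ((Ls τ).prodMap (Lu τ)))
  linarith

/-- Between the times `Tm` and `R - Tp`, a flow line of length `R` from the first disc to the second
one stays in the box. -/
lemma GluingData.mem_box (h : GluingData n ψ p κ Ls Lu τ Wm Wp em ep Tm Tp m' q' V r ρ c) {a : Eu}
    {b : Es} (ha : ‖a‖ ≤ ρ) (hb : ‖b‖ ≤ ρ) {R : ℝ} (hR : ψ R (slice em a) = slice ep b) {s : ℝ}
    (hs : 0 ≤ s) (hsR : s ≤ R - Tm - Tp) : ψ (Tm + s) (slice em a) ∈ MorseGluing.box κ (r / 2) := by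
  have h1 := h.minus.mem a ha
  have h2 := h.plus.mem b hb
  have h3 : ψ (R - Tm - Tp) (ψ Tm (slice em a)) ∈ V := by
    rw [← h.hyp.flow.add, show R - Tm - Tp + Tm = -Tp + R by ring, h.hyp.flow.add, hR]
    exact h2
  have h4 := h.noReturn _ h1 _ (hs.trans hsR) h3 s ⟨hs, hsR⟩
  rwa [← h.hyp.flow.add, add_comm] at h4

lemma box_half_subset (hr : 0 < r) : MorseGluing.box κ (r / 2) ⊆ MorseGluing.box κ r :=
  fun _ hx => ⟨hx.1, hx.2.trans (by linarith)⟩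

lemma GluingData.mem_box_nat (h : GluingData n ψ p κ Ls Lu τ Wm Wp em ep Tm Tp m' q' V r ρ c)
    {a : Eu} {b : Es} (ha : ‖a‖ ≤ ρ) (hb : ‖b‖ ≤ ρ) {R : ℝ} (hR : ψ R (slice em a) = slice ep b)
    {N : ℕ} {t : ℝ} (ht : t ∈ Icc τ (2 * τ)) (hN : N * t = R - Tm - Tp) {j : ℕ} (hj : j ≤ N) :
    ψ (Tm + j * t) (slice em a) ∈ MorseGluing.box κ r := by
  have ht0 : 0 ≤ t := h.hyp.tau_pos.le.trans ht.1
  refine box_half_subset h.box.pos (h.mem_box ha hb hR (by positivity) ?_)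
  rw [← hN]
  exact mul_le_mul_of_nonneg_right (by exact_mod_cast hj) ht0

/-- The end point of a discrete flow line, in the coordinates in which the second disc is given. -/
lemma GluingData.swap_exit (h : GluingData n ψ p κ Ls Lu τ Wm Wp em ep Tm Tp m' q' V r ρ c)
    {a : Eu} {b : Es} {R : ℝ} (hR : ψ R (slice em a) = slice ep b) {N : ℕ} {t : ℝ}
    (hN : N * t = R - Tm - Tp) :
    κ (ψ (Tm + N * t) (slice em a)) = (swapChart κ (ψ (-Tp) (slice ep b))).swap := by
  rw [hN, show Tm + (R - Tm - Tp) = -Tp + R by ring, h.hyp.flow.add, hR, swapChart_apply,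
    Prod.swap_swap]

/-- The flow line of a given length between the two discs is unique. -/
lemma GluingData.eq_of_flow_eq (h : GluingData n ψ p κ Ls Lu τ Wm Wp em ep Tm Tp m' q' V r ρ c)
    {R : ℝ} (hRτ : Tm + Tp + τ ≤ R) {a a' : Eu} {b b' : Es} (ha : ‖a‖ ≤ ρ) (ha' : ‖a'‖ ≤ ρ)
    (hb : ‖b‖ ≤ ρ) (hb' : ‖b'‖ ≤ ρ) (hR : ψ R (slice em a) = slice ep b)
    (hR' : ψ R (slice em a') = slice ep b') : a = a' := by
  obtain ⟨N, t, ht, hN, -⟩ := exists_mul_eq h.hyp.tau_pos (show τ ≤ R - Tm - Tp by linarith)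
  have h0 := h.minus.cone h.c_le' (h.minus.lipschitz ha ha')
  have h1 := h.plus.cone h.c_le' (h.plus.lipschitz hb hb')
  -- the difference of two such flow lines starts in the unstable cone and ends in the stable cone
  have hz := (h.hyp.hyp t ht.1).eq_zero_of_cones
    (w := fun j : ℕ => κ (ψ (Tm + j * t) (slice em a)) - κ (ψ (Tm + j * t) (slice em a')))
    (N := N + 1) (fun j hj => by
      have h2 := h.box.step_sub ht (h.mem_box_nat ha hb hR ht hN hj.le)
        (h.mem_box_nat ha' hb' hR' ht hN hj.le)
      have h3 : Tm + ((j + 1 : ℕ) : ℝ) * t = t + (Tm + j * t) := by push_cast; ring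
      simpa only [h3, h.hyp.flow.add t] using h2)
    (by
      simp only [Nat.cast_zero, zero_mul, add_zero]
      linarith [h0.1, norm_nonneg (κ (ψ Tm (slice em a)) - κ (ψ Tm (slice em a'))).2])
    (by
      simp only [h.swap_exit hR hN, h.swap_exit hR' hN]
      exact h1.1)
  simp only [Nat.cast_zero, zero_mul, add_zero] at hz
  exact sub_eq_zero.1 (h0.2 (by rw [hz]; rfl))

end Gluing

section Gluing

universe u

variable {n : ℕ} {C : Type*} [TopologicalSpace C] [ChartedSpace (EuclideanSpace ℝ (Fin n)) C]
  {Es Eu : Type u} [NormedAddCommGroup Es] [NormedSpace ℝ Es]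
  [NormedAddCommGroup Eu] [NormedSpace ℝ Eu]
  {ψ : ℝ → C → C} {p : C} {κ : OpenPartialHomeomorph C (Es × Eu)}
  {Ls : ℝ → Es →L[ℝ] Es} {Lu : ℝ → Eu →L[ℝ] Eu} {τ : ℝ}
  {Wm Wp : Set C} {em : OpenPartialHomeomorph C (Eu × Es)} {ep : OpenPartialHomeomorph C (Es × Eu)}
  {Tm Tp : ℝ} {m' : Eu →L[ℝ] Es} {q' : Es →L[ℝ] Eu} {V : Set C} {r ρ c : ℝ}

/-- The tangent map at time `t` of the disc, in the chart `κ`. -/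
lemma GluingData.fderiv_slice (h : GluingData n ψ p κ Ls Lu τ Wm Wp em ep Tm Tp m' q' V r ρ c)
    {a : Eu} (ha : ‖a‖ ≤ ρ) {t : ℝ} (ht : ψ t (slice em a) ∈ κ.source) (α : Eu) :
    fderiv ℝ (fun a => κ (ψ t (slice em a))) a α =
      dAt n (fun y => κ (ψ t y)) (slice em a) (dOf n (slice em) a α) :=
  fderiv_comp_dOf (h := fun y => κ (ψ t y)) (h.hyp.flow.mdifferentiableAt_chart h.hyp.chart ht)
    (h.minus.chart.mdifferentiableAt_slice (h.minus.mem_target a ha)) α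

/-- Along a flow line between the two discs, tangent vectors of the disc move by small perturbations
of the linearization. -/
lemma GluingData.step_fderiv (h : GluingData n ψ p κ Ls Lu τ Wm Wp em ep Tm Tp m' q' V r ρ c)
    {a : Eu} {b : Es} (ha : ‖a‖ ≤ ρ) (hb : ‖b‖ ≤ ρ) {R : ℝ} (hR : ψ R (slice em a) = slice ep b)
    {N : ℕ} {t : ℝ} (ht : t ∈ Icc τ (2 * τ)) (hN : N * t = R - Tm - Tp) {j : ℕ} (hj : j < N)
    (α : Eu) :
    ‖fderiv ℝ (fun a => κ (ψ (Tm + (j + 1 : ℕ) * t) (slice em a))) a α -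
      (Ls t).prodMap (Lu t) (fderiv ℝ (fun a => κ (ψ (Tm + j * t) (slice em a))) a α)‖ ≤
      1 / 16 * ‖fderiv ℝ (fun a => κ (ψ (Tm + j * t) (slice em a))) a α‖ := by
  have h1 := h.mem_box_nat ha hb hR ht hN hj.le
  have h2 := h.mem_box_nat ha hb hR ht hN (Nat.succ_le_of_lt hj)
  rw [h.fderiv_slice ha h2.1, h.fderiv_slice ha h1.1]
  have := h.hyp.step_tangent h.box ht h1 (dOf n (slice em) a α)
  have h3 : Tm + ((j + 1 : ℕ) : ℝ) * t = Tm + j * t + t := by push_cast; ring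
  rwa [h3]

/-- At time `-Tp` the tangent vectors of the disc of `Wp` lie in the stable cone. -/
lemma GluingData.exit_cone (h : GluingData n ψ p κ Ls Lu τ Wm Wp em ep Tm Tp m' q' V r ρ c)
    {b : Es} (hb : ‖b‖ ≤ ρ) (β : Es) :
    ‖(fderiv ℝ (fun b => κ (ψ (-Tp) (slice ep b))) b β).2‖ ≤
      1 / 2 * ‖(fderiv ℝ (fun b => κ (ψ (-Tp) (slice ep b))) b β).1‖ ∧
    ((fderiv ℝ (fun b => κ (ψ (-Tp) (slice ep b))) b β).1 = 0 → β = 0) := by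
  have h1 := h.plus.cone h.c_le' (h.plus.fderiv_sub_le hb β)
  have hsw : fderiv ℝ (fun b => swapChart κ (ψ (-Tp) (slice ep b))) b β =
      (fderiv ℝ (fun b => κ (ψ (-Tp) (slice ep b))) b β).swap := by
    have h2 : DifferentiableAt ℝ (fun b => κ (ψ (-Tp) (slice ep b))) b :=
      ((ContinuousLinearEquiv.prodComm ℝ Eu Es).differentiable _).comp b (h.plus.diff b hb)
    have h3 := (ContinuousLinearEquiv.prodComm ℝ Es Eu).hasFDerivAt.comp b h2.hasFDerivAt
    exact congrArg (fun L => L β) h3.fderiv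
  rw [hsw] at h1
  exact h1

/-- Flow lines between the two discs are cut out transversely. -/
lemma GluingData.transverse (h : GluingData n ψ p κ Ls Lu τ Wm Wp em ep Tm Tp m' q' V r ρ c)
    {a : Eu} {b : Es} (ha : ‖a‖ ≤ ρ) (hb : ‖b‖ ≤ ρ) {R : ℝ} (hRτ : Tm + Tp + τ ≤ R)
    (hR : ψ R (slice em a) = slice ep b) {α : Eu} {β : Es}
    (hαβ : fderiv ℝ (fun a => κ (ψ (R - Tp) (slice em a))) a α =
      fderiv ℝ (fun b => κ (ψ (-Tp) (slice ep b))) b β) : α = 0 ∧ β = 0 := by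
  obtain ⟨N, t, ht, hN, -⟩ := exists_mul_eq h.hyp.tau_pos (show τ ≤ R - Tm - Tp by linarith)
  have h0 := h.minus.cone h.c_le' (h.minus.fderiv_sub_le ha α)
  have h1 := h.exit_cone hb β
  have hlast : Tm + ((N + 1 : ℕ) : ℝ) * t = R - Tp := by rw [hN]; ring
  -- a common tangent vector starts in the unstable cone and ends in the stable cone
  have hz := (h.hyp.hyp t ht.1).eq_zero_of_cones
    (w := fun j : ℕ => fderiv ℝ (fun a => κ (ψ (Tm + j * t) (slice em a))) a α)
    (N := N + 1) (fun j hj => h.step_fderiv ha hb hR ht hN hj α)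
    (by
      simp only [Nat.cast_zero, zero_mul, add_zero]
      linarith [h0.1, norm_nonneg (fderiv ℝ (fun a => κ (ψ Tm (slice em a))) a α).2])
    (by
      simp only [hlast, hαβ]
      exact h1.1)
  simp only [Nat.cast_zero, zero_mul, add_zero] at hz
  have hα : α = 0 := h0.2 (by rw [hz]; rfl)
  refine ⟨hα, h1.2 ?_⟩
  rw [← hαβ, hα, map_zero]
  rfl

lemma withEnds_eq_of_forall {E : Type*} {N : ℕ} {u v : E} {x : Fin N → E} {z : ℕ → E}
    (h0 : u = z 0) (hx : ∀ i : Fin N, x i = z (i + 1)) (h1 : v = z (N + 1)) (j : Fin (N + 1 + 1)) :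
    withEnds u v x j = z j := by
  induction j using Fin.cases with
  | zero => rw [withEnds_zero, h0]; rfl
  | succ j =>
    induction j using Fin.lastCases with
    | last =>
      rw [Fin.succ_last, withEnds_last, h1]
      rfl
    | cast j =>
      rw [withEnds_middle, hx]
      rfl

/-- If a discrete orbit in the chart stays in the box, it consists of points of a flow line. -/
lemma GluingData.symm_orbit (h : GluingData n ψ p κ Ls Lu τ Wm Wp em ep Tm Tp m' q' V r ρ c)
    {N : ℕ} {t : ℝ} (ht : t ∈ Icc τ (2 * τ)) {z : Fin (N + 1) → Es × Eu}
    (hz : ∀ i : Fin N, ‖z i.castSucc‖ ≤ r ∧ z i.succ = κ (ψ t (κ.symm (z i.castSucc))))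
    (i : Fin (N + 1)) : κ.symm (z i) = ψ ((i : ℕ) * t) (κ.symm (z 0)) := by
  induction i using Fin.induction with
  | zero => simp [h.hyp.flow.zero]
  | succ i ih =>
    have h3 : ((i.succ : ℕ) : ℝ) * t = t + (i.castSucc : ℕ) * t := by
      simp only [Fin.val_succ, Fin.val_castSucc]
      push_cast
      ring
    rw [(hz i).2, κ.left_inv (h.box.mem t ht _ (hz i).1), ih, h3, h.hyp.flow.add]

variable [FiniteDimensional ℝ Es] [FiniteDimensional ℝ Eu]

lemma GluingData.subset_box (h : GluingData n ψ p κ Ls Lu τ Wm Wp em ep Tm Tp m' q' V r ρ c) :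
    ∀ x ∈ V, x ∈ MorseGluing.box κ (r / 2) := fun x hx => by
  have := h.noReturn x hx 0 le_rfl (by rwa [h.hyp.flow.zero]) 0 ⟨le_rfl, le_rfl⟩
  rwa [h.hyp.flow.zero] at this

/-- From time `Tm` on, the orbit of the point of `Wm ∩ W^s(p)` stays in the box. -/
lemma GluingData.stable_orbit_mem_box
    (h : GluingData n ψ p κ Ls Lu τ Wm Wp em ep Tm Tp m' q' V r ρ c)
    (hs : slice em 0 ∈ stableManifold ψ p) {s : ℝ} (hs0 : 0 ≤ s) :
    ψ (Tm + s) (slice em 0) ∈ MorseGluing.box κ (r / 2) := by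
  have := stable_orbit_mem (h.isOpen.mem_nhds h.mem_nhds) h.noReturn
    (h.minus.mem 0 (by rw [norm_zero]; exact h.rho_pos.le))
    (h.hyp.flow.mapsTo_stableManifold p Tm hs) hs0
  rwa [← h.hyp.flow.add, add_comm] at this

/-- Until time `-Tp`, the orbit of the point of `W^u(p) ∩ Wp` stays in the box. -/
lemma GluingData.unstable_orbit_mem_box
    (h : GluingData n ψ p κ Ls Lu τ Wm Wp em ep Tm Tp m' q' V r ρ c)
    (hu : slice ep 0 ∈ unstableManifold ψ p) {s : ℝ} (hs0 : 0 ≤ s) :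
    ψ (-(Tp + s)) (slice ep 0) ∈ MorseGluing.box κ (r / 2) := by
  have hrev := h.hyp.reverse
  rw [← stableManifold_reverse] at hu
  have hVrev : ∀ x ∈ V, ∀ t, 0 ≤ t → ψ (-t) x ∈ V → ∀ s ∈ Icc 0 t,
      ψ (-s) x ∈ MorseGluing.box κ (r / 2) := fun x hx t ht hxt s hs => by
    have := h.noReturn _ hxt t ht (by rwa [h.hyp.flow.apply_neg]) (t - s)
      ⟨sub_nonneg.2 hs.2, by linarith [hs.1]⟩
    rwa [← h.hyp.flow.add, show t - s + -t = -s by ring] at this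
  have := stable_orbit_mem (ψ := fun t => ψ (-t)) (h.isOpen.mem_nhds h.mem_nhds) hVrev
    (h.plus.mem 0 (by rw [norm_zero]; exact h.rho_pos.le))
    (hrev.flow.mapsTo_stableManifold p Tp hu) hs0
  have h2 : -(Tp + s) = -s + -Tp := by ring
  simpa only [h2, h.hyp.flow.add] using this

/-- Existence of flow lines: the forward orbit of a point of the stable manifold and the backward
orbit of a point of the unstable manifold together form a pseudo-orbit with a small jump near `p`,
which is shadowed by a flow line. -/
lemma GluingData.exists_flow_eq (h : GluingData n ψ p κ Ls Lu τ Wm Wp em ep Tm Tp m' q' V r ρ c)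
    (hs : slice em 0 ∈ stableManifold ψ p) (hu : slice ep 0 ∈ unstableManifold ψ p) {δ : ℝ}
    (hδ : 0 < δ) : ∃ R₁, ∀ R, R₁ ≤ R → ∃ a b, ‖a‖ ≤ δ ∧ ‖b‖ ≤ δ ∧
      ψ R (slice em a) = slice ep b := by
  have hr := h.box.pos
  have hus : slice ep 0 ∈ stableManifold (fun t => ψ (-t)) p := by
    rw [stableManifold_reverse]
    exact hu
  -- the two halves of the pseudo-orbit
  let X : ℝ → C := fun s => ψ (Tm + s) (slice em 0)
  let Y : ℝ → C := fun s => ψ (-(Tp + s)) (slice ep 0)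
  have hX : ∀ s, 0 ≤ s → X s ∈ MorseGluing.box κ (r / 2) := fun s => h.stable_orbit_mem_box hs
  have hY : ∀ s, 0 ≤ s → Y s ∈ MorseGluing.box κ (r / 2) := fun s => h.unstable_orbit_mem_box hu
  have hκ0 : Tendsto κ (𝓝 p) (𝓝 0) := by
    have := (κ.continuousAt h.hyp.mem_source).tendsto
    rwa [h.hyp.chart_fixed] at this
  have hXt : Tendsto (fun s => κ (X s)) atTop (𝓝 0) := hκ0.comp
    ((show Tendsto (fun t => ψ t (slice em 0)) atTop (𝓝 p) from hs).comp
      (tendsto_atTop_add_const_left atTop Tm tendsto_id))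
  have hYt : Tendsto (fun s => κ (Y s)) atTop (𝓝 0) := hκ0.comp
    ((show Tendsto (fun t => ψ (-t) (slice ep 0)) atTop (𝓝 p) from hus).comp
      (tendsto_atTop_add_const_left atTop Tp tendsto_id))
  obtain ⟨e, he0, heδ, heρ, her⟩ : ∃ e > 0, 4 * e ≤ δ ∧ 4 * e ≤ ρ ∧ 4 * e ≤ r / 2 := by
    refine ⟨min δ (min ρ (r / 2)) / 4, by have := h.rho_pos; positivity, ?_, ?_, ?_⟩ <;>
      rw [mul_div_cancel₀ _ (four_ne_zero)]
    · exact min_le_left _ _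
    · exact (min_le_right _ _).trans (min_le_left _ _)
    · exact (min_le_right _ _).trans (min_le_right _ _)
  obtain ⟨S, hS⟩ : ∃ S, ∀ s, S ≤ s → ‖κ (X s)‖ ≤ e / 2 ∧ ‖κ (Y s)‖ ≤ e / 2 := by
    have h1 : ∀ᶠ s in atTop, ‖κ (X s)‖ ≤ e / 2 ∧ ‖κ (Y s)‖ ≤ e / 2 := by
      have h0 : ‖(0 : Es × Eu)‖ < e / 2 := by rw [norm_zero]; positivity
      have h2 := (hXt.norm).eventually_lt_const h0
      have h3 := (hYt.norm).eventually_lt_const h0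
      filter_upwards [h2, h3] with s h4 h5 using ⟨h4.le, h5.le⟩
    exact eventually_atTop.1 h1
  refine ⟨Tm + Tp + τ * (2 * (max S 0 / τ) + 6), fun R hR => ?_⟩
  have hτ := h.hyp.tau_pos
  have hS0 : 0 ≤ max S 0 / τ := div_nonneg (le_max_right _ _) hτ.le
  obtain ⟨N, t, ht, hN, hNτ⟩ := exists_mul_eq hτ (show τ ≤ R - Tm - Tp by nlinarith)
  have ht0 : 0 < t := hτ.trans_le ht.1
  -- both halves have about `N / 2` points
  obtain ⟨N₁, N₂, hN₁₂, hN₁, hN₂⟩ : ∃ N₁ N₂ : ℕ, N₁ + N₂ = N ∧ S ≤ (N₁ + 1 : ℕ) * t ∧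
      S ≤ N₂ * t := by
    have h1 : 2 * (max S 0 / τ) + 6 ≤ N + 2 := by
      refine le_trans ?_ hNτ
      rw [le_div_iff₀ hτ]
      linarith
    have h2 : ∀ K : ℕ, N ≤ 2 * K + 1 → S ≤ K * t := by
      intro K hK
      have h3 : (N : ℝ) ≤ 2 * K + 1 := by exact_mod_cast hK
      have h4 : max S 0 / τ ≤ K := by linarith
      rw [div_le_iff₀ hτ] at h4
      have h5 : (K : ℝ) * τ ≤ K * t := mul_le_mul_of_nonneg_left ht.1 (Nat.cast_nonneg K)
      exact (le_max_left S 0).trans (h4.trans h5)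
    refine ⟨N / 2, N - N / 2, by omega, h2 _ (by omega), h2 _ (by omega)⟩
  -- the pseudo-orbit, with a jump of size at most `e` after `N₁` steps
  let Z : ℕ → C := fun j => if j ≤ N₁ then X (j * t) else Y ((N + 1 - j : ℕ) * t)
  have hZ : ∀ j, Z j ∈ MorseGluing.box κ (r / 2) := by
    intro j
    simp only [Z]
    split_ifs
    · exact hX _ (by positivity)
    · exact hY _ (by positivity)
  have hZ0 : κ (ψ Tm (slice em 0)) = κ (Z 0) := by simp [Z, X]
  have hZ1 : κ (ψ (-Tp) (slice ep 0)) = κ (Z (N + 1)) := by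
    have : ¬ (N + 1 ≤ N₁) := by omega
    simp [Z, Y, this]
  have hstep : ∀ j ≤ N, ‖κ (Z (j + 1)) - κ (ψ t (Z j))‖ ≤ e := by
    intro j hj
    by_cases h1 : j + 1 ≤ N₁
    · have h2 : Z (j + 1) = ψ t (Z j) := by
        simp only [Z, if_pos h1, if_pos (Nat.le_of_succ_le h1), X]
        rw [← h.hyp.flow.add]
        congr 1
        push_cast
        ring
      rw [h2, sub_self, norm_zero]
      exact he0.le
    · by_cases h3 : j ≤ N₁
      · obtain rfl : j = N₁ := by omega
        have h4 : ψ t (Z j) = X ((j + 1 : ℕ) * t) := by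
          simp only [Z, if_pos h3, X]
          rw [← h.hyp.flow.add]
          congr 1
          push_cast
          ring
        have h5 : Z (j + 1) = Y (N₂ * t) := by
          have : N + 1 - (j + 1) = N₂ := by omega
          simp only [Z, if_neg h1, this]
        rw [h4, h5]
        refine (norm_sub_le _ _).trans ?_
        linarith [(hS _ hN₁).1, (hS _ hN₂).2]
      · have h2 : Z (j + 1) = ψ t (Z j) := by
          simp only [Z, if_neg h1, if_neg h3, Y]
          rw [← h.hyp.flow.add]
          congr 1
          have : N + 1 - j = N + 1 - (j + 1) + 1 := by omega
          rw [this]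
          push_cast
          ring
        rw [h2, sub_self, norm_zero]
        exact he0.le
  have hends : ∀ j : Fin (N + 1 + 1), withEnds (κ (ψ Tm (slice em 0))) (κ (ψ (-Tp) (slice ep 0)))
      (fun i : Fin N => κ (Z (i + 1))) j = κ (Z j) :=
    withEnds_eq_of_forall (z := fun j => κ (Z j)) hZ0 (fun _ => rfl) hZ1
  have hVbox := h.subset_box
  obtain ⟨a, b, y, ha, hb, hy, hab⟩ := (h.hyp.hyp t ht.1).exists_orbit
    (φ := fun z => κ (ψ t (κ.symm z))) (r := r) (m := fun a => κ (ψ Tm (slice em a)))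
    (q := fun b => κ (ψ (-Tp) (slice ep b))) (m' := m') (q' := q') (ρ := ρ) (c := c)
    (fun x y hx hy => h.box.lipschitz ht hx hy) h.c_nonneg (h.c_le t ht)
    (fun a a' ha ha' => h.minus.lipschitz ha ha')
    (fun b b' hb hb' => by
      have := h.plus.lipschitz hb hb'
      exact (max_comm _ _).trans_le this)
    (fun a => (h.minus.slope a).trans (by linarith [norm_nonneg a]))
    (fun b => (h.plus.slope b).trans (by linarith [norm_nonneg b]))
    (fun a ha => (hVbox _ (h.minus.mem a ha)).2.trans (by linarith))
    (fun b hb => (hVbox _ (h.plus.mem b hb)).2.trans (by linarith))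
    (x := fun i : Fin N => κ (Z (i + 1))) (fun i => (hZ _).2) he0.le
    (fun i => by
      rw [hends, hends, κ.left_inv (hZ _).1]
      exact hstep i (by omega)) heρ her
  refine ⟨a, b, ha.trans heδ, hb.trans heδ, ?_⟩
  have hma := h.minus.mem a (ha.trans heρ)
  have hqb := h.plus.mem b (hb.trans heρ)
  have horb := h.symm_orbit ht (z := withEnds (κ (ψ Tm (slice em a))) (κ (ψ (-Tp) (slice ep b))) y)
    (fun i => ⟨withEnds_induction (P := fun z => ‖z‖ ≤ r)
      ((hVbox _ hma).2.trans (by linarith)) ((hVbox _ hqb).2.trans (by linarith)) hy i.castSucc,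
      hab i⟩) (Fin.last _)
  rw [withEnds_last, withEnds_zero, κ.left_inv (hVbox _ hma).1, κ.left_inv (hVbox _ hqb).1,
    Fin.val_last, hN, ← h.hyp.flow.add] at horb
  have h1 := congrArg (ψ Tp) horb
  rw [h.hyp.flow.apply_neg, ← h.hyp.flow.add] at h1
  rw [h1]
  congr 1
  ring

end Gluing

/-! ### The family of glued flow lines -/

section Family

universe u

variable {n : ℕ} {C : Type*} [TopologicalSpace C] [ChartedSpace (EuclideanSpace ℝ (Fin n)) C]
  {Es Eu : Type u} [NormedAddCommGroup Es] [NormedSpace ℝ Es]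
  [NormedAddCommGroup Eu] [NormedSpace ℝ Eu]
  {ψ : ℝ → C → C} {p : C} {κ : OpenPartialHomeomorph C (Es × Eu)}
  {Ls : ℝ → Es →L[ℝ] Es} {Lu : ℝ → Eu →L[ℝ] Eu} {τ : ℝ}
  {Wm Wp : Set C} {em : OpenPartialHomeomorph C (Eu × Es)} {ep : OpenPartialHomeomorph C (Es × Eu)}
  {Tm Tp : ℝ} {m' : Eu →L[ℝ] Es} {q' : Es →L[ℝ] Eu} {V : Set C} {r ρ c : ℝ}

lemma isInvertible_of_injective {E F : Type*} [NormedAddCommGroup E] [NormedSpace ℝ E]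
    [NormedAddCommGroup F] [NormedSpace ℝ F] [FiniteDimensional ℝ E] [FiniteDimensional ℝ F]
    (hEF : Module.finrank ℝ E = Module.finrank ℝ F) {L : E →L[ℝ] F} (hL : ∀ v, L v = 0 → v = 0) :
    L.IsInvertible :=
  ⟨(LinearEquiv.ofInjectiveOfFinrankEq L.toLinearMap
    ((injective_iff_map_eq_zero L).2 hL) hEF).toContinuousLinearEquiv, rfl⟩

lemma slice_injective {F G : Type*} [NormedAddCommGroup F] [NormedSpace ℝ F]
    [NormedAddCommGroup G] [NormedSpace ℝ G] {e : OpenPartialHomeomorph C (F × G)} {a a' : F}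
    (ha : (a, (0 : G)) ∈ e.target) (ha' : (a', (0 : G)) ∈ e.target)
    (h : slice e a = slice e a') : a = a' := by
  have := congrArg e h
  rw [slice, slice, e.right_inv ha, e.right_inv ha'] at this
  exact congrArg Prod.fst this

/-- The two ends of the flow lines depend smoothly on the length `R`, by the implicit function
theorem and transversality. -/
lemma GluingData.contDiffAt_family [FiniteDimensional ℝ Es] [FiniteDimensional ℝ Eu]
    (h : GluingData n ψ p κ Ls Lu τ Wm Wp em ep Tm Tp m' q' V r ρ c) {R : ℝ}
    (hRτ : Tm + Tp + τ < R) {a : ℝ → Eu} {b : Es} (ha : ‖a R‖ < ρ) (hb : ‖b‖ < ρ)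
    (hR : ψ R (slice em (a R)) = slice ep b)
    (hall : ∀ᶠ R' in 𝓝 R, ‖a R'‖ ≤ ρ ∧ ∃ b', ‖b'‖ ≤ ρ ∧ ψ R' (slice em (a R')) = slice ep b') :
    ContDiffAt ℝ ∞ a R := by
  -- `G (R, a, b) = 0` says that `b` is the end of the flow line of length `R` from `a`
  let G : ℝ × (Eu × Es) → Es × Eu := fun q =>
    κ (ψ (q.1 - Tp) (slice em q.2.1)) - κ (ψ (-Tp) (slice ep q.2.2))
  have hVbox : ∀ x ∈ V, x ∈ κ.source := fun x hx => (h.subset_box x hx).1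
  have hs2 : ψ (-Tp) (slice ep b) ∈ κ.source := hVbox _ (h.plus.mem b hb.le)
  have hs1 : ψ (R - Tp) (slice em (a R)) = ψ (-Tp) (slice ep b) := by
    rw [← hR, ← h.hyp.flow.add]
    congr 1
    ring
  have hc1 : ContMDiffAt 𝓘(ℝ, Eu) (𝓡 n) ∞ (slice em) (a R) :=
    h.minus.chart.contMDiffAt_slice (h.minus.mem_target _ ha.le)
  have hc2 : ContMDiffAt 𝓘(ℝ, Es) (𝓡 n) ∞ (slice ep) b :=
    h.plus.chart.contMDiffAt_slice (h.plus.mem_target _ hb.le)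
  have hd1 : ContDiffAt ℝ ∞ (fun q : ℝ × Eu => κ (ψ q.1 (slice em q.2))) (R - Tp, a R) :=
    h.hyp.flow.contDiffAt_chart h.hyp.chart hc1 (by rw [hs1]; exact hs2)
  have hd2 : ContDiffAt ℝ ∞ (fun b => κ (ψ (-Tp) (slice ep b))) b :=
    (h.hyp.flow.contDiffAt_chart h.hyp.chart hc2 hs2).comp b (contDiffAt_const.prodMk contDiffAt_id)
  have hG : ContDiffAt ℝ ∞ G (R, (a R, b)) := by
    refine ContDiffAt.sub (ContDiffAt.comp (g := fun q : ℝ × Eu => κ (ψ q.1 (slice em q.2)))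
      (f := fun q : ℝ × (Eu × Es) => (q.1 - Tp, q.2.1)) (R, (a R, b)) hd1 ?_)
      (ContDiffAt.comp (g := fun b => κ (ψ (-Tp) (slice ep b)))
      (f := fun q : ℝ × (Eu × Es) => q.2.2) (R, (a R, b)) hd2 ?_)
    · exact ((contDiff_fst.sub contDiff_const).prodMk
        (contDiff_fst.comp contDiff_snd)).contDiffAt
    · exact (contDiff_snd.comp contDiff_snd).contDiffAt
  have hG0 : G (R, (a R, b)) = 0 := by
    simp only [G, hs1, sub_self]
  -- the derivative of `G` in the direction of `(a, b)` is injective by transversality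
  have hinv : (fderiv ℝ G (R, (a R, b)) ∘L .inr ℝ ℝ (Eu × Es)).IsInvertible := by
    refine isInvertible_of_injective (by simp [Module.finrank_prod, add_comm]) fun v hv => ?_
    have h1 := hasFDerivAt_partial_snd (hG.differentiableAt (by simp))
    have h2 : HasFDerivAt (fun a => κ (ψ (R - Tp) (slice em a)))
        (fderiv ℝ (fun a => κ (ψ (R - Tp) (slice em a))) (a R)) (a R) :=
      ((hd1.comp (a R) (contDiffAt_const.prodMk contDiffAt_id)).differentiableAt
        (by simp)).hasFDerivAt
    have h3 : HasFDerivAt (fun b => κ (ψ (-Tp) (slice ep b)))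
        (fderiv ℝ (fun b => κ (ψ (-Tp) (slice ep b))) b) b :=
      (hd2.differentiableAt (by simp)).hasFDerivAt
    have h4 := (HasFDerivAt.comp (f := Prod.fst) ((a R, b) : Eu × Es) h2 hasFDerivAt_fst).sub
      (HasFDerivAt.comp (f := Prod.snd) ((a R, b) : Eu × Es) h3 hasFDerivAt_snd)
    have h5 := congrArg (fun L => L v) (h1.unique h4)
    have h6 := h5.symm.trans hv
    have h7 := h.transverse ha.le hb.le hRτ.le hR (α := v.1) (β := v.2) (sub_eq_zero.1 h6)
    exact Prod.ext h7.1 h7.2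
  have hne : (∞ : ℕ∞ω) ≠ 0 := by simp
  set φ := hG.implicitFunction hne hinv with hφ
  have hφs : ContDiffAt ℝ ∞ φ R := hG.contDiffAt_implicitFunction hne hinv
  have hφ0 : φ R = (a R, b) := hG.implicitFunction_apply_self hne hinv
  have hφG : ∀ᶠ R' in 𝓝 R, G (R', φ R') = 0 := by
    have := hG.eventually_apply_implicitFunction hne hinv
    rwa [hG0] at this
  have hφc : ContinuousAt φ R := hφs.continuousAt
  have hn1 : ∀ᶠ R' in 𝓝 R, ‖(φ R').1‖ < ρ := by
    refine (continuous_fst.continuousAt.comp hφc).norm.eventually_lt continuousAt_const ?_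
    simpa [hφ0] using ha
  have hn2 : ∀ᶠ R' in 𝓝 R, ‖(φ R').2‖ < ρ := by
    refine (continuous_snd.continuousAt.comp hφc).norm.eventually_lt continuousAt_const ?_
    simpa [hφ0] using hb
  have hsrc : ∀ᶠ R' in 𝓝 R, ψ (R' - Tp) (slice em (φ R').1) ∈ κ.source := by
    have h1 : ContinuousAt (fun R' => slice em (φ R').1) R :=
      ContinuousAt.comp (g := slice em) (f := fun R' => (φ R').1)
        (by rw [hφ0]; exact hc1.continuousAt) (continuous_fst.continuousAt.comp hφc)
    have h2 : ContinuousAt (fun R' => ψ (R' - Tp) (slice em (φ R').1)) R :=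
      h.hyp.flow.continuous.continuousAt.comp
        ((continuousAt_id.sub continuousAt_const).prodMk h1)
    refine h2.eventually (κ.open_source.mem_nhds ?_)
    dsimp only
    rw [hφ0, hs1]
    exact hs2
  -- by uniqueness of flow lines the implicit function agrees with `a`
  have hloc : ∀ᶠ R' in 𝓝 R, a R' = (φ R').1 := by
    filter_upwards [hφG, hn1, hn2, hsrc, hall, lt_mem_nhds hRτ] with R' h1 h2 h3 h4 h5 h6
    obtain ⟨h7, b', h8, h9⟩ := h5
    have h10 := κ.injOn h4 (hVbox _ (h.plus.mem _ h3.le)) (sub_eq_zero.1 h1)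
    have h11 : ψ R' (slice em (φ R').1) = slice ep (φ R').2 := by
      have := congrArg (ψ Tp) h10
      rw [h.hyp.flow.apply_neg, ← h.hyp.flow.add] at this
      rw [← this]
      congr 1
      ring
    exact h.eq_of_flow_eq h6.le h7 h2.le h8 h3.le h9 h11
  exact (contDiff_fst.contDiffAt.comp R hφs).congr_of_eventuallyEq hloc

/-- The flow lines of lengths `R ≥ R₁` between the two discs form a family which converges to the
broken flow line as `R → ∞`. It is smooth for `R > R₁`. -/
lemma GluingData.exists_family [FiniteDimensional ℝ Es] [FiniteDimensional ℝ Eu]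
    (h : GluingData n ψ p κ Ls Lu τ Wm Wp em ep Tm Tp m' q' V r ρ c)
    (hs : slice em 0 ∈ stableManifold ψ p) (hu : slice ep 0 ∈ unstableManifold ψ p) :
    ∃ (R₁ : ℝ) (a : ℝ → Eu) (b : ℝ → Es), Tm + Tp + τ ≤ R₁ ∧
      (∀ R, R₁ ≤ R → ‖a R‖ ≤ ρ ∧ ‖b R‖ ≤ ρ ∧ ψ R (slice em (a R)) = slice ep (b R)) ∧
      (∀ R, R₁ < R → ContDiffAt ℝ ∞ a R) ∧ Tendsto a atTop (𝓝 0) ∧ Tendsto b atTop (𝓝 0) := by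
  have hρ := h.rho_pos
  obtain ⟨R₀, hR₀⟩ := h.exists_flow_eq hs hu (half_pos hρ)
  have hex : ∀ R, ∃ (a : Eu) (b : Es), R₀ ≤ R → ‖a‖ ≤ ρ / 2 ∧ ‖b‖ ≤ ρ / 2 ∧
      ψ R (slice em a) = slice ep b := fun R => by
    by_cases hR : R₀ ≤ R
    · obtain ⟨a, b, hab⟩ := hR₀ R hR
      exact ⟨a, b, fun _ => hab⟩
    · exact ⟨0, 0, fun hR' => absurd hR' hR⟩
  choose a b hab using hex
  have hab' : ∀ R, max R₀ (Tm + Tp + τ) ≤ R → ‖a R‖ ≤ ρ / 2 ∧ ‖b R‖ ≤ ρ / 2 ∧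
      ψ R (slice em (a R)) = slice ep (b R) := fun R hR => hab R ((le_max_left _ _).trans hR)
  -- by uniqueness, the chosen flow lines are the small ones
  have hsmall : ∀ δ > 0, ∀ᶠ R in atTop, ‖a R‖ ≤ δ ∧ ‖b R‖ ≤ δ := by
    intro δ hδ
    obtain ⟨R₂, hR₂⟩ := h.exists_flow_eq hs hu (lt_min hδ (half_pos hρ))
    filter_upwards [eventually_ge_atTop R₂, eventually_ge_atTop (max R₀ (Tm + Tp + τ))] with R h2 h3
    obtain ⟨a', b', ha', hb', hab₂⟩ := hR₂ R h2
    obtain ⟨ha, hb, hab₁⟩ := hab' R h3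
    have ha'' := ha'.trans (min_le_right δ (ρ / 2))
    have hb'' := hb'.trans (min_le_right δ (ρ / 2))
    have haa : a R = a' := h.eq_of_flow_eq ((le_max_right _ _).trans h3) (by linarith)
      (by linarith) (by linarith) (by linarith) hab₁ hab₂
    have hbb : b R = b' := by
      refine slice_injective (h.plus.mem_target _ (by linarith))
        (h.plus.mem_target _ (by linarith)) ?_
      rw [← hab₁, ← hab₂, haa]
    rw [haa, hbb]
    exact ⟨ha'.trans (min_le_left _ _), hb'.trans (min_le_left _ _)⟩
  refine ⟨max R₀ (Tm + Tp + τ), a, b, le_max_right _ _, fun R hR => ?_, fun R hR => ?_, ?_, ?_⟩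
  · obtain ⟨h1, h2, h3⟩ := hab' R hR
    exact ⟨by linarith, by linarith, h3⟩
  · obtain ⟨h1, h2, h3⟩ := hab' R hR.le
    refine h.contDiffAt_family ((le_max_right _ _).trans_lt hR) (by linarith) (by linarith) h3 ?_
    filter_upwards [lt_mem_nhds hR] with R' hR'
    obtain ⟨h1, h2, h3⟩ := hab' R' hR'.le
    exact ⟨by linarith, b R', by linarith, h3⟩
  · rw [tendsto_zero_iff_norm_tendsto_zero, Metric.tendsto_nhds]
    intro δ hδ
    filter_upwards [hsmall (δ / 2) (half_pos hδ)] with R hR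
    rw [Real.dist_0_eq_abs, abs_norm]
    linarith [hR.1]
  · rw [tendsto_zero_iff_norm_tendsto_zero, Metric.tendsto_nhds]
    intro δ hδ
    filter_upwards [hsmall (δ / 2) (half_pos hδ)] with R hR
    rw [Real.dist_0_eq_abs, abs_norm]
    linarith [hR.2]

lemma mem_slice_of_near {F G : Type*} [NormedAddCommGroup F] [NormedSpace ℝ F]
    [NormedAddCommGroup G] [NormedSpace ℝ G] {e : OpenPartialHomeomorph C (F × G)} {W : Set C}
    (he : ∀ y ∈ e.source, y ∈ W ↔ (e y).2 = 0) {y : C} (hy : y ∈ e.source) (hyW : y ∈ W) :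
    slice e (e y).1 = y := by
  have h1 : ((e y).1, (0 : G)) = e y := Prod.ext rfl ((he y hy).1 hyW).symm
  rw [slice, h1, e.left_inv hy]

lemma finrank_tangentSpaceOf_of_chart {F G : Type*} [NormedAddCommGroup F] [NormedSpace ℝ F]
    [NormedAddCommGroup G] [NormedSpace ℝ G] {e : OpenPartialHomeomorph C (F × G)}
    (he : IsSmoothChart n e) {S : Set C} (heS : ∀ y ∈ e.source, y ∈ S ↔ (e y).2 = 0) {x : C}
    (hx : x ∈ S) (hxe : x ∈ e.source) :
    Module.finrank ℝ (tangentSpaceOf n S x) = Module.finrank ℝ F := by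
  have hb := he.dAt_bijective hxe
  have hm := mem_tangentSpaceOf_iff he heS hx hxe
  let L : tangentSpaceOf n S x →ₗ[ℝ] F :=
    (LinearMap.fst ℝ F G ∘ₗ dAt n e x) ∘ₗ (tangentSpaceOf n S x).subtype
  have hL : Function.Bijective L := by
    constructor
    · refine (injective_iff_map_eq_zero L).2 fun v hv => Subtype.ext (hb.1 ?_)
      rw [Submodule.coe_zero, map_zero]
      exact Prod.ext hv ((hm v).1 v.2)
    · intro a
      obtain ⟨v, hv⟩ := hb.2 (a, 0)
      exact ⟨⟨v, (hm v).2 (by rw [hv])⟩, congrArg Prod.fst hv⟩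
  exact (LinearEquiv.ofBijective L hL).finrank_eq

lemma IsSubmanifold.finrank_tangentSpaceOf [IsManifold (𝓡 n) ∞ C] {k l : ℕ} {S : Set C}
    (hS : IsSubmanifold (n := n) k S) (hkl : k + l = n) {x : C} (hx : x ∈ S) :
    Module.finrank ℝ (tangentSpaceOf n S x) = k := by
  obtain ⟨e, he, hxe, -, heS⟩ := hS.exists_chart (F := Fin k → ℝ) (G := Fin l → ℝ) (by simp)
    (by simpa using hkl) hx
  rw [finrank_tangentSpaceOf_of_chart he heS hx hxe, Module.finrank_fin_fun]

/-- The gluing construction applies to submanifolds which are transverse to the stable and the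
unstable manifold. -/
lemma HypFlow.exists_gluingData [IsManifold (𝓡 n) ∞ C] [FiniteDimensional ℝ Es]
    [FiniteDimensional ℝ Eu] (h : HypFlow n ψ p κ Ls Lu τ) {k l : ℕ}
    (hWm : IsSubmanifold (n := n) k Wm) (hWp : IsSubmanifold (n := n) l Wp) (hdim : k + l = n)
    {am ap : C} (ham : am ∈ Wm) (hams : am ∈ stableManifold ψ p) (hapu : ap ∈ unstableManifold ψ p)
    (hap : ap ∈ Wp)
    (htm : tangentSpaceOf n Wm am ⊔ tangentSpaceOf n (stableManifold ψ p) am = ⊤)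
    (htp : tangentSpaceOf n (unstableManifold ψ p) ap ⊔ tangentSpaceOf n Wp ap = ⊤) :
    Module.finrank ℝ Eu = k ∧ Module.finrank ℝ Es = l ∧
    Module.finrank ℝ (tangentSpaceOf n (stableManifold ψ p) am) = Module.finrank ℝ Es ∧
    Module.finrank ℝ (tangentSpaceOf n (unstableManifold ψ p) ap) = Module.finrank ℝ Eu ∧
    ∃ em ep Tm Tp m' q' V r ρ c, GluingData n ψ p κ Ls Lu τ Wm Wp em ep Tm Tp m' q' V r ρ c ∧
      am ∈ em.source ∧ em am = 0 ∧ ap ∈ ep.source ∧ ep ap = 0 := by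
  have hrev := h.reverse
  have hapu' : ap ∈ stableManifold (fun t => ψ (-t)) p := by rwa [stableManifold_reverse]
  -- transversality and `k + l = n` turn the dimension estimates for the stable and the unstable
  -- manifold into equalities
  have h1 := h.finrank_stable_le hams
  have h2 := hrev.finrank_stable_le hapu'
  rw [stableManifold_reverse] at h2
  have h3 := h.finrank_add
  have h4 := Submodule.finrank_add_le_finrank_add_finrank (tangentSpaceOf n Wm am)
    (tangentSpaceOf n (stableManifold ψ p) am)
  have h5 := Submodule.finrank_add_le_finrank_add_finrank
    (tangentSpaceOf n (unstableManifold ψ p) ap) (tangentSpaceOf n Wp ap)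
  rw [htm, finrank_top, finrank_tangentSpace, hWm.finrank_tangentSpaceOf hdim ham] at h4
  rw [htp, finrank_top, finrank_tangentSpace, hWp.finrank_tangentSpaceOf ((add_comm l k).trans hdim) hap] at h5
  have hk : Module.finrank ℝ Eu = k := by omega
  have hl : Module.finrank ℝ Es = l := by omega
  have hds : Module.finrank ℝ (tangentSpaceOf n (stableManifold ψ p) am) =
    Module.finrank ℝ Es := by omega
  have hdu : Module.finrank ℝ (tangentSpaceOf n (unstableManifold ψ p) ap) =
    Module.finrank ℝ Eu := by omega
  refine ⟨hk, hl, hds, hdu, ?_⟩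
  obtain ⟨r, hr⟩ := h.exists_isBox (show (0 : ℝ) < 1 / 16 by norm_num)
  obtain ⟨V, hVo, hpV, hV⟩ := h.exists_open_noReturn (h.box_mem_nhds (half_pos hr.pos))
  have hVκ : V ⊆ κ.source := fun x hx => by
    have := hV x hx 0 le_rfl (by rwa [h.flow.zero]) 0 ⟨le_rfl, le_rfl⟩
    rw [h.flow.zero] at this
    exact this.1
  -- a bound for the linearizations for times in `[τ, 2τ]`
  obtain ⟨B, hB⟩ := (isCompact_Icc (a := τ) (b := 2 * τ)).exists_bound_of_continuousOn
    h.continuous_linearization.continuousOn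
  have hB0 : 0 ≤ B := (norm_nonneg _).trans (hB τ h.mem_Icc)
  have hc : 0 < 1 / (16 * (1 + B)) := by positivity
  obtain ⟨Tm, em, m', -, hem, ham1, ham2, hWem, hTmV, hm', hdm⟩ :=
    h.exists_entry hWm hk ham hams htm hds (hVo.mem_nhds hpV)
  have htp' : tangentSpaceOf n Wp ap ⊔ tangentSpaceOf n (stableManifold (fun t => ψ (-t)) p) ap =
      ⊤ := by rw [stableManifold_reverse, sup_comm]; exact htp
  obtain ⟨Tp, ep, q', -, hep, hap1, hap2, hWep, hTpV, hq', hdq⟩ :=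
    hrev.exists_entry hWp hl hap hapu' htp' (by rw [stableManifold_reverse]; exact hdu)
      (hVo.mem_nhds hpV)
  have hm0 : ((0 : Eu), (0 : Es)) ∈ em.target := by
    have := em.map_source ham1
    rwa [ham2] at this
  have hp0 : ((0 : Es), (0 : Eu)) ∈ ep.target := by
    have := ep.map_source hap1
    rwa [hap2] at this
  have hsm : slice em 0 = am := by
    have := em.left_inv ham1
    rwa [ham2] at this
  have hsp : slice ep 0 = ap := by
    have := ep.left_inv hap1
    rwa [hap2] at this
  obtain ⟨ρ₁, hρ₁, hE₁⟩ := exists_entryDisc h.flow h.chart hem hWem hm0 hVo hVκ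
    (by rwa [hsm]) hm' hdm hc
  obtain ⟨ρ₂, hρ₂, hE₂⟩ := exists_entryDisc hrev.flow hrev.chart hep hWep hp0 hVo hVκ
    (by rwa [hsp]) hq' hdq hc
  refine ⟨em, ep, Tm, Tp, m', q', V, r, min ρ₁ ρ₂, _, ⟨h, hr, hVo, hpV, hV,
    hE₁.mono (min_le_left _ _), hE₂.mono (min_le_right _ _), lt_min hρ₁ hρ₂, hc.le,
    fun t ht => ?_⟩, ham1, ham2, hap1, hap2⟩
  have h6 := hB t ht
  rw [div_mul_eq_mul_div, one_mul, div_le_div_iff₀ (by positivity) (by norm_num)]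
  nlinarith

end Family

/-! ### Signs of frames -/

section Signs

variable {k : ℕ} {F : Type*} [NormedAddCommGroup F] [NormedSpace ℝ F] [FiniteDimensional ℝ F]

lemma SignType.eq_of_mul_eq {s t d : SignType} (hd : d ≠ 0) (h : s * d = t * d) : s = t := by
  revert s t d
  decide

lemma SignType.mul_self_eq_one {s : SignType} (hs : s ≠ 0) : s * s = 1 := by
  revert s
  decide

lemma tupleSign_ne_zero {V : Type*} [AddCommGroup V] [Module ℝ V]
    (o : Orientation ℝ V (Fin k)) (e : Module.Basis (Fin k) ℝ V) : tupleSign o e ≠ 0 := by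
  rw [tupleSign, Ne, sign_eq_zero_iff, AlternatingMap.map_basis_eq_zero_iff]
  exact Module.Ray.someVector_ne_zero o

/-- In coordinates, an orientation is the sign of a determinant. -/
lemma exists_tupleSign_eq {V : Type*} [AddCommGroup V] [Module ℝ V]
    (o : Orientation ℝ V (Fin k)) (b : Module.Basis (Fin k) ℝ F) {P : V →ₗ[ℝ] F}
    (hP : Function.Bijective P) :
    ∃ s : SignType, s ≠ 0 ∧ ∀ v, tupleSign o v = s * SignType.sign (b.det fun i => P (v i)) := by
  let Q := LinearEquiv.ofBijective P hP
  refine ⟨tupleSign o (b.map Q.symm), tupleSign_ne_zero o _, fun v => ?_⟩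
  have h1 := congrArg (fun g => g v) (AlternatingMap.eq_smul_basis_det (b.map Q.symm) o.someVector)
  rw [tupleSign, h1]
  simp only [AlternatingMap.smul_apply, smul_eq_mul, sign_mul, Module.Basis.det_map]
  rfl

lemma det_ne_zero_of_linearIndependent (b : Module.Basis (Fin k) ℝ F) {v : Fin k → F}
    (hv : LinearIndependent ℝ v) : b.det v ≠ 0 := by
  have h1 : Submodule.span ℝ (range v) = ⊤ := by
    refine hv.span_eq_top_of_card_eq_finrank' ?_
    rw [Module.finrank_eq_card_basis b]
  exact ((Module.Basis.is_basis_iff_det b).1 ⟨hv, h1⟩).ne_zero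

lemma det_map_ne_zero (b : Module.Basis (Fin k) ℝ F) {A : F →ₗ[ℝ] F} (hA : ∀ a, A a = 0 → a = 0) :
    b.det (fun i => A (b i)) ≠ 0 :=
  det_ne_zero_of_linearIndependent b (b.linearIndependent.map' A (LinearMap.ker_eq_bot'.2 hA))

lemma continuousWithinAt_det {T : Type*} [TopologicalSpace T] (b : Module.Basis (Fin k) ℝ F)
    {v : T → Fin k → F} {S : Set T} {t : T} (hv : ∀ i, ContinuousWithinAt (fun s => v s i) S t) :
    ContinuousWithinAt (fun s => b.det (v s)) S t := by
  simp only [Module.Basis.det_apply]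
  have h1 : ContinuousWithinAt (fun s => b.toMatrix (v s)) S t := by
    refine continuousWithinAt_pi.2 fun i => continuousWithinAt_pi.2 fun j => ?_
    exact (LinearMap.continuous_of_finiteDimensional (b.coord i)).continuousAt.comp_continuousWithinAt
      (hv j)
  exact (Continuous.matrix_det continuous_id).continuousAt.comp_continuousWithinAt h1

/-- A sign which, locally, differs from the sign of a continuous function by a non-zero constant is
constant on preconnected sets. -/
lemma sign_eq_of_isPreconnected {T : Type*} [TopologicalSpace T] {S : Set T} (hS : IsPreconnected S)
    {s : T → SignType} (hs : ∀ t ∈ S, ∃ d : SignType, d ≠ 0 ∧ ∃ D : T → ℝ,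
      ContinuousWithinAt D S t ∧ ∀ᶠ t' in 𝓝[S] t, d = s t' * SignType.sign (D t'))
    {t t' : T} (ht : t ∈ S) (ht' : t' ∈ S) : s t = s t' := by
  refine hS.constant (fun t₀ ht₀ => ?_) ht ht'
  obtain ⟨d, hd, D, hD, hev⟩ := hs t₀ ht₀
  have h0 := hev.self_of_nhdsWithin ht₀
  have hD0 : D t₀ ≠ 0 := fun h => hd (by rw [h0, h, sign_zero, mul_zero])
  have h1 : ContinuousWithinAt (fun t => SignType.sign (D t)) S t₀ :=
    (continuousAt_sign_of_ne_zero hD0).comp_continuousWithinAt hD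
  have h2 : ∀ᶠ t in 𝓝[S] t₀, SignType.sign (D t) = SignType.sign (D t₀) :=
    h1.eventually (discreteTopology_iff_singleton_mem_nhds.1 inferInstance _)
  refine tendsto_nhds_of_eventually_eq ?_
  filter_upwards [hev, h2] with t h3 h4
  rw [h4] at h3
  exact SignType.eq_of_mul_eq (sign_ne_zero.2 hD0) (h3.symm.trans h0)

/-- Linear isomorphisms which are joined by a segment of isomorphisms have determinants of the same
sign. -/
lemma sign_det_eq_of_segment (b : Module.Basis (Fin k) ℝ F) {A B : F →ₗ[ℝ] F}
    (h : ∀ θ ∈ Icc (0 : ℝ) 1, ∀ a, (1 - θ) • A a + θ • B a = 0 → a = 0) :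
    SignType.sign (b.det fun i => A (b i)) = SignType.sign (b.det fun i => B (b i)) := by
  have key := isPreconnected_Icc.constant (s := Icc (0 : ℝ) 1)
    (f := fun θ => SignType.sign (b.det fun i => (1 - θ) • A (b i) + θ • B (b i)))
    (fun θ hθ => by
      have h1 : b.det (fun i => (1 - θ) • A (b i) + θ • B (b i)) ≠ 0 :=
        det_map_ne_zero b (A := (1 - θ) • A + θ • B) (h θ hθ)
      exact (continuousAt_sign_of_ne_zero h1).comp_continuousWithinAt
        (f := fun θ => b.det fun i => (1 - θ) • A (b i) + θ • B (b i))
        (continuousWithinAt_det b fun i => by fun_prop)) (left_mem_Icc.2 zero_le_one)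
    (right_mem_Icc.2 zero_le_one)
  simpa using key

lemma isoSign_ne_zero {X Z : Type*} [AddCommGroup X] [Module ℝ X] [AddCommGroup Z]
    [Module ℝ Z] (oX : Orientation ℝ X (Fin k)) (oZ : Orientation ℝ Z (Fin k)) (φ : X →ₗ[ℝ] Z) :
    isoSign oX oZ φ ≠ 0 := by
  rw [isoSign]
  split_ifs <;> decide

open Classical in
/-- An isomorphism of oriented spaces preserves or reverses all orientations of frames. -/
lemma tupleSign_map_eq_isoSign_mul {X Z : Type*} [AddCommGroup X] [Module ℝ X] [AddCommGroup Z]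
    [Module ℝ Z] (oX : Orientation ℝ X (Fin k)) (oZ : Orientation ℝ Z (Fin k)) (φ : X →ₗ[ℝ] Z)
    (hφ : Function.Bijective φ) (b : Module.Basis (Fin k) ℝ F) (hX : ∃ P : X →ₗ[ℝ] F,
      Function.Bijective P) (v : Fin k → X) :
    tupleSign oZ (fun i => φ (v i)) = isoSign oX oZ φ * tupleSign oX v := by
  obtain ⟨P, hP⟩ := hX
  obtain ⟨s, hs, h1⟩ := exists_tupleSign_eq oX b hP
  obtain ⟨t, ht, h2⟩ := exists_tupleSign_eq oZ b
    (P := P ∘ₗ (LinearEquiv.ofBijective φ hφ).symm.toLinearMap)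
    (hP.comp (LinearEquiv.ofBijective φ hφ).symm.bijective)
  have h3 : ∀ v : Fin k → X, tupleSign oZ (fun i => φ (v i)) = t * SignType.sign (b.det fun i => P (v i)) := by
    intro v
    rw [h2]
    congr 3
    ext i
    exact congrArg P ((LinearEquiv.ofBijective φ hφ).symm_apply_apply (v i))
  obtain ⟨w, hw⟩ : ∃ w : Fin k → X, SignType.sign (b.det fun i => P (w i)) = 1 := by
    refine ⟨fun i => (LinearEquiv.ofBijective P hP).symm (b i), ?_⟩
    have : (fun i => P ((LinearEquiv.ofBijective P hP).symm (b i))) = b := by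
      ext i
      exact (LinearEquiv.ofBijective P hP).apply_symm_apply (b i)
    rw [this, Module.Basis.det_self, sign_one]
  rw [isoSign, h3, h1]
  split_ifs with h
  · have := h w
    rw [h3, h1, hw, mul_one, mul_one] at this
    rw [this, one_mul]
  · have hst : t ≠ s := fun hst => h fun v => by rw [h3, h1, hst]
    have : t = -s := by
      clear h1 h2 h3
      revert s t
      decide
    rw [this, neg_mul, neg_mul, one_mul]

end Signs

section Cones

universe u

variable {k : ℕ} {Es Eu : Type u} [NormedAddCommGroup Es] [NormedSpace ℝ Es]
  [NormedAddCommGroup Eu] [NormedSpace ℝ Eu] [FiniteDimensional ℝ Eu]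

/-- If a subspace `N` lies in a narrow cone around `Es`, then an orientation of the quotient by `N`
is the sign of the determinant of the `Eu`-components, for all frames in a cone around `Eu`. -/
lemma exists_sign_of_cone {V : Type*} [AddCommGroup V] [Module ℝ V]
    {N : Submodule ℝ V} (o : Orientation ℝ (V ⧸ N) (Fin k)) (b : Module.Basis (Fin k) ℝ Eu)
    {J : V →ₗ[ℝ] Es × Eu} (hJ : Function.Bijective J) [FiniteDimensional ℝ (V ⧸ N)]
    (hdim : Module.finrank ℝ (V ⧸ N) = Module.finrank ℝ Eu) {η K : ℝ} (hη : 0 ≤ η)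
    (hηK : η * K < 1) (hN : ∀ v ∈ N, ‖(J v).2‖ ≤ η * ‖(J v).1‖) :
    ∃ s : SignType, s ≠ 0 ∧ ∀ M : Eu →ₗ[ℝ] V, (∀ a, ‖(J (M a)).1‖ ≤ K * ‖(J (M a)).2‖) →
      (∀ a, (J (M a)).2 = 0 → a = 0) →
      tupleSign o (fun i => N.mkQ (M (b i))) =
        s * SignType.sign (b.det fun i => (J (M (b i))).2) := by
  let Q := LinearEquiv.ofBijective J hJ
  have hQ : ∀ w, J (Q.symm w) = w := Q.apply_symm_apply
  have hzero : ∀ v ∈ N, ‖(J v).1‖ ≤ K * ‖(J v).2‖ → v = 0 := by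
    intro v hv hc
    have h1 := hN v hv
    have h2 : (1 - η * K) * ‖(J v).2‖ ≤ 0 := by
      nlinarith [mul_le_mul_of_nonneg_left hc hη]
    have h3 : ‖(J v).2‖ ≤ 0 := nonpos_of_mul_nonpos_right h2 (by linarith)
    have h4 : (J v).2 = 0 := norm_le_zero_iff.1 h3
    rw [h4, norm_zero, mul_zero] at hc
    exact hJ.1 (by rw [map_zero]; exact Prod.ext (norm_le_zero_iff.1 hc) h4)
  -- the complement `Eu` of `N` gives coordinates on the quotient
  let Θ : Eu →ₗ[ℝ] V ⧸ N := N.mkQ ∘ₗ Q.symm.toLinearMap ∘ₗ LinearMap.inr ℝ Es Eu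
  have hΘi : Function.Injective Θ := by
    refine (injective_iff_map_eq_zero Θ).2 fun a ha => ?_
    have h1 : Q.symm (0, a) ∈ N := (Submodule.Quotient.mk_eq_zero N).1 ha
    have h2 := hN _ h1
    rw [hQ, norm_zero, mul_zero] at h2
    exact norm_le_zero_iff.1 h2
  have hΘ : Function.Bijective Θ :=
    ⟨hΘi, (LinearMap.injective_iff_surjective_of_finrank_eq_finrank hdim.symm).1 hΘi⟩
  let P := LinearEquiv.ofBijective Θ hΘ
  obtain ⟨s, hs, h1⟩ := exists_tupleSign_eq o b (P := P.symm.toLinearMap) P.symm.bijective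
  refine ⟨s, hs, fun M hM hinj => ?_⟩
  rw [h1]
  congr 1
  -- deforming the `Es`-components of the frame to zero, the frame stays complementary to `N`
  refine sign_det_eq_of_segment b (A := P.symm.toLinearMap ∘ₗ N.mkQ ∘ₗ M)
    (B := LinearMap.snd ℝ Es Eu ∘ₗ J ∘ₗ M) fun θ hθ a ha => ?_
  have h2 : N.mkQ (Q.symm ((1 - θ) • (J (M a)).1, (J (M a)).2)) = 0 := by
    have h3 := congrArg P ha
    rw [map_add, map_smul, map_smul, map_zero] at h3
    have h4 : P ((P.symm.toLinearMap ∘ₗ N.mkQ ∘ₗ M) a) = N.mkQ (Q.symm (J (M a))) := by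
      refine (P.apply_symm_apply _).trans ?_
      exact congrArg N.mkQ (Q.symm_apply_apply (M a)).symm
    have h5 : P ((LinearMap.snd ℝ Es Eu ∘ₗ J ∘ₗ M) a) = N.mkQ (Q.symm (0, (J (M a)).2)) := rfl
    rw [h4, h5, ← map_smul N.mkQ, ← map_smul N.mkQ, ← map_smul Q.symm, ← map_smul Q.symm,
      ← map_add N.mkQ, ← map_add Q.symm] at h3
    rw [← h3]
    congr 2
    ext <;> simp [← add_smul]
  have h3 := hzero _ ((Submodule.Quotient.mk_eq_zero N).1 h2) (by
    rw [hQ, norm_smul, Real.norm_eq_abs, abs_of_nonneg (by linarith [hθ.2])]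
    refine le_trans ?_ (hM a)
    exact mul_le_of_le_one_left (norm_nonneg _) (by linarith [hθ.1]))
  rw [LinearEquiv.map_eq_zero_iff] at h3
  exact hinj a (congrArg Prod.snd h3)

variable {Ls : Es →L[ℝ] Es} {Lu : Eu →L[ℝ] Eu}

/-- One step of `IsHyperbolic.sign_det_iterate`: the segment between the unstable components of `M` and
`M'` is close to the segment from the identity to `Lu`, and so it consists of isomorphisms. -/
lemma IsHyperbolic.sign_det_step (h : IsHyperbolic Ls Lu) (b : Module.Basis (Fin k) ℝ Eu)
    (hseg : ∀ s ∈ Icc (0 : ℝ) 1, ∀ v, ‖v‖ ≤ ‖(1 - s) • v + s • Lu v‖) {M M' : Eu →ₗ[ℝ] Es × Eu}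
    (hM : ∀ a, ‖M' a - (Ls.prodMap Lu) (M a)‖ ≤ 1 / 16 * ‖M a‖)
    (hc : ∀ a, ‖(M a).1‖ ≤ ‖(M a).2‖) (hinj : ∀ a, (M a).2 = 0 → a = 0) :
    SignType.sign (b.det fun i => (M (b i)).2) = SignType.sign (b.det fun i => (M' (b i)).2) ∧
      (∀ a, ‖(M' a).1‖ ≤ ‖(M' a).2‖) ∧ ∀ a, (M' a).2 = 0 → a = 0 := by
  refine ⟨?_, fun a => ?_, fun a ha => ?_⟩
  · refine sign_det_eq_of_segment b (A := LinearMap.snd ℝ Es Eu ∘ₗ M)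
      (B := LinearMap.snd ℝ Es Eu ∘ₗ M') fun θ hθ a ha => hinj a ?_
    have ha' : (1 - θ) • (M a).2 + θ • (M' a).2 = 0 := ha
    have h1 := hseg θ hθ (M a).2
    have h2 : ‖(M' a).2 - Lu (M a).2‖ ≤ 1 / 16 * ‖(M a).2‖ := by
      refine (norm_snd_le (M' a - (Ls.prodMap Lu) (M a))).trans ((hM a).trans ?_)
      rw [Prod.norm_def, max_eq_right (hc a)]
    have h3 : (1 - θ) • (M a).2 + θ • Lu (M a).2 = -(θ • ((M' a).2 - Lu (M a).2)) := by
      rw [smul_sub, ← sub_eq_zero, ← ha']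
      abel
    rw [h3, norm_neg, norm_smul, Real.norm_eq_abs, abs_of_nonneg hθ.1] at h1
    have h4 : θ * ‖(M' a).2 - Lu (M a).2‖ ≤ ‖(M' a).2 - Lu (M a).2‖ :=
      mul_le_of_le_one_left (norm_nonneg _) hθ.2
    exact norm_le_zero_iff.1 (by linarith [norm_nonneg (M a).2])
  · have := h.cone_step (η := 1) one_pos le_rfl le_rfl (hM a) (by rw [one_mul]; exact hc a)
    linarith [norm_nonneg (M a).2]
  · have := h.cone_step (η := 1) one_pos le_rfl le_rfl (hM a) (by rw [one_mul]; exact hc a)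
    rw [ha, norm_zero] at this
    exact hinj a (norm_le_zero_iff.1 (by linarith))

/-- Small perturbations of the linear map keep frames in the unstable cone, and do not change the
orientation of their unstable components. -/
lemma IsHyperbolic.sign_det_iterate (h : IsHyperbolic Ls Lu) (b : Module.Basis (Fin k) ℝ Eu)
    (hseg : ∀ s ∈ Icc (0 : ℝ) 1, ∀ v, ‖v‖ ≤ ‖(1 - s) • v + s • Lu v‖) {M : ℕ → Eu →ₗ[ℝ] Es × Eu}
    {N : ℕ} (hM : ∀ j < N, ∀ a, ‖M (j + 1) a - (Ls.prodMap Lu) (M j a)‖ ≤ 1 / 16 * ‖M j a‖)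
    (hc : ∀ a, ‖(M 0 a).1‖ ≤ ‖(M 0 a).2‖) (hinj : ∀ a, (M 0 a).2 = 0 → a = 0) :
    SignType.sign (b.det fun i => (M 0 (b i)).2) = SignType.sign (b.det fun i => (M N (b i)).2) ∧
      (∀ a, ‖(M N a).1‖ ≤ ‖(M N a).2‖) ∧ ∀ a, (M N a).2 = 0 → a = 0 := by
  induction N with
  | zero => exact ⟨rfl, hc, hinj⟩
  | succ N ih =>
    obtain ⟨h1, h2, h3⟩ := ih fun j hj => hM j (hj.trans N.lt_succ_self)
    obtain ⟨h4, h5⟩ := h.sign_det_step b hseg (hM N N.lt_succ_self) h2 h3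
    exact ⟨h1.trans h4, h5⟩

end Cones

/-! ### Orientations along orbits and on discs -/

section Transport

variable {n k : ℕ} {C : Type*} [TopologicalSpace C] [ChartedSpace (EuclideanSpace ℝ (Fin n)) C]
  {ψ : ℝ → C → C}

/-- Moving the vectors of a continuous section along an orbit back to the starting point gives a
continuous function. -/
lemma IsSmoothFlow.continuousAt_dAt_orbit [IsManifold (𝓡 n) ∞ C] (hψ : IsSmoothFlow n ψ)
    {E : Type*} [NormedAddCommGroup E] [NormedSpace ℝ E] {e : OpenPartialHomeomorph C E}
    (he : IsSmoothChart n e) {x : C} (hx : x ∈ e.source) {t₀ : ℝ}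
    {v : (t : ℝ) → TangentSpace (𝓡 n) (ψ t x)}
    (hv : ContinuousAt (fun t => (⟨ψ t x, v t⟩ : TangentBundle (𝓡 n) C)) t₀) :
    ContinuousAt (fun t => dAt n (fun y => e (ψ (-t) y)) (ψ t x) (v t)) t₀ := by
  let e' := chartAt (EuclideanSpace ℝ (Fin n)) (ψ t₀ x)
  have he' : IsSmoothChart n e' :=
    IsSmoothChart.of_mem_maximalAtlas (IsManifold.chart_mem_maximalAtlas (ψ t₀ x))
  have hx' : ψ t₀ x ∈ e'.source := mem_chart_source _ _
  let Φ : ℝ × EuclideanSpace ℝ (Fin n) → E := fun q => e (ψ q.1 (e'.symm q.2))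
  have hΦ : ∀ t, ψ t x ∈ e'.source → ContDiffAt ℝ ∞ Φ (-t, e' (ψ t x)) := fun t ht =>
    hψ.contDiffAt_chart he (he'.contMDiffAt_symm (e'.map_source ht))
      (by rw [e'.left_inv ht, hψ.neg_apply]; exact hx)
  have h1 : ∀ t, ψ t x ∈ e'.source → dAt n (fun y => e (ψ (-t) y)) (ψ t x) (v t) =
      fderiv ℝ Φ (-t, e' (ψ t x)) (0, dAt n e' (ψ t x) (v t)) := by
    intro t ht
    have h2 : (fun y => e (ψ (-t) y)) =ᶠ[𝓝 (ψ t x)] fun y => Φ (-t, e' y) := by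
      filter_upwards [e'.open_source.mem_nhds ht] with y hy
      simp only [Φ, e'.left_inv hy]
    have h3 := hasFDerivAt_partial_snd ((hΦ t ht).differentiableAt (by simp))
    rw [dAt_congr h2, dAt_vector_comp (g := fun z => Φ (-t, z)) (he'.mdifferentiableAt ht)
      h3.differentiableAt, h3.fderiv]
    rfl
  have hcont : ContinuousAt (fun t => ψ t x) t₀ := (hψ.continuous_left x).continuousAt
  have h4 : ContinuousAt (fun t => dAt n e' (ψ t x) (v t)) t₀ := by
    have := continuousWithinAt_dAt (x := fun t => ψ t x) (v := v) (A := univ) e'.open_source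
      he'.smooth hx' ((continuousWithinAt_univ _ _).2 hv)
    exact (continuousWithinAt_univ _ _).1 this
  have h5 : ContinuousAt (fun t => fderiv ℝ Φ (-t, e' (ψ t x))) t₀ := by
    have h6 := ((hΦ t₀ hx').fderiv_right (m := 0) (WithTop.coe_le_coe.2 le_top)).continuousAt
    exact ContinuousAt.comp (f := fun t => (-t, e' (ψ t x))) h6
      (continuousAt_neg.prodMk
        (ContinuousAt.comp (f := fun t => ψ t x) (e'.continuousAt hx') hcont))
  refine (h5.clm_apply ((continuousAt_const (y := (0 : ℝ))).prodMk h4)).congr ?_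
  filter_upwards [hcont.eventually (e'.open_source.mem_nhds hx')] with t ht using (h1 t ht).symm

/-- The differential of the flow as a linear isomorphism. -/
def IsSmoothFlow.dEquiv [IsManifold (𝓡 n) ∞ C] (hψ : IsSmoothFlow n ψ) (t : ℝ) (x : C) :
    TangentSpace (𝓡 n) x ≃ₗ[ℝ] TangentSpace (𝓡 n) (ψ t x) :=
  LinearEquiv.ofBijective (dMap n (ψ t) x) (hψ.dMap_bijective t x)

/-- If the orientations `s t * sign det (Q (dψᵗ)⁻¹ ·)` along an orbit admit continuous local frames of
constant sign, then `s` is constant. -/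
lemma IsSmoothFlow.orbit_sign_eq [IsManifold (𝓡 n) ∞ C] (hψ : IsSmoothFlow n ψ) {x : C}
    (Q : TangentSpace (𝓡 n) x →ₗ[ℝ] (Fin k → ℝ)) {s : ℝ → SignType}
    (hs : ∀ t₀, ∃ d : SignType, d ≠ 0 ∧ ∃ F : Fin k → (y : C) → TangentSpace (𝓡 n) y,
      (∀ i, ContinuousAt (fun t => (⟨ψ t x, F i (ψ t x)⟩ : TangentBundle (𝓡 n) C)) t₀) ∧
      ∀ᶠ t in 𝓝 t₀, d = s t * SignType.sign ((Pi.basisFun ℝ (Fin k)).det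
        fun i => Q ((hψ.dEquiv t x).symm (F i (ψ t x))))) (t t' : ℝ) : s t = s t' := by
  refine sign_eq_of_isPreconnected isPreconnected_univ (s := s) (fun t₀ _ => ?_) (mem_univ t) (mem_univ t')
  obtain ⟨d, hd, F, hF, hev⟩ := hs t₀
  refine ⟨d, hd, _, ?_, by rwa [nhdsWithin_univ]⟩
  refine continuousWithinAt_det _ fun i => (ContinuousAt.continuousWithinAt ?_)
  let e := chartAt (EuclideanSpace ℝ (Fin n)) x
  have he : IsSmoothChart n e :=
    IsSmoothChart.of_mem_maximalAtlas (IsManifold.chart_mem_maximalAtlas x)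
  have hx : x ∈ e.source := mem_chart_source _ _
  let J := LinearEquiv.ofBijective (dAt n e x) (he.dAt_bijective hx)
  have h1 := hψ.continuousAt_dAt_orbit he hx (hF i)
  have h2 : ∀ t, dAt n (fun y => e (ψ (-t) y)) (ψ t x) (F i (ψ t x)) =
      J ((hψ.dEquiv t x).symm (F i (ψ t x))) := by
    intro t
    have h3 := dAt_comp_dMap (h := fun y => e (ψ (-t) y)) (g := ψ t) (x := x)
      (hψ.mdifferentiableAt_chart he (by rwa [hψ.neg_apply])) (hψ.mdifferentiable t x)
      ((hψ.dEquiv t x).symm (F i (ψ t x)))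
    simp only [hψ.neg_apply] at h3
    have h4 : dMap n (ψ t) x ((hψ.dEquiv t x).symm (F i (ψ t x))) = F i (ψ t x) :=
      (hψ.dEquiv t x).apply_symm_apply _
    rw [h4] at h3
    exact h3.symm
  have h5 : (fun t => Q ((hψ.dEquiv t x).symm (F i (ψ t x)))) = fun t =>
      (Q ∘ₗ J.symm.toLinearMap) (dAt n (fun y => e (ψ (-t) y)) (ψ t x) (F i (ψ t x))) := by
    ext1 t
    rw [h2]
    simp
  rw [h5]
  exact (LinearMap.continuous_of_finiteDimensional
    (Q ∘ₗ J.symm.toLinearMap)).continuousAt.comp h1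

/-- A continuous section over a set is continuous along a curve in the set. -/
lemma continuousAt_frame_orbit {S U : Set C} {x₀ : C} {F : (y : C) → TangentSpace (𝓡 n) y}
    [IsManifold (𝓡 n) ∞ C] {T : Type*} [TopologicalSpace T] {γ : T → C} {A : Set T} {t : T}
    (hF : ContinuousOn (fun y => (⟨y, F y⟩ : TangentBundle (𝓡 n) C)) (S ∩ U)) (hγ : γ t = x₀)
    (hU : U ∈ 𝓝 x₀) (ht : t ∈ A) (hS : MapsTo γ A S) (hc : ContinuousWithinAt γ A t) :
    ContinuousWithinAt (fun s => (⟨γ s, F (γ s)⟩ : TangentBundle (𝓡 n) C)) A t := by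
  subst hγ
  have h1 : ContinuousWithinAt (fun y => (⟨y, F y⟩ : TangentBundle (𝓡 n) C)) (S ∩ U) (γ t) :=
    hF _ ⟨hS ht, mem_of_mem_nhds hU⟩
  refine ContinuousWithinAt.comp_of_preimage_mem_nhdsWithin (s := A) h1 hc ?_
  filter_upwards [self_mem_nhdsWithin, hc hU] with s h2 h3 using ⟨hS h2, h3⟩

/-- An orientation of an invariant set is invariant under the differential of the flow. Pulled back
along an orbit to its starting point, it is locally, hence globally constant. -/
lemma IsOrientationOf.transport [IsManifold (𝓡 n) ∞ C] (hψ : IsSmoothFlow n ψ) {S : Set C}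
    (hS : ∀ t, MapsTo (ψ t) S S)
    {o : (x : S) → Orientation ℝ (tangentSpaceOf n S (x : C)) (Fin k)} (ho : IsOrientationOf S o)
    {x : C} (hx : x ∈ S) (hk : Module.finrank ℝ (tangentSpaceOf n S x) = k)
    (v : Fin k → tangentSpaceOf n S x) (t : ℝ) (hxt : ψ t x ∈ S)
    (hv : ∀ i, dMap n (ψ t) x (v i) ∈ tangentSpaceOf n S (ψ t x)) :
    tupleSign (o ⟨ψ t x, hxt⟩) (fun i => ⟨dMap n (ψ t) x (v i), hv i⟩) = tupleSign (o ⟨x, hx⟩) v := by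
  -- `P t` gives coordinates on `T_{ψ t x} S` by pulling back to `x`; `s t` is the orientation of these
  -- coordinates
  let R : tangentSpaceOf n S x ≃ₗ[ℝ] (Fin k → ℝ) :=
    LinearEquiv.ofFinrankEq _ _ (by rw [hk, Module.finrank_fin_fun])
  obtain ⟨Q, hQ⟩ := R.toLinearMap.exists_extend
  have hQv : ∀ v : tangentSpaceOf n S x, Q v = R v := fun v => congrArg (fun L => L v) hQ
  let D := hψ.dEquiv (n := n)
  have hD : ∀ t (w : TangentSpace (𝓡 n) (ψ t x)), w ∈ tangentSpaceOf n S (ψ t x) →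
      (D t x).symm w ∈ tangentSpaceOf n S x := fun t w hw => by
    rw [← hψ.dMap_mem_iff hS t x]
    have : dMap n (ψ t) x ((D t x).symm w) = w := (D t x).apply_symm_apply w
    rwa [this]
  let P : ∀ t, tangentSpaceOf n S (ψ t x) →ₗ[ℝ] (Fin k → ℝ) := fun t =>
    Q ∘ₗ (D t x).symm.toLinearMap ∘ₗ (tangentSpaceOf n S (ψ t x)).subtype
  have hP : ∀ t, Function.Bijective (P t) := by
    intro t
    constructor
    · refine (injective_iff_map_eq_zero (P t)).2 fun w hw => Subtype.ext ?_
      have h1 : R ⟨_, hD t w w.2⟩ = 0 := (hQv ⟨_, hD t w w.2⟩).symm.trans hw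
      have h2 := congrArg Subtype.val ((R.map_eq_zero_iff).1 h1)
      exact ((D t x).symm.map_eq_zero_iff).1 h2
    · intro c
      refine ⟨⟨D t x (R.symm c), (hψ.dMap_mem_iff hS t x _).2 (R.symm c).2⟩, ?_⟩
      have h1 : (D t x).symm (D t x (R.symm c)) = R.symm c := (D t x).symm_apply_apply _
      refine (congrArg Q h1).trans ((hQv _).trans (R.apply_symm_apply c))
  have hsig : ∀ t, ∃ s : SignType, s ≠ 0 ∧ ∀ v, tupleSign (o ⟨ψ t x, hS t hx⟩) v =
      s * SignType.sign ((Pi.basisFun ℝ (Fin k)).det fun i => P t (v i)) := fun t =>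
    exists_tupleSign_eq (o ⟨ψ t x, hS t hx⟩) _ (hP t)
  choose s hs0 hs using hsig
  have hconst := hψ.orbit_sign_eq Q (s := s) (fun t₀ => by
    obtain ⟨U, hU, F, d, hd, hF, hFs⟩ := ho _ (hS t₀ hx)
    refine ⟨d, hd, F, fun i => ?_, ?_⟩
    · exact (continuousWithinAt_univ _ _).1 (continuousAt_frame_orbit (hF i) rfl hU (mem_univ _)
        (fun t _ => hS t hx) (hψ.continuous_left x).continuousAt.continuousWithinAt)
    · filter_upwards [(hψ.continuous_left x).continuousAt hU] with t ht
      obtain ⟨h1, h2⟩ := hFs ⟨_, hS t hx⟩ ht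
      rw [← h2, hs]
      rfl)
  have hval : ∀ t, ∀ hv : ∀ i, dMap n (ψ t) x (v i) ∈ tangentSpaceOf n S (ψ t x),
      tupleSign (o ⟨ψ t x, hS t hx⟩) (fun i => ⟨dMap n (ψ t) x (v i), hv i⟩) =
        s 0 * SignType.sign ((Pi.basisFun ℝ (Fin k)).det fun i => R (v i)) := by
    intro t hv
    rw [hs, hconst t 0]
    congr 3
    ext1 i
    have h1 : (D t x).symm (D t x (v i)) = v i := (D t x).symm_apply_apply _
    exact (congrArg Q h1).trans (hQv _)
  have hid : ∀ g : C → C, g = id → ∀ (hg : g x ∈ S)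
      (hm : ∀ i, dMap n g x (v i) ∈ tangentSpaceOf n S (g x)),
      tupleSign (o ⟨g x, hg⟩) (fun i => ⟨dMap n g x (v i), hm i⟩) = tupleSign (o ⟨x, hx⟩) v := by
    rintro _ rfl hg hm
    congr 1
    ext1 i
    refine Subtype.ext ?_
    have : mfderiv (𝓡 n) (𝓡 n) (id : C → C) x = ContinuousLinearMap.id ℝ _ := mfderiv_id
    exact congrArg (fun L => L (v i : TangentSpace (𝓡 n) x)) this
  have h0 : ψ 0 = id := funext hψ.zero
  rw [hval t hv, ← hval 0 fun i => (hψ.dMap_mem_iff hS 0 x _).2 (v i).2]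
  exact hid _ h0 _ _

/-- A coorientation of an invariant set is invariant under the differential of the flow. -/
lemma IsCoorientationOf.transport [IsManifold (𝓡 n) ∞ C] (hψ : IsSmoothFlow n ψ) {S : Set C}
    (hS : ∀ t, MapsTo (ψ t) S S)
    {c : (x : S) → Orientation ℝ (NormalSpace n S (x : C)) (Fin k)} (hc : IsCoorientationOf S c)
    {x : C} (hx : x ∈ S) (hk : Module.finrank ℝ (NormalSpace n S x) = k)
    (v : Fin k → TangentSpace (𝓡 n) x) (t : ℝ) (hxt : ψ t x ∈ S) :
    tupleSign (c ⟨ψ t x, hxt⟩)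
      (fun i => (tangentSpaceOf n S (ψ t x)).mkQ (dMap n (ψ t) x (v i))) =
    tupleSign (c ⟨x, hx⟩) (fun i => (tangentSpaceOf n S x).mkQ (v i)) := by
  -- `P t` gives coordinates on the normal space at `ψ t x` by pulling back to `x`; `s t` is the
  -- orientation of these coordinates
  let R : NormalSpace n S x ≃ₗ[ℝ] (Fin k → ℝ) :=
    LinearEquiv.ofFinrankEq _ _ (by rw [hk, Module.finrank_fin_fun])
  let Q : TangentSpace (𝓡 n) x →ₗ[ℝ] (Fin k → ℝ) := R.toLinearMap ∘ₗ (tangentSpaceOf n S x).mkQ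
  have hQ0 : ∀ v, Q v = 0 ↔ v ∈ tangentSpaceOf n S x := fun v =>
    (R.map_eq_zero_iff).trans (Submodule.Quotient.mk_eq_zero _)
  let D := hψ.dEquiv (n := n)
  have hD : ∀ t (w : TangentSpace (𝓡 n) (ψ t x)), w ∈ tangentSpaceOf n S (ψ t x) ↔
      (D t x).symm w ∈ tangentSpaceOf n S x := fun t w => by
    rw [← hψ.dMap_mem_iff hS t x ((D t x).symm w)]
    have : dMap n (ψ t) x ((D t x).symm w) = w := (D t x).apply_symm_apply w
    rw [this]
  let P : ∀ t, NormalSpace n S (ψ t x) →ₗ[ℝ] (Fin k → ℝ) := fun t =>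
    (tangentSpaceOf n S (ψ t x)).liftQ (Q ∘ₗ (D t x).symm.toLinearMap)
      (fun w hw => (hQ0 _).2 ((hD t w).1 hw))
  have hP : ∀ t, Function.Bijective (P t) := by
    intro t
    constructor
    · refine (injective_iff_map_eq_zero (P t)).2 fun w hw => ?_
      obtain ⟨w, rfl⟩ := Submodule.mkQ_surjective _ w
      exact (Submodule.Quotient.mk_eq_zero _).2 ((hD t w).2 ((hQ0 _).1 hw))
    · intro a
      obtain ⟨u, hu⟩ := Submodule.mkQ_surjective _ (R.symm a)
      refine ⟨(tangentSpaceOf n S (ψ t x)).mkQ (D t x u), ?_⟩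
      have h1 : (D t x).symm (D t x u) = u := (D t x).symm_apply_apply _
      refine (congrArg Q h1).trans ?_
      rw [← R.apply_symm_apply a, ← hu]
      rfl
  have hsig : ∀ t, ∃ s : SignType, s ≠ 0 ∧ ∀ v, tupleSign (c ⟨ψ t x, hS t hx⟩) v =
      s * SignType.sign ((Pi.basisFun ℝ (Fin k)).det fun i => P t (v i)) := fun t =>
    exists_tupleSign_eq (c ⟨ψ t x, hS t hx⟩) _ (hP t)
  choose s hs0 hs using hsig
  have hconst := hψ.orbit_sign_eq Q (s := s) (fun t₀ => by
    obtain ⟨U, hU, F, d, hd, hF, hFs⟩ := hc _ (hS t₀ hx)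
    refine ⟨d, hd, F, fun i => ?_, ?_⟩
    · exact (continuousWithinAt_univ _ _).1 (continuousAt_frame_orbit (hF i) rfl hU (mem_univ _)
        (fun t _ => hS t hx) (hψ.continuous_left x).continuousAt.continuousWithinAt)
    · filter_upwards [(hψ.continuous_left x).continuousAt hU] with t ht
      rw [← hFs ⟨_, hS t hx⟩ ht, hs]
      rfl)
  have hval : ∀ t, tupleSign (c ⟨ψ t x, hS t hx⟩)
      (fun i => (tangentSpaceOf n S (ψ t x)).mkQ (dMap n (ψ t) x (v i))) =
        s 0 * SignType.sign ((Pi.basisFun ℝ (Fin k)).det fun i => Q (v i)) := by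
    intro t
    rw [hs, hconst t 0]
    congr 3
    ext1 i
    have h1 : (D t x).symm (D t x (v i)) = v i := (D t x).symm_apply_apply _
    exact congrArg Q h1
  have hid : ∀ g : C → C, g = id → ∀ (hg : g x ∈ S),
      tupleSign (c ⟨g x, hg⟩) (fun i => (tangentSpaceOf n S (g x)).mkQ (dMap n g x (v i))) =
        tupleSign (c ⟨x, hx⟩) (fun i => (tangentSpaceOf n S x).mkQ (v i)) := by
    rintro _ rfl hg
    congr 1
    ext1 i
    have : mfderiv (𝓡 n) (𝓡 n) (id : C → C) x = ContinuousLinearMap.id ℝ _ := mfderiv_id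
    exact congrArg (fun L => (tangentSpaceOf n S x).mkQ (L (v i))) this
  have h0 : ψ 0 = id := funext hψ.zero
  rw [hval t, ← hval 0]
  exact hid _ h0 _

end Transport

section Disc

variable {n k : ℕ} {C : Type*} [TopologicalSpace C] [ChartedSpace (EuclideanSpace ℝ (Fin n)) C]
  {F G : Type*} [NormedAddCommGroup F] [NormedSpace ℝ F] [NormedAddCommGroup G] [NormedSpace ℝ G]

lemma continuousOn_slice {e : OpenPartialHomeomorph C (F × G)} {ρ : ℝ}
    (ht : ∀ a : F, ‖a‖ ≤ ρ → (a, (0 : G)) ∈ e.target) :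
    ContinuousOn (slice e) (Metric.closedBall 0 ρ) :=
  e.continuousOn_symm.comp (by fun_prop) fun a ha => ht a (mem_closedBall_zero_iff.1 ha)

/-- On a disc, an orientation of a submanifold differs by a constant sign from the orientation given by
the chart. -/
lemma IsOrientationOf.exists_sign_disc [IsManifold (𝓡 n) ∞ C] [FiniteDimensional ℝ F] {S : Set C}
    {o : (x : S) → Orientation ℝ (tangentSpaceOf n S (x : C)) (Fin k)} (ho : IsOrientationOf S o)
    {e : OpenPartialHomeomorph C (F × G)} (he : IsSmoothChart n e)
    (hS : ∀ y ∈ e.source, y ∈ S ↔ (e y).2 = 0) {ρ : ℝ} (hρ : 0 ≤ ρ)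
    (ht : ∀ a : F, ‖a‖ ≤ ρ → (a, (0 : G)) ∈ e.target) (b : Module.Basis (Fin k) ℝ F) :
    ∃ s : SignType, ∀ a : F, ‖a‖ ≤ ρ → ∀ (ha : slice e a ∈ S) (v : Fin k → F)
      (hv : ∀ i, dOf n (slice e) a (v i) ∈ tangentSpaceOf n S (slice e a)),
      tupleSign (o ⟨slice e a, ha⟩) (fun i => ⟨dOf n (slice e) a (v i), hv i⟩) =
        s * SignType.sign (b.det v) := by
  have hsrc : ∀ a : F, ‖a‖ ≤ ρ → slice e a ∈ e.source := fun a ha => e.map_target (ht a ha)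
  have hmem : ∀ a : F, ‖a‖ ≤ ρ → slice e a ∈ S := fun a ha => by
    rw [hS _ (hsrc a ha), slice, e.right_inv (ht a ha)]
  have hP : ∀ a : F, ‖a‖ ≤ ρ → Function.Bijective ((LinearMap.fst ℝ F G ∘ₗ dAt n e (slice e a)) ∘ₗ
      (tangentSpaceOf n S (slice e a)).subtype) := by
    intro a ha
    have hb := he.dAt_bijective (hsrc a ha)
    have hm := mem_tangentSpaceOf_iff he hS (hmem a ha) (hsrc a ha)
    constructor
    · refine (injective_iff_map_eq_zero _).2 fun v hv => Subtype.ext (hb.1 ?_)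
      rw [Submodule.coe_zero, map_zero]
      exact Prod.ext hv ((hm v).1 v.2)
    · intro z
      obtain ⟨v, hv⟩ := hb.2 (z, 0)
      exact ⟨⟨v, (hm v).2 (by rw [hv])⟩, congrArg Prod.fst hv⟩
  have hsig : ∀ a : F, ∃ s : SignType, ∀ ha : ‖a‖ ≤ ρ, ∀ v,
      tupleSign (o ⟨slice e a, hmem a ha⟩) v = s * SignType.sign (b.det fun i =>
        (dAt n e (slice e a) (v i : TangentSpace (𝓡 n) (slice e a))).1) := by
    intro a
    by_cases ha : ‖a‖ ≤ ρ
    · obtain ⟨s, -, hs⟩ := exists_tupleSign_eq (o ⟨slice e a, hmem a ha⟩) b (hP a ha)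
      exact ⟨s, fun _ => hs⟩
    · exact ⟨0, fun h => absurd h ha⟩
  choose s hs using hsig
  have hconst : ∀ a, ‖a‖ ≤ ρ → s a = s 0 := fun a ha => sign_eq_of_isPreconnected
    (convex_closedBall (0 : F) ρ).isPreconnected (s := s) (fun a₀ ha₀ => by
    have ha₀' := mem_closedBall_zero_iff.1 ha₀
    obtain ⟨U, hU, Fr, d, hd, hF, hFs⟩ := ho _ (hmem a₀ ha₀')
    have hsl : ContinuousWithinAt (slice e) (Metric.closedBall 0 ρ) a₀ := continuousOn_slice ht a₀ ha₀
    refine ⟨d, hd, _, continuousWithinAt_det b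
      (v := fun a i => (dAt n e (slice e a) (Fr i (slice e a))).1) fun i => ?_, ?_⟩
    · exact continuous_fst.continuousAt.comp_continuousWithinAt
        (continuousWithinAt_dAt e.open_source he.smooth (hsrc a₀ ha₀')
          (continuousAt_frame_orbit (hF i) rfl hU ha₀
            (fun a ha => hmem a (mem_closedBall_zero_iff.1 ha)) hsl))
    · filter_upwards [self_mem_nhdsWithin, hsl hU] with a ha haU
      have ha' := mem_closedBall_zero_iff.1 ha
      obtain ⟨h1, h2⟩ := hFs ⟨_, hmem a ha'⟩ haU
      rw [← h2, hs a ha']) (mem_closedBall_zero_iff.2 ha) (Metric.mem_closedBall_self hρ)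
  refine ⟨s 0, fun a ha haS v hv => ?_⟩
  rw [hs a ha, hconst a ha]
  simp only [he.dAt_dOf_slice (ht a ha)]

/-- On a disc, a coorientation of a submanifold differs by a constant sign from the one given by the
second component of the chart. -/
lemma IsCoorientationOf.exists_sign_disc [IsManifold (𝓡 n) ∞ C] [FiniteDimensional ℝ G] {S : Set C}
    {c : (x : S) → Orientation ℝ (NormalSpace n S (x : C)) (Fin k)} (hc : IsCoorientationOf S c)
    {e : OpenPartialHomeomorph C (F × G)} (he : IsSmoothChart n e)
    (hS : ∀ y ∈ e.source, y ∈ S ↔ (e y).2 = 0) {ρ : ℝ} (hρ : 0 ≤ ρ)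
    (ht : ∀ a : F, ‖a‖ ≤ ρ → (a, (0 : G)) ∈ e.target) (b : Module.Basis (Fin k) ℝ G) :
    ∃ s : SignType, s ≠ 0 ∧ ∀ a : F, ‖a‖ ≤ ρ → ∀ (ha : slice e a ∈ S)
      (v : Fin k → TangentSpace (𝓡 n) (slice e a)),
      tupleSign (c ⟨slice e a, ha⟩) (fun i => (tangentSpaceOf n S (slice e a)).mkQ (v i)) =
        s * SignType.sign (b.det fun i => (dAt n e (slice e a) (v i)).2) := by
  have hsrc : ∀ a : F, ‖a‖ ≤ ρ → slice e a ∈ e.source := fun a ha => e.map_target (ht a ha)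
  have hmem : ∀ a : F, ‖a‖ ≤ ρ → slice e a ∈ S := fun a ha => by
    rw [hS _ (hsrc a ha), slice, e.right_inv (ht a ha)]
  have hsig : ∀ a : F, ∃ s : SignType, s ≠ 0 ∧ ∀ ha : ‖a‖ ≤ ρ,
      ∀ v : Fin k → TangentSpace (𝓡 n) (slice e a),
      tupleSign (c ⟨slice e a, hmem a ha⟩)
        (fun i => (tangentSpaceOf n S (slice e a)).mkQ (v i)) =
        s * SignType.sign (b.det fun i => (dAt n e (slice e a) (v i)).2) := by
    intro a
    by_cases ha : ‖a‖ ≤ ρ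
    · have hb := he.dAt_bijective (hsrc a ha)
      have hm := mem_tangentSpaceOf_iff he hS (hmem a ha) (hsrc a ha)
      let P : NormalSpace n S (slice e a) →ₗ[ℝ] G := (tangentSpaceOf n S (slice e a)).liftQ
        (LinearMap.snd ℝ F G ∘ₗ dAt n e (slice e a)) (fun w hw => (hm w).1 hw)
      have hP : Function.Bijective P := by
        constructor
        · refine (injective_iff_map_eq_zero P).2 fun w hw => ?_
          obtain ⟨w, rfl⟩ := Submodule.mkQ_surjective _ w
          exact (Submodule.Quotient.mk_eq_zero _).2 ((hm w).2 hw)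
        · intro z
          obtain ⟨v, hv⟩ := hb.2 (0, z)
          exact ⟨(tangentSpaceOf n S (slice e a)).mkQ v, congrArg Prod.snd hv⟩
      obtain ⟨s, hs0, hs⟩ := exists_tupleSign_eq (c ⟨slice e a, hmem a ha⟩) b hP
      exact ⟨s, hs0, fun _ v => hs _⟩
    · exact ⟨1, one_ne_zero, fun h => absurd h ha⟩
  choose s hs0 hs using hsig
  have hconst : ∀ a, ‖a‖ ≤ ρ → s a = s 0 := fun a ha => sign_eq_of_isPreconnected
    (convex_closedBall (0 : F) ρ).isPreconnected (s := s) (fun a₀ ha₀ => by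
    have ha₀' := mem_closedBall_zero_iff.1 ha₀
    obtain ⟨U, hU, Fr, d, hd, hF, hFs⟩ := hc _ (hmem a₀ ha₀')
    have hsl : ContinuousWithinAt (slice e) (Metric.closedBall 0 ρ) a₀ := continuousOn_slice ht a₀ ha₀
    refine ⟨d, hd, _, continuousWithinAt_det b
      (v := fun a i => (dAt n e (slice e a) (Fr i (slice e a))).2) fun i => ?_, ?_⟩
    · exact continuous_snd.continuousAt.comp_continuousWithinAt
        (continuousWithinAt_dAt e.open_source he.smooth (hsrc a₀ ha₀')
          (continuousAt_frame_orbit (hF i) rfl hU ha₀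
            (fun a ha => hmem a (mem_closedBall_zero_iff.1 ha)) hsl))
    · filter_upwards [self_mem_nhdsWithin, hsl hU] with a ha haU
      have ha' := mem_closedBall_zero_iff.1 ha
      rw [← hFs ⟨_, hmem a ha'⟩ haU, hs a ha']) (mem_closedBall_zero_iff.2 ha)
    (Metric.mem_closedBall_self hρ)
  refine ⟨s 0, hs0 0, fun a ha haS v => ?_⟩
  rw [hs a ha, hconst a ha]

end Disc

/-! ### Orientations near the fixed point -/

section NearFixedPoint

universe u

variable {n k : ℕ} {C : Type*} [TopologicalSpace C] [ChartedSpace (EuclideanSpace ℝ (Fin n)) C]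
  {Es Eu : Type u} [NormedAddCommGroup Es] [NormedSpace ℝ Es]
  [NormedAddCommGroup Eu] [NormedSpace ℝ Eu] [FiniteDimensional ℝ Es] [FiniteDimensional ℝ Eu]
  {ψ : ℝ → C → C} {p : C} {κ : OpenPartialHomeomorph C (Es × Eu)}
  {Ls : ℝ → Es →L[ℝ] Es} {Lu : ℝ → Eu →L[ℝ] Eu} {τ : ℝ}

lemma HypFlow.mem_stableManifold_fixed (h : HypFlow n ψ p κ Ls Lu τ) : p ∈ stableManifold ψ p := by
  have : (fun t => ψ t p) = fun _ => p := funext h.fixed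
  rw [stableManifold, mem_ofPred_eq, this]
  exact tendsto_const_nhds

lemma HypFlow.mem_unstableManifold_fixed (h : HypFlow n ψ p κ Ls Lu τ) :
    p ∈ unstableManifold ψ p := by
  have : (fun t => ψ t p) = fun _ => p := funext h.fixed
  rw [unstableManifold, mem_ofPred_eq, this]
  exact tendsto_const_nhds

lemma HypFlow.finrank_normalSpace (h : HypFlow n ψ p κ Ls Lu τ) {x : C}
    (hx : Module.finrank ℝ (tangentSpaceOf n (stableManifold ψ p) x) = Module.finrank ℝ Es) :
    Module.finrank ℝ (NormalSpace n (stableManifold ψ p) x) = Module.finrank ℝ Eu := by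
  have h1 := Submodule.finrank_quotient_add_finrank (tangentSpaceOf n (stableManifold ψ p) x)
  have h2 := h.finrank_add
  rw [finrank_tangentSpace, hx] at h1
  exact Nat.add_right_cancel (h1.trans ((add_comm _ _).trans h2).symm)

lemma HypFlow.dAt_swapChart (h : HypFlow n ψ p κ Ls Lu τ) {x : C} (hx : x ∈ κ.source)
    (v : TangentSpace (𝓡 n) x) : dAt n (swapChart κ) x v = (dAt n κ x v).swap := by
  have h1 := dAt_vector_comp (g := (Prod.swap : Es × Eu → Eu × Es))
    (h.chart.mdifferentiableAt hx) ((ContinuousLinearEquiv.prodComm ℝ Es Eu).differentiable _) v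
  refine h1.trans ?_
  exact congrArg (fun L => L (dAt n κ x v)) (ContinuousLinearEquiv.prodComm ℝ Es Eu).fderiv

lemma HypFlow.mem_tangentSpaceOf_unstable_fixed (h : HypFlow n ψ p κ Ls Lu τ)
    (v : TangentSpace (𝓡 n) p) :
    v ∈ tangentSpaceOf n (unstableManifold ψ p) p ↔ (dAt n κ p v).1 = 0 := by
  have := h.reverse.mem_tangentSpaceOf_fixed v
  rwa [stableManifold_reverse, h.dAt_swapChart h.mem_source] at this

lemma HypFlow.finrank_stable_fixed (h : HypFlow n ψ p κ Ls Lu τ) :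
    Module.finrank ℝ (tangentSpaceOf n (stableManifold ψ p) p) = Module.finrank ℝ Es := by
  let R : tangentSpaceOf n (stableManifold ψ p) p →ₗ[ℝ] Es :=
    (LinearMap.fst ℝ Es Eu ∘ₗ dAt n κ p) ∘ₗ (tangentSpaceOf n (stableManifold ψ p) p).subtype
  have hb := h.chart.dAt_bijective h.mem_source
  have hR : Function.Bijective R := by
    constructor
    · refine (injective_iff_map_eq_zero _).2 fun v hv => Subtype.ext (hb.1 ?_)
      rw [Submodule.coe_zero, map_zero]
      exact Prod.ext hv ((h.mem_tangentSpaceOf_fixed v).1 v.2)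
    · intro z
      obtain ⟨v, hv⟩ := hb.2 (z, 0)
      exact ⟨⟨v, (h.mem_tangentSpaceOf_fixed v).2 (by rw [hv])⟩, congrArg Prod.fst hv⟩
  exact (LinearEquiv.ofBijective R hR).finrank_eq

lemma injective_of_det_ne_zero {F : Type*} [NormedAddCommGroup F] [NormedSpace ℝ F]
    [FiniteDimensional ℝ F] (b : Module.Basis (Fin k) ℝ F) {A : F →ₗ[ℝ] F}
    (hA : b.det (fun i => A (b i)) ≠ 0) : Function.Injective A := by
  have h1 : LinearMap.det A ≠ 0 := by
    have := b.det_comp A b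
    rw [Module.Basis.det_self, mul_one] at this
    rw [← this]
    exact hA
  exact LinearMap.ker_eq_bot.1 (LinearMap.isUnit_iff_ker_eq_bot A |>.1
    ((LinearMap.isUnit_iff_isUnit_det A).2 h1.isUnit))

/-- Linear maps to `Es × Eu` which are close to a map with injective `Eu`-component take values in
a cone around `Eu`. -/
lemma exists_cone_of_injective (B : Eu →L[ℝ] Es × Eu) (hB : ∀ a, (B a).2 = 0 → a = 0) :
    ∃ K ≥ 1, ∃ ε > 0, ∀ B' : Eu →L[ℝ] Es × Eu, ‖B' - B‖ ≤ ε →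
      ∀ a, ‖(B' a).1‖ ≤ K * ‖(B' a).2‖ ∧ ((B' a).2 = 0 → a = 0) := by
  obtain ⟨m, hm, hBm⟩ := LinearMap.exists_antilipschitzWith
    (LinearMap.snd ℝ Es Eu ∘ₗ B.toLinearMap) (LinearMap.ker_eq_bot'.2 hB)
  have hm' : (0 : ℝ) < m := hm
  have h1 : ∀ a, ‖a‖ ≤ m * ‖(B a).2‖ := fun a => by
    have := hBm.le_mul_dist a 0
    simpa using this
  refine ⟨2 * m * ‖B‖ + 1, by nlinarith [norm_nonneg B], 1 / (2 * m), by positivity,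
    fun B' hB' a => ?_⟩
  have h2 : ‖B' a - B a‖ ≤ 1 / (2 * m) * ‖a‖ := (B' - B).le_of_opNorm_le hB' a
  have h3 : ‖(B' a).2 - (B a).2‖ ≤ 1 / (2 * m) * ‖a‖ := (norm_snd_le (B' a - B a)).trans h2
  have h4 : ‖(B' a).1 - (B a).1‖ ≤ 1 / (2 * m) * ‖a‖ := (norm_fst_le (B' a - B a)).trans h2
  have h5 : ‖(B a).2‖ ≤ ‖(B' a).2‖ + 1 / (2 * m) * ‖a‖ := by
    have := norm_le_insert (B' a).2 (B a).2
    linarith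
  have h6 : ‖a‖ ≤ 2 * m * ‖(B' a).2‖ := by
    have h7 := (h1 a).trans (mul_le_mul_of_nonneg_left h5 hm'.le)
    have h8 : (m : ℝ) * (‖(B' a).2‖ + 1 / (2 * m) * ‖a‖) = m * ‖(B' a).2‖ + ‖a‖ / 2 := by
      field_simp
    linarith
  constructor
  · have h7 : ‖(B' a).1‖ ≤ ‖B‖ * ‖a‖ + 1 / (2 * m) * ‖a‖ := by
      have h8 := norm_le_insert' (B' a).1 (B a).1
      have h9 := (norm_fst_le (B a)).trans (B.le_opNorm a)
      linarith
    have h8 : (‖B‖ + 1 / (2 * m)) * ‖a‖ ≤ (‖B‖ + 1 / (2 * m)) * (2 * m * ‖(B' a).2‖) :=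
      mul_le_mul_of_nonneg_left h6 (by positivity)
    have h9 : (‖B‖ + 1 / (2 * m)) * (2 * m * ‖(B' a).2‖) = (2 * m * ‖B‖ + 1) * ‖(B' a).2‖ := by
      field_simp
    linarith
  · intro h0
    rw [h0, norm_zero, mul_zero] at h6
    exact norm_le_zero_iff.1 h6

/-- Near the fixed point, a coorientation of the stable manifold is the sign of the determinant of
the unstable components, for frames in the unstable cone. -/
lemma HypFlow.exists_coorientation_sign [IsManifold (𝓡 n) ∞ C] (h : HypFlow n ψ p κ Ls Lu τ)
    {cs : (x : stableManifold ψ p) →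
      Orientation ℝ (NormalSpace n (stableManifold ψ p) (x : C)) (Fin k)}
    (hcs : IsCoorientationOf (stableManifold ψ p) cs) (b : Module.Basis (Fin k) ℝ Eu) :
    ∃ c : SignType, c ≠ 0 ∧ ∀ᶠ x in 𝓝 p, ∀ hx : x ∈ stableManifold ψ p,
      Module.finrank ℝ (tangentSpaceOf n (stableManifold ψ p) x) = Module.finrank ℝ Es →
      ∀ M : Eu →ₗ[ℝ] TangentSpace (𝓡 n) x,
        (∀ a, ‖(dAt n κ x (M a)).1‖ ≤ ‖(dAt n κ x (M a)).2‖) →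
        (∀ a, (dAt n κ x (M a)).2 = 0 → a = 0) →
        tupleSign (cs ⟨x, hx⟩) (fun i => (tangentSpaceOf n (stableManifold ψ p) x).mkQ (M (b i))) =
          c * SignType.sign (b.det fun i => (dAt n κ x (M (b i))).2) := by
  have hp := h.mem_stableManifold_fixed
  obtain ⟨U, hU, F, s, hs, hF, hFs⟩ := hcs p hp
  have hpU := mem_of_mem_nhds hU
  have hFc : ∀ i, ContinuousWithinAt (fun x => dAt n κ x (F i x)) (stableManifold ψ p ∩ U) p :=
    fun i => continuousWithinAt_dAt κ.open_source h.chart.smooth h.mem_source (hF i p ⟨hp, hpU⟩)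
  -- the frame at the fixed point has linearly independent unstable components
  have hdet : b.det (fun i => (dAt n κ p (F i p)).2) ≠ 0 := by
    let P : NormalSpace n (stableManifold ψ p) p →ₗ[ℝ] Eu :=
      (tangentSpaceOf n (stableManifold ψ p) p).liftQ (LinearMap.snd ℝ Es Eu ∘ₗ dAt n κ p)
        (fun w hw => (h.mem_tangentSpaceOf_fixed w).1 hw)
    have hP : Function.Bijective P := by
      constructor
      · refine (injective_iff_map_eq_zero P).2 fun w hw => ?_
        obtain ⟨w, rfl⟩ := Submodule.mkQ_surjective _ w
        exact (Submodule.Quotient.mk_eq_zero _).2 ((h.mem_tangentSpaceOf_fixed w).2 hw)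
      · intro z
        obtain ⟨v, hv⟩ := (h.chart.dAt_bijective h.mem_source).2 (0, z)
        exact ⟨(tangentSpaceOf n (stableManifold ψ p) p).mkQ v, congrArg Prod.snd hv⟩
    obtain ⟨s', -, hs'⟩ := exists_tupleSign_eq (cs ⟨p, hp⟩) b hP
    intro h0
    have h1 := hFs ⟨p, hp⟩ hpU
    rw [hs'] at h1
    have h2 : b.det (fun i => P ((tangentSpaceOf n (stableManifold ψ p) p).mkQ (F i p))) = 0 := h0
    rw [h2, sign_zero, mul_zero] at h1
    exact hs h1.symm
  -- near `p`, the span of the frame `F` stays in a cone of aperture `K` around `Eu`, and the tangent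
  -- spaces of the stable manifold are in the cone of aperture `1 / (2 K)` around `Es`; so
  -- `exists_sign_of_cone` applies to both `F` and `M`, and they can be compared
  let B : C → Eu →L[ℝ] Es × Eu := fun x =>
    ∑ i, (LinearMap.toContinuousLinearMap (b.coord i)).smulRight (dAt n κ x (F i x))
  have hBc : ContinuousWithinAt B (stableManifold ψ p ∩ U) p :=
    tendsto_finsetSum _ fun i _ => ((ContinuousLinearMap.smulRightL ℝ Eu (Es × Eu)
      (LinearMap.toContinuousLinearMap (b.coord i))).continuous.continuousAt.comp_continuousWithinAt
        (hFc i))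
  have hBa : ∀ x a, B x a = dAt n κ x (b.constr ℝ (fun i => F i x) a) := fun x a => by
    simp [B, Module.Basis.constr_apply_fintype, _root_.sum_apply]
  have hBi : ∀ x i, B x (b i) = dAt n κ x (F i x) := fun x i => by
    rw [hBa, Module.Basis.constr_basis]
  obtain ⟨K, hK, ε, hε, hcone⟩ := exists_cone_of_injective (B p) (fun a ha => by
    have h1 := injective_of_det_ne_zero b (A := LinearMap.snd ℝ Es Eu ∘ₗ (B p).toLinearMap)
      (by simpa [hBi] using hdet)
    exact (injective_iff_map_eq_zero _).1 h1 a ha)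
  have hK0 : 0 < K := by linarith
  have hη : 0 < 1 / (2 * K) := by positivity
  have hη1 : 1 / (2 * K) ≤ 1 := by
    rw [div_le_one (by positivity)]
    linarith
  have hnear : ∀ᶠ x in 𝓝[stableManifold ψ p ∩ U] p, ‖B x - B p‖ ≤ ε := by
    have h1 := (hBc.sub (continuousWithinAt_const (b := B p))).norm
    have h2 : ‖B p - B p‖ < ε := by rwa [sub_self, norm_zero]
    filter_upwards [h1.eventually_lt continuousWithinAt_const h2] with x hx using hx.le
  have hsign : ∀ᶠ x in 𝓝[stableManifold ψ p ∩ U] p,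
      SignType.sign (b.det fun i => (dAt n κ x (F i x)).2) =
        SignType.sign (b.det fun i => (dAt n κ p (F i p)).2) := by
    have h1 := continuousWithinAt_det b (v := fun x i => (dAt n κ x (F i x)).2)
      (fun i => continuous_snd.continuousAt.comp_continuousWithinAt (hFc i))
    exact (ContinuousAt.comp_continuousWithinAt (f := fun x => b.det fun i => (dAt n κ x (F i x)).2)
      (continuousAt_sign_of_ne_zero hdet) h1).eventually
      (discreteTopology_iff_singleton_mem_nhds.1 inferInstance _)
  refine ⟨s * SignType.sign (b.det fun i => (dAt n κ p (F i p)).2),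
    mul_ne_zero hs (sign_ne_zero.2 hdet), ?_⟩
  filter_upwards [eventually_nhdsWithin_iff.1 hnear, eventually_nhdsWithin_iff.1 hsign, hU,
    h.eventually_stable_cone hη hη1, κ.open_source.mem_nhds h.mem_source]
    with x h1 h2 h3 h4 h5 hx hdim M hM hinj
  obtain ⟨s', -, hs'⟩ := exists_sign_of_cone (cs ⟨x, hx⟩) b (h.chart.dAt_bijective h5)
    (h.finrank_normalSpace hdim) hη.le (K := K) (by field_simp; norm_num) (h4 hx)
  have h6 := hs' (b.constr ℝ fun i => F i x) (fun a => by
    rw [← hBa]; exact (hcone _ (h1 ⟨hx, h3⟩) a).1) (fun a ha => by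
    rw [← hBa] at ha; exact (hcone _ (h1 ⟨hx, h3⟩) a).2 ha)
  simp only [Module.Basis.constr_basis] at h6
  rw [h2 ⟨hx, h3⟩] at h6
  have h7 := hFs ⟨x, hx⟩ h3
  rw [hs' M (fun a => (hM a).trans (le_mul_of_one_le_left (norm_nonneg _) hK)) hinj]
  congr 1
  have h8 := SignType.mul_self_eq_one (sign_ne_zero.2 hdet)
  rw [← h7, h6, mul_assoc, h8, mul_one]

/-- Near the fixed point, an orientation of the unstable manifold is the sign of the determinant of
the unstable components. -/
lemma HypFlow.exists_orientation_sign [IsManifold (𝓡 n) ∞ C] (h : HypFlow n ψ p κ Ls Lu τ)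
    {ou : (x : unstableManifold ψ p) →
      Orientation ℝ (tangentSpaceOf n (unstableManifold ψ p) (x : C)) (Fin k)}
    (hou : IsOrientationOf (unstableManifold ψ p) ou) (b : Module.Basis (Fin k) ℝ Eu) :
    ∃ c : SignType, c ≠ 0 ∧ ∀ᶠ x in 𝓝 p, ∀ hx : x ∈ unstableManifold ψ p,
      Module.finrank ℝ (tangentSpaceOf n (unstableManifold ψ p) x) = Module.finrank ℝ Eu →
      ∀ v, tupleSign (ou ⟨x, hx⟩) v = c * SignType.sign
        (b.det fun i => (dAt n κ x (v i : TangentSpace (𝓡 n) x)).2) := by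
  have hp := h.mem_unstableManifold_fixed
  have hrev := h.reverse
  have hcone : ∀ᶠ x in 𝓝 p, x ∈ κ.source ∧ (x ∈ unstableManifold ψ p →
      ∀ v ∈ tangentSpaceOf n (unstableManifold ψ p) x,
        ‖(dAt n κ x v).1‖ ≤ 1 * ‖(dAt n κ x v).2‖) := by
    filter_upwards [hrev.eventually_stable_cone one_pos le_rfl,
      κ.open_source.mem_nhds h.mem_source] with x h1 h2
    refine ⟨h2, fun hx v hv => ?_⟩
    rw [stableManifold_reverse] at h1
    have := h1 hx v hv
    rwa [h.dAt_swapChart h2] at this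
  -- the unstable component is an isomorphism on the tangent spaces, which are in the unstable cone
  have hP : ∀ᶠ x in 𝓝 p, x ∈ unstableManifold ψ p →
      Module.finrank ℝ (tangentSpaceOf n (unstableManifold ψ p) x) = Module.finrank ℝ Eu →
      Function.Bijective ((LinearMap.snd ℝ Es Eu ∘ₗ dAt n κ x) ∘ₗ
        (tangentSpaceOf n (unstableManifold ψ p) x).subtype) := by
    filter_upwards [hcone] with x h1 hx hdim
    have hi : Function.Injective ((LinearMap.snd ℝ Es Eu ∘ₗ dAt n κ x) ∘ₗ
        (tangentSpaceOf n (unstableManifold ψ p) x).subtype) := by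
      refine (injective_iff_map_eq_zero _).2 fun v hv => Subtype.ext
        ((h.chart.dAt_bijective h1.1).1 ?_)
      have hv' : (dAt n κ x (v : TangentSpace (𝓡 n) x)).2 = 0 := hv
      have h2 := h1.2 hx v v.2
      rw [hv', norm_zero, mul_zero] at h2
      rw [Submodule.coe_zero, map_zero]
      exact Prod.ext (norm_le_zero_iff.1 h2) hv'
    exact ⟨hi, (LinearMap.injective_iff_surjective_of_finrank_eq_finrank hdim).1 hi⟩
  obtain ⟨U, hU, F, s, hs, hF, hFs⟩ := hou p hp
  have hpU := mem_of_mem_nhds hU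
  have hFc : ∀ i, ContinuousWithinAt (fun x => dAt n κ x (F i x)) (unstableManifold ψ p ∩ U) p :=
    fun i => continuousWithinAt_dAt κ.open_source h.chart.smooth h.mem_source (hF i p ⟨hp, hpU⟩)
  have hrank : Module.finrank ℝ (tangentSpaceOf n (unstableManifold ψ p) p) =
      Module.finrank ℝ Eu := by
    have := hrev.finrank_stable_fixed
    rwa [stableManifold_reverse] at this
  have hdet : b.det (fun i => (dAt n κ p (F i p)).2) ≠ 0 := by
    obtain ⟨s', -, hs'⟩ := exists_tupleSign_eq (ou ⟨p, hp⟩) b (hP.self_of_nhds hp hrank)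
    intro h0
    obtain ⟨h1, h2⟩ := hFs ⟨p, hp⟩ hpU
    rw [hs'] at h2
    have h3 : b.det (fun i => ((LinearMap.snd ℝ Es Eu ∘ₗ dAt n κ p) ∘ₗ
        (tangentSpaceOf n (unstableManifold ψ p) p).subtype) ⟨F i p, h1 i⟩) = 0 := h0
    rw [h3, sign_zero, mul_zero] at h2
    exact hs h2.symm
  have hsign : ∀ᶠ x in 𝓝[unstableManifold ψ p ∩ U] p,
      SignType.sign (b.det fun i => (dAt n κ x (F i x)).2) =
        SignType.sign (b.det fun i => (dAt n κ p (F i p)).2) := by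
    have h1 := continuousWithinAt_det b (v := fun x i => (dAt n κ x (F i x)).2)
      (fun i => continuous_snd.continuousAt.comp_continuousWithinAt (hFc i))
    exact (ContinuousAt.comp_continuousWithinAt (f := fun x => b.det fun i => (dAt n κ x (F i x)).2)
      (continuousAt_sign_of_ne_zero hdet) h1).eventually
      (discreteTopology_iff_singleton_mem_nhds.1 inferInstance _)
  refine ⟨s * SignType.sign (b.det fun i => (dAt n κ p (F i p)).2),
    mul_ne_zero hs (sign_ne_zero.2 hdet), ?_⟩
  filter_upwards [eventually_nhdsWithin_iff.1 hsign, hU, hP] with x h1 h2 h3 hx hdim v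
  obtain ⟨s', -, hs'⟩ := exists_tupleSign_eq (ou ⟨x, hx⟩) b (h3 hx hdim)
  obtain ⟨h4, h5⟩ := hFs ⟨x, hx⟩ h2
  rw [hs'] at h5
  have h6 : s' * SignType.sign (b.det fun i => (dAt n κ x (F i x)).2) = s := h5
  rw [h1 ⟨hx, h2⟩] at h6
  rw [hs' v, ← h6, mul_assoc s', SignType.mul_self_eq_one (sign_ne_zero.2 hdet), mul_one]
  rfl

/-- The coorientation of the stable manifold which is induced by an orientation of the unstable
manifold has the same sign in the chart. -/
lemma HypFlow.exists_sign [IsManifold (𝓡 n) ∞ C] (h : HypFlow n ψ p κ Ls Lu τ)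
    {ou : (x : unstableManifold ψ p) →
      Orientation ℝ (tangentSpaceOf n (unstableManifold ψ p) (x : C)) (Fin k)}
    {cs : (x : stableManifold ψ p) →
      Orientation ℝ (NormalSpace n (stableManifold ψ p) (x : C)) (Fin k)}
    (hou : IsOrientationOf (unstableManifold ψ p) ou)
    (hcs : IsCoorientationOf (stableManifold ψ p) cs) (hind : InducesCoorientation ψ p ou cs)
    (b : Module.Basis (Fin k) ℝ Eu) :
    ∃ c : SignType, c ≠ 0 ∧ (∀ᶠ x in 𝓝 p, ∀ hx : x ∈ stableManifold ψ p,
      Module.finrank ℝ (tangentSpaceOf n (stableManifold ψ p) x) = Module.finrank ℝ Es →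
      ∀ M : Eu →ₗ[ℝ] TangentSpace (𝓡 n) x,
        (∀ a, ‖(dAt n κ x (M a)).1‖ ≤ ‖(dAt n κ x (M a)).2‖) →
        (∀ a, (dAt n κ x (M a)).2 = 0 → a = 0) →
        tupleSign (cs ⟨x, hx⟩) (fun i => (tangentSpaceOf n (stableManifold ψ p) x).mkQ (M (b i))) =
          c * SignType.sign (b.det fun i => (dAt n κ x (M (b i))).2)) ∧
    ∀ᶠ x in 𝓝 p, ∀ hx : x ∈ unstableManifold ψ p,
      Module.finrank ℝ (tangentSpaceOf n (unstableManifold ψ p) x) = Module.finrank ℝ Eu →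
      ∀ v, tupleSign (ou ⟨x, hx⟩) v = c * SignType.sign
        (b.det fun i => (dAt n κ x (v i : TangentSpace (𝓡 n) x)).2) := by
  obtain ⟨c, hc, h1⟩ := h.exists_coorientation_sign hcs b
  obtain ⟨c', hc', h2⟩ := h.exists_orientation_sign hou b
  refine ⟨c, hc, h1, ?_⟩
  suffices hcc : c = c' by rwa [hcc]
  have hs := h.mem_stableManifold_fixed
  have hu := h.mem_unstableManifold_fixed
  -- both signs are computed at `p`, on the frame of the unstable subspace in the chart
  let J := LinearEquiv.ofBijective (dAt n κ p) (h.chart.dAt_bijective h.mem_source)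
  let M : Eu →ₗ[ℝ] TangentSpace (𝓡 n) p := J.symm.toLinearMap ∘ₗ LinearMap.inr ℝ Es Eu
  have hM : ∀ a, dAt n κ p (M a) = (0, a) := fun a => J.apply_symm_apply _
  have h3 := h1.self_of_nhds hs h.finrank_stable_fixed M
    (fun a => by simp [hM]) (fun a ha => by simpa [hM] using ha)
  have hrank : Module.finrank ℝ (tangentSpaceOf n (unstableManifold ψ p) p) =
      Module.finrank ℝ Eu := by
    have := h.reverse.finrank_stable_fixed
    rwa [stableManifold_reverse] at this
  have h4 := h2.self_of_nhds hu hrank fun i =>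
    ⟨M (b i), (h.mem_tangentSpaceOf_unstable_fixed _).2 (by rw [hM])⟩
  have h5 := hind hu hs fun i =>
    ⟨M (b i), (h.mem_tangentSpaceOf_unstable_fixed _).2 (by rw [hM])⟩
  rw [h4] at h5
  have h6 := h3.symm.trans h5
  simpa only [hM, Module.Basis.det_self, sign_one, mul_one] using h6

end NearFixedPoint

/-! ### The orientation of the glued flow lines -/

section GluedOrientation

universe u

variable {n k : ℕ} {C : Type*} [TopologicalSpace C] [ChartedSpace (EuclideanSpace ℝ (Fin n)) C]
  [IsManifold (𝓡 n) ∞ C]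
  {Es Eu : Type u} [NormedAddCommGroup Es] [NormedSpace ℝ Es]
  [NormedAddCommGroup Eu] [NormedSpace ℝ Eu] [FiniteDimensional ℝ Es] [FiniteDimensional ℝ Eu]
  {ψ : ℝ → C → C} {p : C} {κ : OpenPartialHomeomorph C (Es × Eu)}
  {Ls : ℝ → Es →L[ℝ] Es} {Lu : ℝ → Eu →L[ℝ] Eu} {τ : ℝ}
  {Wm Wp : Set C} {em : OpenPartialHomeomorph C (Eu × Es)} {ep : OpenPartialHomeomorph C (Es × Eu)}
  {Tm Tp : ℝ} {m' : Eu →L[ℝ] Es} {q' : Es →L[ℝ] Eu} {V : Set C} {r ρ c : ℝ}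

lemma IsSmoothFlow.dAt_chart_bijective (hψ : IsSmoothFlow n ψ) {E : Type*} [NormedAddCommGroup E]
    [NormedSpace ℝ E] {e : OpenPartialHomeomorph C E} (he : IsSmoothChart n e) {t : ℝ} {x : C}
    (hx : ψ t x ∈ e.source) : Function.Bijective (dAt n (fun y => e (ψ t y)) x) := by
  have h1 : (dAt n (fun y => e (ψ t y)) x : TangentSpace (𝓡 n) x → E) =
      dAt n e (ψ t x) ∘ dMap n (ψ t) x :=
    funext fun v => dAt_comp_dMap (he.mdifferentiableAt hx) (hψ.mdifferentiable t x) v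
  rw [h1]
  exact (he.dAt_bijective hx).comp (hψ.dMap_bijective t x)

lemma toNormal_bijective {A B : Set C} {x : C}
    (htr : tangentSpaceOf n A x ⊔ tangentSpaceOf n B x = ⊤)
    (hrank : Module.finrank ℝ (tangentSpaceOf n A x) = Module.finrank ℝ (NormalSpace n B x)) :
    Function.Bijective (toNormal n A B x) := by
  have hs : Function.Surjective (toNormal n A B x) := by
    intro z
    obtain ⟨v, rfl⟩ := Submodule.mkQ_surjective _ z
    obtain ⟨v₁, hv₁, v₂, hv₂, hv₁₂⟩ := Submodule.mem_sup.1
      (htr ▸ Submodule.mem_top : v ∈ tangentSpaceOf n A x ⊔ tangentSpaceOf n B x)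
    refine ⟨⟨v₁, hv₁⟩, (Submodule.Quotient.eq _).2 ?_⟩
    rw [← hv₁₂]
    simpa using hv₂
  exact ⟨(LinearMap.injective_iff_surjective_of_finrank_eq_finrank hrank).2 hs, hs⟩

/-- When the disc of `Wm` enters the box, its tangent frames lie in the unstable cone, and their
unstable components are positively oriented. -/
lemma GluingData.entry_sign (h : GluingData n ψ p κ Ls Lu τ Wm Wp em ep Tm Tp m' q' V r ρ c)
    (b : Module.Basis (Fin k) ℝ Eu) {a : Eu} (ha : ‖a‖ ≤ ρ) :
    SignType.sign (b.det fun i => (fderiv ℝ (fun a => κ (ψ Tm (slice em a))) a (b i)).2) = 1 ∧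
      (∀ α, ‖(fderiv ℝ (fun a => κ (ψ Tm (slice em a))) a α).1‖ ≤
        ‖(fderiv ℝ (fun a => κ (ψ Tm (slice em a))) a α).2‖) ∧
      ∀ α, (fderiv ℝ (fun a => κ (ψ Tm (slice em a))) a α).2 = 0 → α = 0 := by
  set M := fderiv ℝ (fun a => κ (ψ Tm (slice em a))) a
  have hM := h.minus.fderiv_sub_le ha
  have hcone := fun α => h.minus.cone h.c_le' (hM α)
  refine ⟨?_, fun α => (hcone α).1.trans (by linarith [norm_nonneg (M α).2]), fun α => (hcone α).2⟩
  -- `M` is close to `α ↦ (m' α, α)`, so its unstable component is close to the identity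
  have h1 := sign_det_eq_of_segment b (A := LinearMap.id)
    (B := LinearMap.snd ℝ Es Eu ∘ₗ M.toLinearMap) fun θ hθ α hα => by
      have h2 : ‖(M α).2 - α‖ ≤ 1 / 16 * ‖α‖ :=
        (norm_snd_le (M α - (m' α, α))).trans ((hM α).trans
          (mul_le_mul_of_nonneg_right h.c_le' (norm_nonneg α)))
      have h3 : α = -(θ • ((M α).2 - α)) := by
        have h4 : (1 - θ) • α + θ • (M α).2 = 0 := hα
        rw [smul_sub, neg_sub, ← sub_eq_zero, ← h4, sub_smul, one_smul]
        abel
      have h5 : ‖α‖ ≤ ‖(M α).2 - α‖ := by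
        conv_lhs => rw [h3]
        rw [norm_neg, norm_smul, Real.norm_eq_abs, abs_of_nonneg hθ.1]
        exact mul_le_of_le_one_left (norm_nonneg _) hθ.2
      exact norm_le_zero_iff.1 (by linarith [norm_nonneg α])
  have h2 : b.det (fun i => (LinearMap.id : Eu →ₗ[ℝ] Eu) (b i)) = 1 := b.det_self
  rw [h2, sign_one] at h1
  exact h1.symm

lemma GluingData.norm_zero_le (h : GluingData n ψ p κ Ls Lu τ Wm Wp em ep Tm Tp m' q' V r ρ c)
    {E : Type*} [NormedAddCommGroup E] : ‖(0 : E)‖ ≤ ρ := by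
  rw [norm_zero]
  exact h.rho_pos.le

lemma GluingData.finrank_minus (h : GluingData n ψ p κ Ls Lu τ Wm Wp em ep Tm Tp m' q' V r ρ c)
    {a : Eu} (ha : ‖a‖ ≤ ρ) :
    Module.finrank ℝ (tangentSpaceOf n Wm (slice em a)) = Module.finrank ℝ Eu :=
  finrank_tangentSpaceOf_of_chart h.minus.chart h.minus.mem_iff (h.minus.slice_mem ha)
    (em.map_target (h.minus.mem_target a ha))

lemma GluingData.finrank_plus (h : GluingData n ψ p κ Ls Lu τ Wm Wp em ep Tm Tp m' q' V r ρ c)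
    {b : Es} (hb : ‖b‖ ≤ ρ) :
    Module.finrank ℝ (NormalSpace n Wp (slice ep b)) = Module.finrank ℝ Eu := by
  have h1 := Submodule.finrank_quotient_add_finrank (tangentSpaceOf n Wp (slice ep b))
  have h2 := h.hyp.finrank_add
  rw [finrank_tangentSpace, finrank_tangentSpaceOf_of_chart h.plus.chart h.plus.mem_iff
    (h.plus.slice_mem hb) (ep.map_target (h.plus.mem_target b hb))] at h1
  exact Nat.add_right_cancel (h1.trans ((add_comm _ _).trans h2).symm)

/-- The tangent frames of the disc of `Wm` along the stable orbit. -/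
lemma GluingData.stable_sign (h : GluingData n ψ p κ Ls Lu τ Wm Wp em ep Tm Tp m' q' V r ρ c)
    (b : Module.Basis (Fin k) ℝ Eu) (hs : slice em 0 ∈ stableManifold ψ p) (j : ℕ) :
    SignType.sign (b.det fun i =>
      (fderiv ℝ (fun a => κ (ψ (Tm + j * τ) (slice em a))) 0 (b i)).2) = 1 ∧
      (∀ α, ‖(fderiv ℝ (fun a => κ (ψ (Tm + j * τ) (slice em a))) 0 α).1‖ ≤
        ‖(fderiv ℝ (fun a => κ (ψ (Tm + j * τ) (slice em a))) 0 α).2‖) ∧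
      ∀ α, (fderiv ℝ (fun a => κ (ψ (Tm + j * τ) (slice em a))) 0 α).2 = 0 → α = 0 := by
  have hτ := h.hyp.tau_pos
  have hbox : ∀ j : ℕ, ψ (Tm + j * τ) (slice em 0) ∈ MorseGluing.box κ r := fun j =>
    box_half_subset h.box.pos (h.stable_orbit_mem_box hs (by positivity))
  have h0 := h.entry_sign b (a := 0) h.norm_zero_le
  have h1 := (h.hyp.hyp τ le_rfl).sign_det_iterate b (h.hyp.segment τ le_rfl) (N := j)
    (M := fun j => (fderiv ℝ (fun a => κ (ψ (Tm + j * τ) (slice em a))) 0).toLinearMap)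
    (fun i _ α => by
      have h2 := h.hyp.step_tangent_nat h.box (hbox i) (dOf n (slice em) 0 α)
      rwa [← h.fderiv_slice h.norm_zero_le (hbox i).1,
        ← h.fderiv_slice h.norm_zero_le (hbox (i + 1)).1] at h2)
    (by simpa using h0.2.1) (by simpa using h0.2.2)
  simp only [ContinuousLinearMap.coe_coe, Nat.cast_zero, zero_mul, add_zero] at h1
  exact ⟨h1.1.symm.trans h0.1, h1.2⟩

/-- The frame of the disc of `Wm` which is given by the chart has the orientation `ε₋ s`, where `s` is
the sign of the coorientation of the stable manifold near `p`: moved by the flow along the stable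
orbit, the frame arrives near `p` in the unstable cone with positively oriented unstable
components. -/
lemma GluingData.sign_minus (h : GluingData n ψ p κ Ls Lu τ Wm Wp em ep Tm Tp m' q' V r ρ c)
    (b : Module.Basis (Fin k) ℝ Eu)
    {om : (x : Wm) → Orientation ℝ (tangentSpaceOf n Wm (x : C)) (Fin k)}
    (hom : IsOrientationOf Wm om)
    {cs : (x : stableManifold ψ p) →
      Orientation ℝ (NormalSpace n (stableManifold ψ p) (x : C)) (Fin k)}
    (hcs : IsCoorientationOf (stableManifold ψ p) cs) {s : SignType} (hs0 : s ≠ 0)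
    (hs : ∀ᶠ x in 𝓝 p, ∀ hx : x ∈ stableManifold ψ p,
      Module.finrank ℝ (tangentSpaceOf n (stableManifold ψ p) x) = Module.finrank ℝ Es →
      ∀ M : Eu →ₗ[ℝ] TangentSpace (𝓡 n) x,
        (∀ a, ‖(dAt n κ x (M a)).1‖ ≤ ‖(dAt n κ x (M a)).2‖) →
        (∀ a, (dAt n κ x (M a)).2 = 0 → a = 0) →
        tupleSign (cs ⟨x, hx⟩) (fun i => (tangentSpaceOf n (stableManifold ψ p) x).mkQ (M (b i))) =
          s * SignType.sign (b.det fun i => (dAt n κ x (M (b i))).2))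
    (hm : slice em 0 ∈ Wm) (hms : slice em 0 ∈ stableManifold ψ p)
    (htr : tangentSpaceOf n Wm (slice em 0) ⊔ tangentSpaceOf n (stableManifold ψ p) (slice em 0) = ⊤)
    (hdim : Module.finrank ℝ (tangentSpaceOf n (stableManifold ψ p) (slice em 0)) =
      Module.finrank ℝ Es) {a : Eu} (ha : ‖a‖ ≤ ρ) (haW : slice em a ∈ Wm)
    (hv : ∀ i, dOf n (slice em) a (b i) ∈ tangentSpaceOf n Wm (slice em a)) :
    tupleSign (om ⟨slice em a, haW⟩) (fun i => ⟨dOf n (slice em) a (b i), hv i⟩) =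
      pointSign om cs (slice em 0) hm hms * s := by
  obtain ⟨s', hs'⟩ := hom.exists_sign_disc h.minus.chart h.minus.mem_iff h.rho_pos.le
    h.minus.mem_target b
  have hb1 : SignType.sign (b.det b) = 1 := by rw [b.det_self, sign_one]
  rw [hs' a ha haW b hv, hb1, mul_one]
  have hv0 : ∀ i, dOf n (slice em) 0 (b i) ∈ tangentSpaceOf n Wm (slice em 0) := fun i =>
    h.minus.chart.dOf_slice_mem h.minus.mem_iff (h.minus.mem_target 0 h.norm_zero_le) (b i)
  have h0 := hs' 0 h.norm_zero_le hm b hv0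
  rw [hb1, mul_one] at h0
  have hN := h.hyp.finrank_normalSpace hdim
  -- the sign of the intersection point compares the orientations
  have hφ : Function.Bijective (toNormal n Wm (stableManifold ψ p) (slice em 0)) :=
    toNormal_bijective htr ((h.finrank_minus h.norm_zero_le).trans hN.symm)
  have h1 := tupleSign_map_eq_isoSign_mul (om ⟨slice em 0, hm⟩) (cs ⟨slice em 0, hms⟩) _ hφ b
    ⟨_, (LinearEquiv.ofFinrankEq _ _ (h.finrank_minus h.norm_zero_le)).bijective⟩
    (fun i => ⟨dOf n (slice em) 0 (b i), hv0 i⟩)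
  -- the coorientation of the stable manifold is transported to a neighbourhood of `p`
  have hτ := h.hyp.tau_pos
  have ht : Tendsto (fun j : ℕ => ψ (Tm + j * τ) (slice em 0)) atTop (𝓝 p) :=
    (show Tendsto (fun t => ψ t (slice em 0)) atTop (𝓝 p) from hms).comp
      (tendsto_atTop_add_const_left atTop Tm
        (tendsto_natCast_atTop_atTop.atTop_mul_const hτ))
  obtain ⟨j, hj⟩ := (ht.eventually hs).exists
  have hbox : ψ (Tm + j * τ) (slice em 0) ∈ MorseGluing.box κ r :=
    box_half_subset h.box.pos (h.stable_orbit_mem_box hms (by positivity))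
  have hmt := h.hyp.flow.mapsTo_stableManifold p
  have h2 := hcs.transport h.hyp.flow hmt hms (hN.trans (Module.finrank_eq_card_basis b ▸ by simp))
    (fun i => dOf n (slice em) 0 (b i)) (Tm + j * τ) (hmt _ hms)
  have hM : ∀ α, dAt n κ (ψ (Tm + j * τ) (slice em 0))
      (dMap n (ψ (Tm + j * τ)) (slice em 0) (dOf n (slice em) 0 α)) =
      fderiv ℝ (fun a => κ (ψ (Tm + j * τ) (slice em a))) 0 α := fun α => by
    rw [h.fderiv_slice h.norm_zero_le hbox.1]
    exact (dAt_comp_dMap (h.hyp.chart.mdifferentiableAt hbox.1)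
      (h.hyp.flow.mdifferentiable _ _) _).symm
  obtain ⟨h3, h4, h5⟩ := h.stable_sign b hms j
  have h6 := hj (hmt _ hms) (by rw [h.hyp.flow.finrank_tangentSpaceOf hmt, hdim])
    (dMap n (ψ (Tm + j * τ)) (slice em 0) ∘ₗ dOf n (slice em) 0)
    (fun α => by rw [LinearMap.comp_apply, hM]; exact h4 α)
    (fun α => by rw [LinearMap.comp_apply, hM]; exact h5 α)
  simp only [LinearMap.comp_apply, hM, h3, mul_one] at h6
  have h7 : pointSign om cs (slice em 0) hm hms * s' = s := by
    rw [← h0, ← h6, h2]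
    exact h1.symm
  have h8 : pointSign om cs (slice em 0) hm hms ≠ 0 := fun h9 => hs0 (by rw [← h7, h9, zero_mul])
  rw [← h7, ← mul_assoc, SignType.mul_self_eq_one h8, one_mul]

/-- The coorientation of the disc of `Wp`: it is the same sign at all points of the disc. -/
lemma GluingData.exists_sign_plus
    (h : GluingData n ψ p κ Ls Lu τ Wm Wp em ep Tm Tp m' q' V r ρ c)
    (b : Module.Basis (Fin k) ℝ Eu)
    {cp : (x : Wp) → Orientation ℝ (NormalSpace n Wp (x : C)) (Fin k)}
    (hcp : IsCoorientationOf Wp cp) :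
    ∃ s : SignType, ∀ β : Es, ‖β‖ ≤ ρ → ∀ y, y = slice ep β → ∀ (hy : y ∈ Wp)
      (M : Eu →ₗ[ℝ] TangentSpace (𝓡 n) y),
      (∀ a, ‖(dAt n (fun y => κ (ψ (-Tp) y)) y (M a)).1‖ ≤
        ‖(dAt n (fun y => κ (ψ (-Tp) y)) y (M a)).2‖) →
      (∀ a, (dAt n (fun y => κ (ψ (-Tp) y)) y (M a)).2 = 0 → a = 0) →
      tupleSign (cp ⟨y, hy⟩) (fun i => (tangentSpaceOf n Wp y).mkQ (M (b i))) =
        s * SignType.sign (b.det fun i => (dAt n (fun y => κ (ψ (-Tp) y)) y (M (b i))).2) := by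
  have hsrc : ∀ β : Es, ‖β‖ ≤ ρ → ψ (-Tp) (slice ep β) ∈ κ.source := fun β hβ =>
    (h.subset_box _ (h.plus.mem β hβ)).1
  have hJ : ∀ β : Es, ‖β‖ ≤ ρ →
      Function.Bijective (dAt n (fun y => κ (ψ (-Tp) y)) (slice ep β)) := fun β hβ =>
    h.hyp.flow.dAt_chart_bijective h.hyp.chart (hsrc β hβ)
  -- at the exit of the box, the tangent spaces of `Wp` are in the stable cone, so that at each point
  -- the coorientation is a sign times the determinant of the unstable components
  have hN : ∀ β : Es, ‖β‖ ≤ ρ → ∀ v ∈ tangentSpaceOf n Wp (slice ep β),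
      ‖(dAt n (fun y => κ (ψ (-Tp) y)) (slice ep β) v).2‖ ≤
        1 / 2 * ‖(dAt n (fun y => κ (ψ (-Tp) y)) (slice ep β) v).1‖ := by
    intro β hβ v hv
    have hte := h.plus.mem_target β hβ
    have hse : slice ep β ∈ ep.source := ep.map_target hte
    have h1 := (mem_tangentSpaceOf_iff h.plus.chart h.plus.mem_iff (h.plus.slice_mem hβ) hse v).1 hv
    have h2 : v = dOf n (slice ep) β (dAt n ep (slice ep β) v).1 := by
      refine (h.plus.chart.dAt_bijective hse).1 ?_
      rw [h.plus.chart.dAt_dOf_slice hte]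
      exact Prod.ext rfl h1
    have h3 := (h.exit_cone hβ (dAt n ep (slice ep β) v).1).1
    rw [fderiv_comp_dOf (h := fun y => κ (ψ (-Tp) y))
      (h.hyp.flow.mdifferentiableAt_chart h.hyp.chart (hsrc β hβ))
      (h.plus.chart.mdifferentiableAt_slice hte), ← h2] at h3
    exact h3
  have hsig : ∀ β : Es, ∃ s : SignType, s ≠ 0 ∧ ∀ hβ : ‖β‖ ≤ ρ,
      ∀ M : Eu →ₗ[ℝ] TangentSpace (𝓡 n) (slice ep β),
      (∀ a, ‖(dAt n (fun y => κ (ψ (-Tp) y)) (slice ep β) (M a)).1‖ ≤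
        1 * ‖(dAt n (fun y => κ (ψ (-Tp) y)) (slice ep β) (M a)).2‖) →
      (∀ a, (dAt n (fun y => κ (ψ (-Tp) y)) (slice ep β) (M a)).2 = 0 → a = 0) →
      tupleSign (cp ⟨slice ep β, h.plus.slice_mem hβ⟩)
        (fun i => (tangentSpaceOf n Wp (slice ep β)).mkQ (M (b i))) =
        s * SignType.sign
          (b.det fun i => (dAt n (fun y => κ (ψ (-Tp) y)) (slice ep β) (M (b i))).2) := by
    intro β
    by_cases hβ : ‖β‖ ≤ ρ
    · obtain ⟨s, hs0, hs⟩ := exists_sign_of_cone (cp ⟨slice ep β, h.plus.slice_mem hβ⟩) b (hJ β hβ)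
        (h.finrank_plus hβ) (η := 1 / 2) (K := 1) (by norm_num) (by norm_num) (hN β hβ)
      exact ⟨s, hs0, fun _ => hs⟩
    · exact ⟨1, one_ne_zero, fun hβ' => absurd hβ' hβ⟩
  choose s hs0 hs using hsig
  obtain ⟨s', hs'0, hs'⟩ := hcp.exists_sign_disc h.plus.chart h.plus.mem_iff h.rho_pos.le
    h.plus.mem_target b
  -- compare both expressions on the frame of the unstable subspace in the chart `κ`
  let g : Es × Eu → Es × Eu := fun z => ep (ψ Tp (κ.symm z))
  let D : Es → ℝ := fun β => b.det fun i =>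
    (fderiv ℝ g (κ (ψ (-Tp) (slice ep β))) (0, b i)).2
  have hg : ∀ β : Es, ‖β‖ ≤ ρ → ContDiffAt ℝ ∞ g (κ (ψ (-Tp) (slice ep β))) := fun β hβ => by
    have h1 := h.hyp.flow.contDiffAt_chart (t := Tp) h.plus.chart
      (h.hyp.chart.contMDiffAt_symm (κ.map_source (hsrc β hβ))) (by
        rw [κ.left_inv (hsrc β hβ), h.hyp.flow.apply_neg]
        exact ep.map_target (h.plus.mem_target β hβ))
    exact h1.comp (κ (ψ (-Tp) (slice ep β))) (contDiffAt_const.prodMk contDiffAt_id)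
  have hsD : ∀ β : Es, ‖β‖ ≤ ρ → s β = s' * SignType.sign (D β) := by
    intro β hβ
    let J := LinearEquiv.ofBijective _ (hJ β hβ)
    let M : Eu →ₗ[ℝ] TangentSpace (𝓡 n) (slice ep β) := J.symm.toLinearMap ∘ₗ LinearMap.inr ℝ Es Eu
    have hM : ∀ a, dAt n (fun y => κ (ψ (-Tp) y)) (slice ep β) (M a) = (0, a) := fun a =>
      J.apply_symm_apply _
    have h1 := hs β hβ M (fun a => by simp [hM]) (fun a ha => by simpa [hM] using ha)
    have h2 := hs' β hβ (h.plus.slice_mem hβ) (fun i => M (b i))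
    have h3 : ∀ a, dAt n ep (slice ep β) (M a) =
        fderiv ℝ g (κ (ψ (-Tp) (slice ep β))) (0, a) := fun a => by
      rw [← hM a]
      refine Eq.trans ?_ (dAt_vector_comp (g := g)
        (h.hyp.flow.mdifferentiableAt_chart h.hyp.chart (hsrc β hβ))
        ((hg β hβ).differentiableAt (by simp)) (M a))
      refine congrArg (fun L : TangentSpace (𝓡 n) (slice ep β) →ₗ[ℝ] Es × Eu => L (M a))
        (dAt_congr ?_)
      have h4 : ∀ᶠ y in 𝓝 (slice ep β), ψ (-Tp) y ∈ κ.source :=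
        (h.hyp.flow.continuous_right (-Tp)).continuousAt.eventually
          (κ.open_source.mem_nhds (hsrc β hβ))
      filter_upwards [h4] with y hy
      simp only [g, κ.left_inv hy, h.hyp.flow.apply_neg]
    rw [h1] at h2
    simpa only [hM, h3, Module.Basis.det_self, sign_one, mul_one] using h2
  have hconst : ∀ β : Es, ‖β‖ ≤ ρ → s β = s 0 := fun β hβ => sign_eq_of_isPreconnected
    (convex_closedBall (0 : Es) ρ).isPreconnected (s := s) (fun β₀ hβ₀ => by
      have hβ₀' := mem_closedBall_zero_iff.1 hβ₀
      refine ⟨s', hs'0, D, ?_, ?_⟩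
      · refine continuousWithinAt_det b fun i => continuous_snd.continuousAt.comp_continuousWithinAt ?_
        have h1 := ((hg β₀ hβ₀').fderiv_right (m := 0) (WithTop.coe_le_coe.2 le_top)).continuousAt
        have h2 : ContinuousWithinAt (fun β => κ (ψ (-Tp) (slice ep β)))
            (Metric.closedBall 0 ρ) β₀ :=
          ContinuousAt.comp_continuousWithinAt (f := fun β => ψ (-Tp) (slice ep β))
            (κ.continuousAt (hsrc β₀ hβ₀')) (ContinuousAt.comp_continuousWithinAt (f := slice ep)
              (h.hyp.flow.continuous_right (-Tp)).continuousAt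
              (continuousOn_slice h.plus.mem_target β₀ hβ₀))
        exact (ContinuousAt.comp_continuousWithinAt
          (f := fun β => κ (ψ (-Tp) (slice ep β))) h1 h2).clm_apply continuousWithinAt_const
      · filter_upwards [self_mem_nhdsWithin] with β hβ
        have h1 := hsD β (mem_closedBall_zero_iff.1 hβ)
        have h2 : SignType.sign (D β) ≠ 0 := fun h3 => hs0 β (by rw [h1, h3, mul_zero])
        rw [h1, mul_assoc, SignType.mul_self_eq_one h2, mul_one])
      (mem_closedBall_zero_iff.2 hβ) (Metric.mem_closedBall_self h.rho_pos.le)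
  refine ⟨s 0, ?_⟩
  rintro β hβ _ rfl hy M hM hinj
  rw [← hconst β hβ]
  exact hs β hβ M (fun a => by rw [one_mul]; exact hM a) hinj

end GluedOrientation

section GluedOrientation

universe u

variable {n k : ℕ} {C : Type*} [TopologicalSpace C] [ChartedSpace (EuclideanSpace ℝ (Fin n)) C]
  [IsManifold (𝓡 n) ∞ C]
  {Es Eu : Type u} [NormedAddCommGroup Es] [NormedSpace ℝ Es]
  [NormedAddCommGroup Eu] [NormedSpace ℝ Eu] [FiniteDimensional ℝ Es] [FiniteDimensional ℝ Eu]
  {ψ : ℝ → C → C} {p : C} {κ : OpenPartialHomeomorph C (Es × Eu)}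
  {Ls : ℝ → Es →L[ℝ] Es} {Lu : ℝ → Eu →L[ℝ] Eu} {τ : ℝ}
  {Wm Wp : Set C} {em : OpenPartialHomeomorph C (Eu × Es)} {ep : OpenPartialHomeomorph C (Es × Eu)}
  {Tm Tp : ℝ} {m' : Eu →L[ℝ] Es} {q' : Es →L[ℝ] Eu} {V : Set C} {r ρ c : ℝ}

/-- The sign in `exists_sign_plus` is computed along the unstable orbit. -/
lemma GluingData.sign_plus_eq
    (h : GluingData n ψ p κ Ls Lu τ Wm Wp em ep Tm Tp m' q' V r ρ c)
    (b : Module.Basis (Fin k) ℝ Eu)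
    {ou : (x : unstableManifold ψ p) →
      Orientation ℝ (tangentSpaceOf n (unstableManifold ψ p) (x : C)) (Fin k)}
    (hou : IsOrientationOf (unstableManifold ψ p) ou)
    {cp : (x : Wp) → Orientation ℝ (NormalSpace n Wp (x : C)) (Fin k)} {s d : SignType}
    (hd : ∀ᶠ x in 𝓝 p, ∀ hx : x ∈ unstableManifold ψ p,
      Module.finrank ℝ (tangentSpaceOf n (unstableManifold ψ p) x) = Module.finrank ℝ Eu →
      ∀ v, tupleSign (ou ⟨x, hx⟩) v = d * SignType.sign
        (b.det fun i => (dAt n κ x (v i : TangentSpace (𝓡 n) x)).2))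
    (hu : slice ep 0 ∈ unstableManifold ψ p) (hp : slice ep 0 ∈ Wp)
    (htr : tangentSpaceOf n (unstableManifold ψ p) (slice ep 0) ⊔ tangentSpaceOf n Wp (slice ep 0)
      = ⊤)
    (hdim : Module.finrank ℝ (tangentSpaceOf n (unstableManifold ψ p) (slice ep 0)) =
      Module.finrank ℝ Eu)
    (hs : ∀ M : Eu →ₗ[ℝ] TangentSpace (𝓡 n) (slice ep (0 : Es)),
      (∀ a, ‖(dAt n (fun y => κ (ψ (-Tp) y)) (slice ep 0) (M a)).1‖ ≤
        ‖(dAt n (fun y => κ (ψ (-Tp) y)) (slice ep 0) (M a)).2‖) →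
      (∀ a, (dAt n (fun y => κ (ψ (-Tp) y)) (slice ep 0) (M a)).2 = 0 → a = 0) →
      tupleSign (cp ⟨slice ep 0, hp⟩) (fun i => (tangentSpaceOf n Wp (slice ep 0)).mkQ (M (b i))) =
        s * SignType.sign
          (b.det fun i => (dAt n (fun y => κ (ψ (-Tp) y)) (slice ep 0) (M (b i))).2)) :
    s = pointSign ou cp (slice ep 0) hu hp * d := by
  have hτ := h.hyp.tau_pos
  let Q : Eu ≃ₗ[ℝ] tangentSpaceOf n (unstableManifold ψ p) (slice ep 0) :=
    LinearEquiv.ofFinrankEq _ _ hdim.symm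
  let M : Eu →ₗ[ℝ] TangentSpace (𝓡 n) (slice ep (0 : Es)) :=
    (tangentSpaceOf n (unstableManifold ψ p) (slice ep 0)).subtype ∘ₗ Q.toLinearMap
  have h1 := tupleSign_map_eq_isoSign_mul (ou ⟨slice ep 0, hu⟩) (cp ⟨slice ep 0, hp⟩) _
    (toNormal_bijective htr (hdim.trans (h.finrank_plus h.norm_zero_le).symm)) b
    ⟨Q.symm.toLinearMap, Q.symm.bijective⟩ (fun i => Q (b i))
  -- at late negative times, the orbit and its tangent frame are near `p`
  have ht : Tendsto (fun j : ℕ => ψ (-(Tp + j * τ)) (slice ep 0)) atTop (𝓝 p) :=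
    (show Tendsto (fun t => ψ t (slice ep 0)) atBot (𝓝 p) from hu).comp
      (tendsto_neg_atTop_atBot.comp (tendsto_atTop_add_const_left atTop Tp
        (tendsto_natCast_atTop_atTop.atTop_mul_const hτ)))
  obtain ⟨j, hj, hj'⟩ := ((ht.eventually hd).and (ht.eventually
    (h.hyp.reverse.eventually_stable_cone zero_lt_one le_rfl))).exists
  have hmt := h.hyp.flow.mapsTo_unstableManifold p
  have hbox : ∀ i : ℕ, ψ (-(Tp + i * τ)) (slice ep 0) ∈ MorseGluing.box κ r := fun i =>
    box_half_subset h.box.pos (h.unstable_orbit_mem_box hu (by positivity))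
  have hv : ∀ a, dMap n (ψ (-(Tp + j * τ))) (slice ep 0) (M a) ∈
      tangentSpaceOf n (unstableManifold ψ p) (ψ (-(Tp + j * τ)) (slice ep 0)) := fun a =>
    dMap_mem_tangentSpaceOf (h.hyp.flow.contMDiff _).contMDiffAt (hmt _) (Q a).2
  have h2 : tupleSign (ou ⟨_, hmt _ hu⟩) (fun i => ⟨_, hv (b i)⟩) =
      tupleSign (ou ⟨slice ep 0, hu⟩) fun i => Q (b i) := hou.transport h.hyp.flow hmt hu
    (hdim.trans (Module.finrank_eq_card_basis b ▸ by simp)) (fun i => Q (b i)) (-(Tp + j * τ))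
    (hmt _ hu) (fun i => hv (b i))
  have h3 := hj (hmt _ hu) (by rw [h.hyp.flow.finrank_tangentSpaceOf hmt, hdim])
    (fun i => ⟨_, hv (b i)⟩)
  let N : ℕ → Eu →ₗ[ℝ] Es × Eu := fun i =>
    dAt n (fun y => κ (ψ (-(Tp + i * τ)) y)) (slice ep 0) ∘ₗ M
  have hN : ∀ a, dAt n κ (ψ (-(Tp + j * τ)) (slice ep 0))
      (dMap n (ψ (-(Tp + j * τ))) (slice ep 0) (M a)) = N j a := fun a =>
    (dAt_comp_dMap (h.hyp.chart.mdifferentiableAt (hbox j).1)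
      (h.hyp.flow.mdifferentiable _ _) _).symm
  have hcone : ∀ a, ‖(N j a).1‖ ≤ ‖(N j a).2‖ := fun a => by
    have h4 := hj' (by rw [stableManifold_reverse]; exact hmt _ hu) _
      (by rw [stableManifold_reverse]; exact hv a)
    rw [h.hyp.dAt_swapChart (hbox j).1, hN, one_mul] at h4
    exact h4
  have hNinj : Function.Injective (N j) :=
    (h.hyp.flow.dAt_chart_bijective h.hyp.chart (hbox j).1).1.comp
      (Subtype.val_injective.comp Q.injective)
  have hinj : ∀ a, (N j a).2 = 0 → a = 0 := fun a ha => by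
    have h4 := hcone a
    rw [ha, norm_zero, norm_le_zero_iff] at h4
    exact hNinj ((Prod.ext h4 ha).trans (map_zero (N j)).symm)
  -- forward iteration preserves the cone and the sign
  have h5 := (h.hyp.hyp τ le_rfl).sign_det_iterate b (h.hyp.segment τ le_rfl) (N := j)
    (M := fun i => N (j - i)) (fun i hi a => by
      have h6 := h.hyp.step_tangent h.box h.hyp.mem_Icc (hbox (j - i)) (M a)
      have h7 : -(Tp + (j - i : ℕ) * τ) + τ = -(Tp + (j - (i + 1) : ℕ) * τ) := by
        rw [Nat.cast_sub hi.le, Nat.cast_sub hi]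
        push_cast
        ring
      rw [h7] at h6
      exact h6)
    hcone hinj
  simp only [Nat.sub_zero, Nat.sub_self] at h5
  have hN0 : N 0 = dAt n (fun y => κ (ψ (-Tp) y)) (slice ep 0) ∘ₗ M := by
    simp only [N, Nat.cast_zero, zero_mul, add_zero]
  rw [hN0] at h5
  have h8 := hs M h5.2.1 h5.2.2
  have h9 : SignType.sign (b.det fun i => (N j (b i)).2) ≠ 0 := by
    rw [Ne, sign_eq_zero_iff]
    exact det_map_ne_zero b (A := LinearMap.snd ℝ Es Eu ∘ₗ N j) hinj
  refine SignType.eq_of_mul_eq h9 ?_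
  simp only [hN] at h3
  rw [mul_assoc, ← h3, h2, h5.1]
  exact h8.symm.trans h1

/-- Along the glued flow lines, `dψ^R` maps `T Wm` isomorphically to `T C / T Wp`, with sign
`ε₋ ε₊`. -/
lemma GluingData.flow_sign
    (h : GluingData n ψ p κ Ls Lu τ Wm Wp em ep Tm Tp m' q' V r ρ c)
    (b : Module.Basis (Fin k) ℝ Eu)
    {om : (x : Wm) → Orientation ℝ (tangentSpaceOf n Wm (x : C)) (Fin k)}
    {cp : (x : Wp) → Orientation ℝ (NormalSpace n Wp (x : C)) (Fin k)}
    {ou : (x : unstableManifold ψ p) →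
      Orientation ℝ (tangentSpaceOf n (unstableManifold ψ p) (x : C)) (Fin k)}
    {cs : (x : stableManifold ψ p) →
      Orientation ℝ (NormalSpace n (stableManifold ψ p) (x : C)) (Fin k)}
    (hom : IsOrientationOf Wm om) (hcp : IsCoorientationOf Wp cp)
    (hou : IsOrientationOf (unstableManifold ψ p) ou)
    (hcs : IsCoorientationOf (stableManifold ψ p) cs) (hind : InducesCoorientation ψ p ou cs)
    (hm : slice em 0 ∈ Wm) (hms : slice em 0 ∈ stableManifold ψ p)
    (hu : slice ep 0 ∈ unstableManifold ψ p) (hp : slice ep 0 ∈ Wp)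
    (htrm : tangentSpaceOf n Wm (slice em 0) ⊔
      tangentSpaceOf n (stableManifold ψ p) (slice em 0) = ⊤)
    (htrp : tangentSpaceOf n (unstableManifold ψ p) (slice ep 0) ⊔ tangentSpaceOf n Wp (slice ep 0)
      = ⊤)
    (hdimm : Module.finrank ℝ (tangentSpaceOf n (stableManifold ψ p) (slice em 0)) =
      Module.finrank ℝ Es)
    (hdimp : Module.finrank ℝ (tangentSpaceOf n (unstableManifold ψ p) (slice ep 0)) =
      Module.finrank ℝ Eu) {a : Eu} {β : Es} (ha : ‖a‖ ≤ ρ) (hβ : ‖β‖ ≤ ρ) {R : ℝ}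
    (hRτ : Tm + Tp + τ ≤ R) (hR : ψ R (slice em a) = slice ep β) (hma : slice em a ∈ Wm)
    (hpa : ψ R (slice em a) ∈ Wp) (v : Fin k → tangentSpaceOf n Wm (slice em a)) :
    tupleSign (cp ⟨ψ R (slice em a), hpa⟩)
      (fun i => (tangentSpaceOf n Wp (ψ R (slice em a))).mkQ (dMap n (ψ R) (slice em a) (v i))) =
      pointSign om cs (slice em 0) hm hms * pointSign ou cp (slice ep 0) hu hp *
        tupleSign (om ⟨slice em a, hma⟩) v := by
  obtain ⟨d, hd0, hd, hd'⟩ := h.hyp.exists_sign hou hcs hind b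
  obtain ⟨s, hs⟩ := h.exists_sign_plus b hcp
  have hsd := h.sign_plus_eq b hou hd' hu hp htrp hdimp
    (hs 0 h.norm_zero_le _ rfl hp)
  have hv0 : ∀ α, dOf n (slice em) a α ∈ tangentSpaceOf n Wm (slice em a) := fun α =>
    h.minus.chart.dOf_slice_mem h.minus.mem_iff (h.minus.mem_target a ha) α
  have h1 := h.sign_minus b hom hcs hd0 hd hm hms htrm hdimm ha hma fun i => hv0 (b i)
  -- the frame of the disc of `Wm`, moved to the exit of the box
  obtain ⟨N, t, ht, hNt, -⟩ := exists_mul_eq h.hyp.tau_pos (S := R - Tm - Tp) (by linarith)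
  have h2 := h.entry_sign b ha
  have h3 := (h.hyp.hyp t ht.1).sign_det_iterate b (h.hyp.segment t ht.1) (N := N + 1)
    (M := fun j => (fderiv ℝ (fun a => κ (ψ (Tm + j * t) (slice em a))) a).toLinearMap)
    (fun j hj α => h.step_fderiv ha hβ hR ht hNt hj α)
    (by simpa using h2.2.1) (by simpa using h2.2.2)
  have hTN : Tm + (N + 1 : ℕ) * t = R - Tp := by rw [hNt]; ring
  simp only [ContinuousLinearMap.coe_coe, Nat.cast_zero, zero_mul, add_zero, hTN, h2.1] at h3
  have hx : ψ (R - Tp) (slice em a) = ψ (-Tp) (ψ R (slice em a)) := by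
    rw [← h.hyp.flow.add, neg_add_eq_sub]
  have hsrc : ψ (-Tp) (ψ R (slice em a)) ∈ κ.source := by
    rw [hR]
    exact (h.subset_box _ (h.plus.mem β hβ)).1
  have hJ : ∀ α, dAt n (fun y => κ (ψ (-Tp) y)) (ψ R (slice em a))
      (dMap n (ψ R) (slice em a) (dOf n (slice em) a α)) =
      fderiv ℝ (fun a => κ (ψ (R - Tp) (slice em a))) a α := fun α => by
    rw [h.fderiv_slice ha (hx ▸ hsrc), ← dAt_comp_dMap
      (h.hyp.flow.mdifferentiableAt_chart h.hyp.chart hsrc) (h.hyp.flow.mdifferentiable _ _)]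
    simp only [← h.hyp.flow.add, neg_add_eq_sub]
  have h4 := hs β hβ _ hR hpa (dMap n (ψ R) (slice em a) ∘ₗ dOf n (slice em) a)
    (fun α => by rw [LinearMap.comp_apply, hJ]; exact h3.2.1 α)
    (fun α => by rw [LinearMap.comp_apply, hJ]; exact h3.2.2 α)
  simp only [LinearMap.comp_apply, hJ, ← h3.1, mul_one] at h4
  -- the map `T Wm → T C / T Wp`
  let φ : tangentSpaceOf n Wm (slice em a) →ₗ[ℝ] NormalSpace n Wp (ψ R (slice em a)) :=
    (tangentSpaceOf n Wp (ψ R (slice em a))).mkQ ∘ₗ dMap n (ψ R) (slice em a) ∘ₗ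
      (tangentSpaceOf n Wm (slice em a)).subtype
  have hrank : Module.finrank ℝ (NormalSpace n Wp (ψ R (slice em a))) = Module.finrank ℝ Eu := by
    rw [hR]
    exact h.finrank_plus hβ
  let P : NormalSpace n Wp (ψ R (slice em a)) ≃ₗ[ℝ] Eu := LinearEquiv.ofFinrankEq _ _ hrank
  let D : Eu →ₗ[ℝ] tangentSpaceOf n Wm (slice em a) := (dOf n (slice em) a).codRestrict _ hv0
  have hs0 : s ≠ 0 := by
    rw [hsd]
    exact mul_ne_zero (isoSign_ne_zero _ _ _) hd0
  -- `φ` maps a frame to a frame of non-zero sign, so it is surjective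
  have hφs : Function.Surjective φ := by
    obtain ⟨s', hs'0, hs'⟩ := exists_tupleSign_eq (cp ⟨ψ R (slice em a), hpa⟩) b
      (P := P.toLinearMap) P.bijective
    have h5 := hs' (fun i => φ (D (b i)))
    have h6 : b.det (fun i => (P.toLinearMap ∘ₗ φ ∘ₗ D) (b i)) ≠ 0 := fun h7 => by
      refine hs0 (h4.symm.trans (h5.trans ?_))
      change s' * SignType.sign (b.det (fun i => (P.toLinearMap ∘ₗ φ ∘ₗ D) (b i))) = 0
      rw [h7, sign_zero, mul_zero]
    have h8 := LinearMap.injective_iff_surjective.1 (injective_of_det_ne_zero b h6)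
    intro z
    obtain ⟨α, hα⟩ := h8 (P z)
    exact ⟨D α, P.injective hα⟩
  have hrank' : Module.finrank ℝ (tangentSpaceOf n Wm (slice em a)) =
      Module.finrank ℝ (NormalSpace n Wp (ψ R (slice em a))) := (h.finrank_minus ha).trans hrank.symm
  have hφ : Function.Bijective φ :=
    ⟨(LinearMap.injective_iff_surjective_of_finrank_eq_finrank hrank').2 hφs, hφs⟩
  have h9 := tupleSign_map_eq_isoSign_mul (om ⟨slice em a, hma⟩) (cp ⟨ψ R (slice em a), hpa⟩) φ hφ b
    ⟨_, (LinearEquiv.ofFinrankEq _ _ (h.finrank_minus ha)).bijective⟩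
  refine (h9 v).trans (congrArg (· * tupleSign (om ⟨slice em a, hma⟩) v) ?_)
  have h10 := h9 fun i => ⟨dOf n (slice em) a (b i), hv0 (b i)⟩
  rw [h1] at h10
  have h11 : pointSign om cs (slice em 0) hm hms ≠ 0 := isoSign_ne_zero _ _ _
  refine SignType.eq_of_mul_eq (mul_ne_zero h11 hd0) (h10.symm.trans (h4.trans ?_))
  rw [hsd, mul_assoc, mul_left_comm (pointSign ou cp (slice ep 0) hu hp), ← mul_assoc,
    SignType.mul_self_eq_one h11, one_mul]

end GluedOrientation

/-! ### Orientations of one-dimensional kernels -/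

section KernelOrientation

variable {k : ℕ} {V X Z : Type*} [AddCommGroup V] [Module ℝ V] [AddCommGroup X] [Module ℝ X]
  [AddCommGroup Z] [Module ℝ Z]

/-- Adding multiples of the first vector to the other ones does not change an alternating map. -/
lemma map_cons_add_smul (g : X [⋀^Fin (k + 1)]→ₗ[ℝ] ℝ) (κ : X) (v : Fin k → X) (θ : Fin k → ℝ) :
    g (Fin.cons κ fun i => v i + θ i • κ) = g (Fin.cons κ v) := by
  classical
  suffices h : ∀ s : Finset (Fin k),
      g (Fin.cons κ (s.piecewise (fun i => v i + θ i • κ) v)) = g (Fin.cons κ v) by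
    have := h Finset.univ
    rwa [Finset.piecewise_univ] at this
  intro s
  induction s using Finset.induction_on with
  | empty => rw [Finset.piecewise_empty]
  | insert j s hj ih =>
    set w := s.piecewise (fun i => v i + θ i • κ) v with hw
    have h1 : w j = v j := Finset.piecewise_eq_of_notMem _ _ _ hj
    rw [Finset.piecewise_insert, Fin.cons_update, g.map_update_add, g.map_update_smul, ← hw, ← h1,
      ← Fin.cons_update, Function.update_eq_self, ih]
    have h2 : g (Function.update (Fin.cons κ w : Fin (k + 1) → X) j.succ κ) = 0 :=
      g.map_eq_zero_of_eq _ (i := 0) (j := j.succ)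
        (by rw [Function.update_of_ne (Fin.succ_ne_zero j).symm, Function.update_self, Fin.cons_zero])
        (Fin.succ_ne_zero j).symm
    rw [h2, smul_zero, add_zero]

lemma tupleSign_cons_neg {o : Orientation ℝ X (Fin (k + 1))} (ξ : X) (v : Fin k → X) :
    tupleSign o (Fin.cons (-ξ) v : Fin (k + 1) → X) =
      -tupleSign o (Fin.cons ξ v : Fin (k + 1) → X) := by
  have h1 := o.someVector.map_update_neg (Fin.cons ξ v : Fin (k + 1) → X) 0 ξ
  rw [Fin.update_cons_zero, Fin.update_cons_zero] at h1
  rw [tupleSign, h1, Left.sign_neg]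
  rfl

/-- If `X = ℝ ν ⊕ L V` and `φ` maps `L V` isomorphically to `Z` with sign `ε`, then the vector
`ν + L ξ` of the kernel of `φ` has orientation `ε`. -/
lemma kernelVectorSign_of_orientedAsSum [FiniteDimensional ℝ V] (hV : Module.finrank ℝ V = k)
    {oV : Orientation ℝ V (Fin k)} {oX : Orientation ℝ X (Fin (k + 1))}
    {oZ : Orientation ℝ Z (Fin k)} {ν : X} {L : V →ₗ[ℝ] X} (ho : OrientedAsSum oV oX ν L)
    (hX : ∀ x, ∃ (θ : ℝ) (u : V), x = θ • ν + L u) {φ : X →ₗ[ℝ] Z} {ε : SignType} (hε : ε ≠ 0)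
    (hφ : ∀ v : Fin k → V, tupleSign oZ (fun i => φ (L (v i))) = ε * tupleSign oV v) (ξ : V)
    (hξ : φ (ν + L ξ) = 0) : KernelVectorSign oX oZ φ (ν + L ξ) ε := by
  refine ⟨hξ, fun v => ?_⟩
  choose θ u hu using fun i => hX (v i)
  -- subtract multiples of the kernel vector, so that the frame lies in `L V`
  let w : Fin k → V := fun i => u i - θ i • ξ
  have hv : v = fun i => L (w i) + θ i • (ν + L ξ) := by
    ext i
    rw [hu i, map_sub, map_smul]
    module
  have h1 : tupleSign oX (Fin.cons (ν + L ξ) v : Fin (k + 1) → X) = tupleSign oV w := by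
    rw [← ho w, tupleSign, tupleSign, hv, map_cons_add_smul]
    have h2 := oX.someVector.map_update_add
      (Fin.cons ν (fun i => L (w i)) : Fin (k + 1) → X) 0 ν (L ξ)
    simp only [Fin.update_cons_zero] at h2
    -- the `k + 1` vectors `ξ, w i` of the `k`-dimensional space `V` are linearly dependent
    have h3 : oX.someVector (Fin.cons (L ξ) fun i => L (w i)) = 0 := by
      refine oX.someVector.map_linearDependent _ fun h4 => ?_
      have h5 : (Fin.cons (L ξ) fun i => L (w i) : Fin (k + 1) → X) =
          L ∘ (Fin.cons ξ w : Fin (k + 1) → V) := by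
        ext i
        refine Fin.cases rfl (fun j => rfl) i
      rw [h5] at h4
      have h6 := h4.of_comp.fintype_card_le_finrank
      rw [hV, Fintype.card_fin] at h6
      omega
    rw [h2, h3, add_zero]
  have h2 : ∀ i, φ (v i) = φ (L (w i)) := fun i => by
    rw [congrFun hv i, map_add φ, map_smul φ, hξ, smul_zero, add_zero]
  simp only [h1, h2, hφ]
  rw [← mul_assoc, SignType.mul_self_eq_one hε, one_mul]

end KernelOrientation

/-! ### Velocities of curves of flow lines -/

section Velocity

variable {n : ℕ} {C : Type*} [TopologicalSpace C] [ChartedSpace (EuclideanSpace ℝ (Fin n)) C]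
  {ψ : ℝ → C → C}

lemma velocity_eq_dOf {γ : ℝ → C} {R₀ R : ℝ} (hγ : MDifferentiableAt 𝓘(ℝ, ℝ) (𝓡 n) γ R)
    (hR : R₀ ≤ R) : velocity n R₀ γ R = dOf n γ R 1 :=
  congrArg (fun L : TangentSpace 𝓘(ℝ, ℝ) R →L[ℝ] TangentSpace (𝓡 n) (γ R) => L (1 : ℝ))
    (mfderivWithin_eq_mfderiv ((uniqueDiffOn_Ici R₀).uniqueMDiffOn R hR) hγ)

lemma IsSmoothFlow.mdifferentiableAt_uncurry (hψ : IsSmoothFlow n ψ) (q : ℝ × C) :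
    MDifferentiableAt (𝓘(ℝ, ℝ).prod (𝓡 n)) (𝓡 n) (fun q : ℝ × C => ψ q.1 q.2) q :=
  (hψ.smooth q).mdifferentiableAt (by simp)

lemma IsSmoothFlow.flowDiff_apply (hψ : IsSmoothFlow n ψ) {S : Set C} (R : ℝ) (w : C) (θ : ℝ)
    (v : tangentSpaceOf n S w) :
    flowDiff n ψ S R w (θ, v) = θ • dOf n (fun t => ψ t w) R 1 + dMap n (ψ R) w v := by
  have h1 := mfderiv_prod_eq_add_apply (hψ.mdifferentiableAt_uncurry (R, w))
    (v := (show TangentSpace (𝓘(ℝ, ℝ).prod (𝓡 n)) ((R, w) : ℝ × C) from (θ, v.1)))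
  refine Eq.trans h1 ?_
  refine congrArg (· + dMap n (ψ R) w v) ?_
  change dOf n (fun t => ψ t w) R θ = _
  rw [← map_smul, smul_eq_mul, mul_one]

/-- The chain rule for `t ↦ ψ t (γ t)`. -/
lemma IsSmoothFlow.dOf_flow_curve (hψ : IsSmoothFlow n ψ) {γ : ℝ → C} {R : ℝ}
    (hγ : MDifferentiableAt 𝓘(ℝ, ℝ) (𝓡 n) γ R) :
    dOf n (fun t => ψ t (γ t)) R 1 =
      dOf n (fun t => ψ t (γ R)) R 1 + dMap n (ψ R) (γ R) (dOf n γ R 1) := by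
  have h0 : MDifferentiableAt 𝓘(ℝ, ℝ) (𝓘(ℝ, ℝ).prod (𝓡 n)) (fun t : ℝ => (t, γ t)) R :=
    mdifferentiableAt_id.prodMk hγ
  have h1 := mfderiv_comp_apply (I' := 𝓘(ℝ, ℝ).prod (𝓡 n)) R (g := fun q : ℝ × C => ψ q.1 q.2)
    (f := fun t : ℝ => (t, γ t)) (hψ.mdifferentiableAt_uncurry _) h0 (1 : ℝ)
  refine Eq.trans h1 ?_
  have h2 := mfderiv_prod_eq_add_apply (hψ.mdifferentiableAt_uncurry (R, γ R))
    (v := mfderiv 𝓘(ℝ, ℝ) (𝓘(ℝ, ℝ).prod (𝓡 n)) (fun t : ℝ => (t, γ t)) R (1 : ℝ))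
  refine Eq.trans h2 ?_
  have h3 := (hasMFDerivAt_id R).prodMk hγ.hasMFDerivAt
  have h4 : mfderiv 𝓘(ℝ, ℝ) (𝓘(ℝ, ℝ).prod (𝓡 n)) (fun t : ℝ => (t, γ t)) R (1 : ℝ) =
      ((1 : ℝ), dOf n γ R 1) := congrArg (fun L => L (1 : ℝ)) h3.mfderiv
  rw [h4]
  rfl

end Velocity

/-! ### Orientations of curves of flow lines -/

section CurveOrientation

variable {n k : ℕ} {C : Type*} [TopologicalSpace C] [ChartedSpace (EuclideanSpace ℝ (Fin n)) C]
  {ψ : ℝ → C → C} {Wm Wp : Set C}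
  {om : (x : Wm) → Orientation ℝ (tangentSpaceOf n Wm (x : C)) (Fin k)}
  {cp : (x : Wp) → Orientation ℝ (NormalSpace n Wp (x : C)) (Fin k)} {R : ℝ} {w : C}
  {hw : w ∈ Wm} {hwR : ψ R w ∈ Wp} {ε : SignType}

lemma IsSmoothFlow.flowDiff_inr (hψ : IsSmoothFlow n ψ) (v : tangentSpaceOf n Wm w) :
    flowDiff n ψ Wm R w (0, v) = dMap n (ψ R) w v := by
  rw [hψ.flowDiff_apply, zero_smul, zero_add]

/-- `kernelVectorSign_of_orientedAsSum` for `X = ℝ ⊕ T Wm`, with first vector `(1, 0)`. -/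
lemma IsSmoothFlow.flowLineVectorSign (hψ : IsSmoothFlow n ψ)
    (hk : Module.finrank ℝ (tangentSpaceOf n Wm w) = k) (hε : ε ≠ 0)
    (hφ : ∀ v : Fin k → tangentSpaceOf n Wm w, tupleSign (cp ⟨ψ R w, hwR⟩)
      (fun i => (tangentSpaceOf n Wp (ψ R w)).mkQ (dMap n (ψ R) w (v i))) =
        ε * tupleSign (om ⟨w, hw⟩) v)
    {ξm : TangentSpace (𝓡 n) w} {ξp : TangentSpace (𝓡 n) (ψ R w)}
    (hm : ξm ∈ tangentSpaceOf n Wm w) (hp : ξp ∈ tangentSpaceOf n Wp (ψ R w))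
    (hξ : flowDiff n ψ Wm R w (1, ⟨ξm, hm⟩) = ξp) :
    FlowLineVectorSign ψ om cp R w hw hwR ξm ξp ε := by
  refine ⟨hm, hp, hξ, fun oX hoX => ?_⟩
  have h1 : ((1 : ℝ), (⟨ξm, hm⟩ : tangentSpaceOf n Wm w)) =
      (1, 0) + LinearMap.inr ℝ ℝ (tangentSpaceOf n Wm w) ⟨ξm, hm⟩ := by simp
  have h2 : flowLineMap n ψ Wm Wp R w (1, ⟨ξm, hm⟩) = 0 := by
    refine (Submodule.Quotient.mk_eq_zero _).2 ?_
    rw [hξ]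
    exact hp
  rw [h1] at h2 ⊢
  refine kernelVectorSign_of_orientedAsSum hk hoX (fun x => ⟨x.1, x.2, by simp⟩) hε
    (fun v => ?_) _ h2
  rw [← hφ v]
  congr 1
  ext i
  exact congrArg (tangentSpaceOf n Wp (ψ R w)).mkQ (hψ.flowDiff_inr (v i))

/-- `kernelVectorSign_of_orientedAsSum` for the tangent space `X` of the flow-out of `Wm`, with first
vector `dψ(1, 0) = -grad f`. -/
lemma IsSmoothFlow.flowoutMinusVectorSign (hψ : IsSmoothFlow n ψ)
    (hk : Module.finrank ℝ (tangentSpaceOf n Wm w) = k) (hε : ε ≠ 0)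
    (hφ : ∀ v : Fin k → tangentSpaceOf n Wm w, tupleSign (cp ⟨ψ R w, hwR⟩)
      (fun i => (tangentSpaceOf n Wp (ψ R w)).mkQ (dMap n (ψ R) w (v i))) =
        ε * tupleSign (om ⟨w, hw⟩) v)
    {ξm : TangentSpace (𝓡 n) w} {ξp : TangentSpace (𝓡 n) (ψ R w)}
    (hm : ξm ∈ tangentSpaceOf n Wm w) (hp : ξp ∈ tangentSpaceOf n Wp (ψ R w))
    (hξ : flowDiff n ψ Wm R w (1, ⟨ξm, hm⟩) = ξp) :
    FlowoutMinusVectorSign ψ om cp R w hw hwR ξp ε := by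
  refine ⟨⟨_, hξ⟩, fun oX hoX => ?_⟩
  have h1 : (⟨ξp, ⟨_, hξ⟩⟩ : flowoutMinus n ψ Wm R w) =
      (flowDiff n ψ Wm R w).rangeRestrict (1, 0) + ((flowDiff n ψ Wm R w).rangeRestrict ∘ₗ
        LinearMap.inr ℝ ℝ (tangentSpaceOf n Wm w)) ⟨ξm, hm⟩ := by
    refine Subtype.ext (hξ.symm.trans ?_)
    rw [LinearMap.comp_apply, ← map_add]
    simp
  have h2 : ((tangentSpaceOf n Wp (ψ R w)).mkQ ∘ₗ (flowoutMinus n ψ Wm R w).subtype)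
      ⟨ξp, ⟨_, hξ⟩⟩ = 0 := (Submodule.Quotient.mk_eq_zero _).2 hp
  rw [h1] at h2 ⊢
  refine kernelVectorSign_of_orientedAsSum hk hoX ?_ hε (fun v => ?_) _ h2
  · rintro ⟨_, q, rfl⟩
    refine ⟨q.1, q.2, Subtype.ext ?_⟩
    change flowDiff n ψ Wm R w q =
      q.1 • flowDiff n ψ Wm R w (1, 0) + flowDiff n ψ Wm R w (0, q.2)
    rw [← map_smul, ← map_add]
    simp
  · rw [← hφ v]
    congr 1
    ext i
    exact congrArg (tangentSpaceOf n Wp (ψ R w)).mkQ (hψ.flowDiff_inr (v i))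

/-- The sign is `-ε`: modulo `T Wp`, the map `dψ^R` sends the velocity `ξm` to `grad f`, which
is minus the first vector in the coorientation of the flow-out of `Wp`. -/
lemma flowoutPlusVectorSign [RiemannianBundle (fun x : C => TangentSpace (𝓡 n) x)] {f : C → ℝ}
    (hk : Module.finrank ℝ (NormalSpace n Wp (ψ R w)) = k) (hε : ε ≠ 0)
    (hφ : ∀ v : Fin k → tangentSpaceOf n Wm w, tupleSign (cp ⟨ψ R w, hwR⟩)
      (fun i => (tangentSpaceOf n Wp (ψ R w)).mkQ (dMap n (ψ R) w (v i))) =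
        ε * tupleSign (om ⟨w, hw⟩) v)
    (hf : grad n f (ψ R w) ∉ tangentSpaceOf n Wp (ψ R w))
    {ξm : TangentSpace (𝓡 n) w} (hm : ξm ∈ tangentSpaceOf n Wm w)
    (hp : -grad n f (ψ R w) + dMap n (ψ R) w ξm ∈ tangentSpaceOf n Wp (ψ R w)) :
    FlowoutPlusVectorSign f ψ om cp R w hw hwR ξm (-ε) := by
  -- `T C / T Wp` contains a non-zero vector, so `Wp` has positive codimension
  obtain ⟨j, rfl⟩ : ∃ j, k = j + 1 := by
    refine Nat.exists_eq_succ_of_ne_zero fun h => hf ?_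
    have h1 : Subsingleton (NormalSpace n Wp (ψ R w)) :=
      Module.finrank_zero_iff.1 (hk.trans h)
    exact (Submodule.Quotient.mk_eq_zero _).1 (Subsingleton.elim _ 0)
  refine ⟨hm, j, rfl, fun oZ hoZ => ⟨?_, fun v => ?_⟩⟩
  · refine (Submodule.Quotient.mk_eq_zero _).2 ?_
    have h1 : dMap n (ψ R) w ξm = (-1 : ℝ) • (-grad n f (ψ R w)) +
        (-grad n f (ψ R w) + dMap n (ψ R) w ξm) := by module
    refine Submodule.mem_comap.2 ?_
    change dMap n (ψ R) w ξm ∈ _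
    rw [h1]
    exact Submodule.add_mem_sup
      (Submodule.smul_mem _ _ (Submodule.mem_span_singleton_self _)) hp
  · have h1 := hoZ fun i => (v i : TangentSpace (𝓡 n) w)
    -- modulo `T Wp`, the vector `-grad f` of the coorientation can be replaced by `dψ^R (-ξm)`
    have h2 := hφ (Fin.cons (-⟨ξm, hm⟩) v : Fin (j + 1) → tangentSpaceOf n Wm w)
    have h3 : (fun i : Fin (j + 1) => (tangentSpaceOf n Wp (ψ R w)).mkQ
        ((Fin.cons (-grad n f (ψ R w)) (fun i => mfderiv (𝓡 n) (𝓡 n) (ψ R) w (v i)) :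
            Fin (j + 1) → TangentSpace (𝓡 n) (ψ R w)) (Fin.cast rfl i))) =
        fun i => (tangentSpaceOf n Wp (ψ R w)).mkQ (dMap n (ψ R) w
          ((Fin.cons (-⟨ξm, hm⟩) v : Fin (j + 1) → tangentSpaceOf n Wm w) i)) := by
      ext i
      refine Fin.cases ?_ (fun i => rfl) i
      refine (Submodule.Quotient.eq _).2 ?_
      change -grad n f (ψ R w) - dMap n (ψ R) w (-ξm) ∈ _
      rwa [map_neg, sub_neg_eq_add]
    rw [h3, h2, tupleSign_cons_neg] at h1
    have h4 : Orientation.reindex ℝ (tangentSpaceOf n Wm w) (finCongr rfl) (om ⟨w, hw⟩) =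
        om ⟨w, hw⟩ := by
      rw [finCongr_refl, Orientation.reindex_refl]
      rfl
    rw [h4]
    refine Eq.trans ?_ (congrArg (fun s => -ε * s) h1)
    rw [neg_mul, mul_neg, mul_neg, neg_neg, ← mul_assoc, SignType.mul_self_eq_one hε, one_mul]

end CurveOrientation

/-! ### Immersed curves of flow lines and isolation of the broken flow line -/

section Isolation

variable {n : ℕ} {C : Type*} [TopologicalSpace C] [ChartedSpace (EuclideanSpace ℝ (Fin n)) C]
  {ψ : ℝ → C → C}

lemma IsSmoothFlow.contMDiffAt_flow_curve (hψ : IsSmoothFlow n ψ) {γ : ℝ → C} {R : ℝ}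
    (hγ : ContMDiffAt 𝓘(ℝ, ℝ) (𝓡 n) ∞ γ R) :
    ContMDiffAt 𝓘(ℝ, ℝ) (𝓡 n) ∞ (fun t => ψ t (γ t)) R :=
  ContMDiffAt.comp (g := fun q : ℝ × C => ψ q.1 q.2) R (hψ.smooth _) (contMDiffAt_id.prodMk hγ)

/-- The first component of the curve is `R`, so it is an injective immersion as soon as it is smooth. -/
lemma IsSmoothFlow.isInjectiveImmersionOn (hψ : IsSmoothFlow n ψ) {γ : ℝ → C} {R₀ : ℝ}
    (hγ : ∀ R, R₀ ≤ R → ContMDiffAt 𝓘(ℝ, ℝ) (𝓡 n) ∞ γ R) :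
    IsInjectiveImmersionOn n R₀ (fun R => (R, γ R, ψ R (γ R))) := by
  have h1 : ∀ R, R₀ ≤ R → ContMDiffAt 𝓘(ℝ, ℝ) ((𝓡 n).prod (𝓡 n)) ∞
      (fun R => (γ R, ψ R (γ R))) R := fun R hR =>
    (hγ R hR).prodMk (hψ.contMDiffAt_flow_curve (hγ R hR))
  refine ⟨fun R hR => (contMDiffAt_id.prodMk (h1 R hR)).contMDiffWithinAt,
    fun R _ R' _ h => congrArg Prod.fst h, fun R hR u v huv => ?_⟩
  have h2 := (hasMFDerivAt_id (I := 𝓘(ℝ, ℝ)) R).prodMk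
    ((h1 R hR).mdifferentiableAt (by simp)).hasMFDerivAt
  have h3 : mfderivWithin 𝓘(ℝ, ℝ) (𝓘(ℝ, ℝ).prod ((𝓡 n).prod (𝓡 n)))
      (fun R => (R, γ R, ψ R (γ R))) (Ici R₀) R = _ :=
    (mfderivWithin_eq_mfderiv ((uniqueDiffOn_Ici R₀).uniqueMDiffOn R hR)
      h2.mdifferentiableAt).trans h2.mfderiv
  rw [h3] at huv
  exact congrArg Prod.fst huv

variable [T2Space C]

/-- If `f ap < f am`, flow lines between points near `am` and `ap` have at least length `R₀`: lengths
in `[0, R₀]` are excluded by compactness, and negative lengths by the monotonicity of the energy. -/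
lemma eventually_le_of_flow_eq (hψ : IsSmoothFlow n ψ) {f : C → ℝ} (hf : Continuous f)
    (hmono : ∀ x, Antitone fun t => f (ψ t x)) {p am ap : C} (hp : ∀ t, ψ t p = p)
    (hsu : ∀ x, x ∈ stableManifold ψ p → x ∈ unstableManifold ψ p → x = p)
    (hm : am ∈ stableManifold ψ p) (hu : ap ∈ unstableManifold ψ p) (hlt : f ap < f am) (R₀ : ℝ) :
    ∀ᶠ q in 𝓝 ((am, ap) : C × C), ∀ R, ψ R q.1 = q.2 → R₀ ≤ R := by
  have h1 : ∀ R, ψ R am ≠ ap := by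
    intro R hR
    have h2 : am ∈ unstableManifold ψ p := by
      have h3 := hψ.mapsTo_unstableManifold p (-R) hu
      rwa [← hR, hψ.neg_apply] at h3
    have h3 := hsu am hm h2
    rw [h3, hp] at hR
    exact hlt.ne (by rw [← hR, h3])
  have h2 : ∀ᶠ q in 𝓝 ((am, ap) : C × C), ∀ R ∈ Icc 0 R₀, ψ R q.1 ≠ q.2 := by
    refine isCompact_Icc.eventually_forall_of_forall_eventually fun R _ => ?_
    have h3 : ContinuousAt (fun z : (C × C) × ℝ => ψ z.2 z.1.1) ((am, ap), R) :=
      (hψ.continuous.comp (continuous_snd.prodMk (continuous_fst.comp continuous_fst))).continuousAt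
    exact (h3.prodMk (continuous_snd.comp continuous_fst).continuousAt).eventually
      (isClosed_diagonal.isOpen_compl.mem_nhds (h1 R))
  have h3 : ∀ᶠ q in 𝓝 ((am, ap) : C × C), f q.2 < f q.1 :=
    (hf.comp continuous_snd).continuousAt.eventually_lt (hf.comp continuous_fst).continuousAt hlt
  filter_upwards [h2, h3] with q h4 h5 R hR
  by_contra! h6
  rcases le_or_gt 0 R with h7 | h7
  · exact h4 R ⟨h7, h6.le⟩ hR
  · have h8 := hmono q.1 h7.le
    simp only [hR, hψ.zero] at h8
    exact absurd h5 h8.not_gt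

variable [IsManifold (𝓡 n) ∞ C] [RiemannianBundle (fun x : C => TangentSpace (𝓡 n) x)]

lemma IsNegGradFlow.energy_le_of_mem_stable {f : C → ℝ} (hψ : IsNegGradFlow (n := n) f ψ)
    (hf : ContMDiff (𝓡 n) 𝓘(ℝ, ℝ) ∞ f) {p x : C} (hx : x ∈ stableManifold ψ p) :
    f p ≤ f x := by
  have h1 : Tendsto (fun t => f (ψ t x)) atTop (𝓝 (f p)) :=
    (hf.continuous.tendsto p).comp hx
  have h2 := (hψ.antitone_energy hf x).le_of_tendsto h1 0
  simpa only [hψ.zero] using h2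

lemma IsNegGradFlow.le_energy_of_mem_unstable {f : C → ℝ} (hψ : IsNegGradFlow (n := n) f ψ)
    (hf : ContMDiff (𝓡 n) 𝓘(ℝ, ℝ) ∞ f) {p x : C} (hx : x ∈ unstableManifold ψ p) :
    f x ≤ f p := by
  have h1 : Tendsto (fun t => f (ψ t x)) atBot (𝓝 (f p)) :=
    (hf.continuous.tendsto p).comp hx
  have h2 := (hψ.antitone_energy hf x).ge_of_tendsto h1 0
  simpa only [hψ.zero] using h2

/-- The energy strictly decreases along a broken flow line, unless it is constant. -/
lemma IsNegGradFlow.energy_lt_of_ne {f : C → ℝ} (hψ : IsNegGradFlow (n := n) f ψ)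
    (hf : ContMDiff (𝓡 n) 𝓘(ℝ, ℝ) ∞ f) {p am ap : C} (hm : am ∈ stableManifold ψ p)
    (hu : ap ∈ unstableManifold ψ p) (hne : ¬(am = p ∧ ap = p)) : f ap < f am := by
  have hflow := hψ.isSmoothFlow
  have h1 := hψ.energy_le_of_mem_stable hf hm
  have h2 := hψ.le_energy_of_mem_unstable hf hu
  by_cases ham : am = p
  · have hap : ap ≠ p := fun h => hne ⟨ham, h⟩
    have h3 : grad n f ap ≠ 0 := fun h => hap (by
      have h4 : Tendsto (fun t => ψ t ap) atBot (𝓝 p) := hu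
      simp only [hψ.apply_eq_of_grad_eq_zero h] at h4
      exact tendsto_nhds_unique tendsto_const_nhds h4)
    have h4 : grad n f (ψ (-1) ap) ≠ 0 := fun h => by
      have h5 := hψ.apply_eq_of_grad_eq_zero h 1
      rw [hflow.apply_neg] at h5
      exact h3 (h5 ▸ h)
    have h5 := hψ.energy_lt hf h4 one_pos
    rw [hflow.apply_neg] at h5
    exact (h5.trans_le (hψ.le_energy_of_mem_unstable hf
      (hflow.mapsTo_unstableManifold p (-1) hu))).trans_le h1
  · have h3 : grad n f am ≠ 0 := fun h => ham (by
      have h4 : Tendsto (fun t => ψ t am) atTop (𝓝 p) := hm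
      simp only [hψ.apply_eq_of_grad_eq_zero h] at h4
      exact tendsto_nhds_unique tendsto_const_nhds h4)
    exact h2.trans_lt ((hψ.energy_le_of_mem_stable hf
      (hflow.mapsTo_stableManifold p 1 hm)).trans_lt (hψ.energy_lt hf h3 one_pos))

/-- Neighbourhoods contain balls of the Riemannian distance. -/
lemma exists_riemannianEDist_forall [IsContMDiffRiemannianBundle (𝓡 n) ∞
    (EuclideanSpace ℝ (Fin n)) (fun x : C => TangentSpace (𝓡 n) x)] {am ap : C} {P : C × C → Prop}
    (hP : ∀ᶠ q in 𝓝 (am, ap), P q) : ∃ δ : ℝ, 0 < δ ∧ ∀ x y : C,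
      riemannianEDist (𝓡 n) x am + riemannianEDist (𝓡 n) y ap < ENNReal.ofReal δ → P (x, y) := by
  have hcb : IsContinuousRiemannianBundle (EuclideanSpace ℝ (Fin n))
      (fun x : C => TangentSpace (𝓡 n) x) := isContinuousRiemannianBundle
  have h1 : IsManifold (𝓡 n) 1 C := IsManifold.of_le (n := ∞) (by simp)
  have h2 : LocallyCompactSpace C := ChartedSpace.locallyCompactSpace (EuclideanSpace ℝ (Fin n)) C
  rw [nhds_prod_eq] at hP
  obtain ⟨U, hU, U', hU', hUU⟩ := Filter.eventually_prod_iff.1 hP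
  obtain ⟨c, hc, hcU⟩ := setOfPred_riemannianEDist_lt_subset_nhds (𝓡 n) hU
  obtain ⟨c', hc', hcU'⟩ := setOfPred_riemannianEDist_lt_subset_nhds (𝓡 n) hU'
  refine ⟨min c c', lt_min hc hc', fun x y hxy => hUU (hcU ?_) (hcU' ?_)⟩
  · rw [mem_ofPred_eq, riemannianEDist_comm]
    refine (le_self_add.trans_lt hxy).trans_le ?_
    rw [← ENNReal.ofReal_coe_nnreal]
    exact ENNReal.ofReal_le_ofReal (min_le_left _ _)
  · rw [mem_ofPred_eq, riemannianEDist_comm]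
    refine (le_add_self.trans_lt hxy).trans_le ?_
    rw [← ENNReal.ofReal_coe_nnreal]
    exact ENNReal.ofReal_le_ofReal (min_le_right _ _)

end Isolation
end MorseGluing

end

open MorseGluing in
theorem mainTheorem10 {n k l : ℕ} {C : Type*} [TopologicalSpace C] [T2Space C]
    [SecondCountableTopology C] [ChartedSpace (EuclideanSpace ℝ (Fin n)) C]
    [IsManifold (𝓡 n) ∞ C]
    [RiemannianBundle (fun x : C => TangentSpace (𝓡 n) x)]
    [IsContMDiffRiemannianBundle (𝓡 n) ∞ (EuclideanSpace ℝ (Fin n))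
      (fun x : C => TangentSpace (𝓡 n) x)]
    (f : C → ℝ) (hf : IsMorse n f)
    (ψ : ℝ → C → C) (hψ : IsNegGradFlow (n := n) f ψ)
    (Wm Wp : Set C) (hWm : IsSubmanifold (n := n) k Wm) (hWp : IsSubmanifold (n := n) l Wp)
    (hdim : k + l = n)
    (p : C) (hp : mfderiv (𝓡 n) 𝓘(ℝ, ℝ) f p = 0)
    (htrans : FlowLinesTransverse n ψ Wm Wp)
    (htransm : TransverseIntersection n Wm (stableManifold ψ p))
    (htransp : TransverseIntersection n (unstableManifold ψ p) Wp)
    (am ap : C) (ham : am ∈ Wm) (hams : am ∈ stableManifold ψ p)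
    (hapu : ap ∈ unstableManifold ψ p) (hap : ap ∈ Wp) :
    ∃ (R₀ : ℝ) (wm : ℝ → C),
      -- `R ↦ (R, w₋ᴿ, w₊ᴿ)`, `w₊ᴿ = ψᴿ(w₋ᴿ)`, is an injective immersion `[R₀, ∞) → W₋ ×_ψ W₊`
      (∀ R ∈ Ici R₀, (R, wm R, ψ R (wm R)) ∈ flowLines ψ Wm Wp) ∧
      IsInjectiveImmersionOn n R₀ (fun R => (R, wm R, ψ R (wm R))) ∧
      -- (i) convergence to the broken flow line
      Tendsto wm atTop (𝓝 am) ∧ Tendsto (fun R => ψ R (wm R)) atTop (𝓝 ap) ∧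
      -- (ii) all nearby flow lines belong to the family
      (∃ δ : ℝ, 0 < δ ∧ ∀ (R : ℝ) (x y : C), (R, x, y) ∈ flowLines ψ Wm Wp →
        riemannianEDist (𝓡 n) x am + riemannianEDist (𝓡 n) y ap < ENNReal.ofReal δ →
        (R₀ ≤ R → x = wm R ∧ y = ψ R (wm R)) ∧ (¬ (am = p ∧ ap = p) → R₀ ≤ R)) ∧
      -- (iii) orientations
      ∀ (om : (x : Wm) → Orientation ℝ (tangentSpaceOf n Wm (x : C)) (Fin k))
        (cp : (x : Wp) → Orientation ℝ (NormalSpace n Wp (x : C)) (Fin k))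
        (ou : (x : unstableManifold ψ p) →
          Orientation ℝ (tangentSpaceOf n (unstableManifold ψ p) (x : C)) (Fin k))
        (cs : (x : stableManifold ψ p) →
          Orientation ℝ (NormalSpace n (stableManifold ψ p) (x : C)) (Fin k)),
        IsOrientationOf Wm om → IsCoorientationOf Wp cp →
        IsOrientationOf (unstableManifold ψ p) ou → IsCoorientationOf (stableManifold ψ p) cs →
        InducesCoorientation ψ p ou cs →
        ∀ ε : SignType, ε = pointSign om cs am ham hams * pointSign ou cp ap hapu hap →
        ∀ R, R₀ ≤ R → ∀ (hm : wm R ∈ Wm) (hpR : ψ R (wm R) ∈ Wp),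
          FlowLineVectorSign ψ om cp R (wm R) hm hpR
            (velocity n R₀ wm R) (velocity n R₀ (fun R => ψ R (wm R)) R) ε ∧
          (GradTransverse (n := n) f Wm →
            FlowoutMinusVectorSign ψ om cp R (wm R) hm hpR
              (velocity n R₀ (fun R => ψ R (wm R)) R) ε) ∧
          (GradTransverse (n := n) f Wp →
            FlowoutPlusVectorSign f ψ om cp R (wm R) hm hpR (velocity n R₀ wm R) (-ε)) := by
  have hflow := hψ.isSmoothFlow
  obtain ⟨I, J, κ, Ls, Lu, τ, hyp⟩ := hψ.exists_hypFlow hf hp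
  have htm := htransm am ⟨ham, hams⟩
  have htp := htransp ap ⟨hapu, hap⟩
  obtain ⟨hk, hl, hdm, hdp, em, ep, Tm, Tp, m', q', V, r, ρ, c, h, hame, ham0, hape, hap0⟩ :=
    hyp.exists_gluingData hWm hWp hdim ham hams hapu hap htm htp
  obtain rfl : slice em 0 = am := by
    have h1 := mem_slice_of_near h.minus.mem_iff hame ham
    rwa [ham0] at h1
  obtain rfl : slice ep 0 = ap := by
    have h1 := mem_slice_of_near h.plus.mem_iff hape hap
    rwa [hap0] at h1
  obtain ⟨R₁, a, b, hR₁, hab, ha, ha0, hb0⟩ := h.exists_family hams hapu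
  have hle : ∀ R, R₁ + 1 ≤ R → R₁ ≤ R := fun R hR => by linarith
  have hsm : ∀ R, R₁ + 1 ≤ R → ContMDiffAt 𝓘(ℝ, ℝ) (𝓡 n) ∞ (fun R => slice em (a R)) R :=
    fun R hR => (h.minus.chart.contMDiffAt_slice
      (h.minus.mem_target _ (hab R (hle R hR)).1)).comp R
        (ha R (by linarith)).contMDiffAt
  have hslm : ContinuousAt (slice em) 0 :=
    (h.minus.chart.contMDiffAt_slice (h.minus.mem_target 0 h.norm_zero_le)).continuousAt
  have hslp : ContinuousAt (slice ep) 0 :=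
    (h.plus.chart.contMDiffAt_slice (h.plus.mem_target 0 h.norm_zero_le)).continuousAt
  have hmWm : ∀ R, R₁ ≤ R → slice em (a R) ∈ Wm := fun R hR => h.minus.slice_mem (hab R hR).1
  have hpWp : ∀ R, R₁ ≤ R → ψ R (slice em (a R)) ∈ Wp := fun R hR => by
    rw [(hab R hR).2.2]
    exact h.plus.slice_mem (hab R hR).2.1
  -- the family is smooth for `R > R₁`; starting at `R₁ + 1` makes it smooth at the initial point too
  refine ⟨R₁ + 1, fun R => slice em (a R), fun R hR => ⟨hmWm R (hle R hR), hpWp R (hle R hR), rfl⟩,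
    hflow.isInjectiveImmersionOn hsm, hslm.tendsto.comp ha0, ?_, ?_, ?_⟩
  · refine (hslp.tendsto.comp hb0).congr' ?_
    filter_upwards [eventually_ge_atTop R₁] with R hR
    exact (hab R hR).2.2.symm
  · -- near the broken flow line, the points of `Wm` and `Wp` have small coordinates
    have h1 : ∀ᶠ x in 𝓝 (slice em (0 : J → ℝ)), x ∈ em.source ∧ ‖(em x).1‖ ≤ ρ := by
      refine (em.open_source.eventually_mem hame).and ?_
      have h2 : ContinuousAt (fun x => ‖(em x).1‖) (slice em (0 : J → ℝ)) :=
        (em.continuousAt hame).fst.norm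
      have h3 := h2.eventually_lt continuousAt_const
        (show ‖(em (slice em (0 : J → ℝ))).1‖ < ρ by rw [ham0]; simpa using h.rho_pos)
      exact h3.mono fun x hx => hx.le
    have h1' : ∀ᶠ y in 𝓝 (slice ep (0 : I → ℝ)), y ∈ ep.source ∧ ‖(ep y).1‖ ≤ ρ := by
      refine (ep.open_source.eventually_mem hape).and ?_
      have h2 : ContinuousAt (fun x => ‖(ep x).1‖) (slice ep (0 : I → ℝ)) :=
        (ep.continuousAt hape).fst.norm
      have h3 := h2.eventually_lt continuousAt_const
        (show ‖(ep (slice ep (0 : I → ℝ))).1‖ < ρ by rw [hap0]; simpa using h.rho_pos)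
      exact h3.mono fun x hx => hx.le
    have h2 : ∀ᶠ q in 𝓝 ((slice em (0 : J → ℝ), slice ep (0 : I → ℝ)) : C × C),
        ¬(slice em (0 : J → ℝ) = p ∧ slice ep (0 : I → ℝ) = p) →
          ∀ R, ψ R q.1 = q.2 → R₁ + 1 ≤ R := by
      by_cases hne : slice em (0 : J → ℝ) = p ∧ slice ep (0 : I → ℝ) = p
      · exact Eventually.of_forall fun q h => absurd hne h
      · exact (eventually_le_of_flow_eq hflow hf.1.continuous (hψ.antitone_energy hf.1) hyp.fixed
          (fun x => hyp.eq_of_mem_of_mem) hams hapu (hψ.energy_lt_of_ne hf.1 hams hapu hne)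
          (R₁ + 1)).mono fun q hq _ => hq
    obtain ⟨δ, hδ, hδP⟩ := exists_riemannianEDist_forall (n := n) ((h1.prod_nhds h1').and h2)
    refine ⟨δ, hδ, fun R x y ⟨hxW, hyW, hxy⟩ hlt => ?_⟩
    obtain ⟨⟨⟨hx, hxρ⟩, hy, hyρ⟩, hR⟩ := hδP x y hlt
    refine ⟨fun hRR => ?_, fun hne => hR hne R hxy⟩
    have hx' := mem_slice_of_near h.minus.mem_iff hx hxW
    have hy' := mem_slice_of_near h.plus.mem_iff hy hyW
    obtain ⟨h3, h4, h5⟩ := hab R (hle R hRR)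
    have h6 := h.eq_of_flow_eq (hR₁.trans (hle R hRR)) hxρ h3 hyρ h4
      (by rw [hx', hy']; exact hxy) h5
    have h7 : x = slice em (a R) := by rw [← h6, hx']
    exact ⟨h7, hxy.symm.trans (congrArg (ψ R) h7)⟩
  · rintro om cp ou cs hom hcp hou hcs hind ε rfl R hR hm hpR
    obtain ⟨h3, h4, h5⟩ := hab R (hle R hR)
    have hε : pointSign om cs (slice em 0) ham hams * pointSign ou cp (slice ep 0) hapu hap ≠ 0 :=
      mul_ne_zero (isoSign_ne_zero _ _ _) (isoSign_ne_zero _ _ _)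
    have hφ := h.flow_sign ((Module.finBasisOfFinrankEq ℝ (J → ℝ) hk)) hom hcp hou hcs hind ham hams
      hapu hap htm htp hdm hdp h3 h4 (hR₁.trans (hle R hR)) h5 hm hpR
    have hγ := (hsm R hR).mdifferentiableAt (by simp)
    have hγ' := (hflow.contMDiffAt_flow_curve (hsm R hR)).mdifferentiableAt (by simp)
    have hfm : Module.finrank ℝ (tangentSpaceOf n Wm (slice em (a R))) = k :=
      (h.finrank_minus h3).trans hk
    have hfp : Module.finrank ℝ (NormalSpace n Wp (ψ R (slice em (a R)))) = k := by
      rw [h5]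
      exact (h.finrank_plus h4).trans hk
    have hev : ∀ᶠ R' in 𝓝 R, R₁ ≤ R' := (eventually_gt_nhds (by linarith)).mono fun _ => le_of_lt
    have hξm : dOf n (fun R => slice em (a R)) R 1 ∈ tangentSpaceOf n Wm (slice em (a R)) :=
      mem_tangentSpaceOf' (γ := fun R => slice em (a R)) (hsm R hR) (hev.mono fun R' => hmWm R')
    have hξp : dOf n (fun R => ψ R (slice em (a R))) R 1 ∈
        tangentSpaceOf n Wp (ψ R (slice em (a R))) :=
      mem_tangentSpaceOf' (γ := fun R => ψ R (slice em (a R)))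
        (hflow.contMDiffAt_flow_curve (hsm R hR)) (hev.mono fun R' => hpWp R')
    have hvel := hflow.dOf_flow_curve hγ
    have hξ : flowDiff n ψ Wm R (slice em (a R)) (1, ⟨_, hξm⟩) =
        dOf n (fun R => ψ R (slice em (a R))) R 1 := by
      rw [hflow.flowDiff_apply, one_smul]
      exact hvel.symm
    rw [velocity_eq_dOf hγ hR, velocity_eq_dOf hγ' hR]
    refine ⟨hflow.flowLineVectorSign hfm hε hφ hξm hξp hξ,
      fun _ => hflow.flowoutMinusVectorSign hfm hε hφ hξm hξp hξ,
      fun hg => flowoutPlusVectorSign hfp hε hφ (hg _ hpR) hξm ?_⟩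
    rw [hψ.velocity_eq] at hvel
    exact hvel ▸ hξp
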